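/- **Conventions.** A $\mathrm{Gpd}^*$-category is a bicategory $\mathcal C$ with invertible 2-cells, with a distinguished 1-cell $0_{A,B}:A\to B$ for all $A,B$ and 2-cells $f\circ 0\Rightarrow 0$ and $0\circ f\Rightarrow 0$ that are natural in $f$, compatible with identities, with composition and with each other, and that agree for $0\circ 0\Rightarrow 0$. It is *strictly described* if it is a strict 2-category, $f\circ 0=0$, $0\circ f=0$, $\alpha\circ 0=\mathrm{id}$ and $0\circ\alpha=\mathrm{id}$ for all 1-cells $f$ and 2-cells $\alpha$, and the 2-cells $f\circ0\Rightarrow0$, $0\circ f\Rightarrow0$ are identities. A *zero object* is an object $Z$ such that every 1-cell $f$ into or out of $Z$ has exactly one 2-cell $f\Rightarrow 0$. Products, coproducts, pullbacks and pushouts are the 2-categorical ones (universal up to a unique compatible 2-cell). In the following, canonical 2-cells such as $f\circ 0\Rightarrow 0$ are suppressed. A *kernel* of $f:A\to B$ is a universal triple $(K,\,k:K\to A,\,\varepsilon:f\circ k\Rightarrow 0)$; a *cokernel* is a universal triple $(Q,\,q:B\to Q,\,\pi:q\circ f\Rightarrow 0)$. One writes $f=\ker(\mathrm{cok} f)$ if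 $(A,f,\pi)$ is a kernel of $q$, where $(Q,q,\pi)$ is the cokernel of $f$; dually for $f=\mathrm{cok}(\ker f)$. Let $f:A\to B$ be a 1-cell. It is *faithful* if $f\circ-:\mathcal C(X,A)\to\mathcal C(X,B)$ is a faithful functor for all $X$; *0-faithful* if $f\circ\alpha=\mathrm{id}$ implies $\alpha=\mathrm{id}$ for all $\alpha:0\Rightarrow0:X\to A$; *fully 0-faithful* if for all $a:X\to A$ every $\beta:f\circ a\Rightarrow 0$ is $f\circ\alpha$ for a unique $\alpha:a\Rightarrow0$; *0-monomorphic* if this holds for those $\beta$ that are compatible with the cokernel $(Q,q,\pi)$, i.e. $q\circ\beta=\pi\circ a$. Cofaithful, (fully) 0-cofaithful and 0-epimorphic 1-cells are defined dually (reversing 1-cells). The *copip* of $f$ is the universal $\rho:0\Rightarrow0:B\to P$ with $\rho\circ f=\mathrm{id}$; the *root* of $\chi:0\Rightarrow0:A\to B$ is the universal $r:R\to A$ with $\chi\circ r=\mathrm{id}$; *pip* and *coroot* are the dual notions. A $\mathrm{Gpd}^*$-category with zero object, finite products and coproducts, kernels and cokernels is * a *2-abelian $\mathrm{Gpd}$-category*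 if every 0-faithful $f$ satisfies $f=\ker(\mathrm{cok}f)$, every 0-cofaithful $f$ satisfies $f=\mathrm{cok}(\ker f)$, every fully 0-faithful 1-cell is canonically the root of its copip, and every fully 0-cofaithful 1-cell is canonically the coroot of its pip; * an *abelian $\mathrm{Gpd}$-category* if every 0-monomorphic $f$ satisfies $f=\ker(\mathrm{cok}f)$, every 0-epimorphic $f$ satisfies $f=\mathrm{cok}(\ker f)$, fully 0-faithful and 0-monomorphic 1-cells are stable under pushout, and fully 0-cofaithful and 0-epimorphic 1-cells are stable under pullback. A *symmetric categorical group* is a symmetric monoidal groupoid in which every object is invertible up to isomorphism; with symmetric monoidal functors and monoidal transformations they form a 2-category $\mathrm{SCG}$. A *locally SCG 2-category* (without the condition (LS3+) that $\mathbf S(0,0)$ is the zero categorical group) is a strict 2-category $\mathbf S$ with a symmetric categorical group structure on every $\mathbf S(A,B)$, with unit $0_{A,B}$, such that $0_{B,C}\circ0_{A,B}=0_{A,C}$, composition makes $\mathrm{Hom}:\mathbf S^{op}\times\mathbf S\to\mathrm{SCG}$ a strict 2-functor, the unit isomorphisms of $-\circ 0_{A,B}$ and of $0_{B,C}\circ-$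 (at the unit) are identities, there is a zero object, and any two objects have a product and a coproduct. It is regarded as a $\mathrm{Gpd}^*$-category by means of the units $0_{A,B}$ and the unit isomorphisms of the functors $f\circ-$ and $-\circ f$. It is a *relatively exact 2-category* (without (LS3+)) if moreover every 1-cell has a kernel and a cokernel, a 1-cell $f$ is faithful if and only if $f=\ker(\mathrm{cok}f)$, and $f$ is cofaithful if and only if $f=\mathrm{cok}(\ker f)$. **Theorem.** (i) Every strictly described 2-abelian $\mathrm{Gpd}$-category $\mathcal C$ is a relatively exact 2-category without condition (LS3+): there is a locally SCG structure on $\mathcal C$ whose underlying $\mathrm{Gpd}^*$-category is $\mathcal C$ and which is relatively exact. (ii) Every relatively exact 2-category without condition (LS3+) is an abelian $\mathrm{Gpd}$-category. It is not necessarily strictly described: there is a relatively exact 2-category without (LS3+) in which the identities $f\circ0=0$, $0\circ f=0$ do not all hold. -/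

import Mathlib

universe w v u

namespace TwoCat

open CategoryTheory
open scoped CategoryTheory.Bicategory

-- In a bicategory the composite written `g ∘ f` on paper is `f ≫ g`; `f ◁ η` and `η ▷ g` are the
-- horizontal composites of a 2-cell `η` with `f` on the source side, with `g` on the target side.

section General

variable {C : Type u} [Bicategory.{w, v} C]

/-- `f` is faithful: every functor `f ∘ - : C(X, A) ⥤ C(X, B)` is faithful. -/
def IsFaithful {A B : C} (f : A ⟶ B) : Prop :=
  ∀ X : C, (Bicategory.postcomp X f).Faithful

/-- `f` is cofaithful: every functor `- ∘ f : C(B, Y) ⥤ C(A, Y)` is faithful. -/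
def IsCofaithful {A B : C} (f : A ⟶ B) : Prop :=
  ∀ Y : C, (Bicategory.precomp Y f).Faithful

/-- `(P, p₁, p₂)` is a (2-categorical) product of `A` and `B`: every pair of 1-cells factors up to
2-cells, and between any two factorizations there is a unique compatible 2-cell. -/
structure IsProduct {A B P : C} (p₁ : P ⟶ A) (p₂ : P ⟶ B) : Prop where
  exists_lift : ∀ {X : C} (x₁ : X ⟶ A) (x₂ : X ⟶ B),
    ∃ t : X ⟶ P, Nonempty (t ≫ p₁ ⟶ x₁) ∧ Nonempty (t ≫ p₂ ⟶ x₂)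
  unique_lift : ∀ {X : C} (x₁ : X ⟶ A) (x₂ : X ⟶ B)
    (t : X ⟶ P) (σ₁ : t ≫ p₁ ⟶ x₁) (σ₂ : t ≫ p₂ ⟶ x₂)
    (t' : X ⟶ P) (σ₁' : t' ≫ p₁ ⟶ x₁) (σ₂' : t' ≫ p₂ ⟶ x₂),
    ∃! τ : t ⟶ t', τ ▷ p₁ ≫ σ₁' = σ₁ ∧ τ ▷ p₂ ≫ σ₂' = σ₂

/-- `(P, i₁, i₂)` is a (2-categorical) coproduct of `A` and `B`. -/
structure IsCoproduct {A B P : C} (i₁ : A ⟶ P) (i₂ : B ⟶ P) : Prop where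
  exists_desc : ∀ {Y : C} (y₁ : A ⟶ Y) (y₂ : B ⟶ Y),
    ∃ t : P ⟶ Y, Nonempty (i₁ ≫ t ⟶ y₁) ∧ Nonempty (i₂ ≫ t ⟶ y₂)
  unique_desc : ∀ {Y : C} (y₁ : A ⟶ Y) (y₂ : B ⟶ Y)
    (t : P ⟶ Y) (σ₁ : i₁ ≫ t ⟶ y₁) (σ₂ : i₂ ≫ t ⟶ y₂)
    (t' : P ⟶ Y) (σ₁' : i₁ ≫ t' ⟶ y₁) (σ₂' : i₂ ≫ t' ⟶ y₂),
    ∃! τ : t ⟶ t', i₁ ◁ τ ≫ σ₁' = σ₁ ∧ i₂ ◁ τ ≫ σ₂' = σ₂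

variable (C) in
/-- Any two 0-cells have a product. -/
def HasProducts : Prop :=
  ∀ A B : C, ∃ (P : C) (p₁ : P ⟶ A) (p₂ : P ⟶ B), IsProduct p₁ p₂

variable (C) in
/-- Any two 0-cells have a coproduct. -/
def HasCoproducts : Prop :=
  ∀ A B : C, ∃ (P : C) (i₁ : A ⟶ P) (i₂ : B ⟶ P), IsCoproduct i₁ i₂

/-- The square with the 2-cell `γ : p ≫ f ⟶ q ≫ g` is a (2-categorical) pullback of `f` and `g`.
The 1-cell `q` is the pullback of `f` along `g`. -/
structure IsPullbackSq {A B D P : C} {p : P ⟶ A} {q : P ⟶ D} {f : A ⟶ B} {g : D ⟶ B}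
    (γ : p ≫ f ⟶ q ≫ g) : Prop where
  exists_lift : ∀ {X : C} (x : X ⟶ A) (z : X ⟶ D) (δ : x ≫ f ⟶ z ≫ g),
    ∃ (t : X ⟶ P) (σ : t ≫ p ⟶ x) (τ : t ≫ q ⟶ z),
      σ ▷ f ≫ δ = (α_ t p f).hom ≫ t ◁ γ ≫ (α_ t q g).inv ≫ τ ▷ g
  unique_lift : ∀ {X : C} (x : X ⟶ A) (z : X ⟶ D) (δ : x ≫ f ⟶ z ≫ g)
    (t : X ⟶ P) (σ : t ≫ p ⟶ x) (τ : t ≫ q ⟶ z)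
    (t' : X ⟶ P) (σ' : t' ≫ p ⟶ x) (τ' : t' ≫ q ⟶ z),
    σ ▷ f ≫ δ = (α_ t p f).hom ≫ t ◁ γ ≫ (α_ t q g).inv ≫ τ ▷ g →
    σ' ▷ f ≫ δ = (α_ t' p f).hom ≫ t' ◁ γ ≫ (α_ t' q g).inv ≫ τ' ▷ g →
    ∃! θ : t ⟶ t', θ ▷ p ≫ σ' = σ ∧ θ ▷ q ≫ τ' = τ

/-- The square with the 2-cell `γ : f ≫ i ⟶ g ≫ j` is a (2-categorical) pushout of `f` and `g`.
The 1-cell `j` is the pushout of `f` along `g`. -/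
structure IsPushoutSq {A B D P : C} {f : A ⟶ B} {g : A ⟶ D} {i : B ⟶ P} {j : D ⟶ P}
    (γ : f ≫ i ⟶ g ≫ j) : Prop where
  exists_desc : ∀ {Y : C} (y : B ⟶ Y) (z : D ⟶ Y) (δ : f ≫ y ⟶ g ≫ z),
    ∃ (t : P ⟶ Y) (σ : i ≫ t ⟶ y) (τ : j ≫ t ⟶ z),
      f ◁ σ ≫ δ = (α_ f i t).inv ≫ γ ▷ t ≫ (α_ g j t).hom ≫ g ◁ τ
  unique_desc : ∀ {Y : C} (y : B ⟶ Y) (z : D ⟶ Y) (δ : f ≫ y ⟶ g ≫ z)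
    (t : P ⟶ Y) (σ : i ≫ t ⟶ y) (τ : j ≫ t ⟶ z)
    (t' : P ⟶ Y) (σ' : i ≫ t' ⟶ y) (τ' : j ≫ t' ⟶ z),
    f ◁ σ ≫ δ = (α_ f i t).inv ≫ γ ▷ t ≫ (α_ g j t).hom ≫ g ◁ τ →
    f ◁ σ' ≫ δ = (α_ f i t').inv ≫ γ ▷ t' ≫ (α_ g j t').hom ≫ g ◁ τ' →
    ∃! θ : t ⟶ t', i ◁ θ ≫ σ' = σ ∧ j ◁ θ ≫ τ' = τ

/-- A property of 1-cells is stable under pushout. -/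
def StableUnderPushout (Φ : ∀ {A B : C}, (A ⟶ B) → Prop) : Prop :=
  ∀ {A B D P : C} {f : A ⟶ B} {g : A ⟶ D} {i : B ⟶ P} {j : D ⟶ P} (γ : f ≫ i ⟶ g ≫ j),
    IsPushoutSq γ → Φ f → Φ j

/-- A property of 1-cells is stable under pullback. -/
def StableUnderPullback (Φ : ∀ {A B : C}, (A ⟶ B) → Prop) : Prop :=
  ∀ {A B D P : C} {p : P ⟶ A} {q : P ⟶ D} {f : A ⟶ B} {g : D ⟶ B} (γ : p ≫ f ⟶ q ≫ g),
    IsPullbackSq γ → Φ f → Φ q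

/-- `Z` is a zero object with respect to the zero 1-cells `zero A B`: every 1-cell `f` out of or
into `Z` has a unique 2-cell from `f` to the zero 1-cell. -/
structure IsZeroObject (zero : ∀ A B : C, A ⟶ B) (Z : C) : Prop where
  from_zero : ∀ {A : C} (f : Z ⟶ A), ∃! _θ : f ⟶ zero Z A, True
  to_zero : ∀ {A : C} (f : A ⟶ Z), ∃! _τ : f ⟶ zero A Z, True

end General

/-- A `Gpd*`-category structure on a bicategory `C`, i.e. a (weak) enrichment of `C` in pointed
groupoids: all 2-cells are invertible, every hom-groupoid `C(A, B)` has a distinguished object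
`zero A B`, and composition with zero is zero up to coherent invertible 2-cells. -/
structure GpdStar (C : Type u) [Bicategory.{w, v} C] where
  locallyGroupoid : Bicategory.IsLocallyGroupoid C
  zero (A B : C) : A ⟶ B
  /-- the 2-cell `f ∘ 0 ⟹ 0` -/
  zeroComp (X : C) {A B : C} (f : A ⟶ B) : zero X A ≫ f ≅ zero X B
  /-- the 2-cell `0 ∘ f ⟹ 0` -/
  compZero {A B : C} (f : A ⟶ B) (Y : C) : f ≫ zero B Y ≅ zero A Y
  zeroComp_naturality (X : C) {A B : C} {f g : A ⟶ B} (η : f ⟶ g) :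
    zero X A ◁ η ≫ (zeroComp X g).hom = (zeroComp X f).hom
  compZero_naturality {A B : C} {f g : A ⟶ B} (η : f ⟶ g) (Y : C) :
    η ▷ zero B Y ≫ (compZero g Y).hom = (compZero f Y).hom
  zeroComp_id (X A : C) : zeroComp X (𝟙 A) = ρ_ (zero X A)
  compZero_id (A Y : C) : compZero (𝟙 A) Y = λ_ (zero A Y)
  zeroComp_comp (X : C) {A B D : C} (f : A ⟶ B) (g : B ⟶ D) :
    (zeroComp X (f ≫ g)).hom =
      (α_ (zero X A) f g).inv ≫ (zeroComp X f).hom ▷ g ≫ (zeroComp X g).hom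
  compZero_comp {A B D : C} (f : A ⟶ B) (g : B ⟶ D) (Y : C) :
    (compZero (f ≫ g) Y).hom =
      (α_ f g (zero D Y)).hom ≫ f ◁ (compZero g Y).hom ≫ (compZero f Y).hom
  comp_zero_comp {A B D E : C} (f : A ⟶ B) (g : D ⟶ E) :
    (compZero f D).hom ▷ g ≫ (zeroComp A g).hom =
      (α_ f (zero B D) g).hom ≫ f ◁ (zeroComp B g).hom ≫ (compZero f E).hom
  zero_zero (A B D : C) : zeroComp A (zero B D) = compZero (zero A B) D

namespace GpdStar

variable {C : Type u} [Bicategory.{w, v} C] (G : GpdStar C)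

/-- Composition with zero 1-cells is strictly zero: `f ∘ 0 = 0` and `0 ∘ f = 0`. -/
structure HasStrictZeros : Prop where
  zero_comp : ∀ (X : C) {A B : C} (f : A ⟶ B), G.zero X A ≫ f = G.zero X B
  comp_zero : ∀ {A B : C} (f : A ⟶ B) (Y : C), f ≫ G.zero B Y = G.zero A Y

/-- `C` is strictly described: it is a strict 2-category, `f ∘ 0 = 0`, `0 ∘ f = 0`, `α ∘ 0 = id`,
`0 ∘ α = id`, and the 2-cells of the pointed enrichment are identities. -/
structure IsStrictlyDescribed : Prop extends G.HasStrictZeros where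
  strict : Bicategory.Strict C
  zero_whisker : ∀ (X : C) {A B : C} {f g : A ⟶ B} (η : f ⟶ g),
    G.zero X A ◁ η = eqToHom ((zero_comp X f).trans (zero_comp X g).symm)
  whisker_zero : ∀ {A B : C} {f g : A ⟶ B} (η : f ⟶ g) (Y : C),
    η ▷ G.zero B Y = eqToHom ((comp_zero f Y).trans (comp_zero g Y).symm)
  zeroComp_eq : ∀ (X : C) {A B : C} (f : A ⟶ B), G.zeroComp X f = eqToIso (zero_comp X f)
  compZero_eq : ∀ {A B : C} (f : A ⟶ B) (Y : C), G.compZero f Y = eqToIso (comp_zero f Y)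

/-- `(K, k, e)` with `e : f ∘ k ⟹ 0` is a kernel of `f`. -/
structure IsKernel {A B K : C} (f : A ⟶ B) (k : K ⟶ A) (e : k ≫ f ⟶ G.zero K B) : Prop where
  exists_lift : ∀ {X : C} (x : X ⟶ A) (ξ : x ≫ f ⟶ G.zero X B),
    ∃ (t : X ⟶ K) (σ : t ≫ k ⟶ x),
      σ ▷ f ≫ ξ = (α_ t k f).hom ≫ t ◁ e ≫ (G.compZero t B).hom
  unique_lift : ∀ {X : C} (x : X ⟶ A) (ξ : x ≫ f ⟶ G.zero X B)
    (t : X ⟶ K) (σ : t ≫ k ⟶ x) (t' : X ⟶ K) (σ' : t' ≫ k ⟶ x),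
    σ ▷ f ≫ ξ = (α_ t k f).hom ≫ t ◁ e ≫ (G.compZero t B).hom →
    σ' ▷ f ≫ ξ = (α_ t' k f).hom ≫ t' ◁ e ≫ (G.compZero t' B).hom →
    ∃! τ : t ⟶ t', τ ▷ k ≫ σ' = σ

/-- `(Q, q, π)` with `π : q ∘ f ⟹ 0` is a cokernel of `f`. -/
structure IsCokernel {A B Q : C} (f : A ⟶ B) (q : B ⟶ Q) (π : f ≫ q ⟶ G.zero A Q) : Prop where
  exists_desc : ∀ {Y : C} (y : B ⟶ Y) (ξ : f ≫ y ⟶ G.zero A Y),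
    ∃ (t : Q ⟶ Y) (σ : q ≫ t ⟶ y),
      f ◁ σ ≫ ξ = (α_ f q t).inv ≫ π ▷ t ≫ (G.zeroComp A t).hom
  unique_desc : ∀ {Y : C} (y : B ⟶ Y) (ξ : f ≫ y ⟶ G.zero A Y)
    (t : Q ⟶ Y) (σ : q ≫ t ⟶ y) (t' : Q ⟶ Y) (σ' : q ≫ t' ⟶ y),
    f ◁ σ ≫ ξ = (α_ f q t).inv ≫ π ▷ t ≫ (G.zeroComp A t).hom →
    f ◁ σ' ≫ ξ = (α_ f q t').inv ≫ π ▷ t' ≫ (G.zeroComp A t').hom →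
    ∃! τ : t ⟶ t', q ◁ τ ≫ σ' = σ

/-- Every 1-cell has a kernel. -/
def HasKernels : Prop :=
  ∀ {A B : C} (f : A ⟶ B), ∃ (K : C) (k : K ⟶ A) (e : k ≫ f ⟶ G.zero K B), G.IsKernel f k e

/-- Every 1-cell has a cokernel. -/
def HasCokernels : Prop :=
  ∀ {A B : C} (f : A ⟶ B), ∃ (Q : C) (q : B ⟶ Q) (π : f ≫ q ⟶ G.zero A Q), G.IsCokernel f q π

-- Kernels, cokernels, pips and copips are unique up to equivalence, so that it does not matter
-- which one is taken in the following definitions.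

/-- `f = ker (cok f)`: if `(Q, q, π)` is the cokernel of `f`, then `(A, f, π)` is a kernel of `q`. -/
def IsKerOfCok {A B : C} (f : A ⟶ B) : Prop :=
  ∃ (Q : C) (q : B ⟶ Q) (π : f ≫ q ⟶ G.zero A Q), G.IsCokernel f q π ∧ G.IsKernel q f π

/-- `f = cok (ker f)`: if `(K, k, e)` is the kernel of `f`, then `(B, f, e)` is a cokernel of `k`. -/
def IsCokOfKer {A B : C} (f : A ⟶ B) : Prop :=
  ∃ (K : C) (k : K ⟶ A) (e : k ≫ f ⟶ G.zero K B), G.IsKernel f k e ∧ G.IsCokernel k f e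

/-- `f` is 0-faithful: for `α : 0 ⟹ 0 : X ⟶ A`, if `f ∘ α = id` then `α = id`. -/
def IsZeroFaithful {A B : C} (f : A ⟶ B) : Prop :=
  ∀ {X : C} (α : G.zero X A ⟶ G.zero X A), α ▷ f = 𝟙 (G.zero X A ≫ f) → α = 𝟙 (G.zero X A)

/-- `f` is 0-cofaithful. -/
def IsZeroCofaithful {A B : C} (f : A ⟶ B) : Prop :=
  ∀ {Y : C} (α : G.zero B Y ⟶ G.zero B Y), f ◁ α = 𝟙 (f ≫ G.zero B Y) → α = 𝟙 (G.zero B Y)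

/-- `f` is fully 0-faithful: every `β : f ∘ a ⟹ 0` is `f ∘ α` for a unique `α : a ⟹ 0`. -/
def IsFullyZeroFaithful {A B : C} (f : A ⟶ B) : Prop :=
  ∀ {X : C} (a : X ⟶ A) (β : a ≫ f ⟶ G.zero X B),
    ∃! α : a ⟶ G.zero X A, α ▷ f ≫ (G.zeroComp X f).hom = β

/-- `f` is fully 0-cofaithful. -/
def IsFullyZeroCofaithful {A B : C} (f : A ⟶ B) : Prop :=
  ∀ {Y : C} (b : B ⟶ Y) (β : f ≫ b ⟶ G.zero A Y),
    ∃! α : b ⟶ G.zero B Y, f ◁ α ≫ (G.compZero f Y).hom = β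

/-- `f` is 0-monomorphic: if `(Q, q, π)` is the cokernel of `f`, then every `β : f ∘ a ⟹ 0` that is
compatible with `π` is `f ∘ α` for a unique `α : a ⟹ 0`. -/
def IsZeroMonomorphic {A B : C} (f : A ⟶ B) : Prop :=
  ∃ (Q : C) (q : B ⟶ Q) (π : f ≫ q ⟶ G.zero A Q), G.IsCokernel f q π ∧
    ∀ {X : C} (a : X ⟶ A) (β : a ≫ f ⟶ G.zero X B),
      β ▷ q ≫ (G.zeroComp X q).hom = (α_ a f q).hom ≫ a ◁ π ≫ (G.compZero a Q).hom →
      ∃! α : a ⟶ G.zero X A, α ▷ f ≫ (G.zeroComp X f).hom = β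

/-- `f` is 0-epimorphic. -/
def IsZeroEpimorphic {A B : C} (f : A ⟶ B) : Prop :=
  ∃ (K : C) (k : K ⟶ A) (e : k ≫ f ⟶ G.zero K B), G.IsKernel f k e ∧
    ∀ {Y : C} (b : B ⟶ Y) (β : f ≫ b ⟶ G.zero A Y),
      k ◁ β ≫ (G.compZero k Y).hom = (α_ k f b).inv ≫ e ▷ b ≫ (G.zeroComp K b).hom →
      ∃! α : b ⟶ G.zero B Y, f ◁ α ≫ (G.compZero f Y).hom = β

/-- `(P, π)` with `π : 0 ⟹ 0 : P ⟶ A` is a pip of `f : A ⟶ B`: it is universal among the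
`χ : 0 ⟹ 0 : X ⟶ A` with `f ∘ χ = id`. -/
structure IsPip {A B P : C} (f : A ⟶ B) (π : G.zero P A ⟶ G.zero P A) : Prop where
  condition : π ▷ f = 𝟙 (G.zero P A ≫ f)
  exists_lift : ∀ {X : C} (χ : G.zero X A ⟶ G.zero X A), χ ▷ f = 𝟙 (G.zero X A ≫ f) →
    ∃ t : X ⟶ P, t ◁ π ≫ (G.compZero t A).hom = (G.compZero t A).hom ≫ χ
  unique_lift : ∀ {X : C} (χ : G.zero X A ⟶ G.zero X A) (t t' : X ⟶ P),
    t ◁ π ≫ (G.compZero t A).hom = (G.compZero t A).hom ≫ χ →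
    t' ◁ π ≫ (G.compZero t' A).hom = (G.compZero t' A).hom ≫ χ →
    ∃! _τ : t ⟶ t', True

/-- `(P, ρ)` with `ρ : 0 ⟹ 0 : B ⟶ P` is a copip of `f : A ⟶ B`: it is universal among the
`χ : 0 ⟹ 0 : B ⟶ Y` with `χ ∘ f = id`. -/
structure IsCopip {A B P : C} (f : A ⟶ B) (ρ : G.zero B P ⟶ G.zero B P) : Prop where
  condition : f ◁ ρ = 𝟙 (f ≫ G.zero B P)
  exists_desc : ∀ {Y : C} (χ : G.zero B Y ⟶ G.zero B Y), f ◁ χ = 𝟙 (f ≫ G.zero B Y) →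
    ∃ t : P ⟶ Y, ρ ▷ t ≫ (G.zeroComp B t).hom = (G.zeroComp B t).hom ≫ χ
  unique_desc : ∀ {Y : C} (χ : G.zero B Y ⟶ G.zero B Y) (t t' : P ⟶ Y),
    ρ ▷ t ≫ (G.zeroComp B t).hom = (G.zeroComp B t).hom ≫ χ →
    ρ ▷ t' ≫ (G.zeroComp B t').hom = (G.zeroComp B t').hom ≫ χ →
    ∃! _τ : t ⟶ t', True

/-- `r` is a root of `χ : 0 ⟹ 0 : A ⟶ B`: it is universal among the 1-cells `x` into `A` with
`χ ∘ x = id`. -/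
structure IsRoot {A B R : C} (χ : G.zero A B ⟶ G.zero A B) (r : R ⟶ A) : Prop where
  condition : r ◁ χ = 𝟙 (r ≫ G.zero A B)
  exists_lift : ∀ {X : C} (x : X ⟶ A), x ◁ χ = 𝟙 (x ≫ G.zero A B) →
    ∃ t : X ⟶ R, Nonempty (t ≫ r ⟶ x)
  unique_lift : ∀ {X : C} (x : X ⟶ A) (t : X ⟶ R) (σ : t ≫ r ⟶ x) (t' : X ⟶ R)
    (σ' : t' ≫ r ⟶ x), ∃! τ : t ⟶ t', τ ▷ r ≫ σ' = σ

/-- `c` is a coroot of `χ : 0 ⟹ 0 : A ⟶ B`: it is universal among the 1-cells `y` out of `B` with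
`y ∘ χ = id`. -/
structure IsCoroot {A B R : C} (χ : G.zero A B ⟶ G.zero A B) (c : B ⟶ R) : Prop where
  condition : χ ▷ c = 𝟙 (G.zero A B ≫ c)
  exists_desc : ∀ {Y : C} (y : B ⟶ Y), χ ▷ y = 𝟙 (G.zero A B ≫ y) →
    ∃ t : R ⟶ Y, Nonempty (c ≫ t ⟶ y)
  unique_desc : ∀ {Y : C} (y : B ⟶ Y) (t : R ⟶ Y) (σ : c ≫ t ⟶ y) (t' : R ⟶ Y)
    (σ' : c ≫ t' ⟶ y), ∃! τ : t ⟶ t', c ◁ τ ≫ σ' = σ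

/-- `f` is canonically the root of its copip. -/
def IsRootOfCopip {A B : C} (f : A ⟶ B) : Prop :=
  ∃ (P : C) (ρ : G.zero B P ⟶ G.zero B P), G.IsCopip f ρ ∧ G.IsRoot ρ f

/-- `f` is canonically the coroot of its pip. -/
def IsCorootOfPip {A B : C} (f : A ⟶ B) : Prop :=
  ∃ (P : C) (π : G.zero P A ⟶ G.zero P A), G.IsPip f π ∧ G.IsCoroot π f

/-- Zero object, finite products and coproducts (the zero object is the empty product and the empty
coproduct), kernels and cokernels. -/
structure HasFiniteLimitData : Prop where
  zeroObject : ∃ Z : C, IsZeroObject G.zero Z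
  products : HasProducts C
  coproducts : HasCoproducts C
  kernels : G.HasKernels
  cokernels : G.HasCokernels

/-- Abelian `Gpd`-categories. -/
structure IsAbelian : Prop extends G.HasFiniteLimitData where
  zeroMonomorphic : ∀ {A B : C} (f : A ⟶ B), G.IsZeroMonomorphic f → G.IsKerOfCok f
  zeroEpimorphic : ∀ {A B : C} (f : A ⟶ B), G.IsZeroEpimorphic f → G.IsCokOfKer f
  fullyZeroFaithful_pushout : StableUnderPushout (C := C) G.IsFullyZeroFaithful
  zeroMonomorphic_pushout : StableUnderPushout (C := C) G.IsZeroMonomorphic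
  fullyZeroCofaithful_pullback : StableUnderPullback (C := C) G.IsFullyZeroCofaithful
  zeroEpimorphic_pullback : StableUnderPullback (C := C) G.IsZeroEpimorphic

/-- 2-abelian `Gpd`-categories. -/
structure IsTwoAbelian : Prop extends G.HasFiniteLimitData where
  zeroFaithful : ∀ {A B : C} (f : A ⟶ B), G.IsZeroFaithful f → G.IsKerOfCok f
  zeroCofaithful : ∀ {A B : C} (f : A ⟶ B), G.IsZeroCofaithful f → G.IsCokOfKer f
  fullyZeroFaithful : ∀ {A B : C} (f : A ⟶ B), G.IsFullyZeroFaithful f → G.IsRootOfCopip f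
  fullyZeroCofaithful : ∀ {A B : C} (f : A ⟶ B), G.IsFullyZeroCofaithful f → G.IsCorootOfPip f

end GpdStar

section Hom

variable {C : Type u} [Bicategory.{w, v} C]

/-- The functor `Hom(f, g) = g ∘ - ∘ f : C(A, B) ⥤ C(A', B')`. -/
@[simps]
def homMap {A' A B B' : C} (f : A' ⟶ A) (g : B ⟶ B') : (A ⟶ B) ⥤ (A' ⟶ B') where
  obj h := (f ≫ h) ≫ g
  map κ := (f ◁ κ) ▷ g

/-- The natural transformation `Hom(η, θ) = θ ∘ - ∘ η`. -/
@[simps]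
def homMap₂ {A' A B B' : C} {f f' : A' ⟶ A} {g g' : B ⟶ B'} (η : f ⟶ f') (θ : g ⟶ g') :
    homMap f g ⟶ homMap f' g' where
  app h := (η ▷ h) ▷ g ≫ (f' ≫ h) ◁ θ
  naturality h h' κ := by
    change (f ◁ κ) ▷ g ≫ (η ▷ h') ▷ g ≫ (f' ≫ h') ◁ θ =
      ((η ▷ h) ▷ g ≫ (f' ≫ h) ◁ θ) ≫ (f' ◁ κ) ▷ g'
    rw [← Bicategory.comp_whiskerRight_assoc, Bicategory.whisker_exchange,
      Bicategory.comp_whiskerRight_assoc, ← Bicategory.whisker_exchange, Category.assoc]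

/-- `Hom(f', g') ∘ Hom(f, g) ⟹ Hom(f ∘ f', g' ∘ g)`. In a strict 2-category its components are
identities. -/
@[simps]
def homComp {A'' A' A B B' B'' : C} (f' : A'' ⟶ A') (f : A' ⟶ A) (g : B ⟶ B') (g' : B' ⟶ B'') :
    homMap f g ⋙ homMap f' g' ⟶ homMap (f' ≫ f) (g ≫ g') where
  app h := (α_ f' (f ≫ h) g).inv ▷ g' ≫ ((α_ f' f h).inv ▷ g) ▷ g' ≫
    (α_ ((f' ≫ f) ≫ h) g g').hom
  naturality h h' κ := by
    change (f' ◁ (f ◁ κ) ▷ g) ▷ g' ≫ (α_ f' (f ≫ h') g).inv ▷ g' ≫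
        ((α_ f' f h').inv ▷ g) ▷ g' ≫ (α_ ((f' ≫ f) ≫ h') g g').hom =
      ((α_ f' (f ≫ h) g).inv ▷ g' ≫ ((α_ f' f h).inv ▷ g) ▷ g' ≫
        (α_ ((f' ≫ f) ≫ h) g g').hom) ≫ ((f' ≫ f) ◁ κ) ▷ (g ≫ g')
    bicategory

/-- `Hom(id, id) ⟹ id`. In a strict 2-category its components are identities. -/
@[simps]
def homId (A B : C) : homMap (𝟙 A) (𝟙 B) ⟶ 𝟭 (A ⟶ B) where
  app h := (ρ_ (𝟙 A ≫ h)).hom ≫ (λ_ h).hom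
  naturality h h' κ := by
    change (𝟙 A ◁ κ) ▷ 𝟙 B ≫ (ρ_ (𝟙 A ≫ h')).hom ≫ (λ_ h').hom =
      ((ρ_ (𝟙 A ≫ h)).hom ≫ (λ_ h).hom) ≫ κ
    simp

end Hom

/-- Conditions (LS1) and (LS2): a strict 2-category whose hom-categories are symmetric categorical
groups (symmetric monoidal groupoids in which every object has an inverse up to isomorphism) with
`0 ∘ 0 = 0`, such that `Hom` is a strict 2-functor to symmetric categorical groups. As the
underlying functors and natural transformations of this 2-functor are given by composition, this
means: the functors `Hom(f, g)` are symmetric monoidal, the transformations `Hom(η, θ)` are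
monoidal, and the equalities of functors `Hom(f', g') ∘ Hom(f, g) = Hom(f ∘ f', g' ∘ g)` and
`Hom(id, id) = id` are equalities of monoidal functors. -/
structure HomSCG (C : Type u) [Bicategory.{w, v} C] where
  strict : Bicategory.Strict C
  locallyGroupoid : Bicategory.IsLocallyGroupoid C
  [monoidal : ∀ A B : C, MonoidalCategory (A ⟶ B)]
  [symmetric : ∀ A B : C, SymmetricCategory (A ⟶ B)]
  exists_inverse : ∀ {A B : C} (f : A ⟶ B), ∃ g : A ⟶ B,
    Nonempty (MonoidalCategory.tensorObj f g ≅ MonoidalCategory.tensorUnit (A ⟶ B))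
  unit_comp_unit : ∀ A B D : C,
    MonoidalCategory.tensorUnit (A ⟶ B) ≫ MonoidalCategory.tensorUnit (B ⟶ D) =
      MonoidalCategory.tensorUnit (A ⟶ D)
  [homBraided : ∀ {A' A B B' : C} (f : A' ⟶ A) (g : B ⟶ B'), (homMap f g).Braided]
  homMap₂_monoidal : ∀ {A' A B B' : C} {f f' : A' ⟶ A} {g g' : B ⟶ B'} (η : f ⟶ f') (θ : g ⟶ g'),
    NatTrans.IsMonoidal (homMap₂ η θ)
  homComp_monoidal : ∀ {A'' A' A B B' B'' : C}
    (f' : A'' ⟶ A') (f : A' ⟶ A) (g : B ⟶ B') (g' : B' ⟶ B''),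
    NatTrans.IsMonoidal (homComp f' f g g')
  homId_monoidal : ∀ A B : C, NatTrans.IsMonoidal (homId A B)

namespace HomSCG

variable {C : Type u} [Bicategory.{w, v} C] (S : HomSCG C)

/-- The unit `0` of the symmetric categorical group `C(A, B)`. -/
def zero (A B : C) : A ⟶ B :=
  letI := S.monoidal A B
  MonoidalCategory.tensorUnit (A ⟶ B)

/-- The unit isomorphism `g ∘ 0 ∘ f ⟹ 0` of the symmetric monoidal functor `Hom(f, g)`. -/
def unitIso {A' A B B' : C} (f : A' ⟶ A) (g : B ⟶ B') :
    (f ≫ S.zero A B) ≫ g ≅ S.zero A' B' :=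
  letI := S.monoidal
  letI := S.symmetric
  letI := S.homBraided f g
  (Functor.Monoidal.εIso (homMap f g)).symm

/-- The unit isomorphism `f ∘ 0 ⟹ 0` of the symmetric monoidal functor
`f ∘ - = Hom(id, f) : C(X, A) ⥤ C(X, B)`. -/
def postUnit (X : C) {A B : C} (f : A ⟶ B) : S.zero X A ≫ f ≅ S.zero X B :=
  Bicategory.whiskerRightIso (λ_ (S.zero X A)).symm f ≪≫ S.unitIso (𝟙 X) f

/-- The unit isomorphism `0 ∘ f ⟹ 0` of the symmetric monoidal functor
`- ∘ f = Hom(f, id) : C(B, Y) ⥤ C(A, Y)`. -/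
def preUnit {A B : C} (f : A ⟶ B) (Y : C) : f ≫ S.zero B Y ≅ S.zero A Y :=
  (ρ_ (f ≫ S.zero B Y)).symm ≪≫ S.unitIso f (𝟙 Y)

theorem unitIso_map₂ {A' A B B' : C} {f f' : A' ⟶ A} {g g' : B ⟶ B'} (η : f ⟶ f')
    (θ : g ⟶ g') :
    (η ▷ S.zero A B) ▷ g ≫ (f' ≫ S.zero A B) ◁ θ ≫ (S.unitIso f' g').hom =
      (S.unitIso f g).hom := by
  let := S.monoidal
  let := S.symmetric
  let := S.homBraided f g
  let := S.homBraided f' g'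
  have h : (S.unitIso f g).inv ≫ (η ▷ S.zero A B) ▷ g ≫ (f' ≫ S.zero A B) ◁ θ =
    (S.unitIso f' g').inv := (S.homMap₂_monoidal η θ).unit
  rw [← Iso.inv_comp_eq_id, ← Category.assoc (f := (η ▷ S.zero A B) ▷ g), ← Category.assoc, h,
    Iso.inv_hom_id]

theorem unitIso_comp {A'' A' A B B' B'' : C} (f' : A'' ⟶ A') (f : A' ⟶ A) (g : B ⟶ B')
    (g' : B' ⟶ B'') :
    (α_ f' (f ≫ S.zero A B) g).inv ▷ g' ≫ ((α_ f' f (S.zero A B)).inv ▷ g) ▷ g' ≫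
      (α_ ((f' ≫ f) ≫ S.zero A B) g g').hom ≫ (S.unitIso (f' ≫ f) (g ≫ g')).hom =
    (f' ◁ (S.unitIso f g).hom) ▷ g' ≫ (S.unitIso f' g').hom := by
  let := S.monoidal
  let := S.symmetric
  let := S.homBraided f g
  let := S.homBraided f' g'
  let := S.homBraided (f' ≫ f) (g ≫ g')
  have h : ((S.unitIso f' g').inv ≫ (f' ◁ (S.unitIso f g).inv) ▷ g') ≫
      (α_ f' (f ≫ S.zero A B) g).inv ▷ g' ≫ ((α_ f' f (S.zero A B)).inv ▷ g) ▷ g' ≫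
      (α_ ((f' ≫ f) ≫ S.zero A B) g g').hom = (S.unitIso (f' ≫ f) (g ≫ g')).inv :=
    (S.homComp_monoidal f' f g g').unit
  rw [← cancel_epi ((S.unitIso f' g').inv ≫ (f' ◁ (S.unitIso f g).inv) ▷ g')]
  have h2 := h =≫ (S.unitIso (f' ≫ f) (g ≫ g')).hom
  simp only [Category.assoc, Iso.inv_hom_id] at h2 ⊢
  rw [h2]
  simp

theorem unitIso_id (A B : C) :
    (S.unitIso (𝟙 A) (𝟙 B)).hom = (ρ_ (𝟙 A ≫ S.zero A B)).hom ≫ (λ_ (S.zero A B)).hom := by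
  let := S.monoidal
  let := S.symmetric
  let := S.homBraided (𝟙 A) (𝟙 B)
  have h : (S.unitIso (𝟙 A) (𝟙 B)).inv ≫
      (ρ_ (𝟙 A ≫ S.zero A B)).hom ≫ (λ_ (S.zero A B)).hom = 𝟙 _ :=
    (S.homId_monoidal A B).unit
  rw [← cancel_epi (S.unitIso (𝟙 A) (𝟙 B)).inv, h, Iso.inv_hom_id]

theorem unitIso_eq_pre_post {A B D E : C} (f : A ⟶ B) (g : D ⟶ E) :
    (S.unitIso f g).hom = (S.preUnit f D).hom ▷ g ≫ (S.postUnit A g).hom := by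
  have h := S.unitIso_comp (𝟙 A) f (𝟙 D) g
  rw [← S.unitIso_map₂ (λ_ f).inv (λ_ g).inv]
  have e : (S.preUnit f D).hom ▷ g ≫ (S.postUnit A g).hom =
      ((ρ_ (f ≫ S.zero B D)).inv ≫ (λ_ _).inv) ▷ g ≫
        (𝟙 A ◁ (S.unitIso f (𝟙 D)).hom) ▷ g ≫ (S.unitIso (𝟙 A) g).hom := by
    simp [preUnit, postUnit]
  rw [e, ← h]
  simp only [← Category.assoc]
  congr 1
  bicategory

theorem unitIso_eq_post_pre {A B D E : C} (f : A ⟶ B) (g : D ⟶ E) :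
    (S.unitIso f g).hom =
      (α_ f (S.zero B D) g).hom ≫ f ◁ (S.postUnit B g).hom ≫ (S.preUnit f E).hom := by
  have h := S.unitIso_comp f (𝟙 B) g (𝟙 E)
  rw [← S.unitIso_map₂ (ρ_ f).inv (ρ_ g).inv]
  have e : (α_ f (S.zero B D) g).hom ≫ f ◁ (S.postUnit B g).hom ≫ (S.preUnit f E).hom =
      (α_ f (S.zero B D) g).hom ≫ f ◁ (λ_ (S.zero B D)).inv ▷ g ≫ (ρ_ _).inv ≫
        (f ◁ (S.unitIso (𝟙 B) g).hom) ▷ 𝟙 E ≫ (S.unitIso f (𝟙 E)).hom := by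
    simp [preUnit, postUnit]
  rw [e, ← h]
  simp only [← Category.assoc]
  congr 1
  bicategory

theorem postUnit_naturality (X : C) {A B : C} {f g : A ⟶ B} (η : f ⟶ g) :
    S.zero X A ◁ η ≫ (S.postUnit X g).hom = (S.postUnit X f).hom := by
  have h := S.unitIso_map₂ (A := X) (𝟙 (𝟙 X)) η
  simp only [postUnit, Iso.trans_hom, ← h]
  simp

theorem preUnit_naturality {A B : C} {f g : A ⟶ B} (η : f ⟶ g) (Y : C) :
    η ▷ S.zero B Y ≫ (S.preUnit g Y).hom = (S.preUnit f Y).hom := by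
  have h := S.unitIso_map₂ (B := Y) η (𝟙 (𝟙 Y))
  simp only [preUnit, Iso.trans_hom, ← h]
  simp

theorem postUnit_id (X A : C) : S.postUnit X (𝟙 A) = ρ_ (S.zero X A) := by
  ext
  simp [postUnit, unitIso_id]

theorem preUnit_id (A Y : C) : S.preUnit (𝟙 A) Y = λ_ (S.zero A Y) := by
  ext
  simp [preUnit, unitIso_id]

theorem postUnit_comp (X : C) {A B D : C} (f : A ⟶ B) (g : B ⟶ D) :
    (S.postUnit X (f ≫ g)).hom =
      (α_ (S.zero X A) f g).inv ≫ (S.postUnit X f).hom ▷ g ≫ (S.postUnit X g).hom := by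
  have h := S.unitIso_comp (𝟙 X) (𝟙 X) f g
  have h1 := S.unitIso_map₂ (A := X) (λ_ (𝟙 X)).inv (𝟙 (f ≫ g))
  have e : (S.postUnit X f).hom ▷ g ≫ (S.postUnit X g).hom =
      ((λ_ (S.zero X A)).inv ▷ f ≫ (λ_ _).inv) ▷ g ≫
        (𝟙 X ◁ (S.unitIso (𝟙 X) f).hom) ▷ g ≫ (S.unitIso (𝟙 X) g).hom := by
    simp [postUnit]
  rw [e, ← h]
  simp only [postUnit, Iso.trans_hom, ← h1]
  simp only [← Category.assoc]
  congr 1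
  simp only [Bicategory.whiskerRightIso_hom, Iso.symm_hom]
  bicategory

theorem preUnit_comp {A B D : C} (f : A ⟶ B) (g : B ⟶ D) (Y : C) :
    (S.preUnit (f ≫ g) Y).hom =
      (α_ f g (S.zero D Y)).hom ≫ f ◁ (S.preUnit g Y).hom ≫ (S.preUnit f Y).hom := by
  have h := S.unitIso_comp f g (𝟙 Y) (𝟙 Y)
  have h1 := S.unitIso_map₂ (B := Y) (𝟙 (f ≫ g)) (λ_ (𝟙 Y)).inv
  have e : f ◁ (S.preUnit g Y).hom ≫ (S.preUnit f Y).hom =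
      f ◁ (ρ_ (g ≫ S.zero D Y)).inv ≫ (ρ_ _).inv ≫
        (f ◁ (S.unitIso g (𝟙 Y)).hom) ▷ 𝟙 Y ≫ (S.unitIso f (𝟙 Y)).hom := by
    simp [preUnit]
  rw [e, ← h]
  simp only [preUnit, Iso.trans_hom, ← h1]
  simp only [← Category.assoc]
  congr 1
  simp only [Iso.symm_hom]
  bicategory

end HomSCG

/-- Locally `SCG` 2-categories, without condition (LS3+). -/
structure LocallySCG (C : Type u) [Bicategory.{w, v} C] extends HomSCG C where
  /-- `(- ∘ 0)_I = id` -/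
  preUnit_zero : ∀ A B D : C,
    toHomSCG.preUnit (toHomSCG.zero A B) D = eqToIso (unit_comp_unit A B D)
  /-- `(0 ∘ -)_I = id` -/
  postUnit_zero : ∀ A B D : C,
    toHomSCG.postUnit A (toHomSCG.zero B D) = eqToIso (unit_comp_unit A B D)
  zeroObject : ∃ Z : C, IsZeroObject toHomSCG.zero Z
  products : HasProducts C
  coproducts : HasCoproducts C

namespace LocallySCG

variable {C : Type u} [Bicategory.{w, v} C] (S : LocallySCG C)

/-- The underlying `Gpd*`-category of a locally `SCG` 2-category: the zero 1-cells are the units of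
the hom-groupoids, the 2-cells `f ∘ 0 ⟹ 0` and `0 ∘ f ⟹ 0` are the unit isomorphisms of the
symmetric monoidal functors `f ∘ -` and `- ∘ f`. -/
def toGpdStar : GpdStar C where
  locallyGroupoid := S.locallyGroupoid
  zero := S.zero
  zeroComp X _ _ f := S.postUnit X f
  compZero f Y := S.preUnit f Y
  zeroComp_naturality X _ _ _ _ η := S.postUnit_naturality X η
  compZero_naturality η Y := S.preUnit_naturality η Y
  zeroComp_id := S.postUnit_id
  compZero_id := S.preUnit_id
  zeroComp_comp X _ _ _ f g := S.postUnit_comp X f g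
  compZero_comp f g Y := S.preUnit_comp f g Y
  comp_zero_comp f g := (S.unitIso_eq_pre_post f g).symm.trans (S.unitIso_eq_post_pre f g)
  zero_zero A B D := (S.postUnit_zero A B D).trans (S.preUnit_zero A B D).symm

/-- Relatively exact 2-categories, without condition (LS3+). -/
structure IsRelativelyExact : Prop where
  kernels : S.toGpdStar.HasKernels
  cokernels : S.toGpdStar.HasCokernels
  faithful_iff : ∀ {A B : C} (f : A ⟶ B), IsFaithful f ↔ S.toGpdStar.IsKerOfCok f
  cofaithful_iff : ∀ {A B : C} (f : A ⟶ B), IsCofaithful f ↔ S.toGpdStar.IsCokOfKer f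

end LocallySCG

end TwoCat

-- (i) In a 2-abelian `Gpd`-category the comparison from the coproduct of `B` with itself to the
-- product is 0-faithful and 0-cofaithful, hence the kernel of its cokernel and the cokernel of its
-- kernel. Both of these turn out to be null, so the comparison is an equivalence and `B` has a
-- double that is product and coproduct at once (`IsTwoAbelian.exists_biproduct`). The sum of `f, g
-- : A ⟶ B` is the pair of `f` and `g` followed by the codiagonal.
--
-- The difficulty is the coherence of this sum. Composition on either side preserves sums; applied
-- to the codiagonal itself, this yields an interchange `χ : (f + h) + (g + k) ⟶ (f + g) + (h + k)`,
-- from which associativity and commutativity are defined by the Eckmann-Hilton argument, that is,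
-- by inserting zeros. Every functor that preserves sums and `χ` then preserves associativity and
-- commutativity. This applies to the codiagonal and to the two projections, viewed as functors from
-- `C(A, B ⊕ B)` to `C(A, B)`. The projections are jointly faithful, and every 1-cell is the
-- codiagonal image of a pair one of whose components is zero. So a coherence equation at `(a, b, c,
-- d)` follows from its instances at `(a, 0, 0, 0)` and `(0, b, c, d)` (`IsSplitting.induction`),
-- and these follow from the unit laws, together with the coherence equations already established.
--
-- Negatives come from the shear `(p₁, fold)` of `B ⊕ B`: it is 0-faithful with null cokernel, so
-- the identity factors through it, and a component of the factorization is a negative of the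
-- identity (`SemiAdditive.hasNeg`). Relative exactness follows because faithful implies 0-faithful,
-- while every kernel is faithful.
--
-- (ii) Adding a negative turns any automorphism of a 1-cell into one of `0`, so 0-faithful and
-- faithful coincide, and every 0-faithful 1-cell is the kernel of its cokernel. For the stability
-- axioms, a pushout of `f` and `g` is a cokernel of the difference `i₁ f - i₂ g` into the
-- coproduct. Projecting this difference to the first summand gives back `f`, so it inherits
-- 0-faithfulness and is the kernel of the 1-cell to the pushout; the properties of the opposite
-- edge are read off from this. Pullbacks are treated dually.
--
-- The example consists of 2-vector spaces over `ℚ`: a 1-cell is a pair of linear maps and a 2-cell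
-- is a linear map from the first space of the source to the second space of the target. Each 1-cell
-- also carries an element of a nontrivial monoid that the 2-cells ignore. Up to 2-cells nothing is
-- changed by these marks, but `0 ∘ f` and `f ∘ 0` retain the mark of `f` and so need not equal `0`.

universe v₁ v₂ v₃ v₄ u₁ u₂ u₃ u₄

/-! ### Additions with unit and interchange; the Eckmann-Hilton associativity and commutativity. -/

namespace TwoCat

open CategoryTheory

/-- A category with an addition functor and a two-sided unit for it. -/
class UnitalAdd (M : Type u₁) [Category.{v₁} M] where
  add : M → M → M
  map {f f' g g' : M} (η : f ⟶ f') (θ : g ⟶ g') : add f g ⟶ add f' g'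
  map_id (f g : M) : map (𝟙 f) (𝟙 g) = 𝟙 (add f g)
  map_comp_map {f f' f'' g g' g'' : M} (η : f ⟶ f') (θ : g ⟶ g') (η' : f' ⟶ f'')
    (θ' : g' ⟶ g'') : map η θ ≫ map η' θ' = map (η ≫ η') (θ ≫ θ')
  zero : M
  lam (f : M) : add zero f ⟶ f
  rho (f : M) : add f zero ⟶ f
  lam_naturality {f g : M} (η : f ⟶ g) : map (𝟙 zero) η ≫ lam g = lam f ≫ η
  rho_naturality {f g : M} (η : f ⟶ g) : map η (𝟙 zero) ≫ rho g = rho f ≫ η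
  lam_zero : lam zero = rho zero

namespace UnitalAdd

scoped infixl:65 " ⊹ " => UnitalAdd.add
scoped infixl:65 " ⊹ₘ " => UnitalAdd.map

attribute [simp] map_id map_comp_map

variable {M : Type u₁} [Category.{v₁} M] [UnitalAdd M]

@[simp]
theorem map_comp_map_assoc {f f' f'' g g' g'' h : M} (η : f ⟶ f') (θ : g ⟶ g') (η' : f' ⟶ f'')
    (θ' : g' ⟶ g'') (κ : f'' ⊹ g'' ⟶ h) :
    (η ⊹ₘ θ) ≫ (η' ⊹ₘ θ') ≫ κ = ((η ≫ η') ⊹ₘ (θ ≫ θ')) ≫ κ := by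
  rw [← Category.assoc, map_comp_map]

variable [IsGroupoid M]

theorem lam_zero_add (f : M) : lam (zero ⊹ f) = 𝟙 zero ⊹ₘ lam f := by
  rw [← cancel_mono (lam f), lam_naturality]

theorem rho_add_zero (f : M) : rho (f ⊹ zero) = rho f ⊹ₘ 𝟙 zero := by
  rw [← cancel_mono (rho f), rho_naturality]

theorem inv_map {f f' g g' : M} (η : f ⟶ f') (θ : g ⟶ g') :
    inv (η ⊹ₘ θ) = inv η ⊹ₘ inv θ := by
  rw [← cancel_epi (η ⊹ₘ θ)]
  simp

theorem lam_inv_naturality {f g : M} (η : f ⟶ g) :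
    inv (lam f) ≫ (𝟙 zero ⊹ₘ η) = η ≫ inv (lam g) := by
  rw [IsIso.inv_comp_eq, ← Category.assoc, IsIso.eq_comp_inv, lam_naturality]

theorem rho_inv_naturality {f g : M} (η : f ⟶ g) :
    inv (rho f) ≫ (η ⊹ₘ 𝟙 zero) = η ≫ inv (rho g) := by
  rw [IsIso.inv_comp_eq, ← Category.assoc, IsIso.eq_comp_inv, rho_naturality]

end UnitalAdd

open UnitalAdd

/-- The structure on a functor of preserving the addition and its unit. -/
class AddPres {M : Type u₁} {N : Type u₂} [Category.{v₁} M] [Category.{v₂} N] [UnitalAdd M]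
    [UnitalAdd N] (F : M ⥤ N) where
  δ (F) (f g : M) : F.obj (f ⊹ g) ⟶ F.obj f ⊹ F.obj g
  υ (F) : F.obj (zero : M) ⟶ (zero : N)
  δ_naturality (F) {f f' g g' : M} (η : f ⟶ f') (θ : g ⟶ g') :
    F.map (η ⊹ₘ θ) ≫ δ f' g' = δ f g ≫ (F.map η ⊹ₘ F.map θ)
  δ_lam (F) (g : M) : δ zero g ≫ (υ ⊹ₘ 𝟙 _) ≫ lam (F.obj g) = F.map (lam g)
  δ_rho (F) (f : M) : δ f zero ≫ (𝟙 _ ⊹ₘ υ) ≫ rho (F.obj f) = F.map (rho f)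

/-- A unital addition that is compatible with itself, in the sense that addition is a functor
preserving addition. -/
class Interchange (M : Type u₁) [Category.{v₁} M] [UnitalAdd M] where
  χ (f h g k : M) : (f ⊹ h) ⊹ (g ⊹ k) ⟶ (f ⊹ g) ⊹ (h ⊹ k)
  χ_naturality {f h g k f' h' g' k' : M} (η : f ⟶ f') (θ : h ⟶ h') (κ : g ⟶ g') (ι : k ⟶ k') :
    ((η ⊹ₘ θ) ⊹ₘ (κ ⊹ₘ ι)) ≫ χ f' h' g' k' = χ f h g k ≫ ((η ⊹ₘ κ) ⊹ₘ (θ ⊹ₘ ι))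
  χ_mid_zero (f g : M) :
    χ f zero g zero ≫ (𝟙 _ ⊹ₘ lam zero) ≫ rho (f ⊹ g) = rho f ⊹ₘ rho g
  χ_zero_mid (h k : M) :
    χ zero h zero k ≫ (lam zero ⊹ₘ 𝟙 _) ≫ lam (h ⊹ k) = lam h ⊹ₘ lam k
  χ_right_zero (f h : M) :
    χ f h zero zero ≫ (rho f ⊹ₘ rho h) = (𝟙 _ ⊹ₘ lam zero) ≫ rho (f ⊹ h)

/-- The functor `F` is compatible with the interchange. -/
class InterchangePres {M : Type u₁} {N : Type u₂} [Category.{v₁} M] [Category.{v₂} N]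
    [UnitalAdd M] [UnitalAdd N] [Interchange M] [Interchange N] (F : M ⥤ N) [AddPres F] :
    Prop where
  map_χ (F) (f h g k : M) : F.map (Interchange.χ f h g k) ≫ AddPres.δ F (f ⊹ g) (h ⊹ k) ≫
      (AddPres.δ F f g ⊹ₘ AddPres.δ F h k) =
    AddPres.δ F (f ⊹ h) (g ⊹ k) ≫ (AddPres.δ F f h ⊹ₘ AddPres.δ F g k) ≫
      Interchange.χ (F.obj f) (F.obj h) (F.obj g) (F.obj k)

open AddPres Interchange

section Assoc

variable {M : Type u₁} [Category.{v₁} M] [UnitalAdd M] [Interchange M] [IsGroupoid M]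

/-- The associativity of addition. -/
noncomputable def assoc (f g h : M) : (f ⊹ g) ⊹ h ⟶ f ⊹ (g ⊹ h) :=
  -- Interchange with a zero inserted: `(f + g) + h ≅ (f + g) + (0 + h) ≅ (f + 0) + (g + h) ≅ f + (g
  -- + h)`.
  (𝟙 _ ⊹ₘ inv (lam h)) ≫ χ f g zero h ≫ (rho f ⊹ₘ 𝟙 _)

/-- The commutativity of addition. -/
noncomputable def comm (f g : M) : f ⊹ g ⟶ g ⊹ f :=
  (inv (lam f) ⊹ₘ inv (rho g)) ≫ χ zero f g zero ≫ (lam g ⊹ₘ rho f)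

theorem assoc_naturality {f g h f' g' h' : M} (η : f ⟶ f') (θ : g ⟶ g') (κ : h ⟶ h') :
    ((η ⊹ₘ θ) ⊹ₘ κ) ≫ assoc f' g' h' = assoc f g h ≫ (η ⊹ₘ (θ ⊹ₘ κ)) := by
  have := χ_naturality η θ (𝟙 zero) κ
  simp only [assoc, Category.assoc, map_comp_map, Category.id_comp, Category.comp_id,
    map_comp_map_assoc, ← rho_naturality, ← lam_inv_naturality]
  have e : (η ⊹ₘ θ) ⊹ₘ (inv (lam h) ≫ (𝟙 zero ⊹ₘ κ)) =
      (𝟙 _ ⊹ₘ inv (lam h)) ≫ ((η ⊹ₘ θ) ⊹ₘ (𝟙 zero ⊹ₘ κ)) := by simp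
  rw [e, Category.assoc, reassoc_of% this]
  simp

theorem comm_naturality {f g f' g' : M} (η : f ⟶ f') (θ : g ⟶ g') :
    (η ⊹ₘ θ) ≫ comm f' g' = comm f g ≫ (θ ⊹ₘ η) := by
  have := χ_naturality (𝟙 zero) η θ (𝟙 zero)
  simp only [comm, Category.assoc, map_comp_map,
    map_comp_map_assoc, ← rho_naturality, ← lam_naturality, ← lam_inv_naturality,
    ← rho_inv_naturality]
  rw [← map_comp_map, Category.assoc, reassoc_of% this]
  simp

/-- Once the unit isomorphisms are inserted, this is the compatibility of `χ` with a zero second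
summand. It and the next three lemmas are the degenerate cases to which all coherence equations will
be reduced. -/
theorem assoc_right_zero (f : M) :
    assoc f zero zero ≫ (𝟙 f ⊹ₘ lam zero) = rho f ⊹ₘ 𝟙 zero := by
  have h := χ_right_zero f zero
  rw [rho_add_zero, ← lam_zero] at h
  simp only [assoc, Category.assoc, map_comp_map, Category.id_comp, Category.comp_id, h]
  simp

theorem assoc_left_zero (g h : M) : assoc zero g h ≫ lam (g ⊹ h) = lam g ⊹ₘ 𝟙 h := by
  have e := χ_zero_mid g h
  rw [lam_zero] at e
  simp only [assoc, Category.assoc, e]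
  simp

theorem comm_zero (f : M) : comm f zero ≫ lam f = rho f := by
  have h := χ_zero_mid f zero
  have e : (lam zero ⊹ₘ rho f) ≫ lam f = (lam zero ⊹ₘ 𝟙 _) ≫ lam (f ⊹ zero) ≫ rho f := by
    rw [← lam_naturality]
    simp
  simp only [comm, Category.assoc, e]
  rw [reassoc_of% h, lam_zero]
  simp

theorem zero_comm (g : M) : comm zero g ≫ rho g = lam g := by
  have h := χ_mid_zero zero g
  have e : (lam g ⊹ₘ rho zero) ≫ rho g = (𝟙 _ ⊹ₘ lam zero) ≫ rho (zero ⊹ g) ≫ lam g := by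
    rw [← rho_naturality, lam_zero]
    simp
  simp only [comm, Category.assoc, e]
  rw [reassoc_of% h, ← lam_zero]
  simp

variable {N : Type u₂} [Category.{v₂} N] [UnitalAdd N] [Interchange N] [IsGroupoid N]
variable (F : M ⥤ N) [AddPres F] [InterchangePres F]

/-- Associativity is composed of `χ` and unit isomorphisms, all of which `F` preserves. This is what
defining associativity through `χ` achieves. -/
theorem map_assoc (f g h : M) : F.map (assoc f g h) ≫ δ F f (g ⊹ h) ≫ (𝟙 _ ⊹ₘ δ F g h) =
    δ F (f ⊹ g) h ≫ (δ F f g ⊹ₘ 𝟙 _) ≫ assoc (F.obj f) (F.obj g) (F.obj h) := by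
  have h1 := InterchangePres.map_χ F f g zero h
  have h2 := δ_naturality F (𝟙 (f ⊹ g)) (inv (lam h))
  have h3 := δ_naturality F (rho f) (𝟙 (g ⊹ h))
  have h4 := χ_naturality (𝟙 (F.obj f)) (𝟙 (F.obj g)) (υ F) (𝟙 (F.obj h))
  -- The zero inserted in `M` is carried to the zero inserted in `N` by `υ`; `h4'` moves this `υ`
  -- across the interchange.
  have e : F.map (inv (lam h)) ≫ δ F zero h ≫ (υ F ⊹ₘ 𝟙 _) = inv (lam (F.obj h)) := by
    rw [← cancel_mono (lam (F.obj h))]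
    simp only [Category.assoc, δ_lam, ← F.map_comp]
    simp
  have e2 := δ_rho F f
  have e4 : F.map (rho f) ⊹ₘ δ F g h =
    (δ F f zero ⊹ₘ δ F g h) ≫ ((𝟙 _ ⊹ₘ υ F) ⊹ₘ 𝟙 _) ≫ (rho (F.obj f) ⊹ₘ 𝟙 _) := by simp [e2]
  have h4' : (𝟙 _ ⊹ₘ (υ F ⊹ₘ 𝟙 _)) ≫ χ (F.obj f) (F.obj g) zero (F.obj h) =
    χ _ _ _ _ ≫ ((𝟙 _ ⊹ₘ υ F) ⊹ₘ 𝟙 _) := by simpa using h4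
  calc _ = F.map (𝟙 _ ⊹ₘ inv (lam h)) ≫ F.map (χ f g zero h) ≫ δ F _ _ ≫
        (F.map (rho f) ⊹ₘ δ F g h) := by
        simp only [assoc, F.map_comp, Category.assoc, reassoc_of% h3]
        simp
    _ = F.map (𝟙 _ ⊹ₘ inv (lam h)) ≫ δ F _ _ ≫ (δ F f g ⊹ₘ δ F zero h) ≫ χ _ _ _ _ ≫
        ((𝟙 _ ⊹ₘ υ F) ⊹ₘ 𝟙 _) ≫ (rho (F.obj f) ⊹ₘ 𝟙 _) := by
        rw [e4, reassoc_of% h1]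
    _ = _ := by
        rw [reassoc_of% h2, ← reassoc_of% h4', F.map_id]
        simp only [assoc, map_comp_map_assoc, Category.id_comp, Category.comp_id, e]

theorem map_comm (f g : M) : F.map (comm f g) ≫ δ F g f = δ F f g ≫ comm (F.obj f) (F.obj g) := by
  have h1 := InterchangePres.map_χ F zero f g zero
  have h2 := δ_naturality F (inv (lam f)) (inv (rho g))
  have h3 := δ_naturality F (lam g) (rho f)
  have h4 := χ_naturality (υ F) (𝟙 (F.obj f)) (𝟙 (F.obj g)) (υ F)
  have e : F.map (inv (lam f)) ≫ δ F zero f ≫ (υ F ⊹ₘ 𝟙 _) = inv (lam (F.obj f)) := by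
    rw [← cancel_mono (lam (F.obj f))]
    simp only [Category.assoc, δ_lam, ← F.map_comp]
    simp
  have e' : F.map (inv (rho g)) ≫ δ F g zero ≫ (𝟙 _ ⊹ₘ υ F) = inv (rho (F.obj g)) := by
    rw [← cancel_mono (rho (F.obj g))]
    simp only [Category.assoc, δ_rho, ← F.map_comp]
    simp
  have e4 : F.map (lam g) ⊹ₘ F.map (rho f) =
    (δ F zero g ⊹ₘ δ F f zero) ≫ ((υ F ⊹ₘ 𝟙 _) ⊹ₘ (𝟙 _ ⊹ₘ υ F)) ≫
      (lam (F.obj g) ⊹ₘ rho (F.obj f)) := by simp [δ_rho, δ_lam]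
  calc _ = F.map (inv (lam f) ⊹ₘ inv (rho g)) ≫ F.map (χ zero f g zero) ≫ δ F _ _ ≫
        (F.map (lam g) ⊹ₘ F.map (rho f)) := by
        simp only [comm, F.map_comp, Category.assoc, h3]
    _ = F.map (inv (lam f) ⊹ₘ inv (rho g)) ≫ δ F _ _ ≫ (δ F zero f ⊹ₘ δ F g zero) ≫ χ _ _ _ _ ≫
        ((υ F ⊹ₘ 𝟙 _) ⊹ₘ (𝟙 _ ⊹ₘ υ F)) ≫ (lam (F.obj g) ⊹ₘ rho (F.obj f)) := by
        rw [e4, reassoc_of% h1]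
    _ = _ := by
        rw [reassoc_of% h2, ← reassoc_of% h4]
        simp only [comm, map_comp_map_assoc, e, e']

end Assoc

end TwoCat

/-! ### Coherence of an addition by splitting objects into pairs; the resulting symmetric monoidal
structure. -/

namespace TwoCat

open CategoryTheory UnitalAdd AddPres Interchange

/-- Used to compare a coherence equation in `M`, mapped by `F`, with the corresponding equation in
`N`: both sides are conjugated by the same structural isomorphisms of `F`. -/
theorem map_eq_iff {M : Type u₁} [Category.{v₁} M] {N : Type u₂} [Category.{v₂} N] [IsGroupoid N]
    {F : M ⥤ N} {a b : M} {l r : a ⟶ b} {a' b' : N} {l' r' : a' ⟶ b'}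
    (e : F.obj a ⟶ a') (c : F.obj b ⟶ b') (hl : F.map l ≫ c = e ≫ l')
    (hr : F.map r ≫ c = e ≫ r') : F.map l = F.map r ↔ l' = r' := by
  rw [← cancel_mono c, hl, hr, cancel_epi]

theorem conj_eq_iff {M : Type u₁} [Category.{v₁} M] [IsGroupoid M] {a b : M} {l r : a ⟶ b}
    {a' b' : M} {l' r' : a' ⟶ b'} (e : a ⟶ a') (c : b ⟶ b') (hl : l ≫ c = e ≫ l')
    (hr : r ≫ c = e ≫ r') : l = r ↔ l' = r' := by
  rw [← cancel_mono c, hl, hr, cancel_epi]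

section Splitting

variable {M : Type u₁} [Category.{v₁} M] [UnitalAdd M] {N : Type u₂} [Category.{v₂} N]

/-- The functors `P₁` and `P₂` are jointly faithful and any two objects of `M` are the images under
`T` of objects of `N` whose images under one of `P₁`, `P₂` are zero. -/
structure IsSplitting (T P₁ P₂ : N ⥤ M) : Prop where
  faithful {x y : N} {θ θ' : x ⟶ y} : P₁.map θ = P₁.map θ' → P₂.map θ = P₂.map θ' → θ = θ'
  exists_left (f : M) :
    ∃ x : N, Nonempty (T.obj x ⟶ f) ∧ Nonempty (f ⟶ P₁.obj x) ∧ Nonempty (zero ⟶ P₂.obj x)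
  exists_right (f : M) :
    ∃ x : N, Nonempty (T.obj x ⟶ f) ∧ Nonempty (zero ⟶ P₁.obj x) ∧ Nonempty (f ⟶ P₂.obj x)

/-- Write `a` as the `T`-image of the pair `(a, 0)` and `b, c, d` as those of `(0, b)`, `(0, c)`,
`(0, d)`. On first components the claim is the case `(a, 0, 0, 0)`, on second components the case
`(0, b, c, d)`; joint reflection gives it for the pairs, and `T` carries it back to `M`. -/
theorem IsSplitting.induction {T P₁ P₂ : N ⥤ M} (h : IsSplitting T P₁ P₂)
    {Q : M → M → M → M → Prop} {R : N → N → N → N → Prop}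
    (iso : ∀ {a b c d a' b' c' d' : M}, (a ⟶ a') → (b ⟶ b') → (c ⟶ c') → (d ⟶ d') →
      Q a b c d → Q a' b' c' d')
    (image : ∀ {a b c d : N}, R a b c d → Q (T.obj a) (T.obj b) (T.obj c) (T.obj d))
    (reflect : ∀ {a b c d : N}, Q (P₁.obj a) (P₁.obj b) (P₁.obj c) (P₁.obj d) →
      Q (P₂.obj a) (P₂.obj b) (P₂.obj c) (P₂.obj d) → R a b c d)
    (left : ∀ a : M, Q a zero zero zero) (right : ∀ b c d : M, Q zero b c d) (a b c d : M) :
    Q a b c d := by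
  obtain ⟨x, ⟨x₀⟩, ⟨x₁⟩, ⟨x₂⟩⟩ := h.exists_left a
  obtain ⟨y, ⟨y₀⟩, ⟨y₁⟩, ⟨y₂⟩⟩ := h.exists_right b
  obtain ⟨z, ⟨z₀⟩, ⟨z₁⟩, ⟨z₂⟩⟩ := h.exists_right c
  obtain ⟨t, ⟨t₀⟩, ⟨t₁⟩, ⟨t₂⟩⟩ := h.exists_right d
  exact iso x₀ y₀ z₀ t₀ (image (reflect (iso x₁ y₁ z₁ t₁ (left a)) (iso x₂ y₂ z₂ t₂ (right b c d))))

end Splitting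

section Coherence

variable (M : Type u₁) [Category.{v₁} M] [UnitalAdd M] [Interchange M] [IsGroupoid M]

/-- The coherence conditions of a symmetric monoidal category. -/
class IsCoherent : Prop where
  triangle (f h : M) : assoc f zero h ≫ (𝟙 f ⊹ₘ lam h) = rho f ⊹ₘ 𝟙 h
  pentagon (f g h k : M) : (assoc f g h ⊹ₘ 𝟙 k) ≫ assoc f (g ⊹ h) k ≫ (𝟙 f ⊹ₘ assoc g h k) =
    assoc (f ⊹ g) h k ≫ assoc f g (h ⊹ k)
  symmetry (f g : M) : comm f g ≫ comm g f = 𝟙 (f ⊹ g)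
  hexagon (f g h : M) : assoc f g h ≫ comm f (g ⊹ h) ≫ assoc g h f =
    (comm f g ⊹ₘ 𝟙 h) ≫ assoc g f h ≫ (𝟙 g ⊹ₘ comm f h)

variable {M} {N : Type u₂} [Category.{v₂} N] [UnitalAdd N] [Interchange N] [IsGroupoid N]

section Iso

/-- Each coherence equation depends only on the objects up to isomorphism, by naturality; this and
the next three lemmas provide the hypothesis `iso` of the induction. -/
theorem triangle_iso {f h f' h' : M} (η : f ⟶ f') (θ : h ⟶ h') :
    assoc f zero h ≫ (𝟙 f ⊹ₘ lam h) = rho f ⊹ₘ 𝟙 h ↔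
      assoc f' zero h' ≫ (𝟙 f' ⊹ₘ lam h') = rho f' ⊹ₘ 𝟙 h' := by
  refine conj_eq_iff ((η ⊹ₘ 𝟙 zero) ⊹ₘ θ) (η ⊹ₘ θ) ?_ ?_
  · rw [reassoc_of% assoc_naturality η (𝟙 zero) θ]
    simp [lam_naturality]
  · simp [rho_naturality]

theorem pentagon_iso {f g h k f' g' h' k' : M} (η : f ⟶ f') (θ : g ⟶ g') (κ : h ⟶ h')
    (ι : k ⟶ k') :
    (assoc f g h ⊹ₘ 𝟙 k) ≫ assoc f (g ⊹ h) k ≫ (𝟙 f ⊹ₘ assoc g h k) =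
      assoc (f ⊹ g) h k ≫ assoc f g (h ⊹ k) ↔
    (assoc f' g' h' ⊹ₘ 𝟙 k') ≫ assoc f' (g' ⊹ h') k' ≫ (𝟙 f' ⊹ₘ assoc g' h' k') =
      assoc (f' ⊹ g') h' k' ≫ assoc f' g' (h' ⊹ k') := by
  refine conj_eq_iff (((η ⊹ₘ θ) ⊹ₘ κ) ⊹ₘ ι) (η ⊹ₘ (θ ⊹ₘ (κ ⊹ₘ ι))) ?_ ?_
  · simp only [Category.assoc, map_comp_map, map_comp_map_assoc, Category.id_comp,
      Category.comp_id, assoc_naturality]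
    rw [show η ⊹ₘ assoc g h k ≫ (θ ⊹ₘ (κ ⊹ₘ ι)) =
      (η ⊹ₘ ((θ ⊹ₘ κ) ⊹ₘ ι)) ≫ (𝟙 _ ⊹ₘ assoc g' h' k') by simp [assoc_naturality],
      ← reassoc_of% assoc_naturality η (θ ⊹ₘ κ) ι]
    simp
  · simp only [Category.assoc, assoc_naturality, reassoc_of% assoc_naturality (η ⊹ₘ θ) κ ι]

theorem symmetry_iso {f g f' g' : M} (η : f ⟶ f') (θ : g ⟶ g') :
    comm f g ≫ comm g f = 𝟙 (f ⊹ g) ↔ comm f' g' ≫ comm g' f' = 𝟙 (f' ⊹ g') := by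
  refine conj_eq_iff (η ⊹ₘ θ) (η ⊹ₘ θ) ?_ ?_
  · rw [reassoc_of% comm_naturality η θ, comm_naturality, Category.assoc]
  · simp

theorem hexagon_iso {f g h f' g' h' : M} (η : f ⟶ f') (θ : g ⟶ g') (κ : h ⟶ h') :
    assoc f g h ≫ comm f (g ⊹ h) ≫ assoc g h f =
      (comm f g ⊹ₘ 𝟙 h) ≫ assoc g f h ≫ (𝟙 g ⊹ₘ comm f h) ↔
    assoc f' g' h' ≫ comm f' (g' ⊹ h') ≫ assoc g' h' f' =
      (comm f' g' ⊹ₘ 𝟙 h') ≫ assoc g' f' h' ≫ (𝟙 g' ⊹ₘ comm f' h') := by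
  refine conj_eq_iff ((η ⊹ₘ θ) ⊹ₘ κ) (θ ⊹ₘ (κ ⊹ₘ η)) ?_ ?_
  · rw [reassoc_of% assoc_naturality η θ κ, reassoc_of% comm_naturality η (θ ⊹ₘ κ),
      assoc_naturality, Category.assoc, Category.assoc]
  · have e : 𝟙 g ⊹ₘ comm f h = 𝟙 g ⊹ₘ comm f h := rfl
    have e1 : ((η ⊹ₘ θ) ⊹ₘ κ) ≫ (comm f' g' ⊹ₘ 𝟙 h') =
      (comm f g ⊹ₘ 𝟙 h) ≫ ((θ ⊹ₘ η) ⊹ₘ κ) := by simp [comm_naturality]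
    rw [reassoc_of% e1, reassoc_of% assoc_naturality θ η κ]
    simp [comm_naturality]

end Iso

section Map

variable (F : M ⥤ N) [AddPres F] [InterchangePres F]

/-- An equivalence rather than an implication: left to right it transports the equation along `T`,
right to left it provides the equation in the image of `P₁` and `P₂`, from which joint faithfulness
recovers it in `N`. The three lemmas that follow play the same role. -/
theorem triangle_map (f h : M) :
    F.map (assoc f zero h ≫ (𝟙 f ⊹ₘ lam h)) = F.map (rho f ⊹ₘ 𝟙 h) ↔
      assoc (F.obj f) zero (F.obj h) ≫ (𝟙 _ ⊹ₘ lam (F.obj h)) = rho (F.obj f) ⊹ₘ 𝟙 _ := by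
  refine map_eq_iff (δ F _ _ ≫ (δ F f zero ⊹ₘ 𝟙 _) ≫ ((𝟙 _ ⊹ₘ υ F) ⊹ₘ 𝟙 _)) (δ F f h) ?_ ?_
  · rw [F.map_comp, Category.assoc, δ_naturality, F.map_id, ← δ_lam]
    have := map_assoc F f zero h
    have e : (𝟙 (F.obj f) ⊹ₘ δ F zero h ≫ (υ F ⊹ₘ 𝟙 (F.obj h)) ≫ lam (F.obj h)) =
      (𝟙 _ ⊹ₘ δ F zero h) ≫ (𝟙 _ ⊹ₘ (υ F ⊹ₘ 𝟙 (F.obj h))) ≫ (𝟙 _ ⊹ₘ lam _) := by simp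
    rw [e, reassoc_of% this, ← reassoc_of% assoc_naturality (𝟙 (F.obj f)) (υ F) (𝟙 (F.obj h))]
    simp only [Category.assoc]
  · rw [δ_naturality, ← δ_rho]
    simp

theorem pentagon_map (f g h k : M) :
    F.map ((assoc f g h ⊹ₘ 𝟙 k) ≫ assoc f (g ⊹ h) k ≫ (𝟙 f ⊹ₘ assoc g h k)) =
      F.map (assoc (f ⊹ g) h k ≫ assoc f g (h ⊹ k)) ↔
    (assoc (F.obj f) (F.obj g) (F.obj h) ⊹ₘ 𝟙 _) ≫ assoc (F.obj f) (F.obj g ⊹ F.obj h) (F.obj k)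
      ≫ (𝟙 _ ⊹ₘ assoc (F.obj g) (F.obj h) (F.obj k)) =
      assoc (F.obj f ⊹ F.obj g) (F.obj h) (F.obj k) ≫
        assoc (F.obj f) (F.obj g) (F.obj h ⊹ F.obj k) := by
  refine map_eq_iff (δ F _ _ ≫ (δ F _ _ ⊹ₘ 𝟙 _) ≫ ((δ F _ _ ⊹ₘ 𝟙 _) ⊹ₘ 𝟙 _))
    (δ F _ _ ≫ (𝟙 _ ⊹ₘ δ F _ _) ≫ (𝟙 _ ⊹ₘ (𝟙 _ ⊹ₘ δ F _ _))) ?_ ?_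
  · simp only [F.map_comp, Category.assoc]
    rw [reassoc_of% δ_naturality F (𝟙 f) (assoc g h k)]
    have e : (F.map (𝟙 f) ⊹ₘ F.map (assoc g h k)) ≫ (𝟙 (F.obj f) ⊹ₘ δ F g (h ⊹ k)) ≫
        (𝟙 (F.obj f) ⊹ₘ (𝟙 (F.obj g) ⊹ₘ δ F h k)) =
        (𝟙 _ ⊹ₘ δ F (g ⊹ h) k) ≫ (𝟙 _ ⊹ₘ (δ F g h ⊹ₘ 𝟙 _)) ≫ (𝟙 _ ⊹ₘ assoc _ _ _) := by
      simp [map_assoc]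
    rw [e, reassoc_of% map_assoc F f (g ⊹ h) k,
      ← reassoc_of% assoc_naturality (𝟙 (F.obj f)) (δ F g h) (𝟙 (F.obj k)),
      reassoc_of% δ_naturality F (assoc f g h) (𝟙 k)]
    have e' : (F.map (assoc f g h) ⊹ₘ F.map (𝟙 k)) ≫ (δ F f (g ⊹ h) ⊹ₘ 𝟙 (F.obj k)) ≫
        ((𝟙 (F.obj f) ⊹ₘ δ F g h) ⊹ₘ 𝟙 (F.obj k)) =
        (δ F (f ⊹ g) h ⊹ₘ 𝟙 _) ≫ ((δ F f g ⊹ₘ 𝟙 _) ⊹ₘ 𝟙 _) ≫ (assoc _ _ _ ⊹ₘ 𝟙 _) := by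
      simp [map_assoc]
    rw [reassoc_of% e']
  · simp only [F.map_comp, Category.assoc]
    rw [reassoc_of% map_assoc F f g (h ⊹ k),
      ← assoc_naturality (𝟙 (F.obj f)) (𝟙 (F.obj g)) (δ F h k)]
    have e' : (δ F f g ⊹ₘ 𝟙 (F.obj (h ⊹ k))) ≫ ((𝟙 (F.obj f) ⊹ₘ 𝟙 (F.obj g)) ⊹ₘ δ F h k) ≫
        assoc _ _ _ = (𝟙 _ ⊹ₘ δ F h k) ≫ (δ F f g ⊹ₘ (𝟙 _ ⊹ₘ 𝟙 _)) ≫ assoc _ _ _ := by simp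
    rw [e', reassoc_of% map_assoc F (f ⊹ g) h k,
      ← reassoc_of% assoc_naturality (δ F f g) (𝟙 (F.obj h)) (𝟙 (F.obj k))]

theorem symmetry_map (f g : M) :
    F.map (comm f g ≫ comm g f) = F.map (𝟙 (f ⊹ g)) ↔
      comm (F.obj f) (F.obj g) ≫ comm (F.obj g) (F.obj f) = 𝟙 _ := by
  refine map_eq_iff (δ F f g) (δ F f g) ?_ ?_
  · rw [F.map_comp, Category.assoc, map_comm, reassoc_of% map_comm F f g]
  · simp

theorem hexagon_map (f g h : M) :
    F.map (assoc f g h ≫ comm f (g ⊹ h) ≫ assoc g h f) =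
      F.map ((comm f g ⊹ₘ 𝟙 h) ≫ assoc g f h ≫ (𝟙 g ⊹ₘ comm f h)) ↔
    assoc (F.obj f) (F.obj g) (F.obj h) ≫ comm (F.obj f) (F.obj g ⊹ F.obj h) ≫
      assoc (F.obj g) (F.obj h) (F.obj f) =
      (comm (F.obj f) (F.obj g) ⊹ₘ 𝟙 _) ≫ assoc (F.obj g) (F.obj f) (F.obj h) ≫
        (𝟙 _ ⊹ₘ comm (F.obj f) (F.obj h)) := by
  refine map_eq_iff (δ F _ _ ≫ (δ F _ _ ⊹ₘ 𝟙 _)) (δ F _ _ ≫ (𝟙 _ ⊹ₘ δ F _ _)) ?_ ?_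
  · simp only [F.map_comp, Category.assoc]
    rw [map_assoc, reassoc_of% map_comm F f (g ⊹ h), ← reassoc_of% comm_naturality,
      reassoc_of% map_assoc F f g h]
  · simp only [F.map_comp, Category.assoc]
    rw [reassoc_of% δ_naturality F (𝟙 g) (comm f h)]
    have e : (F.map (𝟙 g) ⊹ₘ F.map (comm f h)) ≫ (𝟙 (F.obj g) ⊹ₘ δ F h f) =
      (𝟙 _ ⊹ₘ δ F f h) ≫ (𝟙 _ ⊹ₘ comm _ _) := by simp [map_comm]
    rw [e, reassoc_of% map_assoc F g f h, reassoc_of% δ_naturality F (comm f g) (𝟙 h)]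
    have e' : (F.map (comm f g) ⊹ₘ F.map (𝟙 h)) ≫ (δ F g f ⊹ₘ 𝟙 (F.obj h)) =
      (δ F f g ⊹ₘ 𝟙 _) ≫ (comm _ _ ⊹ₘ 𝟙 _) := by simp [map_comm]
    rw [reassoc_of% e']

end Map

variable {T P₁ P₂ : N ⥤ M} [AddPres T] [AddPres P₁] [AddPres P₂] [InterchangePres T]
  [InterchangePres P₁] [InterchangePres P₂]

theorem IsSplitting.triangle (s : IsSplitting T P₁ P₂) (f h : M) :
    assoc f zero h ≫ (𝟙 f ⊹ₘ lam h) = rho f ⊹ₘ 𝟙 h := by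
  -- The induction has four variables because of the pentagon; here the last two are dummies, filled
  -- with `zero`.
  refine s.induction (Q := fun f h _ _ => assoc f zero h ≫ (𝟙 f ⊹ₘ lam h) = rho f ⊹ₘ 𝟙 h)
    (R := fun f h _ _ => assoc f zero h ≫ (𝟙 f ⊹ₘ lam h) = rho f ⊹ₘ 𝟙 h)
    (fun η θ _ _ => (triangle_iso η θ).1) (fun e => (triangle_map T _ _).1 (congrArg _ e))
    (fun e₁ e₂ => s.faithful ((triangle_map P₁ _ _).2 e₁) ((triangle_map P₂ _ _).2 e₂))
    assoc_right_zero (fun b _ _ => ?_) f h zero zero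
  rw [← lam_zero_add, assoc_left_zero, lam_zero]

theorem IsSplitting.symmetry (s : IsSplitting T P₁ P₂) (f g : M) :
    comm f g ≫ comm g f = 𝟙 (f ⊹ g) := by
  refine s.induction (Q := fun f g _ _ => comm f g ≫ comm g f = 𝟙 (f ⊹ g))
    (R := fun f g _ _ => comm f g ≫ comm g f = 𝟙 (f ⊹ g))
    (fun η θ _ _ => (symmetry_iso η θ).1) (fun e => (symmetry_map T _ _).1 (congrArg _ e))
    (fun e₁ e₂ => s.faithful ((symmetry_map P₁ _ _).2 e₁) ((symmetry_map P₂ _ _).2 e₂))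
    (fun a => ?_) (fun b _ _ => ?_) f g zero zero
  · rw [← cancel_mono (rho a), Category.assoc, zero_comm, comm_zero, Category.id_comp]
  · rw [← cancel_mono (lam b), Category.assoc, comm_zero, zero_comm, Category.id_comp]

theorem IsSplitting.pentagon (s : IsSplitting T P₁ P₂) (f g h k : M) :
    (assoc f g h ⊹ₘ 𝟙 k) ≫ assoc f (g ⊹ h) k ≫ (𝟙 f ⊹ₘ assoc g h k) =
      assoc (f ⊹ g) h k ≫ assoc f g (h ⊹ k) := by
  refine s.induction (Q := fun f g h k => (assoc f g h ⊹ₘ 𝟙 k) ≫ assoc f (g ⊹ h) k ≫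
      (𝟙 f ⊹ₘ assoc g h k) = assoc (f ⊹ g) h k ≫ assoc f g (h ⊹ k))
    (R := fun f g h k => (assoc f g h ⊹ₘ 𝟙 k) ≫ assoc f (g ⊹ h) k ≫
      (𝟙 f ⊹ₘ assoc g h k) = assoc (f ⊹ g) h k ≫ assoc f g (h ⊹ k))
    (fun η θ κ ι => (pentagon_iso η θ κ ι).1) (fun e => (pentagon_map T _ _ _ _).1 (congrArg _ e))
    (fun e₁ e₂ => s.faithful ((pentagon_map P₁ _ _ _ _).2 e₁) ((pentagon_map P₂ _ _ _ _).2 e₂))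
    (fun a => ?_) (fun b c d => ?_) f g h k
  -- The case `(a, 0, 0, 0)`: after composing with unit isomorphisms, every associativity is
  -- absorbed by an instance of the triangle, which is already known for all objects.
  · rw [← cancel_mono (𝟙 a ⊹ₘ lam (zero ⊹ zero)), ← cancel_mono (𝟙 a ⊹ₘ lam zero)]
    have h1 := s.triangle a (zero ⊹ zero)
    have h2 := s.triangle a zero
    simp only [Category.assoc, map_comp_map, Category.comp_id]
    have e : assoc (zero : M) zero zero ≫ lam (zero ⊹ zero) = lam zero ⊹ₘ 𝟙 zero :=
      assoc_left_zero _ _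
    have e2 := assoc_naturality (𝟙 a) (lam (zero : M)) (𝟙 zero)
    have e3 : 𝟙 a ⊹ₘ lam (zero ⊹ zero) ≫ lam zero =
      (𝟙 a ⊹ₘ lam ((zero : M) ⊹ zero)) ≫ (𝟙 _ ⊹ₘ lam zero) := by simp
    rw [reassoc_of% e, e3, reassoc_of% h1]
    have e4 : (rho a ⊹ₘ 𝟙 (zero ⊹ zero)) ≫ (𝟙 a ⊹ₘ lam zero) =
      (𝟙 (a ⊹ zero) ⊹ₘ lam zero) ≫ (rho a ⊹ₘ 𝟙 (zero : M)) := by simp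
    rw [e4, reassoc_of% s.triangle (a ⊹ zero) zero]
    have e5 : (𝟙 a ⊹ₘ (lam zero ⊹ₘ 𝟙 zero) ≫ lam (zero : M)) =
      (𝟙 a ⊹ₘ (lam zero ⊹ₘ 𝟙 zero)) ≫ (𝟙 _ ⊹ₘ lam (zero : M)) := by simp
    rw [e5, ← reassoc_of% e2, h2]
    simp only [map_comp_map, Category.comp_id, rho_add_zero]
    rw [reassoc_of% h2]
  -- The case `(0, b, c, d)`: composing with the left unit isomorphism eliminates each associativity
  -- that involves the leading zero.
  · rw [← cancel_mono (lam _)]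
    simp only [Category.assoc, lam_naturality, assoc_left_zero]
    rw [reassoc_of% assoc_left_zero (b ⊹ c) d]
    simp only [map_comp_map_assoc, assoc_left_zero, Category.comp_id]
    rw [assoc_naturality]
    simp

section Monoidal

/-- The monoidal category whose tensor product is the addition. -/
@[reducible]
noncomputable def monoidalCategory
    (triangle : ∀ f h : M, assoc f zero h ≫ (𝟙 f ⊹ₘ lam h) = rho f ⊹ₘ 𝟙 h)
    (pentagon : ∀ f g h k : M, (assoc f g h ⊹ₘ 𝟙 k) ≫ assoc f (g ⊹ h) k ≫ (𝟙 f ⊹ₘ assoc g h k) =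
      assoc (f ⊹ g) h k ≫ assoc f g (h ⊹ k)) : MonoidalCategory M where
  tensorObj f g := f ⊹ g
  whiskerLeft f _ _ η := 𝟙 f ⊹ₘ η
  whiskerRight η g := η ⊹ₘ 𝟙 g
  tensorHom η θ := η ⊹ₘ θ
  tensorUnit := zero
  associator f g h := asIso (assoc f g h)
  leftUnitor f := asIso (lam f)
  rightUnitor f := asIso (rho f)
  tensorHom_def _ _ := by simp
  id_tensorHom_id := map_id
  tensorHom_comp_tensorHom _ _ _ _ := map_comp_map _ _ _ _
  whiskerLeft_id _ _ := map_id _ _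
  id_whiskerRight _ _ := map_id _ _
  associator_naturality η θ κ := assoc_naturality η θ κ
  leftUnitor_naturality η := lam_naturality η
  rightUnitor_naturality η := rho_naturality η
  pentagon f g h k := pentagon f g h k
  triangle f h := triangle f h

/-- Kelly's consequence of the pentagon and the triangle. No braiding is needed, so it can be used
in the proof of the hexagon. -/
theorem assoc_zero (triangle : ∀ f h : M, assoc f zero h ≫ (𝟙 f ⊹ₘ lam h) = rho f ⊹ₘ 𝟙 h)
    (pentagon : ∀ f g h k : M, (assoc f g h ⊹ₘ 𝟙 k) ≫ assoc f (g ⊹ h) k ≫ (𝟙 f ⊹ₘ assoc g h k) =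
      assoc (f ⊹ g) h k ≫ assoc f g (h ⊹ k)) (g h : M) :
    assoc g h zero ≫ (𝟙 g ⊹ₘ rho h) = rho (g ⊹ h) := by
  let := monoidalCategory triangle pentagon
  exact (MonoidalCategory.rightUnitor_tensor_hom g h).symm

theorem IsSplitting.hexagon (s : IsSplitting T P₁ P₂) (f g h : M) :
    assoc f g h ≫ comm f (g ⊹ h) ≫ assoc g h f =
      (comm f g ⊹ₘ 𝟙 h) ≫ assoc g f h ≫ (𝟙 g ⊹ₘ comm f h) := by
  have az := assoc_zero s.triangle s.pentagon
  refine s.induction (Q := fun f g h _ => assoc f g h ≫ comm f (g ⊹ h) ≫ assoc g h f =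
      (comm f g ⊹ₘ 𝟙 h) ≫ assoc g f h ≫ (𝟙 g ⊹ₘ comm f h))
    (R := fun f g h _ => assoc f g h ≫ comm f (g ⊹ h) ≫ assoc g h f =
      (comm f g ⊹ₘ 𝟙 h) ≫ assoc g f h ≫ (𝟙 g ⊹ₘ comm f h))
    (fun η θ κ _ => (hexagon_iso η θ κ).1) (fun e => (hexagon_map T _ _ _).1 (congrArg _ e))
    (fun e₁ e₂ => s.faithful ((hexagon_map P₁ _ _ _).2 e₁) ((hexagon_map P₂ _ _ _).2 e₂))
    (fun a => ?_) (fun b c _ => ?_) f g h zero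
  -- The case `(a, 0, 0)`: both sides become unit isomorphisms after cancelling, since commuting
  -- past a zero exchanges `rho` with `lam`.
  · rw [← cancel_mono (𝟙 zero ⊹ₘ lam a), ← cancel_mono (lam a)]
    simp only [Category.assoc, map_comp_map, Category.comp_id]
    rw [reassoc_of% s.triangle zero a, ← lam_zero, ← reassoc_of% comm_naturality (𝟙 a) (lam zero),
      comm_zero, reassoc_of% az zero a, reassoc_of% assoc_right_zero a]
    rw [← rho_naturality, map_comp_map_assoc, comm_zero, Category.comp_id]
  · rw [← cancel_mono (𝟙 b ⊹ₘ rho c)]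
    simp only [Category.assoc, map_comp_map, Category.comp_id, zero_comm, az]
    rw [assoc_left_zero, s.triangle]
    simp [zero_comm]

theorem IsSplitting.isCoherent (s : IsSplitting T P₁ P₂) : IsCoherent M where
  triangle := s.triangle
  pentagon := s.pentagon
  symmetry := s.symmetry
  hexagon := s.hexagon

variable [IsCoherent M] [IsCoherent N]

variable (M) in
/-- The monoidal category whose tensor product is a coherent addition. -/
@[reducible]
noncomputable def addMonoidalCategory : MonoidalCategory M :=
  monoidalCategory IsCoherent.triangle IsCoherent.pentagon

attribute [local instance] addMonoidalCategory

variable (M) in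
/-- The symmetric monoidal category whose tensor product is a coherent addition. -/
@[reducible]
noncomputable def addSymmetricCategory : SymmetricCategory M where
  braiding f g := asIso (comm f g)
  braiding_naturality_right f _ _ η := comm_naturality (𝟙 f) η
  braiding_naturality_left η g := comm_naturality η (𝟙 g)
  hexagon_forward f g h := IsCoherent.hexagon f g h
  hexagon_reverse f g h := by
    have e (x y : M) : comm x y = inv (comm y x) := by
      exact IsIso.eq_inv_of_inv_hom_id (IsCoherent.symmetry _ _)
    change inv (assoc f g h) ≫ comm (f ⊹ g) h ≫ inv (assoc h f g) =
      (𝟙 f ⊹ₘ comm g h) ≫ inv (assoc f h g) ≫ (comm f h ⊹ₘ 𝟙 g)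
    rw [e (f ⊹ g), e g h, e f h]
    -- The reverse hexagon is the inverse of the forward hexagon at `(h, f, g)`, because each
    -- commutativity is the inverse of the opposite one.
    have := congrArg (fun x => inv x) (IsCoherent.hexagon h f g)
    simpa [inv_map] using this
  symmetry f g := IsCoherent.symmetry f g

attribute [local instance] addSymmetricCategory

/-- A functor preserving addition and its interchange is braided. -/
@[reducible]
noncomputable def addBraided (F : M ⥤ N) [AddPres F] [InterchangePres F] : F.Braided :=
  letI : F.Monoidal := Functor.CoreMonoidal.toMonoidal
    { εIso := (asIso (υ F)).symm
      μIso f g := (asIso (δ F f g)).symm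
      μIso_hom_natural_left η g := by
        have := δ_naturality F η (𝟙 g)
        change (F.map η ⊹ₘ 𝟙 _) ≫ inv (δ F _ _) = inv (δ F _ _) ≫ F.map (η ⊹ₘ 𝟙 g)
        rw [IsIso.eq_inv_comp, ← F.map_id, ← Category.assoc, ← this]
        simp
      μIso_hom_natural_right f η := by
        have := δ_naturality F (𝟙 f) η
        change (𝟙 _ ⊹ₘ F.map η) ≫ inv (δ F _ _) = inv (δ F _ _) ≫ F.map (𝟙 f ⊹ₘ η)
        rw [IsIso.eq_inv_comp, ← F.map_id, ← Category.assoc, ← this]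
        simp
      associativity f g h := by
        have := map_assoc F f g h
        change (inv (δ F f g) ⊹ₘ 𝟙 _) ≫ inv (δ F _ _) ≫ F.map (assoc f g h) =
          assoc _ _ _ ≫ (𝟙 _ ⊹ₘ inv (δ F g h)) ≫ inv (δ F _ _)
        rw [← cancel_mono (δ F f (g ⊹ h) ≫ (𝟙 _ ⊹ₘ δ F g h))]
        simp only [Category.assoc, this]
        simp
      left_unitality f := by
        change lam (F.obj f) = (inv (υ F) ⊹ₘ 𝟙 _) ≫ inv (δ F _ _) ≫ F.map (lam f)
        rw [← δ_lam]
        simp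
      right_unitality f := by
        change rho (F.obj f) = (𝟙 _ ⊹ₘ inv (υ F)) ≫ inv (δ F _ _) ≫ F.map (rho f)
        rw [← δ_rho]
        simp }
  { braided f g := by
      change inv (δ F f g) ≫ F.map (comm f g) = comm _ _ ≫ inv (δ F g f)
      rw [← cancel_mono (δ F g f)]
      simp [map_comm] }

theorem isMonoidal_of_add {F G : M ⥤ N} [AddPres F] [AddPres G] [InterchangePres F]
    [InterchangePres G] (τ : F ⟶ G) (h₀ : τ.app zero ≫ υ G = υ F)
    (h : ∀ f g : M, τ.app (f ⊹ g) ≫ δ G f g = δ F f g ≫ (τ.app f ⊹ₘ τ.app g)) :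
    letI := addBraided F
    letI := addBraided G
    NatTrans.IsMonoidal τ := by
  let := addBraided F
  let := addBraided G
  refine ⟨?_, fun f g => ?_⟩
  · change inv (υ F) ≫ τ.app zero = inv (υ G)
    rw [IsIso.inv_comp_eq, ← h₀]
    simp
  · change inv (δ F f g) ≫ τ.app (f ⊹ g) = (τ.app f ⊹ₘ τ.app g) ≫ inv (δ G f g)
    rw [IsIso.inv_comp_eq, ← Category.assoc, ← h]
    simp

end Monoidal

end Coherence

end TwoCat

/-! ### The interchange of sums that are presented by pairs. -/

namespace TwoCat

open CategoryTheory UnitalAdd AddPres Interchange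

/-- A presentation of the sums of objects of `M` as the images under `T` of the objects of `N`,
which are pairs of objects of `M` by means of `P₁` and `P₂`. -/
structure SumPresentation {M : Type u₁} {N : Type u₂} [Category.{v₁} M] [Category.{v₂} N]
    [UnitalAdd M] [UnitalAdd N] (T P₁ P₂ : N ⥤ M) [AddPres T] [AddPres P₁] [AddPres P₂] where
  toSum (u : N) {f g : M} (a : P₁.obj u ⟶ f) (b : P₂.obj u ⟶ g) : T.obj u ⟶ f ⊹ g
  map_toSum {u u' : N} (ω : u ⟶ u') {f g : M} (a : P₁.obj u' ⟶ f) (b : P₂.obj u' ⟶ g) :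
    T.map ω ≫ toSum u' a b = toSum u (P₁.map ω ≫ a) (P₂.map ω ≫ b)
  toSum_map (u : N) {f g f' g' : M} (a : P₁.obj u ⟶ f) (b : P₂.obj u ⟶ g) (η : f ⟶ f')
    (θ : g ⟶ g') : toSum u a b ≫ (η ⊹ₘ θ) = toSum u (a ≫ η) (b ≫ θ)
  pair (f g : M) : N
  fst (f g : M) : P₁.obj (pair f g) ⟶ f
  snd (f g : M) : P₂.obj (pair f g) ⟶ g
  exists_lift {u : N} {f g : M} (a : P₁.obj u ⟶ f) (b : P₂.obj u ⟶ g) :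
    ∃ ω : u ⟶ pair f g, P₁.map ω ≫ fst f g = a ∧ P₂.map ω ≫ snd f g = b
  toSum_zero : toSum zero (υ P₁) (υ P₂) ≫ lam zero = υ T
  inl (f : M) : N
  inlAdd (f g : M) : inl (f ⊹ g) ⟶ inl f ⊹ inl g
  inlSum (f : M) : T.obj (inl f) ⟶ f
  inlFst (f : M) : P₁.obj (inl f) ⟶ f
  inlSnd (f : M) : P₂.obj (inl f) ⟶ zero
  inlSum_add (f g : M) : T.map (inlAdd f g) ≫ δ T _ _ ≫ (inlSum f ⊹ₘ inlSum g) = inlSum (f ⊹ g)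
  inlFst_add (f g : M) : P₁.map (inlAdd f g) ≫ δ P₁ _ _ ≫ (inlFst f ⊹ₘ inlFst g) = inlFst (f ⊹ g)
  inlSnd_add (f g : M) :
    P₂.map (inlAdd f g) ≫ δ P₂ _ _ ≫ (inlSnd f ⊹ₘ inlSnd g) ≫ lam zero = inlSnd (f ⊹ g)
  toSum_inl (f : M) : toSum (inl f) (inlFst f) (inlSnd f) ≫ rho f = inlSum f
  inr (f : M) : N
  inrSum (f : M) : T.obj (inr f) ⟶ f
  inrFst (f : M) : P₁.obj (inr f) ⟶ zero
  inrSnd (f : M) : P₂.obj (inr f) ⟶ f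

namespace SumPresentation

variable {M : Type u₁} {N : Type u₂} [Category.{v₁} M] [Category.{v₂} N]
  [UnitalAdd M] [UnitalAdd N] [IsGroupoid M] {T P₁ P₂ : N ⥤ M} [AddPres T] [AddPres P₁]
  [AddPres P₂] (s : SumPresentation T P₁ P₂)

/-- The interchange of additions that exists because `T` preserves addition. -/
noncomputable def χ (f h g k : M) : (f ⊹ h) ⊹ (g ⊹ k) ⟶ (f ⊹ g) ⊹ (h ⊹ k) :=
  inv (s.toSum (s.pair f g ⊹ s.pair h k) (δ P₁ _ _ ≫ (s.fst f g ⊹ₘ s.fst h k))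
    (δ P₂ _ _ ≫ (s.snd f g ⊹ₘ s.snd h k))) ≫ δ T _ _ ≫
    (s.toSum _ (s.fst f g) (s.snd f g) ⊹ₘ s.toSum _ (s.fst h k) (s.snd h k))

/-- The definition of `χ` uses the chosen pairs, but any presentation maps to the chosen one and all
the ingredients are natural. This characterizes `χ`, since it determines it after an invertible
2-cell; later identities are checked on convenient pairs. -/
theorem toSum_χ {u u' : N} {f g h k : M} (a : P₁.obj u ⟶ f) (b : P₂.obj u ⟶ g)
    (c : P₁.obj u' ⟶ h) (d : P₂.obj u' ⟶ k) :
    s.toSum (u ⊹ u') (δ P₁ _ _ ≫ (a ⊹ₘ c)) (δ P₂ _ _ ≫ (b ⊹ₘ d)) ≫ s.χ f h g k =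
      δ T _ _ ≫ (s.toSum u a b ⊹ₘ s.toSum u' c d) := by
  obtain ⟨ω, rfl, rfl⟩ := s.exists_lift a b
  obtain ⟨ω', rfl, rfl⟩ := s.exists_lift c d
  have e : s.toSum (u ⊹ u') (δ P₁ _ _ ≫ ((P₁.map ω ≫ s.fst f g) ⊹ₘ (P₁.map ω' ≫ s.fst h k)))
      (δ P₂ _ _ ≫ ((P₂.map ω ≫ s.snd f g) ⊹ₘ (P₂.map ω' ≫ s.snd h k))) =
      T.map (ω ⊹ₘ ω') ≫ s.toSum _ (δ P₁ _ _ ≫ (s.fst f g ⊹ₘ s.fst h k))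
        (δ P₂ _ _ ≫ (s.snd f g ⊹ₘ s.snd h k)) := by
    rw [map_toSum, reassoc_of% δ_naturality P₁, reassoc_of% δ_naturality P₂]
    simp
  rw [e, χ, Category.assoc, IsIso.hom_inv_id_assoc, reassoc_of% δ_naturality T]
  simp [map_toSum]

/-- Evaluating on the pair `(f, g)` plus the zero pair reduces the claim to the fact that `T`, `P₁`
and `P₂` preserve the right unit. -/
theorem χ_mid (f g : M) :
    s.χ f zero g zero ≫ (𝟙 _ ⊹ₘ lam zero) ≫ rho (f ⊹ g) = rho f ⊹ₘ rho g := by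
  have h := s.toSum_χ (s.fst f g) (s.snd f g) (υ P₁) (υ P₂)
  rw [← cancel_epi (s.toSum _ (δ P₁ _ _ ≫ (s.fst f g ⊹ₘ υ P₁)) (δ P₂ _ _ ≫ (s.snd f g ⊹ₘ υ P₂))),
    reassoc_of% h]
  have e : (s.toSum _ (s.fst f g) (s.snd f g) ⊹ₘ s.toSum zero (υ P₁) (υ P₂)) ≫
    (𝟙 _ ⊹ₘ lam zero) ≫ rho (f ⊹ g) = (𝟙 _ ⊹ₘ υ T) ≫ rho _ ≫ s.toSum _ (s.fst f g) (s.snd f g) := by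
    rw [← rho_naturality, map_comp_map_assoc, map_comp_map_assoc, s.toSum_zero]
    simp
  rw [e, reassoc_of% δ_rho T (s.pair f g), map_toSum, toSum_map, ← δ_rho, ← δ_rho]
  simp [← rho_naturality]

theorem mid_χ (h k : M) :
    s.χ zero h zero k ≫ (lam zero ⊹ₘ 𝟙 _) ≫ lam (h ⊹ k) = lam h ⊹ₘ lam k := by
  have e := s.toSum_χ (υ P₁) (υ P₂) (s.fst h k) (s.snd h k)
  rw [← cancel_epi (s.toSum _ (δ P₁ _ _ ≫ (υ P₁ ⊹ₘ s.fst h k)) (δ P₂ _ _ ≫ (υ P₂ ⊹ₘ s.snd h k))),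
    reassoc_of% e]
  have e : (s.toSum zero (υ P₁) (υ P₂) ⊹ₘ s.toSum _ (s.fst h k) (s.snd h k)) ≫
    (lam zero ⊹ₘ 𝟙 _) ≫ lam (h ⊹ k) = (υ T ⊹ₘ 𝟙 _) ≫ lam _ ≫ s.toSum _ (s.fst h k) (s.snd h k) := by
    rw [← lam_naturality, map_comp_map_assoc, map_comp_map_assoc, s.toSum_zero]
    simp
  rw [e, reassoc_of% δ_lam T (s.pair h k), map_toSum, toSum_map, ← δ_lam, ← δ_lam]
  simp [← lam_naturality]

/-- Evaluation on the pairs `inl f = (f, 0)` and `inl h = (h, 0)`: the claim expresses that the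
inclusion of the first component preserves sums, compatibly with `T`, `P₁` and `P₂`. -/
theorem χ_right (f h : M) :
    s.χ f h zero zero ≫ (rho f ⊹ₘ rho h) = (𝟙 _ ⊹ₘ lam zero) ≫ rho (f ⊹ h) := by
  have e := s.toSum_χ (s.inlFst f) (s.inlSnd f) (s.inlFst h) (s.inlSnd h)
  rw [← cancel_epi (T.map (s.inlAdd f h) ≫ s.toSum _ (δ P₁ _ _ ≫ (s.inlFst f ⊹ₘ s.inlFst h))
    (δ P₂ _ _ ≫ (s.inlSnd f ⊹ₘ s.inlSnd h)))]
  rw [Category.assoc, reassoc_of% e, map_comp_map, toSum_inl, toSum_inl, inlSum_add, map_toSum,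
    inlFst_add, ← toSum_inl, ← inlSnd_add, ← Category.assoc (s.toSum _ _ _), toSum_map]
  simp

/-- The interchange provided by a presentation of sums. -/
@[reducible]
noncomputable def interchange : Interchange M where
  χ := s.χ
  χ_naturality {f h g k f' h' g' k'} η θ κ ι := by
    rw [← cancel_epi (s.toSum _ (δ P₁ _ _ ≫ (s.fst f g ⊹ₘ s.fst h k))
      (δ P₂ _ _ ≫ (s.snd f g ⊹ₘ s.snd h k))), reassoc_of% s.toSum_χ, ← Category.assoc, toSum_map]
    simp only [Category.assoc, map_comp_map, toSum_χ, toSum_map]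
  χ_mid_zero := s.χ_mid
  χ_zero_mid := s.mid_χ
  χ_right_zero := s.χ_right

variable {M' : Type u₃} {N' : Type u₄} [Category.{v₃} M'] [Category.{v₄} N']
  [UnitalAdd M'] [UnitalAdd N'] [IsGroupoid M'] {T' P₁' P₂' : N' ⥤ M'} [AddPres T'] [AddPres P₁']
  [AddPres P₂'] (s' : SumPresentation T' P₁' P₂')

/-- The functor `F₂` is the lift of `F` to pairs. Since `χ` is given by the preservation of sums by
`T`, it is preserved as soon as the comparisons of `F` and `F₂` along `T`, `P₁` and `P₂` respect
sums and presentations. -/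
theorem map_χ (F : M ⥤ M') (F₂ : N ⥤ N') [AddPres F] [AddPres F₂]
    (q₁ : ∀ u, P₁'.obj (F₂.obj u) ⟶ F.obj (P₁.obj u))
    (q₂ : ∀ u, P₂'.obj (F₂.obj u) ⟶ F.obj (P₂.obj u))
    (ζ : ∀ u, T'.obj (F₂.obj u) ⟶ F.obj (T.obj u))
    (hq₁ : ∀ u u', q₁ (u ⊹ u') ≫ F.map (δ P₁ u u') ≫ δ F _ _ =
      P₁'.map (δ F₂ u u') ≫ δ P₁' _ _ ≫ (q₁ u ⊹ₘ q₁ u'))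
    (hq₂ : ∀ u u', q₂ (u ⊹ u') ≫ F.map (δ P₂ u u') ≫ δ F _ _ =
      P₂'.map (δ F₂ u u') ≫ δ P₂' _ _ ≫ (q₂ u ⊹ₘ q₂ u'))
    (hζ : ∀ u u', ζ (u ⊹ u') ≫ F.map (δ T u u') ≫ δ F _ _ =
      T'.map (δ F₂ u u') ≫ δ T' _ _ ≫ (ζ u ⊹ₘ ζ u'))
    (H : ∀ (u : N) {f g : M} (a : P₁.obj u ⟶ f) (b : P₂.obj u ⟶ g),
      ζ u ≫ F.map (s.toSum u a b) ≫ δ F f g =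
        s'.toSum (F₂.obj u) (q₁ u ≫ F.map a) (q₂ u ≫ F.map b)) (f h g k : M) :
    F.map (s.χ f h g k) ≫ δ F (f ⊹ g) (h ⊹ k) ≫ (δ F f g ⊹ₘ δ F h k) =
      δ F (f ⊹ h) (g ⊹ k) ≫ (δ F f h ⊹ₘ δ F g k) ≫
        s'.χ (F.obj f) (F.obj h) (F.obj g) (F.obj k) := by
  -- The claim does not mention pairs; this makes the pairs on which it is evaluated arbitrary
  -- presentations instead of the chosen ones.
  suffices ∀ (U V : N) (a : P₁.obj U ⟶ f) (b : P₂.obj U ⟶ g) (c : P₁.obj V ⟶ h)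
      (d : P₂.obj V ⟶ k), F.map (s.χ f h g k) ≫ δ F (f ⊹ g) (h ⊹ k) ≫ (δ F f g ⊹ₘ δ F h k) =
        δ F (f ⊹ h) (g ⊹ k) ≫ (δ F f h ⊹ₘ δ F g k) ≫
          s'.χ (F.obj f) (F.obj h) (F.obj g) (F.obj k) from
    this _ _ (s.fst f g) (s.snd f g) (s.fst h k) (s.snd h k)
  intro U V a b c d
  have e := s.toSum_χ a b c d
  rw [← cancel_epi (ζ (U ⊹ V) ≫ F.map (s.toSum (U ⊹ V) (δ P₁ _ _ ≫ (a ⊹ₘ c))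
    (δ P₂ _ _ ≫ (b ⊹ₘ d))))]
  have l : ζ (U ⊹ V) ≫ F.map (s.toSum (U ⊹ V) (δ P₁ _ _ ≫ (a ⊹ₘ c)) (δ P₂ _ _ ≫ (b ⊹ₘ d))) ≫
      F.map (s.χ f h g k) ≫ δ F (f ⊹ g) (h ⊹ k) ≫ (δ F f g ⊹ₘ δ F h k) =
      T'.map (δ F₂ U V) ≫ δ T' _ _ ≫ (s'.toSum (F₂.obj U) (q₁ U ≫ F.map a) (q₂ U ≫ F.map b) ⊹ₘ
        s'.toSum (F₂.obj V) (q₁ V ≫ F.map c) (q₂ V ≫ F.map d)) := by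
    rw [← H, ← H, ← F.map_comp_assoc, e, F.map_comp_assoc, reassoc_of% δ_naturality F,
      reassoc_of% hζ]
    simp
  rw [Category.assoc, l, ← s'.toSum_χ, reassoc_of% s'.map_toSum]
  have r := H (U ⊹ V) (δ P₁ _ _ ≫ (a ⊹ₘ c)) (δ P₂ _ _ ≫ (b ⊹ₘ d))
  simp only [Category.assoc]
  rw [reassoc_of% r, ← Category.assoc (s'.toSum _ _ _), toSum_map]
  have r₁ : (q₁ (U ⊹ V) ≫ F.map (δ P₁ U V ≫ (a ⊹ₘ c))) ≫ δ F f h =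
      P₁'.map (δ F₂ U V) ≫ δ P₁' (F₂.obj U) (F₂.obj V) ≫
        ((q₁ U ≫ F.map a) ⊹ₘ (q₁ V ≫ F.map c)) := by
    rw [F.map_comp, Category.assoc, Category.assoc, AddPres.δ_naturality, reassoc_of% hq₁]
    simp
  have r₂ : (q₂ (U ⊹ V) ≫ F.map (δ P₂ U V ≫ (b ⊹ₘ d))) ≫ δ F g k =
      P₂'.map (δ F₂ U V) ≫ δ P₂' (F₂.obj U) (F₂.obj V) ≫
        ((q₂ U ≫ F.map b) ⊹ₘ (q₂ V ≫ F.map d)) := by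
    rw [F.map_comp, Category.assoc, Category.assoc, AddPres.δ_naturality, reassoc_of% hq₂]
    simp
  rw [r₁, r₂]

end SumPresentation

end TwoCat

/-! ### Semiadditive bicategories: the sum of 1-cells and its unit 2-cells. -/

namespace TwoCat

open CategoryTheory Bicategory UnitalAdd AddPres Interchange

/-- A bicategory enriched in pointed groupoids in which the product of every 0-cell with itself
is also a coproduct. -/
class SemiAdditive (C : Type u) [Bicategory.{w, v} C] where
  G : GpdStar C
  dbl : C → C
  p₁ (B : C) : dbl B ⟶ B
  p₂ (B : C) : dbl B ⟶ B
  i₁ (B : C) : B ⟶ dbl B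
  i₂ (B : C) : B ⟶ dbl B
  fold (B : C) : dbl B ⟶ B
  isProduct (B : C) : IsProduct (p₁ B) (p₂ B)
  isCoproduct (B : C) : IsCoproduct (i₁ B) (i₂ B)
  i₁p₁ (B : C) : i₁ B ≫ p₁ B ⟶ 𝟙 B
  i₁p₂ (B : C) : i₁ B ≫ p₂ B ⟶ G.zero B B
  i₂p₁ (B : C) : i₂ B ≫ p₁ B ⟶ G.zero B B
  i₂p₂ (B : C) : i₂ B ≫ p₂ B ⟶ 𝟙 B
  i₁fold (B : C) : 𝟙 B ⟶ i₁ B ≫ fold B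
  i₂fold (B : C) : 𝟙 B ⟶ i₂ B ≫ fold B

namespace SemiAdditive

variable {C : Type u} [Bicategory.{w, v} C] [SemiAdditive C] {A B X Y : C}

instance (A B : C) : IsGroupoid (A ⟶ B) := (G (C := C)).locallyGroupoid A B

/-- The zero 1-cell. -/
abbrev zero (A B : C) : A ⟶ B := (G (C := C)).zero A B

/-- The 2-cell `f ∘ 0 ⟹ 0`. -/
def zeroComp (X : C) (f : A ⟶ B) : zero X A ≫ f ⟶ zero X B := (G.zeroComp X f).hom

/-- The 2-cell `0 ∘ f ⟹ 0`. -/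
def compZero (f : A ⟶ B) (Y : C) : f ≫ zero B Y ⟶ zero A Y := (G.compZero f Y).hom

theorem zeroComp_naturality (X : C) {f g : A ⟶ B} (η : f ⟶ g) :
    zero X A ◁ η ≫ zeroComp X g = zeroComp X f := G.zeroComp_naturality X η

theorem compZero_naturality {f g : A ⟶ B} (η : f ⟶ g) (Y : C) :
    η ▷ zero B Y ≫ compZero g Y = compZero f Y := G.compZero_naturality η Y

theorem zeroComp_id (X A : C) : zeroComp X (𝟙 A) = (ρ_ (zero X A)).hom := by
  rw [zeroComp, G.zeroComp_id]

theorem compZero_id (A Y : C) : compZero (𝟙 A) Y = (λ_ (zero A Y)).hom := by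
  rw [compZero, G.compZero_id]

theorem zeroComp_comp (X : C) {D : C} (f : A ⟶ B) (g : B ⟶ D) :
    zeroComp X (f ≫ g) = (α_ (zero X A) f g).inv ≫ zeroComp X f ▷ g ≫ zeroComp X g :=
  G.zeroComp_comp X f g

theorem compZero_comp {D : C} (f : A ⟶ B) (g : B ⟶ D) (Y : C) :
    compZero (f ≫ g) Y = (α_ f g (zero D Y)).hom ≫ f ◁ compZero g Y ≫ compZero f Y :=
  G.compZero_comp f g Y

theorem comp_zero_comp {D E : C} (f : A ⟶ B) (g : D ⟶ E) :
    compZero f D ▷ g ≫ zeroComp A g =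
      (α_ f (zero B D) g).hom ≫ f ◁ zeroComp B g ≫ compZero f E :=
  G.comp_zero_comp f g

theorem zero_zero (A B D : C) : zeroComp A (zero B D) = compZero (zero A B) D :=
  congrArg Iso.hom (G.zero_zero A B D)

/-- The pair of two 1-cells. -/
noncomputable def pair (f g : A ⟶ B) : A ⟶ dbl B := ((isProduct B).exists_lift f g).choose

noncomputable def fst (f g : A ⟶ B) : pair f g ≫ p₁ B ⟶ f :=
  ((isProduct B).exists_lift f g).choose_spec.1.some

noncomputable def snd (f g : A ⟶ B) : pair f g ≫ p₂ B ⟶ g :=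
  ((isProduct B).exists_lift f g).choose_spec.2.some

theorem pair_ext {u u' : A ⟶ dbl B} {θ θ' : u ⟶ u'} (h₁ : θ ▷ p₁ B = θ' ▷ p₁ B)
    (h₂ : θ ▷ p₂ B = θ' ▷ p₂ B) : θ = θ' :=
  ((isProduct B).unique_lift _ _ u (θ' ▷ p₁ B) (θ' ▷ p₂ B) u' (𝟙 _) (𝟙 _)).unique
    (by simp [h₁, h₂]) (by simp)

theorem copair_ext {u u' : dbl A ⟶ B} {θ θ' : u ⟶ u'} (h₁ : i₁ A ◁ θ = i₁ A ◁ θ')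
    (h₂ : i₂ A ◁ θ = i₂ A ◁ θ') : θ = θ' :=
  ((isCoproduct A).unique_desc _ _ u (i₁ A ◁ θ') (i₂ A ◁ θ') u' (𝟙 _) (𝟙 _)).unique
    (by simp [h₁, h₂]) (by simp)

/-- The 2-cell to a pair with given components. -/
noncomputable def toPair (u : A ⟶ dbl B) {f g : A ⟶ B} (a : u ≫ p₁ B ⟶ f) (b : u ≫ p₂ B ⟶ g) :
    u ⟶ pair f g :=
  ((isProduct B).unique_lift f g u a b (pair f g) (fst f g) (snd f g)).choose

theorem toPair_fst (u : A ⟶ dbl B) {f g : A ⟶ B} (a : u ≫ p₁ B ⟶ f) (b : u ≫ p₂ B ⟶ g) :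
    toPair u a b ▷ p₁ B ≫ fst f g = a :=
  ((isProduct B).unique_lift f g u a b (pair f g) (fst f g) (snd f g)).choose_spec.1.1

theorem toPair_snd (u : A ⟶ dbl B) {f g : A ⟶ B} (a : u ≫ p₁ B ⟶ f) (b : u ≫ p₂ B ⟶ g) :
    toPair u a b ▷ p₂ B ≫ snd f g = b :=
  ((isProduct B).unique_lift f g u a b (pair f g) (fst f g) (snd f g)).choose_spec.1.2

theorem toPair_unique {u : A ⟶ dbl B} {f g : A ⟶ B} {θ θ' : u ⟶ pair f g}
    (h₁ : θ ▷ p₁ B ≫ fst f g = θ' ▷ p₁ B ≫ fst f g)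
    (h₂ : θ ▷ p₂ B ≫ snd f g = θ' ▷ p₂ B ≫ snd f g) : θ = θ' :=
  pair_ext ((cancel_mono _).1 h₁) ((cancel_mono _).1 h₂)

theorem comp_toPair {u u' : A ⟶ dbl B} (ω : u ⟶ u') {f g : A ⟶ B} (a : u' ≫ p₁ B ⟶ f)
    (b : u' ≫ p₂ B ⟶ g) : ω ≫ toPair u' a b = toPair u (ω ▷ p₁ B ≫ a) (ω ▷ p₂ B ≫ b) := by
  apply toPair_unique <;> simp [toPair_fst, toPair_snd]

/-- The sum of two 1-cells. -/
noncomputable def sum (f g : A ⟶ B) : A ⟶ B := pair f g ≫ fold B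

/-- The identity 2-cell to a sum. -/
noncomputable def mkSum (f g : A ⟶ B) : pair f g ≫ fold B ⟶ sum f g := 𝟙 _

/-- The 2-cell by which a 1-cell to `dbl B` with components `f` and `g` gives a sum of `f` and
`g`. -/
noncomputable def toSum (u : A ⟶ dbl B) {f g : A ⟶ B} (a : u ≫ p₁ B ⟶ f) (b : u ≫ p₂ B ⟶ g) :
    u ≫ fold B ⟶ sum f g := toPair u a b ▷ fold B ≫ mkSum f g

theorem whiskerRight_toSum {u u' : A ⟶ dbl B} (ω : u ⟶ u') {f g : A ⟶ B} (a : u' ≫ p₁ B ⟶ f)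
    (b : u' ≫ p₂ B ⟶ g) :
    ω ▷ fold B ≫ toSum u' a b = toSum u (ω ▷ p₁ B ≫ a) (ω ▷ p₂ B ≫ b) := by
  rw [toSum, toSum, ← comp_whiskerRight_assoc, comp_toPair]

theorem toSum_fst_snd (f g : A ⟶ B) : toSum _ (fst f g) (snd f g) = mkSum f g := by
  rw [toSum, show toPair _ (fst f g) (snd f g) = 𝟙 _ from
    toPair_unique (by simp [toPair_fst]) (by simp [toPair_snd]), id_whiskerRight, Category.id_comp]

/-- The functoriality of the sum. -/
noncomputable def sumMap {f f' g g' : A ⟶ B} (η : f ⟶ f') (θ : g ⟶ g') : sum f g ⟶ sum f' g' :=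
  inv (mkSum f g) ≫ toSum _ (fst f g ≫ η) (snd f g ≫ θ)

theorem toSum_sumMap (u : A ⟶ dbl B) {f g f' g' : A ⟶ B} (a : u ≫ p₁ B ⟶ f) (b : u ≫ p₂ B ⟶ g)
    (η : f ⟶ f') (θ : g ⟶ g') : toSum u a b ≫ sumMap η θ = toSum u (a ≫ η) (b ≫ θ) := by
  rw [sumMap, toSum, Category.assoc, IsIso.hom_inv_id_assoc, whiskerRight_toSum,
    reassoc_of% toPair_fst, reassoc_of% toPair_snd]

/-- The inverse of the left unit 2-cell of the sum. -/
noncomputable def lamInv (g : A ⟶ B) : g ⟶ sum (zero A B) g :=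
  (ρ_ g).inv ≫ g ◁ i₂fold B ≫ (α_ g (i₂ B) (fold B)).inv ≫
    toSum (g ≫ i₂ B) ((α_ g (i₂ B) (p₁ B)).hom ≫ g ◁ i₂p₁ B ≫ compZero g B)
      ((α_ g (i₂ B) (p₂ B)).hom ≫ g ◁ i₂p₂ B ≫ (ρ_ g).hom)

/-- The inverse of the right unit 2-cell of the sum. -/
noncomputable def rhoInv (f : A ⟶ B) : f ⟶ sum f (zero A B) :=
  (ρ_ f).inv ≫ f ◁ i₁fold B ≫ (α_ f (i₁ B) (fold B)).inv ≫
    toSum (f ≫ i₁ B) ((α_ f (i₁ B) (p₁ B)).hom ≫ f ◁ i₁p₁ B ≫ (ρ_ f).hom)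
      ((α_ f (i₁ B) (p₂ B)).hom ≫ f ◁ i₁p₂ B ≫ compZero f B)

theorem lamInv_naturality {f g : A ⟶ B} (η : f ⟶ g) :
    lamInv f ≫ sumMap (𝟙 _) η = η ≫ lamInv g := by
  have e : η ≫ (ρ_ g).inv ≫ g ◁ i₂fold B ≫ (α_ g (i₂ B) (fold B)).inv =
    (ρ_ f).inv ≫ f ◁ i₂fold B ≫ (α_ f (i₂ B) (fold B)).inv ≫ (η ▷ i₂ B) ▷ fold B := by
    rw [rightUnitor_inv_naturality_assoc, ← whisker_exchange_assoc]
    simp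
  simp only [lamInv, Category.assoc, toSum_sumMap, Category.comp_id]
  rw [reassoc_of% e, whiskerRight_toSum]
  congr 4
  · rw [← compZero_naturality η, associator_naturality_left_assoc, ← whisker_exchange_assoc]
  · rw [associator_naturality_left_assoc, ← whisker_exchange_assoc, ← rightUnitor_naturality]

theorem rhoInv_naturality {f g : A ⟶ B} (η : f ⟶ g) :
    rhoInv f ≫ sumMap η (𝟙 _) = η ≫ rhoInv g := by
  have e : η ≫ (ρ_ g).inv ≫ g ◁ i₁fold B ≫ (α_ g (i₁ B) (fold B)).inv =
    (ρ_ f).inv ≫ f ◁ i₁fold B ≫ (α_ f (i₁ B) (fold B)).inv ≫ (η ▷ i₁ B) ▷ fold B := by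
    rw [rightUnitor_inv_naturality_assoc, ← whisker_exchange_assoc]
    simp
  simp only [rhoInv, Category.assoc, toSum_sumMap, Category.comp_id]
  rw [reassoc_of% e, whiskerRight_toSum]
  congr 4
  · rw [associator_naturality_left_assoc, ← whisker_exchange_assoc, ← rightUnitor_naturality]
  · rw [← compZero_naturality η, associator_naturality_left_assoc, ← whisker_exchange_assoc]

theorem zeroComp_inv_naturality (X : C) {f g : A ⟶ B} (η : f ⟶ g) :
    inv (zeroComp X f) ≫ zero X A ◁ η = inv (zeroComp X g) := by
  rw [IsIso.inv_comp_eq, IsIso.eq_comp_inv, zeroComp_naturality]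

/-- The canonical 2-cell between the composites of zero with `f` and with `f'` is compatible with
further composition, because nullity of a composite is computed in steps. -/
theorem zero_whisker_conj (X : C) {D : C} (f f' : A ⟶ B) (g : B ⟶ D) :
    (zeroComp X f ≫ inv (zeroComp X f')) ▷ g =
      (α_ _ _ _).hom ≫ zeroComp X (f ≫ g) ≫ inv (zeroComp X (f' ≫ g)) ≫ (α_ _ _ _).inv := by
  simp [zeroComp_comp]

/-- The two unit 2-cells use `i₂` and `i₁` respectively, but both injections become canonically zero
after the zero 1-cell, and the agreement of the two nullities of `0 ∘ 0` identifies the remaining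
components. -/
theorem lamInv_zero : lamInv (zero A B) = rhoInv (zero A B) := by
  have e : zero A B ◁ i₂fold B ≫ (α_ _ _ _).inv ≫
      (zeroComp A (i₂ B) ≫ inv (zeroComp A (i₁ B))) ▷ fold B =
      zero A B ◁ i₁fold B ≫ (α_ _ _ _).inv := by
    rw [zero_whisker_conj, Iso.inv_hom_id_assoc, reassoc_of% zeroComp_naturality A (i₂fold B),
      ← zeroComp_inv_naturality A (i₁fold B), zeroComp_id]
    simp
  rw [lamInv, rhoInv, ← reassoc_of% e, whiskerRight_toSum]
  congr 4
  · rw [zero_whisker_conj, ← zero_zero]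
    have := zeroComp_inv_naturality A (i₁p₁ B)
    simp [reassoc_of% this, zeroComp_naturality, zeroComp_id]
  · rw [zero_whisker_conj, ← zero_zero]
    have := zeroComp_naturality A (i₂p₂ B)
    simp [zeroComp_naturality, ← this, zeroComp_id]

noncomputable instance (A B : C) : UnitalAdd (A ⟶ B) where
  add := sum
  map := sumMap
  map_id f g := by simp [sumMap, toSum_fst_snd]
  map_comp_map η θ η' θ' := by
    rw [sumMap, Category.assoc, toSum_sumMap, sumMap, Category.assoc, Category.assoc]
  zero := zero A B
  lam g := inv (lamInv g)
  rho f := inv (rhoInv f)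
  lam_naturality η := by
    rw [IsIso.comp_inv_eq, Category.assoc, ← lamInv_naturality, IsIso.inv_hom_id_assoc]
  rho_naturality η := by
    rw [IsIso.comp_inv_eq, Category.assoc, ← rhoInv_naturality, IsIso.inv_hom_id_assoc]
  lam_zero := by simp only [lamInv_zero]

end SemiAdditive

end TwoCat

/-! ### Precomposition and postcomposition preserve sums. -/

namespace TwoCat

open CategoryTheory Bicategory UnitalAdd AddPres Interchange

namespace SemiAdditive

variable {C : Type u} [Bicategory.{w, v} C] [SemiAdditive C] {A B X Y : C}

/-- The 2-cell by which a 1-cell to `dbl B` with components `f` and `g` gives a sum of `f` and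
`g`. -/
noncomputable def toAdd (u : A ⟶ dbl B) {f g : A ⟶ B} (a : u ≫ p₁ B ⟶ f) (b : u ≫ p₂ B ⟶ g) :
    u ≫ fold B ⟶ f ⊹ g := toSum u a b

theorem whiskerRight_toAdd {u u' : A ⟶ dbl B} (ω : u ⟶ u') {f g : A ⟶ B} (a : u' ≫ p₁ B ⟶ f)
    (b : u' ≫ p₂ B ⟶ g) :
    ω ▷ fold B ≫ toAdd u' a b = toAdd u (ω ▷ p₁ B ≫ a) (ω ▷ p₂ B ≫ b) :=
  whiskerRight_toSum ω a b

theorem toAdd_map (u : A ⟶ dbl B) {f g f' g' : A ⟶ B} (a : u ≫ p₁ B ⟶ f) (b : u ≫ p₂ B ⟶ g)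
    (η : f ⟶ f') (θ : g ⟶ g') : toAdd u a b ≫ (η ⊹ₘ θ) = toAdd u (a ≫ η) (b ≫ θ) :=
  toSum_sumMap u a b η θ

theorem toAdd_map_assoc (u : A ⟶ dbl B) {f g f' g' h : A ⟶ B} (a : u ≫ p₁ B ⟶ f)
    (b : u ≫ p₂ B ⟶ g) (η : f ⟶ f') (θ : g ⟶ g') (κ : f' ⊹ g' ⟶ h) :
    toAdd u a b ≫ (η ⊹ₘ θ) ≫ κ = toAdd u (a ≫ η) (b ≫ θ) ≫ κ := by
  rw [← toAdd_map, Category.assoc]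

theorem toAdd_eq (u : A ⟶ dbl B) {f g : A ⟶ B} (a : u ≫ p₁ B ⟶ f) (b : u ≫ p₂ B ⟶ g) :
    toAdd u a b = toPair u a b ▷ fold B ≫ toAdd _ (fst f g) (snd f g) := by
  rw [whiskerRight_toAdd, toPair_fst, toPair_snd]

theorem toAdd_lam (g : A ⟶ B) :
    toAdd (g ≫ i₂ B) ((α_ g (i₂ B) (p₁ B)).hom ≫ g ◁ i₂p₁ B ≫ compZero g B)
      ((α_ g (i₂ B) (p₂ B)).hom ≫ g ◁ i₂p₂ B ≫ (ρ_ g).hom) ≫ lam g =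
    (α_ _ _ _).hom ≫ g ◁ inv (i₂fold B) ≫ (ρ_ g).hom := by
  change toSum _ _ _ ≫ inv (lamInv g) = _
  rw [IsIso.comp_inv_eq, lamInv]
  simp

theorem toAdd_rho (f : A ⟶ B) :
    toAdd (f ≫ i₁ B) ((α_ f (i₁ B) (p₁ B)).hom ≫ f ◁ i₁p₁ B ≫ (ρ_ f).hom)
      ((α_ f (i₁ B) (p₂ B)).hom ≫ f ◁ i₁p₂ B ≫ compZero f B) ≫ rho f =
    (α_ _ _ _).hom ≫ f ◁ inv (i₁fold B) ≫ (ρ_ f).hom := by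
  change toSum _ _ _ ≫ inv (rhoInv f) = _
  rw [IsIso.comp_inv_eq, rhoInv]
  simp

/-- Precomposition preserves sums. -/
noncomputable def pre (x : X ⟶ A) (f g : A ⟶ B) : x ≫ (f ⊹ g) ⟶ (x ≫ f) ⊹ (x ≫ g) :=
  x ◁ inv (toAdd _ (fst f g) (snd f g)) ≫ (α_ x (pair f g) (fold B)).inv ≫
    toAdd (x ≫ pair f g) ((α_ _ _ _).hom ≫ x ◁ fst f g) ((α_ _ _ _).hom ≫ x ◁ snd f g)

/-- Characterizes `pre` on every presentation `u` of a sum; the properties of `pre` below are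
obtained by cancelling the invertible 2-cell on the left. -/
theorem whiskerLeft_toAdd_pre (x : X ⟶ A) (u : A ⟶ dbl B) {f g : A ⟶ B} (a : u ≫ p₁ B ⟶ f)
    (b : u ≫ p₂ B ⟶ g) : x ◁ toAdd u a b ≫ pre x f g = (α_ x u (fold B)).inv ≫
      toAdd (x ≫ u) ((α_ _ _ _).hom ≫ x ◁ a) ((α_ _ _ _).hom ≫ x ◁ b) := by
  rw [toAdd_eq u, pre, ← whiskerLeft_comp_assoc, Category.assoc, IsIso.hom_inv_id,
    Category.comp_id, associator_inv_naturality_middle_assoc, whiskerRight_toAdd]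
  simp only [associator_naturality_middle_assoc, ← whiskerLeft_comp, toPair_fst, toPair_snd]

theorem pre_naturality (x : X ⟶ A) {f f' g g' : A ⟶ B} (η : f ⟶ f') (θ : g ⟶ g') :
    x ◁ (η ⊹ₘ θ) ≫ pre x f' g' = pre x f g ≫ ((x ◁ η) ⊹ₘ (x ◁ θ)) := by
  rw [← cancel_epi (x ◁ toAdd _ (fst f g) (snd f g)), reassoc_of% whiskerLeft_toAdd_pre,
    ← whiskerLeft_comp_assoc, toAdd_map, whiskerLeft_toAdd_pre, toAdd_map]
  simp

theorem pre_lam (x : X ⟶ A) (g : A ⟶ B) :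
    pre x (zero A B) g ≫ (compZero x B ⊹ₘ 𝟙 _) ≫ lam (x ≫ g) = x ◁ lam g := by
  have h := toAdd_lam g
  rw [← cancel_epi (x ◁ toAdd (g ≫ i₂ B) ((α_ g (i₂ B) (p₁ B)).hom ≫ g ◁ i₂p₁ B ≫ compZero g B)
      ((α_ g (i₂ B) (p₂ B)).hom ≫ g ◁ i₂p₂ B ≫ (ρ_ g).hom)), reassoc_of% whiskerLeft_toAdd_pre,
    toAdd_map_assoc, ← whiskerLeft_comp, h]
  have h' := toAdd_lam (x ≫ g)
  have e : toAdd (x ≫ g ≫ i₂ B)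
      (((α_ _ _ _).hom ≫ x ◁ ((α_ g (i₂ B) (p₁ B)).hom ≫ g ◁ i₂p₁ B ≫ compZero g B)) ≫
        compZero x B)
      (((α_ _ _ _).hom ≫ x ◁ ((α_ g (i₂ B) (p₂ B)).hom ≫ g ◁ i₂p₂ B ≫ (ρ_ g).hom)) ≫ 𝟙 _) =
      (α_ x g (i₂ B)).inv ▷ fold B ≫ toAdd ((x ≫ g) ≫ i₂ B)
        ((α_ (x ≫ g) (i₂ B) (p₁ B)).hom ≫ (x ≫ g) ◁ i₂p₁ B ≫ compZero (x ≫ g) B)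
        ((α_ (x ≫ g) (i₂ B) (p₂ B)).hom ≫ (x ≫ g) ◁ i₂p₂ B ≫ (ρ_ (x ≫ g)).hom) := by
    rw [whiskerRight_toAdd, compZero_comp]
    congr 1 <;> simp
  rw [e, Category.assoc, h']
  simp

theorem pre_rho (x : X ⟶ A) (f : A ⟶ B) :
    pre x f (zero A B) ≫ (𝟙 _ ⊹ₘ compZero x B) ≫ rho (x ≫ f) = x ◁ rho f := by
  have h := toAdd_rho f
  rw [← cancel_epi (x ◁ toAdd (f ≫ i₁ B) ((α_ f (i₁ B) (p₁ B)).hom ≫ f ◁ i₁p₁ B ≫ (ρ_ f).hom)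
      ((α_ f (i₁ B) (p₂ B)).hom ≫ f ◁ i₁p₂ B ≫ compZero f B)), reassoc_of% whiskerLeft_toAdd_pre,
    toAdd_map_assoc, ← whiskerLeft_comp, h]
  have h' := toAdd_rho (x ≫ f)
  have e : toAdd (x ≫ f ≫ i₁ B)
      (((α_ _ _ _).hom ≫ x ◁ ((α_ f (i₁ B) (p₁ B)).hom ≫ f ◁ i₁p₁ B ≫ (ρ_ f).hom)) ≫ 𝟙 _)
      (((α_ _ _ _).hom ≫ x ◁ ((α_ f (i₁ B) (p₂ B)).hom ≫ f ◁ i₁p₂ B ≫ compZero f B)) ≫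
        compZero x B) =
      (α_ x f (i₁ B)).inv ▷ fold B ≫ toAdd ((x ≫ f) ≫ i₁ B)
        ((α_ (x ≫ f) (i₁ B) (p₁ B)).hom ≫ (x ≫ f) ◁ i₁p₁ B ≫ (ρ_ (x ≫ f)).hom)
        ((α_ (x ≫ f) (i₁ B) (p₂ B)).hom ≫ (x ≫ f) ◁ i₁p₂ B ≫ compZero (x ≫ f) B) := by
    rw [whiskerRight_toAdd, compZero_comp]
    congr 1 <;> simp
  rw [e, Category.assoc, h']
  simp

theorem whiskerRight_pre {x x' : X ⟶ A} (ξ : x ⟶ x') (f g : A ⟶ B) :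
    ξ ▷ (f ⊹ g) ≫ pre x' f g = pre x f g ≫ ((ξ ▷ f) ⊹ₘ (ξ ▷ g)) := by
  rw [← cancel_epi (x ◁ toAdd _ (fst f g) (snd f g)), reassoc_of% whiskerLeft_toAdd_pre,
    whisker_exchange_assoc, whiskerLeft_toAdd_pre, toAdd_map,
    associator_inv_naturality_left_assoc, whiskerRight_toAdd]
  simp only [associator_naturality_left_assoc, Category.assoc, whisker_exchange]

theorem pre_comp {X' : C} (x : X ⟶ X') (y : X' ⟶ A) (f g : A ⟶ B) :
    pre (x ≫ y) f g ≫ ((α_ x y f).hom ⊹ₘ (α_ x y g).hom) =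
      (α_ x y (f ⊹ g)).hom ≫ x ◁ pre y f g ≫ pre x (y ≫ f) (y ≫ g) := by
  rw [← cancel_epi ((x ≫ y) ◁ toAdd _ (fst f g) (snd f g)), reassoc_of% whiskerLeft_toAdd_pre,
    toAdd_map, associator_naturality_right_assoc, ← whiskerLeft_comp_assoc,
    whiskerLeft_toAdd_pre, whiskerLeft_comp_assoc, whiskerLeft_toAdd_pre]
  have e : (α_ (x ≫ y) (pair f g) (fold B)).inv =
    (α_ _ _ _).hom ≫ x ◁ (α_ _ _ _).inv ≫ (α_ _ _ _).inv ≫ (α_ x y (pair f g)).inv ▷ fold B := by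
    simp
  rw [e]
  simp only [Category.assoc, whiskerRight_toAdd]
  congr 4 <;> simp

theorem pre_id (f g : A ⟶ B) : pre (𝟙 A) f g ≫ ((λ_ f).hom ⊹ₘ (λ_ g).hom) = (λ_ _).hom := by
  rw [← cancel_epi (𝟙 A ◁ toAdd _ (fst f g) (snd f g)), reassoc_of% whiskerLeft_toAdd_pre,
    toAdd_map, leftUnitor_naturality]
  have e : (λ_ (pair f g ≫ fold B)).hom = (α_ _ _ _).inv ≫ (λ_ (pair f g)).hom ▷ fold B := by simp
  rw [e]
  simp only [Category.assoc, whiskerRight_toAdd]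
  congr 2 <;> simp

/-- Restricted along either injection, both sides are `y`: on the left because the codiagonal
restricts to the identity, on the right because one summand becomes `y` and the other zero. The
universal property of the coproduct then gives a 2-cell with these restrictions. -/
theorem exists_fold_desc (y : B ⟶ Y) : ∃ γ : fold B ≫ y ⟶ (p₁ B ≫ y) ⊹ (p₂ B ≫ y),
    i₁ B ◁ γ ≫ pre (i₁ B) (p₁ B ≫ y) (p₂ B ≫ y) ≫
      (((α_ _ _ _).inv ≫ i₁p₁ B ▷ y ≫ (λ_ y).hom) ⊹ₘ
        ((α_ _ _ _).inv ≫ i₁p₂ B ▷ y ≫ zeroComp B y)) ≫ rho y =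
      (α_ _ _ _).inv ≫ inv (i₁fold B) ▷ y ≫ (λ_ y).hom ∧
    i₂ B ◁ γ ≫ pre (i₂ B) (p₁ B ≫ y) (p₂ B ≫ y) ≫
      (((α_ _ _ _).inv ≫ i₂p₁ B ▷ y ≫ zeroComp B y) ⊹ₘ
        ((α_ _ _ _).inv ≫ i₂p₂ B ▷ y ≫ (λ_ y).hom)) ≫ lam y =
      (α_ _ _ _).inv ≫ inv (i₂fold B) ▷ y ≫ (λ_ y).hom :=
  ((isCoproduct B).unique_desc y y _ _ _ _ _ _).exists

/-- Postcomposition of the fold 1-cell with `y` is a sum of the projections composed with `y`. -/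
noncomputable def foldAdd (y : B ⟶ Y) : fold B ≫ y ⟶ (p₁ B ≫ y) ⊹ (p₂ B ≫ y) :=
  (exists_fold_desc y).choose

theorem i₁_foldAdd (y : B ⟶ Y) :
    i₁ B ◁ foldAdd y ≫ pre (i₁ B) (p₁ B ≫ y) (p₂ B ≫ y) ≫
      (((α_ _ _ _).inv ≫ i₁p₁ B ▷ y ≫ (λ_ y).hom) ⊹ₘ
        ((α_ _ _ _).inv ≫ i₁p₂ B ▷ y ≫ zeroComp B y)) ≫ rho y =
      (α_ _ _ _).inv ≫ inv (i₁fold B) ▷ y ≫ (λ_ y).hom :=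
  (exists_fold_desc y).choose_spec.1

theorem i₂_foldAdd (y : B ⟶ Y) :
    i₂ B ◁ foldAdd y ≫ pre (i₂ B) (p₁ B ≫ y) (p₂ B ≫ y) ≫
      (((α_ _ _ _).inv ≫ i₂p₁ B ▷ y ≫ zeroComp B y) ⊹ₘ
        ((α_ _ _ _).inv ≫ i₂p₂ B ▷ y ≫ (λ_ y).hom)) ≫ lam y =
      (α_ _ _ _).inv ≫ inv (i₂fold B) ▷ y ≫ (λ_ y).hom :=
  (exists_fold_desc y).choose_spec.2

/-- Postcomposition preserves sums. -/
noncomputable def post (y : B ⟶ Y) (f g : A ⟶ B) : (f ⊹ g) ≫ y ⟶ (f ≫ y) ⊹ (g ≫ y) :=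
  inv (toAdd _ (fst f g) (snd f g)) ▷ y ≫ (α_ _ _ _).hom ≫ pair f g ◁ foldAdd y ≫
    pre (pair f g) _ _ ≫ (((α_ _ _ _).inv ≫ fst f g ▷ y) ⊹ₘ ((α_ _ _ _).inv ≫ snd f g ▷ y))

/-- The universal case is `foldAdd`, and the case of `u` results from precomposing it with `u`. As
for `pre`, this determines `post` and is the tool for all its properties. -/
theorem toAdd_whiskerRight_post (y : B ⟶ Y) (u : A ⟶ dbl B) {f g : A ⟶ B} (a : u ≫ p₁ B ⟶ f)
    (b : u ≫ p₂ B ⟶ g) : toAdd u a b ▷ y ≫ post y f g = (α_ _ _ _).hom ≫ u ◁ foldAdd y ≫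
      pre u _ _ ≫ (((α_ _ _ _).inv ≫ a ▷ y) ⊹ₘ ((α_ _ _ _).inv ≫ b ▷ y)) := by
  rw [toAdd_eq u, post, ← comp_whiskerRight_assoc, Category.assoc, IsIso.hom_inv_id,
    Category.comp_id, associator_naturality_left_assoc, ← whisker_exchange_assoc,
    reassoc_of% whiskerRight_pre, map_comp_map]
  simp only [associator_inv_naturality_left_assoc, ← comp_whiskerRight, toPair_fst, toPair_snd]

theorem post_naturality (y : B ⟶ Y) {f f' g g' : A ⟶ B} (η : f ⟶ f') (θ : g ⟶ g') :
    (η ⊹ₘ θ) ▷ y ≫ post y f' g' = post y f g ≫ ((η ▷ y) ⊹ₘ (θ ▷ y)) := by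
  rw [← cancel_epi (toAdd _ (fst f g) (snd f g) ▷ y), reassoc_of% toAdd_whiskerRight_post,
    ← comp_whiskerRight_assoc, toAdd_map, toAdd_whiskerRight_post]
  simp

/-- Both sides reduce to `foldAdd y` precomposed with `x` and the pair, so the claim rests on the
compatibility of `pre` with composition. -/
theorem pre_post (x : X ⟶ A) (y : B ⟶ Y) (f g : A ⟶ B) :
    pre x f g ▷ y ≫ post y (x ≫ f) (x ≫ g) ≫ ((α_ x f y).hom ⊹ₘ (α_ x g y).hom) =
      (α_ x (f ⊹ g) y).hom ≫ x ◁ post y f g ≫ pre x (f ≫ y) (g ≫ y) := by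
  rw [← cancel_epi ((x ◁ toAdd _ (fst f g) (snd f g)) ▷ y), ← comp_whiskerRight_assoc,
    whiskerLeft_toAdd_pre, comp_whiskerRight_assoc, reassoc_of% toAdd_whiskerRight_post,
    associator_naturality_middle_assoc, ← whiskerLeft_comp_assoc, toAdd_whiskerRight_post]
  simp only [whiskerLeft_comp, Category.assoc, pre_naturality]
  have h := pre_comp x (pair f g) (p₁ B ≫ y) (p₂ B ≫ y)
  have h' : x ◁ pre (pair f g) (p₁ B ≫ y) (p₂ B ≫ y) ≫ pre x _ _ =
    (α_ _ _ _).inv ≫ pre (x ≫ pair f g) (p₁ B ≫ y) (p₂ B ≫ y) ≫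
      ((α_ _ _ _).hom ⊹ₘ (α_ _ _ _).hom) := by rw [h]; simp
  rw [reassoc_of% h', associator_inv_naturality_right_assoc]
  simp

end SemiAdditive

end TwoCat

/-! ### Compatibility of postcomposition with units, 2-cells, composites and identities. -/

namespace TwoCat

open CategoryTheory Bicategory UnitalAdd AddPres Interchange

namespace SemiAdditive

variable {C : Type u} [Bicategory.{w, v} C] [SemiAdditive C] {A B X Y Z : C}

theorem toAdd_post (y : B ⟶ Y) (u : A ⟶ dbl B) {f g : A ⟶ B} (a : u ≫ p₁ B ⟶ f)
    (b : u ≫ p₂ B ⟶ g) {k : A ⟶ Y} (κ : (f ≫ y) ⊹ (g ≫ y) ⟶ k) :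
    toAdd u a b ▷ y ≫ post y f g ≫ κ = (α_ _ _ _).hom ≫ u ◁ foldAdd y ≫
      pre u _ _ ≫ (((α_ _ _ _).inv ≫ a ▷ y) ⊹ₘ ((α_ _ _ _).inv ≫ b ▷ y)) ≫ κ := by
  rw [reassoc_of% toAdd_whiskerRight_post]

theorem pre_comp' {X' : C} (x : X ⟶ X') (y : X' ⟶ A) (f g : A ⟶ B) :
    pre (x ≫ y) f g = (α_ x y (f ⊹ g)).hom ≫ x ◁ pre y f g ≫ pre x (y ≫ f) (y ≫ g) ≫
      ((α_ x y f).inv ⊹ₘ (α_ x y g).inv) := by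
  have h := pre_comp x y f g
  rw [← reassoc_of% h]
  simp

/-- Isolates the restriction of `foldAdd` along `i`, so that the defining equations on the
injections `i₁` and `i₂` can be applied after composing with `g`. -/
theorem whiskerLeft_foldAdd (g : A ⟶ B) (i : B ⟶ dbl B) (y : B ⟶ Y) {k₁ k₂ k : A ⟶ Y}
    (a : (g ≫ i) ≫ p₁ B ≫ y ⟶ k₁) (b : (g ≫ i) ≫ p₂ B ≫ y ⟶ k₂) (κ : k₁ ⊹ k₂ ⟶ k) :
    (g ≫ i) ◁ foldAdd y ≫ pre (g ≫ i) _ _ ≫ (a ⊹ₘ b) ≫ κ =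
      (α_ _ _ _).hom ≫ g ◁ (i ◁ foldAdd y ≫ pre i _ _) ≫ pre g _ _ ≫
        (((α_ _ _ _).inv ≫ a) ⊹ₘ ((α_ _ _ _).inv ≫ b)) ≫ κ := by
  rw [pre_comp']
  simp

theorem post_lam (y : B ⟶ Y) (g : A ⟶ B) :
    post y (zero A B) g ≫ (zeroComp A y ⊹ₘ 𝟙 _) ≫ lam (g ≫ y) = lam g ▷ y := by
  rw [← cancel_epi (toAdd (g ≫ i₂ B)
    ((α_ g (i₂ B) (p₁ B)).hom ≫ g ◁ i₂p₁ B ≫ compZero g B)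
    ((α_ g (i₂ B) (p₂ B)).hom ≫ g ◁ i₂p₂ B ≫ (ρ_ g).hom) ▷ y), toAdd_post, ← comp_whiskerRight,
    toAdd_lam, map_comp_map_assoc, whiskerLeft_foldAdd]
  have h := congrArg (g ◁ ·) (i₂_foldAdd y)
  simp only [whiskerLeft_comp] at h
  have e : ((α_ g (i₂ B) (p₁ B ≫ y)).inv ≫ ((α_ (g ≫ i₂ B) (p₁ B) y).inv ≫
      ((α_ g (i₂ B) (p₁ B)).hom ≫ g ◁ i₂p₁ B ≫ compZero g B) ▷ y) ≫ zeroComp A y) =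
      (g ◁ ((α_ _ _ _).inv ≫ i₂p₁ B ▷ y ≫ zeroComp B y)) ≫ compZero g Y := by
    have := comp_zero_comp g y
    simp [this]
  have e' : ((α_ g (i₂ B) (p₂ B ≫ y)).inv ≫ ((α_ (g ≫ i₂ B) (p₂ B) y).inv ≫
      ((α_ g (i₂ B) (p₂ B)).hom ≫ g ◁ i₂p₂ B ≫ (ρ_ g).hom) ▷ y) ≫ 𝟙 _) =
      (g ◁ ((α_ _ _ _).inv ≫ i₂p₂ B ▷ y ≫ (λ_ y).hom)) ≫ 𝟙 _ := by
    simp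
  rw [e, e', ← map_comp_map_assoc, ← reassoc_of% pre_naturality, pre_lam, whiskerLeft_comp_assoc, h]
  simp

theorem post_rho (y : B ⟶ Y) (f : A ⟶ B) :
    post y f (zero A B) ≫ (𝟙 _ ⊹ₘ zeroComp A y) ≫ rho (f ≫ y) = rho f ▷ y := by
  rw [← cancel_epi (toAdd (f ≫ i₁ B)
    ((α_ f (i₁ B) (p₁ B)).hom ≫ f ◁ i₁p₁ B ≫ (ρ_ f).hom)
    ((α_ f (i₁ B) (p₂ B)).hom ≫ f ◁ i₁p₂ B ≫ compZero f B) ▷ y), toAdd_post, ← comp_whiskerRight,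
    toAdd_rho, map_comp_map_assoc, whiskerLeft_foldAdd]
  have h := congrArg (f ◁ ·) (i₁_foldAdd y)
  simp only [whiskerLeft_comp] at h
  have e : ((α_ f (i₁ B) (p₂ B ≫ y)).inv ≫ ((α_ (f ≫ i₁ B) (p₂ B) y).inv ≫
      ((α_ f (i₁ B) (p₂ B)).hom ≫ f ◁ i₁p₂ B ≫ compZero f B) ▷ y) ≫ zeroComp A y) =
      (f ◁ ((α_ _ _ _).inv ≫ i₁p₂ B ▷ y ≫ zeroComp B y)) ≫ compZero f Y := by
    have := comp_zero_comp f y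
    simp [this]
  have e' : ((α_ f (i₁ B) (p₁ B ≫ y)).inv ≫ ((α_ (f ≫ i₁ B) (p₁ B) y).inv ≫
      ((α_ f (i₁ B) (p₁ B)).hom ≫ f ◁ i₁p₁ B ≫ (ρ_ f).hom) ▷ y) ≫ 𝟙 _) =
      (f ◁ ((α_ _ _ _).inv ≫ i₁p₁ B ▷ y ≫ (λ_ y).hom)) ≫ 𝟙 _ := by
    simp
  rw [e, e', ← map_comp_map_assoc, ← reassoc_of% pre_naturality, pre_rho, whiskerLeft_comp_assoc, h]
  simp

/-- Equality of 2-cells out of `dbl B` is tested on the two injections, where `foldAdd` is known.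
The same method proves `foldAdd_comp`, `foldAdd_id` and `compZero_foldAdd`. -/
theorem foldAdd_naturality {y y' : B ⟶ Y} (θ : y ⟶ y') :
    fold B ◁ θ ≫ foldAdd y' = foldAdd y ≫ ((p₁ B ◁ θ) ⊹ₘ (p₂ B ◁ θ)) := by
  apply copair_ext
  · rw [← cancel_mono (pre (i₁ B) (p₁ B ≫ y') (p₂ B ≫ y') ≫
      (((α_ _ _ _).inv ≫ i₁p₁ B ▷ y' ≫ (λ_ y').hom) ⊹ₘ
        ((α_ _ _ _).inv ≫ i₁p₂ B ▷ y' ≫ zeroComp B y')) ≫ rho y')]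
    simp only [whiskerLeft_comp, Category.assoc]
    rw [i₁_foldAdd, reassoc_of% pre_naturality, map_comp_map_assoc]
    have e₁ : i₁ B ◁ p₁ B ◁ θ ≫ (α_ _ _ _).inv ≫ i₁p₁ B ▷ y' ≫ (λ_ y').hom =
        ((α_ _ _ _).inv ≫ i₁p₁ B ▷ y ≫ (λ_ y).hom) ≫ θ := by
      rw [associator_inv_naturality_right_assoc, whisker_exchange_assoc]
      simp
    have e₂ : i₁ B ◁ p₂ B ◁ θ ≫ (α_ _ _ _).inv ≫ i₁p₂ B ▷ y' ≫ zeroComp B y' =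
        ((α_ _ _ _).inv ≫ i₁p₂ B ▷ y ≫ zeroComp B y) ≫ 𝟙 _ := by
      rw [associator_inv_naturality_right_assoc, whisker_exchange_assoc, zeroComp_naturality]
      simp
    have hr : (θ ⊹ₘ 𝟙 (zero B Y)) ≫ rho y' = rho y ≫ θ := rho_naturality θ
    rw [e₁, e₂, ← map_comp_map_assoc, hr, reassoc_of% i₁_foldAdd,
      associator_inv_naturality_right_assoc, whisker_exchange_assoc]
    simp
  · rw [← cancel_mono (pre (i₂ B) (p₁ B ≫ y') (p₂ B ≫ y') ≫
      (((α_ _ _ _).inv ≫ i₂p₁ B ▷ y' ≫ zeroComp B y') ⊹ₘ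
        ((α_ _ _ _).inv ≫ i₂p₂ B ▷ y' ≫ (λ_ y').hom)) ≫ lam y')]
    simp only [whiskerLeft_comp, Category.assoc]
    rw [i₂_foldAdd, reassoc_of% pre_naturality, map_comp_map_assoc]
    have e₁ : i₂ B ◁ p₂ B ◁ θ ≫ (α_ _ _ _).inv ≫ i₂p₂ B ▷ y' ≫ (λ_ y').hom =
        ((α_ _ _ _).inv ≫ i₂p₂ B ▷ y ≫ (λ_ y).hom) ≫ θ := by
      rw [associator_inv_naturality_right_assoc, whisker_exchange_assoc]
      simp
    have e₂ : i₂ B ◁ p₁ B ◁ θ ≫ (α_ _ _ _).inv ≫ i₂p₁ B ▷ y' ≫ zeroComp B y' =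
        ((α_ _ _ _).inv ≫ i₂p₁ B ▷ y ≫ zeroComp B y) ≫ 𝟙 _ := by
      rw [associator_inv_naturality_right_assoc, whisker_exchange_assoc, zeroComp_naturality]
      simp
    have hl : (𝟙 (zero B Y) ⊹ₘ θ) ≫ lam y' = lam y ≫ θ := lam_naturality θ
    rw [e₁, e₂, ← map_comp_map_assoc, hl, reassoc_of% i₂_foldAdd,
      associator_inv_naturality_right_assoc, whisker_exchange_assoc]
    simp

theorem whiskerLeft_post {y y' : B ⟶ Y} (θ : y ⟶ y') (f g : A ⟶ B) :
    (f ⊹ g) ◁ θ ≫ post y' f g = post y f g ≫ ((f ◁ θ) ⊹ₘ (g ◁ θ)) := by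
  rw [← cancel_epi (toAdd _ (fst f g) (snd f g) ▷ y), ← whisker_exchange_assoc,
    toAdd_whiskerRight_post, toAdd_post, associator_naturality_right_assoc,
    ← whiskerLeft_comp_assoc, foldAdd_naturality, whiskerLeft_comp_assoc,
    reassoc_of% pre_naturality, map_comp_map, map_comp_map]
  simp only [associator_inv_naturality_right_assoc, whisker_exchange, Category.assoc]

/-- On an injection, both sides delete a zero summand: the left at once, the right first after `y`
and then after `z`. They agree because `post z` is compatible with units. -/
theorem foldAdd_comp (y : B ⟶ Y) (z : Y ⟶ Z) :
    foldAdd (y ≫ z) = (α_ _ _ _).inv ≫ foldAdd y ▷ z ≫ post z _ _ ≫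
      ((α_ _ _ _).hom ⊹ₘ (α_ _ _ _).hom) := by
  apply copair_ext
  · rw [← cancel_mono (pre (i₁ B) (p₁ B ≫ y ≫ z) (p₂ B ≫ y ≫ z) ≫
      (((α_ _ _ _).inv ≫ i₁p₁ B ▷ (y ≫ z) ≫ (λ_ (y ≫ z)).hom) ⊹ₘ
        ((α_ _ _ _).inv ≫ i₁p₂ B ▷ (y ≫ z) ≫ zeroComp B (y ≫ z))) ≫ rho (y ≫ z)), i₁_foldAdd]
    have h := pre_post (i₁ B) z (p₁ B ≫ y) (p₂ B ≫ y)
    simp only [whiskerLeft_comp, Category.assoc]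
    rw [reassoc_of% pre_naturality, map_comp_map_assoc]
    have h' : i₁ B ◁ post z (p₁ B ≫ y) (p₂ B ≫ y) ≫ pre (i₁ B) _ _ =
        (α_ _ _ _).inv ≫ pre (i₁ B) _ _ ▷ z ≫ post z _ _ ≫
          ((α_ _ _ _).hom ⊹ₘ (α_ _ _ _).hom) := by
      rw [h]; simp
    rw [reassoc_of% h', map_comp_map_assoc]
    have e₁ : (α_ (i₁ B) (p₁ B ≫ y) z).hom ≫ i₁ B ◁ (α_ (p₁ B) y z).hom ≫ (α_ _ _ _).inv ≫
        i₁p₁ B ▷ (y ≫ z) ≫ (λ_ (y ≫ z)).hom =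
        ((α_ _ _ _).inv ≫ i₁p₁ B ▷ y ≫ (λ_ y).hom) ▷ z ≫ 𝟙 _ := by
      simp
    have e₂ : (α_ (i₁ B) (p₂ B ≫ y) z).hom ≫ i₁ B ◁ (α_ (p₂ B) y z).hom ≫ (α_ _ _ _).inv ≫
        i₁p₂ B ▷ (y ≫ z) ≫ zeroComp B (y ≫ z) =
        ((α_ _ _ _).inv ≫ i₁p₂ B ▷ y ≫ zeroComp B y) ▷ z ≫ zeroComp B z := by
      simp [zeroComp_comp]
    rw [e₁, e₂, ← map_comp_map_assoc, ← reassoc_of% post_naturality, post_rho,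
      associator_inv_naturality_middle_assoc]
    simp only [← comp_whiskerRight]
    rw [i₁_foldAdd]
    simp
  · rw [← cancel_mono (pre (i₂ B) (p₁ B ≫ y ≫ z) (p₂ B ≫ y ≫ z) ≫
      (((α_ _ _ _).inv ≫ i₂p₁ B ▷ (y ≫ z) ≫ zeroComp B (y ≫ z)) ⊹ₘ
        ((α_ _ _ _).inv ≫ i₂p₂ B ▷ (y ≫ z) ≫ (λ_ (y ≫ z)).hom)) ≫ lam (y ≫ z)), i₂_foldAdd]
    have h := pre_post (i₂ B) z (p₁ B ≫ y) (p₂ B ≫ y)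
    simp only [whiskerLeft_comp, Category.assoc]
    rw [reassoc_of% pre_naturality, map_comp_map_assoc]
    have h' : i₂ B ◁ post z (p₁ B ≫ y) (p₂ B ≫ y) ≫ pre (i₂ B) _ _ =
        (α_ _ _ _).inv ≫ pre (i₂ B) _ _ ▷ z ≫ post z _ _ ≫
          ((α_ _ _ _).hom ⊹ₘ (α_ _ _ _).hom) := by
      rw [h]; simp
    rw [reassoc_of% h', map_comp_map_assoc]
    have e₁ : (α_ (i₂ B) (p₂ B ≫ y) z).hom ≫ i₂ B ◁ (α_ (p₂ B) y z).hom ≫ (α_ _ _ _).inv ≫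
        i₂p₂ B ▷ (y ≫ z) ≫ (λ_ (y ≫ z)).hom =
        ((α_ _ _ _).inv ≫ i₂p₂ B ▷ y ≫ (λ_ y).hom) ▷ z ≫ 𝟙 _ := by
      simp
    have e₂ : (α_ (i₂ B) (p₁ B ≫ y) z).hom ≫ i₂ B ◁ (α_ (p₁ B) y z).hom ≫ (α_ _ _ _).inv ≫
        i₂p₁ B ▷ (y ≫ z) ≫ zeroComp B (y ≫ z) =
        ((α_ _ _ _).inv ≫ i₂p₁ B ▷ y ≫ zeroComp B y) ▷ z ≫ zeroComp B z := by
      simp [zeroComp_comp]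
    rw [e₁, e₂, ← map_comp_map_assoc, ← reassoc_of% post_naturality, post_lam,
      associator_inv_naturality_middle_assoc]
    simp only [← comp_whiskerRight]
    rw [i₂_foldAdd]
    simp

theorem post_comp (y : B ⟶ Y) (z : Y ⟶ Z) (f g : A ⟶ B) :
    post (y ≫ z) f g = (α_ _ _ _).inv ≫ post y f g ▷ z ≫ post z _ _ ≫
      ((α_ _ _ _).hom ⊹ₘ (α_ _ _ _).hom) := by
  rw [← cancel_epi (toAdd _ (fst f g) (snd f g) ▷ (y ≫ z)), toAdd_whiskerRight_post, foldAdd_comp,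
    associator_inv_naturality_left_assoc, ← comp_whiskerRight_assoc, toAdd_whiskerRight_post]
  simp only [comp_whiskerRight, Category.assoc, reassoc_of% post_naturality, map_comp_map]
  have h := pre_post (pair f g) z (p₁ B ≫ y) (p₂ B ≫ y)
  have h' : pair f g ◁ post z (p₁ B ≫ y) (p₂ B ≫ y) ≫ pre (pair f g) _ _ =
      (α_ _ _ _).inv ≫ pre (pair f g) _ _ ▷ z ≫ post z _ _ ≫
        ((α_ _ _ _).hom ⊹ₘ (α_ _ _ _).hom) := by
    rw [h]; simp
  simp only [whiskerLeft_comp, Category.assoc, reassoc_of% pre_naturality, reassoc_of% h',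
    map_comp_map]
  simp

theorem i₁_toAdd (B : C) : toAdd (i₁ B) (i₁p₁ B) (i₁p₂ B) ≫ rho (𝟙 B) = inv (i₁fold B) := by
  have h := toAdd_rho (𝟙 B)
  have e : toAdd (𝟙 B ≫ i₁ B) ((α_ (𝟙 B) (i₁ B) (p₁ B)).hom ≫ 𝟙 B ◁ i₁p₁ B ≫ (ρ_ (𝟙 B)).hom)
      ((α_ (𝟙 B) (i₁ B) (p₂ B)).hom ≫ 𝟙 B ◁ i₁p₂ B ≫ compZero (𝟙 B) B) =
      (λ_ (i₁ B)).hom ▷ fold B ≫ toAdd (i₁ B) (i₁p₁ B) (i₁p₂ B) := by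
    rw [whiskerRight_toAdd, compZero_id]
    congr 1 <;> simp
  rw [e, Category.assoc] at h
  rw [← cancel_epi ((λ_ (i₁ B)).hom ▷ fold B), h]
  simp

theorem i₂_toAdd (B : C) : toAdd (i₂ B) (i₂p₁ B) (i₂p₂ B) ≫ lam (𝟙 B) = inv (i₂fold B) := by
  have h := toAdd_lam (𝟙 B)
  have e : toAdd (𝟙 B ≫ i₂ B) ((α_ (𝟙 B) (i₂ B) (p₁ B)).hom ≫ 𝟙 B ◁ i₂p₁ B ≫ compZero (𝟙 B) B)
      ((α_ (𝟙 B) (i₂ B) (p₂ B)).hom ≫ 𝟙 B ◁ i₂p₂ B ≫ (ρ_ (𝟙 B)).hom) =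
      (λ_ (i₂ B)).hom ▷ fold B ≫ toAdd (i₂ B) (i₂p₁ B) (i₂p₂ B) := by
    rw [whiskerRight_toAdd, compZero_id]
    congr 1 <;> simp
  rw [e, Category.assoc] at h
  rw [← cancel_epi ((λ_ (i₂ B)).hom ▷ fold B), h]
  simp

/-- The identity of `dbl B` presents the codiagonal as the sum of the two projections, and this
presentation is what `foldAdd (𝟙 B)` amounts to. -/
theorem foldAdd_id : foldAdd (𝟙 B) ≫ ((ρ_ _).hom ⊹ₘ (ρ_ _).hom) =
    (ρ_ (fold B)).hom ≫ (λ_ (fold B)).inv ≫ toAdd (𝟙 _) (λ_ _).hom (λ_ _).hom := by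
  apply copair_ext
  · rw [← cancel_mono (pre (i₁ B) _ _ ≫ (i₁p₁ B ⊹ₘ i₁p₂ B) ≫ rho (𝟙 B))]
    simp only [whiskerLeft_comp, Category.assoc]
    rw [reassoc_of% pre_naturality, reassoc_of% whiskerLeft_toAdd_pre, map_comp_map_assoc,
      toAdd_map_assoc]
    have h := i₁_foldAdd (𝟙 B)
    have e : (α_ (i₁ B) (p₁ B) (𝟙 B)).inv ≫ i₁p₁ B ▷ 𝟙 B ≫ (λ_ (𝟙 B)).hom =
      i₁ B ◁ (ρ_ _).hom ≫ i₁p₁ B := by simp [unitors_equal]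
    have e' : (α_ (i₁ B) (p₂ B) (𝟙 B)).inv ≫ i₁p₂ B ▷ 𝟙 B ≫ zeroComp B (𝟙 B) =
      i₁ B ◁ (ρ_ _).hom ≫ i₁p₂ B := by simp [zeroComp_id]
    rw [e, e'] at h
    rw [h]
    have e₂ : toAdd (i₁ B ≫ 𝟙 _) (((α_ (i₁ B) (𝟙 _) (p₁ B)).hom ≫ i₁ B ◁ (λ_ _).hom) ≫ i₁p₁ B)
        (((α_ (i₁ B) (𝟙 _) (p₂ B)).hom ≫ i₁ B ◁ (λ_ _).hom) ≫ i₁p₂ B) =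
        (ρ_ _).hom ▷ fold B ≫ toAdd (i₁ B) (i₁p₁ B) (i₁p₂ B) := by
      rw [whiskerRight_toAdd]
      congr 1 <;> simp
    rw [e₂, Category.assoc, i₁_toAdd]
    simp [unitors_equal]
  · rw [← cancel_mono (pre (i₂ B) _ _ ≫ (i₂p₁ B ⊹ₘ i₂p₂ B) ≫ lam (𝟙 B))]
    simp only [whiskerLeft_comp, Category.assoc]
    rw [reassoc_of% pre_naturality, reassoc_of% whiskerLeft_toAdd_pre, map_comp_map_assoc,
      toAdd_map_assoc]
    have h := i₂_foldAdd (𝟙 B)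
    have e : (α_ (i₂ B) (p₂ B) (𝟙 B)).inv ≫ i₂p₂ B ▷ 𝟙 B ≫ (λ_ (𝟙 B)).hom =
      i₂ B ◁ (ρ_ _).hom ≫ i₂p₂ B := by simp [unitors_equal]
    have e' : (α_ (i₂ B) (p₁ B) (𝟙 B)).inv ≫ i₂p₁ B ▷ 𝟙 B ≫ zeroComp B (𝟙 B) =
      i₂ B ◁ (ρ_ _).hom ≫ i₂p₁ B := by simp [zeroComp_id]
    rw [e, e'] at h
    rw [h]
    have e₂ : toAdd (i₂ B ≫ 𝟙 _) (((α_ (i₂ B) (𝟙 _) (p₁ B)).hom ≫ i₂ B ◁ (λ_ _).hom) ≫ i₂p₁ B)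
        (((α_ (i₂ B) (𝟙 _) (p₂ B)).hom ≫ i₂ B ◁ (λ_ _).hom) ≫ i₂p₂ B) =
        (ρ_ _).hom ▷ fold B ≫ toAdd (i₂ B) (i₂p₁ B) (i₂p₂ B) := by
      rw [whiskerRight_toAdd]
      congr 1 <;> simp
    rw [e₂, Category.assoc, i₂_toAdd]
    simp [unitors_equal]

theorem post_id (f g : A ⟶ B) : post (𝟙 B) f g ≫ ((ρ_ f).hom ⊹ₘ (ρ_ g).hom) = (ρ_ _).hom := by
  rw [← cancel_epi (toAdd _ (fst f g) (snd f g) ▷ 𝟙 B), toAdd_post, map_comp_map]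
  have e : ((α_ _ _ _).inv ≫ fst f g ▷ 𝟙 B) ≫ (ρ_ f).hom =
    pair f g ◁ (ρ_ (p₁ B)).hom ≫ fst f g := by simp
  have e' : ((α_ _ _ _).inv ≫ snd f g ▷ 𝟙 B) ≫ (ρ_ g).hom =
    pair f g ◁ (ρ_ (p₂ B)).hom ≫ snd f g := by simp
  rw [e, e', ← map_comp_map, ← reassoc_of% pre_naturality, ← whiskerLeft_comp_assoc, foldAdd_id]
  simp only [whiskerLeft_comp, Category.assoc]
  rw [reassoc_of% whiskerLeft_toAdd_pre, toAdd_map]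
  have e₂ : toAdd (pair f g ≫ 𝟙 _) (((α_ (pair f g) (𝟙 _) (p₁ B)).hom ≫ pair f g ◁ (λ_ _).hom) ≫
        fst f g)
      (((α_ (pair f g) (𝟙 _) (p₂ B)).hom ≫ pair f g ◁ (λ_ _).hom) ≫ snd f g) =
      (ρ_ _).hom ▷ fold B ≫ toAdd _ (fst f g) (snd f g) := by
    rw [whiskerRight_toAdd]
    congr 1 <;> simp
  rw [e₂, rightUnitor_naturality]
  simp

end SemiAdditive

end TwoCat

/-! ### Interchange and coherence for the sum on hom-groupoids. -/

namespace TwoCat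

open CategoryTheory Bicategory UnitalAdd AddPres Interchange

namespace SemiAdditive

variable {C : Type u} [Bicategory.{w, v} C] [SemiAdditive C] {A B X Y Z : C}

theorem compZero_foldAdd (B Y : C) :
    foldAdd (zero B Y) ≫ (compZero (p₁ B) Y ⊹ₘ compZero (p₂ B) Y) ≫ lam (zero (dbl B) Y) =
      compZero (fold B) Y := by
  have hl : lam (zero (dbl B) Y) = rho (zero (dbl B) Y) := lam_zero
  have hl' : lam (zero B Y) = rho (zero B Y) := lam_zero
  apply copair_ext
  · rw [← cancel_mono (compZero (i₁ B) Y)]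
    have h := i₁_foldAdd (zero B Y)
    have e : (α_ _ _ _).inv ≫ i₁p₁ B ▷ zero B Y ≫ (λ_ (zero B Y)).hom =
        i₁ B ◁ compZero (p₁ B) Y ≫ compZero (i₁ B) Y := by
      have := compZero_naturality (i₁p₁ B) Y
      rw [compZero_id, compZero_comp] at this
      rw [this]
      simp
    have e' : (α_ _ _ _).inv ≫ i₁p₂ B ▷ zero B Y ≫ zeroComp B (zero B Y) =
        i₁ B ◁ compZero (p₂ B) Y ≫ compZero (i₁ B) Y := by
      have := compZero_naturality (i₁p₂ B) Y
      rw [compZero_comp] at this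
      rw [zero_zero, this]
      simp
    have e'' : (α_ _ _ _).inv ≫ inv (i₁fold B) ▷ zero B Y ≫ (λ_ (zero B Y)).hom =
        i₁ B ◁ compZero (fold B) Y ≫ compZero (i₁ B) Y := by
      have := compZero_naturality (inv (i₁fold B)) Y
      rw [compZero_id, compZero_comp] at this
      rw [this]
      simp
    rw [e, e', e''] at h
    rw [← h, whiskerLeft_comp, whiskerLeft_comp, hl, ← pre_rho]
    have hr : (compZero (i₁ B) Y ⊹ₘ 𝟙 (zero B Y)) ≫ rho (zero B Y) = rho _ ≫ compZero (i₁ B) Y :=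
      rho_naturality _
    simp only [Category.assoc]
    rw [← hr, reassoc_of% pre_naturality]
    simp
  · rw [← cancel_mono (compZero (i₂ B) Y)]
    have h := i₂_foldAdd (zero B Y)
    have e : (α_ _ _ _).inv ≫ i₂p₂ B ▷ zero B Y ≫ (λ_ (zero B Y)).hom =
        i₂ B ◁ compZero (p₂ B) Y ≫ compZero (i₂ B) Y := by
      have := compZero_naturality (i₂p₂ B) Y
      rw [compZero_id, compZero_comp] at this
      rw [this]
      simp
    have e' : (α_ _ _ _).inv ≫ i₂p₁ B ▷ zero B Y ≫ zeroComp B (zero B Y) =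
        i₂ B ◁ compZero (p₁ B) Y ≫ compZero (i₂ B) Y := by
      have := compZero_naturality (i₂p₁ B) Y
      rw [compZero_comp] at this
      rw [zero_zero, this]
      simp
    have e'' : (α_ _ _ _).inv ≫ inv (i₂fold B) ▷ zero B Y ≫ (λ_ (zero B Y)).hom =
        i₂ B ◁ compZero (fold B) Y ≫ compZero (i₂ B) Y := by
      have := compZero_naturality (inv (i₂fold B)) Y
      rw [compZero_id, compZero_comp] at this
      rw [this]
      simp
    rw [e, e', e''] at h
    rw [← h, whiskerLeft_comp, whiskerLeft_comp, ← pre_lam]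
    have hr : (𝟙 (zero B Y) ⊹ₘ compZero (i₂ B) Y) ≫ lam (zero B Y) = lam _ ≫ compZero (i₂ B) Y :=
      lam_naturality _
    simp only [Category.assoc]
    rw [← hr, reassoc_of% pre_naturality]
    simp

/-- Ensures that the nullity of `0 ∘ (f + g)` is the sum of the nullities of the summands; it is
what makes the zero component of an inclusion additive. -/
theorem post_zero (f g : A ⟶ B) (Y : C) :
    post (zero B Y) f g ≫ (compZero f Y ⊹ₘ compZero g Y) ≫ lam (zero A Y) = compZero (f ⊹ g) Y := by
  rw [← cancel_epi (toAdd _ (fst f g) (snd f g) ▷ zero B Y), compZero_naturality, toAdd_post,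
    map_comp_map_assoc, compZero_comp (pair f g) (fold B), ← compZero_foldAdd]
  have e : ((α_ _ _ _).inv ≫ fst f g ▷ zero B Y) ≫ compZero f Y =
      pair f g ◁ compZero (p₁ B) Y ≫ compZero (pair f g) Y := by
    rw [Category.assoc, compZero_naturality, compZero_comp]
    simp
  have e' : ((α_ _ _ _).inv ≫ snd f g ▷ zero B Y) ≫ compZero g Y =
      pair f g ◁ compZero (p₂ B) Y ≫ compZero (pair f g) Y := by
    rw [Category.assoc, compZero_naturality, compZero_comp]
    simp
  have hr : (𝟙 (zero A Y) ⊹ₘ compZero (pair f g) Y) ≫ lam (zero A Y) =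
    lam _ ≫ compZero (pair f g) Y := lam_naturality _
  rw [e, e', whiskerLeft_comp, whiskerLeft_comp, ← pre_lam]
  simp only [Category.assoc]
  rw [← hr, reassoc_of% pre_naturality]
  simp

noncomputable instance (x : X ⟶ A) (B : C) : AddPres (precomp B x) where
  δ f g := pre x f g
  υ := compZero x B
  δ_naturality η θ := pre_naturality x η θ
  δ_lam g := pre_lam x g
  δ_rho f := pre_rho x f

noncomputable instance (A : C) (y : B ⟶ Y) : AddPres (postcomp A y) where
  δ f g := post y f g
  υ := zeroComp A y
  δ_naturality η θ := post_naturality y η θ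
  δ_lam g := post_lam y g
  δ_rho f := post_rho y f

/-- A square of 1-cells filled by `κ` gives two ways to postcompose, and `κ` compares their
preservation of sums. Applied to the squares formed by `dblMap y` with the projections and the
codiagonal. -/
theorem post_comp_post {D : C} {y : B ⟶ Y} {z : Y ⟶ Z} {k : B ⟶ D} {l : D ⟶ Z}
    (κ : y ≫ z ⟶ k ≫ l) (f g : A ⟶ B) :
    ((α_ (f ⊹ g) y z).hom ≫ (f ⊹ g) ◁ κ ≫ (α_ (f ⊹ g) k l).inv) ≫ post k f g ▷ l ≫ post l _ _ =
      post y f g ▷ z ≫ post z _ _ ≫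
        (((α_ f y z).hom ≫ f ◁ κ ≫ (α_ f k l).inv) ⊹ₘ
          ((α_ g y z).hom ≫ g ◁ κ ≫ (α_ g k l).inv)) := by
  have h := whiskerLeft_post κ f g
  rw [post_comp, post_comp] at h
  have h' := ((α_ (f ⊹ g) y z).hom ≫= h) =≫ ((α_ f k l).inv ⊹ₘ (α_ g k l).inv)
  simpa using h'

theorem post_comp_whiskerLeft {y : B ⟶ Y} {z : Y ⟶ Z} {k : B ⟶ Z} (κ : y ≫ z ⟶ k) (f g : A ⟶ B) :
    post y f g ▷ z ≫ post z _ _ ≫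
        (((α_ f y z).hom ≫ f ◁ κ) ⊹ₘ ((α_ g y z).hom ≫ g ◁ κ)) =
      (α_ (f ⊹ g) y z).hom ≫ (f ⊹ g) ◁ κ ≫ post k f g := by
  rw [whiskerLeft_post, post_comp]
  simp

/-- The zero 1-cell to `dbl B` is zero followed by `i₂`, so this is the left unit law at zero. -/
theorem toAdd_zero (A B : C) : toAdd (zero A (dbl B)) (zeroComp A (p₁ B)) (zeroComp A (p₂ B)) ≫
    lam (zero A B) = zeroComp A (fold B) := by
  have h := toAdd_lam (zero A B)
  have e : toAdd (zero A B ≫ i₂ B)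
      ((α_ (zero A B) (i₂ B) (p₁ B)).hom ≫ zero A B ◁ i₂p₁ B ≫ compZero (zero A B) B)
      ((α_ (zero A B) (i₂ B) (p₂ B)).hom ≫ zero A B ◁ i₂p₂ B ≫ (ρ_ (zero A B)).hom) =
      zeroComp A (i₂ B) ▷ fold B ≫
        toAdd (zero A (dbl B)) (zeroComp A (p₁ B)) (zeroComp A (p₂ B)) := by
    rw [whiskerRight_toAdd, ← zero_zero, zeroComp_naturality, ← zeroComp_id, zeroComp_naturality,
      zeroComp_comp, zeroComp_comp]
    simp
  rw [e, Category.assoc] at h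
  rw [← cancel_epi (zeroComp A (i₂ B) ▷ fold B), h, ← zeroComp_id, zeroComp_naturality,
    zeroComp_comp]
  simp

/-- The 2-cell `k ∘ i ∘ f ⟹ f` that is induced by a 2-cell from `k ∘ i` to the identity. -/
def compId {i : B ⟶ Y} {k : Y ⟶ B} (κ : i ≫ k ⟶ 𝟙 B) (f : A ⟶ B) : (f ≫ i) ≫ k ⟶ f :=
  (α_ _ _ _).hom ≫ f ◁ κ ≫ (ρ_ f).hom

/-- The 2-cell `k ∘ i ∘ f ⟹ 0` that is induced by a 2-cell from `k ∘ i` to zero. -/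
def compToZero {i : B ⟶ Y} {k : Y ⟶ Z} (κ : i ≫ k ⟶ zero B Z) (f : A ⟶ B) :
    (f ≫ i) ≫ k ⟶ zero A Z :=
  (α_ _ _ _).hom ≫ f ◁ κ ≫ compZero f Z

theorem compId_add {i : B ⟶ Y} {k : Y ⟶ B} (κ : i ≫ k ⟶ 𝟙 B) (f g : A ⟶ B) :
    post i f g ▷ k ≫ post k _ _ ≫ (compId κ f ⊹ₘ compId κ g) = compId κ (f ⊹ g) := by
  have h := post_comp_whiskerLeft κ f g =≫ ((ρ_ f).hom ⊹ₘ (ρ_ g).hom)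
  simpa [post_id, compId] using h

theorem compToZero_add {i : B ⟶ Y} {k : Y ⟶ Z} (κ : i ≫ k ⟶ zero B Z) (f g : A ⟶ B) :
    post i f g ▷ k ≫ post k _ _ ≫ (compToZero κ f ⊹ₘ compToZero κ g) ≫ lam (zero A Z) =
      compToZero κ (f ⊹ g) := by
  have h := post_comp_whiskerLeft κ f g =≫
    ((compZero f Z ⊹ₘ compZero g Z) ≫ lam (zero A Z))
  simp only [Category.assoc, map_comp_map_assoc, post_zero] at h
  simpa [compToZero] using h

/-- Sums of 1-cells are presented by the 1-cells to `dbl B`. -/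
@[reducible]
noncomputable def sumPresentation (A B : C) :
    SumPresentation (postcomp A (fold B)) (postcomp A (p₁ B)) (postcomp A (p₂ B)) where
  toSum u _ _ a b := toAdd u a b
  map_toSum ω _ _ a b := whiskerRight_toAdd ω a b
  toSum_map u _ _ _ _ a b η θ := toAdd_map u a b η θ
  pair := pair
  fst := fst
  snd := snd
  exists_lift a b := ⟨toPair _ a b, toPair_fst _ a b, toPair_snd _ a b⟩
  toSum_zero := toAdd_zero A B
  inl f := f ≫ i₁ B
  inlAdd f g := post (i₁ B) f g
  inlSum f := compId (inv (i₁fold B)) f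
  inlFst f := compId (i₁p₁ B) f
  inlSnd f := compToZero (i₁p₂ B) f
  inlSum_add f g := compId_add _ f g
  inlFst_add f g := compId_add _ f g
  inlSnd_add f g := compToZero_add _ f g
  toSum_inl f := toAdd_rho f
  inr f := f ≫ i₂ B
  inrSum f := compId (inv (i₂fold B)) f
  inrFst f := compToZero (i₂p₁ B) f
  inrSnd f := compId (i₂p₂ B) f

noncomputable instance (A B : C) : Interchange (A ⟶ B) := (sumPresentation A B).interchange

theorem toAdd_precomp (x : X ⟶ A) (u : A ⟶ dbl B) {f g : A ⟶ B} (a : u ≫ p₁ B ⟶ f)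
    (b : u ≫ p₂ B ⟶ g) : (α_ x u (fold B)).hom ≫ x ◁ toAdd u a b ≫ pre x f g =
      toAdd (x ≫ u) ((α_ _ _ _).hom ≫ x ◁ a) ((α_ _ _ _).hom ≫ x ◁ b) := by
  rw [whiskerLeft_toAdd_pre]
  simp

/-- The lift to pairs is again precomposition with `x`, and the comparisons are associators; they
respect sums because precomposition and postcomposition commute. -/
instance (x : X ⟶ A) (B : C) : InterchangePres (precomp B x) where
  map_χ f h g k := by
    refine (sumPresentation A B).map_χ (sumPresentation X B) (precomp B x) (precomp (dbl B) x)
      (fun u => (α_ x u (p₁ B)).hom) (fun u => (α_ x u (p₂ B)).hom)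
      (fun u => (α_ x u (fold B)).hom) ?_ ?_ ?_ ?_ f h g k
    · exact fun u u' => (pre_post x (p₁ B) u u').symm
    · exact fun u u' => (pre_post x (p₂ B) u u').symm
    · exact fun u u' => (pre_post x (fold B) u u').symm
    · exact fun u _ _ a b => toAdd_precomp x u a b

/-- The 1-cell `dbl B ⟶ dbl Y` induced by `y : B ⟶ Y`. -/
noncomputable def dblMap (y : B ⟶ Y) : dbl B ⟶ dbl Y := pair (p₁ B ≫ y) (p₂ B ≫ y)

noncomputable def dblMapFst (y : B ⟶ Y) : dblMap y ≫ p₁ Y ⟶ p₁ B ≫ y := fst _ _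

noncomputable def dblMapSnd (y : B ⟶ Y) : dblMap y ≫ p₂ Y ⟶ p₂ B ≫ y := snd _ _

noncomputable def dblMapFold (y : B ⟶ Y) : dblMap y ≫ fold Y ⟶ fold B ≫ y :=
  toAdd _ (dblMapFst y) (dblMapSnd y) ≫ inv (foldAdd y)

/-- Here the lift to pairs is postcomposition with `dblMap y`. The 2-cell `dblMapFold` is built from
the inverse of `foldAdd`, so that the two occurrences of `foldAdd` cancel. -/
theorem toAdd_postcomp (y : B ⟶ Y) (u : A ⟶ dbl B) {f g : A ⟶ B} (a : u ≫ p₁ B ⟶ f)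
    (b : u ≫ p₂ B ⟶ g) :
    ((α_ _ _ _).hom ≫ u ◁ dblMapFold y ≫ (α_ _ _ _).inv) ≫ toAdd u a b ▷ y ≫ post y f g =
      toAdd (u ≫ dblMap y) (((α_ _ _ _).hom ≫ u ◁ dblMapFst y ≫ (α_ _ _ _).inv) ≫ a ▷ y)
        (((α_ _ _ _).hom ≫ u ◁ dblMapSnd y ≫ (α_ _ _ _).inv) ≫ b ▷ y) := by
  have h := whiskerLeft_toAdd_pre u (dblMap y) (dblMapFst y) (dblMapSnd y)
  rw [toAdd_whiskerRight_post, dblMapFold, whiskerLeft_comp]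
  have h₀ : u ◁ inv (foldAdd y) ≫ u ◁ foldAdd y = 𝟙 _ := by
    rw [← whiskerLeft_comp, IsIso.inv_hom_id, whiskerLeft_id]
  simp only [Category.assoc, Iso.inv_hom_id_assoc]
  rw [reassoc_of% h₀, reassoc_of% h, Iso.hom_inv_id_assoc, toAdd_map]
  simp

instance (A : C) (y : B ⟶ Y) : InterchangePres (postcomp A y) where
  map_χ f h g k := by
    refine (sumPresentation A B).map_χ (sumPresentation A Y) (postcomp A y)
      (postcomp A (dblMap y))
      (fun u => (α_ _ _ _).hom ≫ u ◁ dblMapFst y ≫ (α_ _ _ _).inv)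
      (fun u => (α_ _ _ _).hom ≫ u ◁ dblMapSnd y ≫ (α_ _ _ _).inv)
      (fun u => (α_ _ _ _).hom ≫ u ◁ dblMapFold y ≫ (α_ _ _ _).inv)
      (fun u u' => post_comp_post _ u u') (fun u u' => post_comp_post _ u u')
      (fun u u' => post_comp_post _ u u') (fun u _ _ a b => toAdd_postcomp y u a b) f h g k

/-- The category of pairs is itself the hom-groupoid to `dbl B`, so it carries the same kind of sum,
and the three functors, being postcompositions, preserve the interchange. -/
theorem isSplitting (A B : C) :
    IsSplitting (postcomp A (fold B)) (postcomp A (p₁ B)) (postcomp A (p₂ B)) where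
  faithful h₁ h₂ := pair_ext h₁ h₂
  exists_left f := ⟨f ≫ i₁ B, ⟨(sumPresentation A B).inlSum f⟩,
    ⟨inv ((sumPresentation A B).inlFst f)⟩, ⟨inv ((sumPresentation A B).inlSnd f)⟩⟩
  exists_right f := ⟨f ≫ i₂ B, ⟨(sumPresentation A B).inrSum f⟩,
    ⟨inv ((sumPresentation A B).inrFst f)⟩, ⟨inv ((sumPresentation A B).inrSnd f)⟩⟩

instance (A B : C) : IsCoherent (A ⟶ B) := (isSplitting A B).isCoherent

end SemiAdditive

end TwoCat

/-! ### The hom-groupoids form a strict 2-functor to symmetric categorical groups. -/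

namespace TwoCat

open CategoryTheory Bicategory UnitalAdd AddPres Interchange

section Comp

variable {M : Type u₁} [Category.{v₁} M] [UnitalAdd M] {N : Type u₂} [Category.{v₂} N]
  [UnitalAdd N] {L : Type u₃} [Category.{v₃} L] [UnitalAdd L]

instance (F : M ⥤ N) (H : N ⥤ L) [AddPres F] [AddPres H] : AddPres (F ⋙ H) where
  δ f g := H.map (δ F f g) ≫ δ H _ _
  υ := H.map (υ F) ≫ υ H
  δ_naturality η θ := by
    have h := AddPres.δ_naturality F η θ
    simp only [Functor.comp_map, Category.assoc, ← AddPres.δ_naturality H, ← H.map_comp_assoc, h]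
  δ_lam g := by
    have h := δ_lam F g
    have h' := AddPres.δ_naturality H (υ F) (𝟙 (F.obj g))
    have e : (H.map (υ F) ≫ υ H) ⊹ₘ 𝟙 (H.obj (F.obj g)) =
      (H.map (υ F) ⊹ₘ H.map (𝟙 _)) ≫ (υ H ⊹ₘ 𝟙 _) := by simp
    simp only [Functor.comp_map, Functor.comp_obj, Category.assoc]
    rw [e, Category.assoc, ← reassoc_of% h', δ_lam H, ← h]
    simp
  δ_rho f := by
    have h := δ_rho F f
    have h' := AddPres.δ_naturality H (𝟙 (F.obj f)) (υ F)
    have e : 𝟙 (H.obj (F.obj f)) ⊹ₘ (H.map (υ F) ≫ υ H) =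
      (H.map (𝟙 _) ⊹ₘ H.map (υ F)) ≫ (𝟙 _ ⊹ₘ υ H) := by simp
    simp only [Functor.comp_map, Functor.comp_obj, Category.assoc]
    rw [e, Category.assoc, ← reassoc_of% h', δ_rho H, ← h]
    simp

instance (F : M ⥤ N) (H : N ⥤ L) [AddPres F] [AddPres H] [Interchange M] [Interchange N]
    [Interchange L] [InterchangePres F] [InterchangePres H] : InterchangePres (F ⋙ H) where
  map_χ f h g k := by
    have e := congrArg H.map (InterchangePres.map_χ F f h g k)
    have e' := InterchangePres.map_χ H (F.obj f) (F.obj h) (F.obj g) (F.obj k)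
    change H.map (F.map (χ f h g k)) ≫ (H.map (δ F _ _) ≫ δ H _ _) ≫
      ((H.map (δ F _ _) ≫ δ H _ _) ⊹ₘ (H.map (δ F _ _) ≫ δ H _ _)) =
      (H.map (δ F _ _) ≫ δ H _ _) ≫ ((H.map (δ F _ _) ≫ δ H _ _) ⊹ₘ (H.map (δ F _ _) ≫ δ H _ _)) ≫
        χ (H.obj (F.obj f)) (H.obj (F.obj h)) (H.obj (F.obj g)) (H.obj (F.obj k))
    simp only [H.map_comp] at e
    simp only [← map_comp_map, Category.assoc, ← e', ← reassoc_of% (AddPres.δ_naturality H)]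
    rw [reassoc_of% e]

attribute [local instance] addMonoidalCategory addSymmetricCategory addBraided

variable [IsGroupoid M] [IsGroupoid N] [IsGroupoid L] [Interchange M] [Interchange N]
  [Interchange L] [IsCoherent M] [IsCoherent N] [IsCoherent L]

/-- Stated separately from `isMonoidal_of_add` because the source carries the composite of the
monoidal structures of `F` and `H`, not the one built from the composite functor's own preservation
of sums. -/
theorem isMonoidal_of_add_comp (F : M ⥤ N) (H : N ⥤ L) (K : M ⥤ L) [AddPres F] [AddPres H]
    [AddPres K] [InterchangePres F] [InterchangePres H] [InterchangePres K] (τ : F ⋙ H ⟶ K)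
    (h₀ : τ.app zero ≫ υ K = H.map (υ F) ≫ υ H)
    (h : ∀ f g : M, τ.app (f ⊹ g) ≫ δ K f g =
      H.map (δ F f g) ≫ δ H _ _ ≫ (τ.app f ⊹ₘ τ.app g)) :
    letI := addBraided F
    letI := addBraided H
    letI := addBraided K
    NatTrans.IsMonoidal τ := by
  refine ⟨?_, fun f g => ?_⟩
  · change (inv (υ H) ≫ H.map (inv (υ F))) ≫ τ.app zero = inv (υ K)
    rw [← cancel_mono (υ K)]
    simp [h₀]
  · change (inv (δ H _ _) ≫ H.map (inv (δ F f g))) ≫ τ.app (f ⊹ g) =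
      (τ.app f ⊹ₘ τ.app g) ≫ inv (δ K f g)
    rw [IsIso.eq_comp_inv, Category.assoc, Category.assoc, h]
    simp

theorem isMonoidal_of_add_id (F : M ⥤ M) [AddPres F] [InterchangePres F] (τ : F ⟶ 𝟭 M)
    (h₀ : τ.app zero = υ F)
    (h : ∀ f g : M, τ.app (f ⊹ g) = δ F f g ≫ (τ.app f ⊹ₘ τ.app g)) :
    letI := addBraided F
    NatTrans.IsMonoidal τ := by
  refine ⟨?_, fun f g => ?_⟩
  · change inv (υ F) ≫ τ.app zero = 𝟙 _
    rw [h₀, IsIso.inv_hom_id]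
  · change inv (δ F f g) ≫ τ.app (f ⊹ g) = (τ.app f ⊹ₘ τ.app g) ≫ 𝟙 _
    rw [h]
    simp

end Comp

namespace SemiAdditive

variable {C : Type u} [Bicategory.{w, v} C] [SemiAdditive C] {A B X Y Z : C}

noncomputable instance (f : X ⟶ A) (g : B ⟶ Y) : AddPres (homMap f g) :=
  inferInstanceAs (AddPres (precomp B f ⋙ postcomp X g))

instance (f : X ⟶ A) (g : B ⟶ Y) : InterchangePres (homMap f g) :=
  inferInstanceAs (InterchangePres (precomp B f ⋙ postcomp X g))

attribute [local instance] addMonoidalCategory addSymmetricCategory addBraided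

theorem homMap₂_isMonoidal {A' A B B' : C} {f f' : A' ⟶ A} {g g' : B ⟶ B'} (η : f ⟶ f')
    (θ : g ⟶ g') : NatTrans.IsMonoidal (homMap₂ η θ) := by
  refine isMonoidal_of_add (F := homMap f g) (G := homMap f' g') _ ?_ fun h k => ?_
  · change ((η ▷ zero A B) ▷ g ≫ (f' ≫ zero A B) ◁ θ) ≫ compZero f' B ▷ g' ≫ zeroComp A' g' =
      compZero f B ▷ g ≫ zeroComp A' g
    rw [← compZero_naturality η, Category.assoc, whisker_exchange_assoc, zeroComp_naturality]
    simp
  · change ((η ▷ (h ⊹ k)) ▷ g ≫ (f' ≫ (h ⊹ k)) ◁ θ) ≫ pre f' h k ▷ g' ≫ post g' _ _ =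
      (pre f h k ▷ g ≫ post g _ _) ≫
        (((η ▷ h) ▷ g ≫ (f' ≫ h) ◁ θ) ⊹ₘ ((η ▷ k) ▷ g ≫ (f' ≫ k) ◁ θ))
    rw [← map_comp_map, Category.assoc, Category.assoc, whisker_exchange_assoc,
      whiskerLeft_post, ← comp_whiskerRight_assoc, whiskerRight_pre, ← reassoc_of% post_naturality]
    simp

theorem homId_isMonoidal (A B : C) : NatTrans.IsMonoidal (homId A B) := by
  refine isMonoidal_of_add_id (homMap (𝟙 A) (𝟙 B)) _ ?_ fun h k => ?_
  · change ((ρ_ (𝟙 A ≫ zero A B)).hom ≫ (λ_ (zero A B)).hom) =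
      compZero (𝟙 A) B ▷ 𝟙 B ≫ zeroComp A (𝟙 B)
    rw [compZero_id, zeroComp_id]
    simp
  · change ((ρ_ (𝟙 A ≫ (h ⊹ k))).hom ≫ (λ_ (h ⊹ k)).hom) =
      (pre (𝟙 A) h k ▷ 𝟙 B ≫ post (𝟙 B) _ _) ≫
        (((ρ_ _).hom ≫ (λ_ h).hom) ⊹ₘ ((ρ_ _).hom ≫ (λ_ k).hom))
    rw [← map_comp_map, Category.assoc, reassoc_of% post_id, ← pre_id]
    simp

/-- Expanding `pre` and `post` of the composites, the only point beyond naturality is that the inner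
`post g` must be moved past the outer `pre f'`, which is `pre_post`. For the units the corresponding
point is `comp_zero_comp`. -/
theorem homComp_isMonoidal {A'' A' A B B' B'' : C} (f' : A'' ⟶ A') (f : A' ⟶ A) (g : B ⟶ B')
    (g' : B' ⟶ B'') : NatTrans.IsMonoidal (homComp f' f g g') := by
  refine isMonoidal_of_add_comp (homMap f g) (homMap f' g') (homMap (f' ≫ f) (g ≫ g')) _ ?_
    fun h k => ?_
  · change ((α_ f' (f ≫ zero A B) g).inv ▷ g' ≫ ((α_ f' f (zero A B)).inv ▷ g) ▷ g' ≫
      (α_ ((f' ≫ f) ≫ zero A B) g g').hom) ≫ compZero (f' ≫ f) B ▷ (g ≫ g') ≫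
        zeroComp A'' (g ≫ g') =
      (f' ◁ (compZero f B ▷ g ≫ zeroComp A' g)) ▷ g' ≫ compZero f' B' ▷ g' ≫ zeroComp A'' g'
    have e := comp_zero_comp f' g
    rw [compZero_comp, zeroComp_comp]
    simp only [comp_whiskerRight, whiskerLeft_comp, Category.assoc]
    have e' : (f' ◁ zeroComp A' g) ▷ g' ≫ compZero f' B' ▷ g' =
        (α_ _ _ _).inv ▷ g' ≫ compZero f' B ▷ g ▷ g' ≫ zeroComp A'' g ▷ g' := by
      simp only [← comp_whiskerRight, e]
      simp
    rw [reassoc_of% e']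
    simp
  · change ((α_ f' (f ≫ (h ⊹ k)) g).inv ▷ g' ≫ ((α_ f' f (h ⊹ k)).inv ▷ g) ▷ g' ≫
      (α_ ((f' ≫ f) ≫ (h ⊹ k)) g g').hom) ≫ pre (f' ≫ f) h k ▷ (g ≫ g') ≫ post (g ≫ g') _ _ =
      (f' ◁ (pre f h k ▷ g ≫ post g _ _)) ▷ g' ≫ (pre f' _ _ ▷ g' ≫ post g' _ _) ≫
        (((α_ f' (f ≫ h) g).inv ▷ g' ≫ ((α_ f' f h).inv ▷ g) ▷ g' ≫
          (α_ ((f' ≫ f) ≫ h) g g').hom) ⊹ₘ ((α_ f' (f ≫ k) g).inv ▷ g' ≫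
          ((α_ f' f k).inv ▷ g) ▷ g' ≫ (α_ ((f' ≫ f) ≫ k) g g').hom))
    have e : f' ◁ post g (f ≫ h) (f ≫ k) ≫ pre f' _ _ =
      (α_ _ _ _).inv ≫ pre f' _ _ ▷ g ≫ post g _ _ ≫ ((α_ _ _ _).hom ⊹ₘ (α_ _ _ _).hom) := by
      rw [pre_post]
      simp
    have e' : (f' ◁ post g (f ≫ h) (f ≫ k)) ▷ g' ≫ pre f' _ _ ▷ g' =
        (α_ _ _ _).inv ▷ g' ≫ pre f' _ _ ▷ g ▷ g' ≫ post g _ _ ▷ g' ≫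
          ((α_ _ _ _).hom ⊹ₘ (α_ _ _ _).hom) ▷ g' := by
      simp only [← comp_whiskerRight, e]
    rw [post_comp, pre_comp']
    simp only [comp_whiskerRight, whiskerLeft_comp, Category.assoc]
    rw [reassoc_of% e', reassoc_of% post_naturality]
    have e'' : post g (f' ≫ f ≫ h) (f' ≫ f ≫ k) ▷ g' ≫
        (((α_ f' f h).inv ▷ g) ⊹ₘ ((α_ f' f k).inv ▷ g)) ▷ g' =
        ((α_ f' f h).inv ⊹ₘ (α_ f' f k).inv) ▷ g ▷ g' ≫ post g _ _ ▷ g' := by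
      rw [← comp_whiskerRight, ← post_naturality, comp_whiskerRight]
    have e₃ := post_naturality g' ((α_ f' f h).inv ▷ g) ((α_ f' f k).inv ▷ g)
    simp
    rw [← map_comp_map ((α_ f' f h).inv ▷ g ▷ g'), ← reassoc_of% e₃, reassoc_of% e'']

variable (C) in
/-- The bicategory `C` has a negative of every identity 1-cell. -/
def HasNeg : Prop := ∀ B : C, ∃ n : B ⟶ B, Nonempty (𝟙 B ⊹ n ⟶ zero B B)

/-- The hom-groupoids are symmetric categorical groups. -/
@[reducible]
noncomputable def homSCG (strict : Bicategory.Strict C) (hn : HasNeg C)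
    (hz : ∀ A B D : C, zero A B ≫ zero B D = zero A D) : HomSCG C where
  strict := strict
  locallyGroupoid := (G (C := C)).locallyGroupoid
  monoidal A B := inferInstance
  symmetric A B := inferInstance
  exists_inverse {A B} f := by
    obtain ⟨n, ⟨ν⟩⟩ := hn B
    -- With `n` a negative of the identity of `B`: `f + n ∘ f ≅ (id + n) ∘ f ≅ 0 ∘ f ≅ 0`.
    exact ⟨f ≫ n, ⟨asIso (((ρ_ f).inv ⊹ₘ 𝟙 _) ≫ inv (pre f (𝟙 B) n) ≫ f ◁ ν ≫ compZero f B)⟩⟩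
  unit_comp_unit := hz
  homBraided f g := inferInstance
  homMap₂_monoidal η θ := homMap₂_isMonoidal η θ
  homComp_monoidal f' f g g' := homComp_isMonoidal f' f g g'
  homId_monoidal A B := homId_isMonoidal A B

theorem homSCG_preUnit (strict : Bicategory.Strict C) (hn : HasNeg C)
    (hz : ∀ A B D : C, zero A B ≫ zero B D = zero A D) (f : A ⟶ B) (Y : C) :
    (homSCG strict hn hz).preUnit f Y = (G (C := C)).compZero f Y := by
  ext
  change (ρ_ (f ≫ zero B Y)).inv ≫ compZero f Y ▷ 𝟙 Y ≫ zeroComp A (𝟙 Y) = compZero f Y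
  simp [zeroComp_id]

theorem homSCG_postUnit (strict : Bicategory.Strict C) (hn : HasNeg C)
    (hz : ∀ A B D : C, zero A B ≫ zero B D = zero A D) (X : C) (f : A ⟶ B) :
    (homSCG strict hn hz).postUnit X f = (G (C := C)).zeroComp X f := by
  ext
  change (λ_ (zero X A)).inv ▷ f ≫ compZero (𝟙 X) A ▷ f ≫ zeroComp X f = zeroComp X f
  simp [compZero_id]

end SemiAdditive

/-- Heterogeneous equalities are needed since the types of the nullities depend on the zero 1-cells;
when applied, the zero 1-cells agree definitionally. -/
theorem GpdStar.ext' {C : Type u} [Bicategory.{w, v} C] {G G' : GpdStar C}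
    (h : G.zero = G'.zero) (h₁ : @GpdStar.zeroComp _ _ G ≍ @GpdStar.zeroComp _ _ G')
    (h₂ : @GpdStar.compZero _ _ G ≍ @GpdStar.compZero _ _ G') : G = G' := by
  cases G
  cases G'
  cases h
  cases h₁
  cases h₂
  rfl

namespace SemiAdditive

variable {C : Type u} [Bicategory.{w, v} C] [SemiAdditive C]

/-- The unit isomorphisms of the monoidal functors are the given nullities of composites with zero,
so the strict description makes them identities at zero and the underlying `Gpd*`-category is the
original one. -/
theorem exists_locallySCG (hG : (G (C := C)).IsStrictlyDescribed) (hn : HasNeg C)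
    (hZ : ∃ Z : C, IsZeroObject (G (C := C)).zero Z) (hP : HasProducts C)
    (hQ : HasCoproducts C) : ∃ S : LocallySCG C, S.toGpdStar = G := by
  let S : LocallySCG C :=
    { homSCG hG.strict hn fun A B D => hG.zero_comp A (zero B D) with
      preUnit_zero A B D := by
        rw [homSCG_preUnit]
        exact hG.compZero_eq _ _
      postUnit_zero A B D := by
        rw [homSCG_postUnit]
        exact hG.zeroComp_eq _ _
      zeroObject := hZ
      products := hP
      coproducts := hQ }
  refine ⟨S, GpdStar.ext' rfl (heq_of_eq ?_) (heq_of_eq ?_)⟩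
  · funext X A B f
    exact homSCG_postUnit hG.strict hn _ X f
  · funext A B f Y
    exact homSCG_preUnit hG.strict hn _ f Y

end SemiAdditive

end TwoCat

/-! ### Detecting null 1-cells and trivial 2-cells on products and coproducts. -/

namespace TwoCat

open CategoryTheory Bicategory

section Whisker

variable {C : Type u} [Bicategory.{w, v} C]

theorem whiskerLeft_eq_id_of_hom {A B D : C} {f f' : A ⟶ B} (η : f ⟶ f') [IsIso η] {g : B ⟶ D}
    {α : g ⟶ g} (h : f ◁ α = 𝟙 _) : f' ◁ α = 𝟙 _ := by
  rw [← cancel_epi (η ▷ g), ← whisker_exchange, h]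
  simp

theorem whiskerRight_eq_id_of_hom {A B D : C} {f f' : A ⟶ B} (η : f' ⟶ f) [IsIso η] {g : D ⟶ A}
    {α : g ⟶ g} (h : α ▷ f = 𝟙 _) : α ▷ f' = 𝟙 _ := by
  rw [← cancel_mono (g ◁ η), ← whisker_exchange, h]
  simp

theorem eq_id_of_id_whiskerLeft {A D : C} {g : A ⟶ D} {α : g ⟶ g} (h : 𝟙 A ◁ α = 𝟙 _) :
    α = 𝟙 _ := by
  rw [id_whiskerLeft, ← Category.assoc, Iso.comp_inv_eq, Category.id_comp] at h
  rw [← cancel_epi (λ_ g).hom, h, Category.comp_id]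

theorem eq_id_of_whiskerRight_id {A D : C} {g : A ⟶ D} {α : g ⟶ g} (h : α ▷ 𝟙 D = 𝟙 _) :
    α = 𝟙 _ := by
  rw [whiskerRight_id, ← Category.assoc, Iso.comp_inv_eq, Category.id_comp] at h
  rw [← cancel_epi (ρ_ g).hom, h, Category.comp_id]

end Whisker

namespace GpdStar

variable {C : Type u} [Bicategory.{w, v} C] (G : GpdStar C) {A B D P X Y : C}

theorem isIso_hom (G : GpdStar C) {f g : A ⟶ B} (η : f ⟶ g) : IsIso η :=
  (G.locallyGroupoid A B).all_isIso η

/-- A 1-cell with a left inverse up to a 2-cell is 0-cofaithful. -/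
theorem isZeroCofaithful_of_section {f : A ⟶ B} {i : B ⟶ A} (e : i ≫ f ⟶ 𝟙 B) :
    G.IsZeroCofaithful f := by
  intro Y α h
  have := G.isIso_hom e
  refine eq_id_of_id_whiskerLeft (whiskerLeft_eq_id_of_hom e ?_)
  simp [h]

theorem isZeroFaithful_of_retraction {f : A ⟶ B} {r : B ⟶ A} (e : 𝟙 A ⟶ f ≫ r) :
    G.IsZeroFaithful f := by
  intro X α h
  have := G.isIso_hom e
  refine eq_id_of_whiskerRight_id (whiskerRight_eq_id_of_hom e ?_)
  simp [h]

section Product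

variable {p₁ : P ⟶ A} {p₂ : P ⟶ B} {i₁ : A ⟶ P} {i₂ : B ⟶ P}

/-- A 1-cell into the product whose second component vanishes is determined by its first component,
hence comes from the first factor. -/
theorem exists_hom_of_comp_snd (hP : IsProduct p₁ p₂) (e₁₁ : i₁ ≫ p₁ ⟶ 𝟙 A)
    (e₁₂ : i₁ ≫ p₂ ⟶ G.zero A B) {k : X ⟶ P} (e : k ≫ p₂ ⟶ G.zero X B) :
    Nonempty ((k ≫ p₁) ≫ i₁ ⟶ k) := by
  have := G.isIso_hom e
  obtain ⟨τ, -⟩ := hP.unique_lift _ _ ((k ≫ p₁) ≫ i₁)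
    ((α_ _ _ _).hom ≫ (k ≫ p₁) ◁ e₁₁ ≫ (ρ_ _).hom)
    ((α_ _ _ _).hom ≫ (k ≫ p₁) ◁ e₁₂ ≫ (G.compZero _ _).hom ≫ inv e) k (𝟙 _) (𝟙 _)
  exact ⟨τ⟩

/-- A partial coproduct property of the product. The kernel of `p₂` factors through `i₁`, so a
1-cell `b` that is null on `i₁` factors through the cokernel `p₂`; the factor is null because `i₂`
is a section of `p₂`. -/
theorem exists_hom_zero_of_injections (hP : IsProduct p₁ p₂) (hp : G.IsCokOfKer p₂)
    (e₁₁ : i₁ ≫ p₁ ⟶ 𝟙 A) (e₁₂ : i₁ ≫ p₂ ⟶ G.zero A B) (e₂₂ : i₂ ≫ p₂ ⟶ 𝟙 B) {b : P ⟶ Y}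
    (β₁ : i₁ ≫ b ⟶ G.zero A Y) (β₂ : i₂ ≫ b ⟶ G.zero B Y) : Nonempty (b ⟶ G.zero P Y) := by
  obtain ⟨K, k, e, -, hk⟩ := hp
  obtain ⟨κ⟩ := G.exists_hom_of_comp_snd hP e₁₁ e₁₂ e
  have := G.isIso_hom κ
  obtain ⟨t, σ, -⟩ := hk.exists_desc b (inv κ ▷ b ≫ (α_ _ _ _).hom ≫ (k ≫ p₁) ◁ β₁ ≫
    (G.compZero _ _).hom)
  have := G.isIso_hom σ
  have := G.isIso_hom e₂₂
  exact ⟨inv σ ≫ p₂ ◁ ((λ_ t).inv ≫ inv e₂₂ ▷ t ≫ (α_ _ _ _).hom ≫ i₂ ◁ σ ≫ β₂) ≫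
    (G.compZero _ _).hom⟩

/-- The same argument one dimension up: triviality on `i₁` lets `α` descend along the cokernel `p₂`
to an endomorphism of zero, which the section `i₂` shows to be trivial. -/
theorem eq_id_of_injections (hP : IsProduct p₁ p₂) (hp : G.IsCokOfKer p₂)
    (e₁₁ : i₁ ≫ p₁ ⟶ 𝟙 A) (e₁₂ : i₁ ≫ p₂ ⟶ G.zero A B) (e₂₂ : i₂ ≫ p₂ ⟶ 𝟙 B)
    {α : G.zero P Y ⟶ G.zero P Y} (h₁ : i₁ ◁ α = 𝟙 _) (h₂ : i₂ ◁ α = 𝟙 _) : α = 𝟙 _ := by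
  obtain ⟨K, k, e, -, hk⟩ := hp
  obtain ⟨κ⟩ := G.exists_hom_of_comp_snd hP e₁₁ e₁₂ e
  have := G.isIso_hom κ
  have hα : k ◁ α = 𝟙 _ := whiskerLeft_eq_id_of_hom κ (by simp [h₁])
  have hc : k ◁ (G.compZero p₂ Y).hom ≫ (G.compZero k Y).hom =
      (α_ _ _ _).inv ≫ e ▷ G.zero B Y ≫ (G.zeroComp K (G.zero B Y)).hom := by
    rw [G.zero_zero, G.compZero_naturality, G.compZero_comp]
    simp
  obtain ⟨τ, hτ, -⟩ := hk.unique_desc _ (G.compZero k Y).hom (G.zero B Y) (G.compZero p₂ Y).hom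
    (G.zero B Y) ((G.compZero p₂ Y).hom ≫ α) hc (by simp [hα, hc])
  have := G.isIso_hom e₂₂
  have hτ' : τ = 𝟙 _ := by
    refine eq_id_of_id_whiskerLeft (whiskerLeft_eq_id_of_hom e₂₂ ?_)
    have h := congrArg (i₂ ◁ ·) hτ
    simp only [whiskerLeft_comp, h₂, Category.comp_id] at h
    have h' : i₂ ◁ p₂ ◁ τ = 𝟙 _ := by
      rw [← cancel_mono (i₂ ◁ (G.compZero p₂ Y).hom), h, Category.id_comp]
    simp [h']
  rw [hτ', whiskerLeft_id, Category.id_comp] at hτ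
  rw [← cancel_epi (G.compZero p₂ Y).hom, hτ, Category.comp_id]

end Product

section Coproduct

variable {j₁ : A ⟶ P} {j₂ : B ⟶ P} {r₁ : P ⟶ A} {r₂ : P ⟶ B}

/-- Dual of `exists_hom_of_comp_snd`; this lemma and the next two dualize the section on products.
-/
theorem exists_hom_of_snd_comp (hP : IsCoproduct j₁ j₂) (e₁₁ : j₁ ≫ r₁ ⟶ 𝟙 A)
    (e₂₁ : j₂ ≫ r₁ ⟶ G.zero B A) {q : P ⟶ X} (e : j₂ ≫ q ⟶ G.zero B X) :
    Nonempty (r₁ ≫ j₁ ≫ q ⟶ q) := by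
  have := G.isIso_hom e
  obtain ⟨τ, -⟩ := hP.unique_desc _ _ (r₁ ≫ j₁ ≫ q)
    ((α_ _ _ _).inv ≫ e₁₁ ▷ (j₁ ≫ q) ≫ (λ_ _).hom)
    ((α_ _ _ _).inv ≫ e₂₁ ▷ (j₁ ≫ q) ≫ (G.zeroComp _ _).hom ≫ inv e) q (𝟙 _) (𝟙 _)
  exact ⟨τ⟩

theorem exists_hom_zero_of_projections (hP : IsCoproduct j₁ j₂) (hj : G.IsKerOfCok j₂)
    (e₁₁ : j₁ ≫ r₁ ⟶ 𝟙 A) (e₂₁ : j₂ ≫ r₁ ⟶ G.zero B A) (e₂₂ : j₂ ≫ r₂ ⟶ 𝟙 B) {a : X ⟶ P}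
    (β₁ : a ≫ r₁ ⟶ G.zero X A) (β₂ : a ≫ r₂ ⟶ G.zero X B) : Nonempty (a ⟶ G.zero X P) := by
  obtain ⟨Q, q, e, -, hq⟩ := hj
  obtain ⟨κ⟩ := G.exists_hom_of_snd_comp hP e₁₁ e₂₁ e
  have := G.isIso_hom κ
  obtain ⟨t, σ, -⟩ := hq.exists_lift a (a ◁ inv κ ≫ (α_ _ _ _).inv ≫ β₁ ▷ (j₁ ≫ q) ≫
    (G.zeroComp _ _).hom)
  have := G.isIso_hom σ
  have := G.isIso_hom e₂₂
  exact ⟨inv σ ≫ ((ρ_ t).inv ≫ t ◁ inv e₂₂ ≫ (α_ _ _ _).inv ≫ σ ▷ r₂ ≫ β₂) ▷ j₂ ≫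
    (G.zeroComp _ _).hom⟩

theorem eq_id_of_projections (hP : IsCoproduct j₁ j₂) (hj : G.IsKerOfCok j₂)
    (e₁₁ : j₁ ≫ r₁ ⟶ 𝟙 A) (e₂₁ : j₂ ≫ r₁ ⟶ G.zero B A) (e₂₂ : j₂ ≫ r₂ ⟶ 𝟙 B)
    {α : G.zero X P ⟶ G.zero X P} (h₁ : α ▷ r₁ = 𝟙 _) (h₂ : α ▷ r₂ = 𝟙 _) : α = 𝟙 _ := by
  obtain ⟨Q, q, e, -, hq⟩ := hj
  obtain ⟨κ⟩ := G.exists_hom_of_snd_comp hP e₁₁ e₂₁ e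
  have := G.isIso_hom κ
  have hα : α ▷ q = 𝟙 _ := whiskerRight_eq_id_of_hom (inv κ) (by simp [h₁])
  have hc : (G.zeroComp X j₂).hom ▷ q ≫ (G.zeroComp X q).hom =
      (α_ _ _ _).hom ≫ G.zero X B ◁ e ≫ (G.compZero (G.zero X B) Q).hom := by
    rw [← G.zero_zero, G.zeroComp_naturality, G.zeroComp_comp]
    simp
  obtain ⟨τ, hτ, -⟩ := hq.unique_lift _ (G.zeroComp X q).hom (G.zero X B) (G.zeroComp X j₂).hom
    (G.zero X B) ((G.zeroComp X j₂).hom ≫ α) hc (by simp [hα, hc])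
  have := G.isIso_hom e₂₂
  have hτ' : τ = 𝟙 _ := by
    refine eq_id_of_whiskerRight_id (whiskerRight_eq_id_of_hom (inv e₂₂) ?_)
    have h := congrArg (· ▷ r₂) hτ
    simp only [comp_whiskerRight, h₂, Category.comp_id] at h
    have h' : τ ▷ j₂ ▷ r₂ = 𝟙 _ := by
      rw [← cancel_mono ((G.zeroComp X j₂).hom ▷ r₂), h, Category.id_comp]
    simp [h']
  rw [hτ', id_whiskerRight, Category.id_comp] at hτ
  rw [← cancel_epi (G.zeroComp X j₂).hom, hτ, Category.comp_id]

end Coproduct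

end GpdStar

end TwoCat

/-! ### Biproducts in 2-abelian `Gpd`-categories. -/

namespace TwoCat

open CategoryTheory Bicategory UnitalAdd

section Equivalence

variable {C : Type u} [Bicategory.{w, v} C] {A B P Q : C}

/-- Precomposition with an equivalence is fully faithful. -/
theorem existsUnique_whiskerLeft {c : Q ⟶ P} {t : P ⟶ Q} (e : t ≫ c ≅ 𝟙 P) (e' : c ≫ t ≅ 𝟙 Q)
    {Y : C} {y y' : P ⟶ Y} (τ : c ≫ y ⟶ c ≫ y') : ∃! θ : y ⟶ y', c ◁ θ = τ := by
  have i₁ : 𝟭 (P ⟶ Y) ≅ precomp Y c ⋙ precomp Y t := NatIso.ofComponents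
    (fun y => (λ_ y).symm ≪≫ whiskerRightIso e.symm y ≪≫ α_ t c y) fun {y z} η => by
      change η ≫ (λ_ z).inv ≫ e.inv ▷ z ≫ (α_ t c z).hom =
        ((λ_ y).inv ≫ e.inv ▷ y ≫ (α_ t c y).hom) ≫ t ◁ c ◁ η
      rw [leftUnitor_inv_naturality_assoc, whisker_exchange_assoc]
      simp
  have i₂ : precomp Y t ⋙ precomp Y c ≅ 𝟭 (Q ⟶ Y) := NatIso.ofComponents
    (fun y => (α_ c t y).symm ≪≫ whiskerRightIso e' y ≪≫ λ_ y) fun {y z} η => by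
      change c ◁ t ◁ η ≫ (α_ c t z).inv ≫ e'.hom ▷ z ≫ (λ_ z).hom =
        ((α_ c t y).inv ≫ e'.hom ▷ y ≫ (λ_ y).hom) ≫ η
      rw [associator_inv_naturality_right_assoc, whisker_exchange_assoc]
      simp
  have h : (precomp Y c).IsEquivalence :=
    (CategoryTheory.Equivalence.mk _ _ i₁ i₂).isEquivalence_functor
  obtain ⟨θ, hθ⟩ := (precomp Y c).map_surjective (X := y) (Y := y') τ
  exact ⟨θ, hθ, fun θ' h' => (precomp Y c).map_injective (h'.trans hθ.symm)⟩

theorem IsCoproduct.comp_equivalence {j₁ : A ⟶ Q} {j₂ : B ⟶ Q} (h : IsCoproduct j₁ j₂) {c : Q ⟶ P}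
    {t : P ⟶ Q} (e : t ≫ c ≅ 𝟙 P) (e' : c ≫ t ≅ 𝟙 Q) : IsCoproduct (j₁ ≫ c) (j₂ ≫ c) where
  exists_desc y₁ y₂ := by
    obtain ⟨s, ⟨σ₁⟩, ⟨σ₂⟩⟩ := h.exists_desc y₁ y₂
    exact ⟨t ≫ s, ⟨(α_ _ _ _).hom ≫ j₁ ◁ ((α_ _ _ _).inv ≫ e'.hom ▷ s ≫ (λ_ s).hom) ≫ σ₁⟩,
      ⟨(α_ _ _ _).hom ≫ j₂ ◁ ((α_ _ _ _).inv ≫ e'.hom ▷ s ≫ (λ_ s).hom) ≫ σ₂⟩⟩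
  unique_desc y₁ y₂ y σ₁ σ₂ y' σ₁' σ₂' := by
    obtain ⟨τ, ⟨hτ₁, hτ₂⟩, hτ⟩ := h.unique_desc y₁ y₂ (c ≫ y) ((α_ _ _ _).inv ≫ σ₁)
      ((α_ _ _ _).inv ≫ σ₂) (c ≫ y') ((α_ _ _ _).inv ≫ σ₁') ((α_ _ _ _).inv ≫ σ₂')
    obtain ⟨θ, hθ, hu⟩ := existsUnique_whiskerLeft e e' τ
    subst hθ
    refine ⟨θ, ⟨?_, ?_⟩, fun θ' h' => hu θ' (hτ _ ⟨?_, ?_⟩)⟩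
    · rw [comp_whiskerLeft]
      simp [hτ₁]
    · rw [comp_whiskerLeft]
      simp [hτ₂]
    · rw [← h'.1, comp_whiskerLeft]
      simp
    · rw [← h'.2, comp_whiskerLeft]
      simp

end Equivalence

namespace GpdStar

variable {C : Type u} [Bicategory.{w, v} C] (G : GpdStar C)

/-- The comparison `c` from coproduct to product is 0-faithful and 0-cofaithful, because
endomorphisms of zero are detected by the projections and by the injections. Its cokernel and its
kernel are null, which gives inverses on both sides, and the coproduct structure is then moved along
`c` to the product. -/
theorem IsTwoAbelian.exists_biproduct (h : G.IsTwoAbelian) (B : C) :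
    ∃ (P : C) (p₁ p₂ : P ⟶ B) (i₁ i₂ : B ⟶ P) (f : P ⟶ B), IsProduct p₁ p₂ ∧ IsCoproduct i₁ i₂ ∧
      Nonempty (i₁ ≫ p₁ ⟶ 𝟙 B) ∧ Nonempty (i₁ ≫ p₂ ⟶ G.zero B B) ∧
      Nonempty (i₂ ≫ p₁ ⟶ G.zero B B) ∧ Nonempty (i₂ ≫ p₂ ⟶ 𝟙 B) ∧
      Nonempty (𝟙 B ⟶ i₁ ≫ f) ∧ Nonempty (𝟙 B ⟶ i₂ ≫ f) := by
  have iso {X Y : C} {f g : X ⟶ Y} (η : f ⟶ g) : IsIso η := G.isIso_hom η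
  obtain ⟨P, p₁, p₂, hP⟩ := h.products B B
  obtain ⟨Q, j₁, j₂, hQ⟩ := h.coproducts B B
  obtain ⟨r₁, ⟨e₁₁⟩, ⟨e₂₁⟩⟩ := hQ.exists_desc (𝟙 B) (G.zero B B)
  obtain ⟨r₂, ⟨e₁₂⟩, ⟨e₂₂⟩⟩ := hQ.exists_desc (G.zero B B) (𝟙 B)
  obtain ⟨c, ⟨c₁⟩, ⟨c₂⟩⟩ := hP.exists_lift r₁ r₂
  let e₁₁' : (j₁ ≫ c) ≫ p₁ ⟶ 𝟙 B := (α_ _ _ _).hom ≫ j₁ ◁ c₁ ≫ e₁₁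
  let e₁₂' : (j₁ ≫ c) ≫ p₂ ⟶ G.zero B B := (α_ _ _ _).hom ≫ j₁ ◁ c₂ ≫ e₁₂
  let e₂₁' : (j₂ ≫ c) ≫ p₁ ⟶ G.zero B B := (α_ _ _ _).hom ≫ j₂ ◁ c₁ ≫ e₂₁
  let e₂₂' : (j₂ ≫ c) ≫ p₂ ⟶ 𝟙 B := (α_ _ _ _).hom ≫ j₂ ◁ c₂ ≫ e₂₂
  have hp : G.IsCokOfKer p₂ := h.zeroCofaithful _ (G.isZeroCofaithful_of_section e₂₂')
  have hj : G.IsKerOfCok j₂ := h.zeroFaithful _ (G.isZeroFaithful_of_retraction (inv e₂₂))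
  have hc : G.IsKerOfCok c := h.zeroFaithful _ fun α hα =>
    G.eq_id_of_projections hQ hj e₁₁ e₂₁ e₂₂
      (whiskerRight_eq_id_of_hom (inv c₁) (by simp [hα]))
      (whiskerRight_eq_id_of_hom (inv c₂) (by simp [hα]))
  have hc' : G.IsCokOfKer c := h.zeroCofaithful _ fun α hα =>
    G.eq_id_of_injections hP hp e₁₁' e₁₂' e₂₂' (by simp [hα]) (by simp [hα])
  -- The cokernel `q` of `c` is null on both injections, hence null. So the identity of `P` lifts to
  -- the kernel of `q`, which is `c`, and `t` is an inverse of `c` on one side.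
  obtain ⟨Q', q, π, -, hc⟩ := hc
  obtain ⟨θ⟩ := G.exists_hom_zero_of_injections hP hp e₁₁' e₁₂' e₂₂'
    ((α_ _ _ _).hom ≫ j₁ ◁ π ≫ (G.compZero j₁ Q').hom)
    ((α_ _ _ _).hom ≫ j₂ ◁ π ≫ (G.compZero j₂ Q').hom)
  obtain ⟨t, σ, -⟩ := hc.exists_lift (𝟙 P) ((λ_ q).hom ≫ θ)
  -- Dually the kernel `k` of `c` is null, so the identity of `Q` extends along the cokernel `c` of
  -- `k`.
  obtain ⟨K, k, π', -, hc'⟩ := hc'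
  obtain ⟨θ'⟩ := G.exists_hom_zero_of_projections hQ hj e₁₁ e₂₁ e₂₂
    (k ◁ inv c₁ ≫ (α_ _ _ _).inv ≫ π' ▷ p₁ ≫ (G.zeroComp K p₁).hom)
    (k ◁ inv c₂ ≫ (α_ _ _ _).inv ≫ π' ▷ p₂ ≫ (G.zeroComp K p₂).hom)
  obtain ⟨t', σ', -⟩ := hc'.exists_desc (𝟙 Q) ((ρ_ k).hom ≫ θ')
  -- The inverses `t` and `t'` on the two sides are isomorphic as usual, so `t` serves as an inverse
  -- on both sides.
  have hi := hQ.comp_equivalence (asIso σ) (asIso (c ◁ ((ρ_ t).inv ≫ t ◁ inv σ' ≫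
    (α_ _ _ _).inv ≫ σ ▷ t' ≫ (λ_ t').hom) ≫ σ'))
  obtain ⟨f, ⟨f₁⟩, ⟨f₂⟩⟩ := hi.exists_desc (𝟙 B) (𝟙 B)
  exact ⟨P, p₁, p₂, j₁ ≫ c, j₂ ≫ c, f, hP, hi, ⟨e₁₁'⟩, ⟨e₁₂'⟩, ⟨e₂₁'⟩, ⟨e₂₂'⟩, ⟨inv f₁⟩, ⟨inv f₂⟩⟩

/-- The semiadditive structure of a 2-abelian `Gpd`-category. -/
@[reducible]
noncomputable def IsTwoAbelian.semiAdditive {G : GpdStar C} (h : G.IsTwoAbelian) :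
    SemiAdditive C := by
  choose P p₁ p₂ i₁ i₂ f h using h.exists_biproduct G
  exact
    { G := G
      dbl := P
      p₁ := p₁
      p₂ := p₂
      i₁ := i₁
      i₂ := i₂
      fold := f
      isProduct B := (h B).1
      isCoproduct B := (h B).2.1
      i₁p₁ B := (h B).2.2.1.some
      i₁p₂ B := (h B).2.2.2.1.some
      i₂p₁ B := (h B).2.2.2.2.1.some
      i₂p₂ B := (h B).2.2.2.2.2.1.some
      i₁fold B := (h B).2.2.2.2.2.2.1.some
      i₂fold B := (h B).2.2.2.2.2.2.2.some }

end GpdStar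

/-! ### Negatives from the shear 1-cell. -/

namespace SemiAdditive

variable {C : Type u} [Bicategory.{w, v} C] [SemiAdditive C]

/-- The codiagonal is the sum of the projections. If the first component of `α` is trivial, then its
image under the codiagonal is, up to the unit law, its second component. -/
theorem eq_id_of_fst_fold {X B : C} {α : zero X (dbl B) ⟶ zero X (dbl B)} (h₁ : α ▷ p₁ B = 𝟙 _)
    (h : α ▷ fold B = 𝟙 _) : α = 𝟙 _ := by
  let z₁ : zero X (dbl B) ≫ p₁ B ⟶ UnitalAdd.zero := zeroComp X (p₁ B)
  let z₂ : zero X (dbl B) ≫ p₂ B ⟶ UnitalAdd.zero := zeroComp X (p₂ B)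
  have e := whiskerRight_toAdd α z₁ z₂
  have e' : toAdd (zero X (dbl B)) z₁ (α ▷ p₂ B ≫ z₂) =
      toAdd _ z₁ z₂ ≫ (𝟙 _ ⊹ₘ (inv z₂ ≫ α ▷ p₂ B ≫ z₂)) := by
    rw [toAdd_map]
    simp
  rw [h, h₁, Category.id_comp, Category.id_comp, e', ← cancel_mono (lam _), Category.assoc,
    lam_naturality] at e
  have e₂ : inv z₂ ≫ α ▷ p₂ B ≫ z₂ = 𝟙 _ := by
    rw [← cancel_epi (toAdd _ z₁ z₂ ≫ lam _)]
    simpa using e.symm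
  refine pair_ext ?_ ?_
  · simpa using h₁
  · rw [IsIso.inv_comp_eq, Category.comp_id] at e₂
    rw [← cancel_mono z₂, e₂]
    simp

/-- The shear `s` with components `p₁` and `fold` is 0-faithful, hence the kernel of its cokernel
`q`. Once `q` is seen to be null, the identity factors as `t` followed by `s`, and the second
component of `t` on the first summand is a negative of the identity. -/
theorem hasNeg (h : (G (C := C)).IsTwoAbelian) : HasNeg C := by
  intro B
  obtain ⟨s, ⟨s₁⟩, ⟨s₂⟩⟩ := (isProduct B).exists_lift (p₁ B) (fold B)
  have hs : (G (C := C)).IsKerOfCok s := h.zeroFaithful _ fun α hα => eq_id_of_fst_fold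
    (whiskerRight_eq_id_of_hom (inv s₁) (by simp [hα]))
    (whiskerRight_eq_id_of_hom (inv s₂) (by simp [hα]))
  obtain ⟨Q, q, π, -, hs⟩ := hs
  -- The shear fixes the second summand, so `q` vanishes on `i₂`; by the coproduct property `q` then
  -- factors through `p₁` as in `κ`.
  obtain ⟨τ, -⟩ := (isProduct B).unique_lift (zero B B) (𝟙 B) (i₂ B ≫ s)
    ((α_ _ _ _).hom ≫ i₂ B ◁ s₁ ≫ i₂p₁ B) ((α_ _ _ _).hom ≫ i₂ B ◁ s₂ ≫ inv (i₂fold B))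
    (i₂ B) (i₂p₁ B) (i₂p₂ B)
  let β₂ : i₂ B ≫ q ⟶ zero B Q :=
    inv τ ▷ q ≫ (α_ _ _ _).hom ≫ i₂ B ◁ π ≫ compZero (i₂ B) Q
  obtain ⟨κ, -⟩ := (isCoproduct B).unique_desc _ _ (p₁ B ≫ i₁ B ≫ q)
    ((α_ _ _ _).inv ≫ i₁p₁ B ▷ _ ≫ (λ_ _).hom)
    ((α_ _ _ _).inv ≫ i₂p₁ B ▷ _ ≫ zeroComp B _ ≫ inv β₂) q (𝟙 _) (𝟙 _)
  let ω : (i₁ B ≫ s) ≫ p₁ B ⟶ 𝟙 B := (α_ _ _ _).hom ≫ i₁ B ◁ s₁ ≫ i₁p₁ B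
  -- Since `p₁ s i₁ ≅ id` on paper, `q i₁ ≅ q i₁ p₁ s i₁ ≅ q s i₁ ≅ 0`.
  let ν : i₁ B ≫ q ⟶ zero B Q := (λ_ _).inv ≫ inv ω ▷ (i₁ B ≫ q) ≫ (α_ _ _ _).hom ≫
    (i₁ B ≫ s) ◁ κ ≫ (α_ _ _ _).hom ≫ i₁ B ◁ π ≫ compZero (i₁ B) Q
  obtain ⟨t, σ, -⟩ := hs.exists_lift (𝟙 _) ((λ_ q).hom ≫ inv κ ≫ p₁ B ◁ ν ≫ compZero (p₁ B) Q)
  let φ {p k : dbl B ⟶ B} (ψ : s ≫ p ⟶ k) : (i₁ B ≫ t) ≫ k ⟶ i₁ B ≫ p :=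
    (i₁ B ≫ t) ◁ inv ψ ≫ (α_ _ _ _).hom ≫ i₁ B ◁ ((α_ _ _ _).inv ≫ σ ▷ p ≫ (λ_ p).hom)
  -- The 1-cell `i₁ ≫ t` has components the identity and `n`, and its codiagonal sum is the second
  -- component of `i₁ ≫ t ≫ s ≅ i₁`, which is zero.
  exact ⟨(i₁ B ≫ t) ≫ p₂ B, ⟨inv (toAdd (i₁ B ≫ t) (φ s₁ ≫ i₁p₁ B) (𝟙 _)) ≫ φ s₂ ≫ i₁p₂ B⟩⟩

end SemiAdditive

/-! ### Faithfulness of kernels and the relative exactness of 2-abelian `Gpd`-categories. -/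

namespace GpdStar

variable {C : Type u} [Bicategory.{w, v} C] {G : GpdStar C} {A B D : C}

theorem isZeroFaithful_of_isFaithful {f : A ⟶ B} (h : IsFaithful f) : G.IsZeroFaithful f := by
  intro X α hα
  have := h X
  exact (postcomp X f).map_injective (hα.trans (id_whiskerRight _ _).symm)

theorem isZeroCofaithful_of_isCofaithful {f : A ⟶ B} (h : IsCofaithful f) :
    G.IsZeroCofaithful f := by
  intro Y α hα
  have := h Y
  exact (precomp Y f).map_injective (hα.trans (whiskerLeft_id _ _).symm)

/-- Two 2-cells with the same composite with `k` are both comparisons between the same two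
factorizations of `t' ≫ k`, with the nullity inherited from `e`. -/
theorem IsKernel.isFaithful {f : A ⟶ B} {k : D ⟶ A} {e : k ≫ f ⟶ G.zero D B}
    (h : G.IsKernel f k e) : IsFaithful k := by
  refine fun X => ⟨fun {t t'} τ τ' hτ => ?_⟩
  change τ ▷ k = τ' ▷ k at hτ
  have c : 𝟙 (t' ≫ k) ▷ f ≫ (α_ t' k f).hom ≫ t' ◁ e ≫ (G.compZero t' B).hom =
      (α_ t' k f).hom ≫ t' ◁ e ≫ (G.compZero t' B).hom := by simp
  refine (h.unique_lift _ _ t (τ ▷ k) t' (𝟙 _) ?_ c).unique (by simp) (by simp [hτ])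
  rw [associator_naturality_left_assoc, ← whisker_exchange_assoc, G.compZero_naturality]

theorem IsCokernel.isCofaithful {f : A ⟶ B} {q : B ⟶ D} {e : f ≫ q ⟶ G.zero A D}
    (h : G.IsCokernel f q e) : IsCofaithful q := by
  refine fun Y => ⟨fun {t t'} τ τ' hτ => ?_⟩
  change q ◁ τ = q ◁ τ' at hτ
  have c : f ◁ 𝟙 (q ≫ t') ≫ (α_ f q t').inv ≫ e ▷ t' ≫ (G.zeroComp A t').hom =
      (α_ f q t').inv ≫ e ▷ t' ≫ (G.zeroComp A t').hom := by simp
  refine (h.unique_desc _ _ t (q ◁ τ) t' (𝟙 _) ?_ c).unique (by simp) (by simp [hτ])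
  rw [associator_inv_naturality_right_assoc, whisker_exchange_assoc, G.zeroComp_naturality]

theorem IsTwoAbelian.exists_relativelyExact (h : G.IsTwoAbelian) (hG : G.IsStrictlyDescribed) :
    ∃ S : LocallySCG C, S.toGpdStar = G ∧ S.IsRelativelyExact := by
  let _ := h.semiAdditive
  obtain ⟨S, rfl⟩ : ∃ S : LocallySCG C, S.toGpdStar = G := SemiAdditive.exists_locallySCG hG
    (SemiAdditive.hasNeg h) h.zeroObject h.products h.coproducts
  exact ⟨S, rfl, h.kernels, h.cokernels,
    fun f => ⟨fun hf => h.zeroFaithful f (isZeroFaithful_of_isFaithful hf),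
      fun ⟨_, _, _, _, hf⟩ => hf.isFaithful⟩,
    fun f => ⟨fun hf => h.zeroCofaithful f (isZeroCofaithful_of_isCofaithful hf),
      fun ⟨_, _, _, _, hf⟩ => hf.isCofaithful⟩⟩

end GpdStar

end TwoCat

/-! ### The addition of 1-cells in a locally `SCG` 2-category. -/

namespace TwoCat

open CategoryTheory
open scoped Bicategory

/-- An addition of 1-cells that is preserved by composition, and for which every 1-cell has a
negative. -/
structure HomAdd {C : Type u} [Bicategory.{w, v} C] (G : GpdStar C) where
  add {A B : C} (f g : A ⟶ B) : A ⟶ B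
  map {A B : C} {f f' g g' : A ⟶ B} (η : f ⟶ f') (θ : g ⟶ g') : add f g ⟶ add f' g'
  map_id {A B : C} (f g : A ⟶ B) : map (𝟙 f) (𝟙 g) = 𝟙 (add f g)
  map_comp_map {A B : C} {f f' f'' g g' g'' : A ⟶ B} (η : f ⟶ f') (θ : g ⟶ g') (η' : f' ⟶ f'')
    (θ' : g' ⟶ g'') : map η θ ≫ map η' θ' = map (η ≫ η') (θ ≫ θ')
  map_bijective {A B : C} (f f' g : A ⟶ B) :
    Function.Bijective fun η : f ⟶ f' => map η (𝟙 g)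
  zero_add {A B : C} (f : A ⟶ B) : Nonempty (add (G.zero A B) f ⟶ f)
  add_zero {A B : C} (f : A ⟶ B) : Nonempty (add f (G.zero A B) ⟶ f)
  exists_neg {A B : C} (f : A ⟶ B) : ∃ n : A ⟶ B, Nonempty (add f n ⟶ G.zero A B)
  post {A B Y : C} (y : B ⟶ Y) (f g : A ⟶ B) : add f g ≫ y ⟶ add (f ≫ y) (g ≫ y)
  post_naturality {A B Y : C} (y : B ⟶ Y) {f f' g g' : A ⟶ B} (η : f ⟶ f') (θ : g ⟶ g') :
    map η θ ▷ y ≫ post y f' g' = post y f g ≫ map (η ▷ y) (θ ▷ y)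
  whiskerLeft_post {A B Y : C} {y y' : B ⟶ Y} (ξ : y ⟶ y') (f g : A ⟶ B) :
    add f g ◁ ξ ≫ post y' f g = post y f g ≫ map (f ◁ ξ) (g ◁ ξ)
  post_comp {A B Y Z : C} (y : B ⟶ Y) (z : Y ⟶ Z) (f g : A ⟶ B) :
    post (y ≫ z) f g = (α_ _ _ _).inv ≫ post y f g ▷ z ≫ post z _ _ ≫
      map (α_ _ _ _).hom (α_ _ _ _).hom
  pre {X A B : C} (x : X ⟶ A) (f g : A ⟶ B) : x ≫ add f g ⟶ add (x ≫ f) (x ≫ g)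
  pre_naturality {X A B : C} (x : X ⟶ A) {f f' g g' : A ⟶ B} (η : f ⟶ f') (θ : g ⟶ g') :
    x ◁ map η θ ≫ pre x f' g' = pre x f g ≫ map (x ◁ η) (x ◁ θ)
  whiskerRight_pre {X A B : C} {x x' : X ⟶ A} (ξ : x ⟶ x') (f g : A ⟶ B) :
    ξ ▷ add f g ≫ pre x' f g = pre x f g ≫ map (ξ ▷ f) (ξ ▷ g)
  pre_comp {W X A B : C} (x : W ⟶ X) (y : X ⟶ A) (f g : A ⟶ B) :
    pre (x ≫ y) f g = (α_ _ _ _).hom ≫ x ◁ pre y f g ≫ pre x _ _ ≫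
      map (α_ _ _ _).inv (α_ _ _ _).inv

section Monoidal

open MonoidalCategory Functor.OplaxMonoidal

variable {M : Type u₁} [Category.{v₁} M] [MonoidalCategory M] {N : Type u₂} [Category.{v₂} N]
  [MonoidalCategory N]

/-- Translation by an invertible object is an equivalence, with translation by the inverse as
quasi-inverse. -/
theorem map_id_bijective {g n : M} (e : g ⊗ n ≅ 𝟙_ M) (e' : n ⊗ g ≅ 𝟙_ M) (f f' : M) :
    Function.Bijective fun η : f ⟶ f' => η ⊗ₘ 𝟙 g := by
  have i {a b : M} (e : a ⊗ b ≅ 𝟙_ M) : 𝟭 M ≅ tensorRight a ⋙ tensorRight b :=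
    (rightUnitorNatIso M).symm ≪≫ (tensoringRight M).mapIso e.symm ≪≫ tensorRightTensor a b
  have h : (tensorRight g).IsEquivalence :=
    (CategoryTheory.Equivalence.mk _ _ (i e) (i e').symm).isEquivalence_functor
  simp only [tensorHom_id]
  exact ⟨(tensorRight g).map_injective, (tensorRight g).map_surjective⟩

/-- The monoidality of `τ` in the direction that takes a composite with a sum to the sum of the
composites, as used for one-sided composition. -/
theorem δ_app {F H : M ⥤ N} [F.Monoidal] [H.Monoidal] (τ : F ⟶ H) [NatTrans.IsMonoidal τ]
    (X Y : M) : τ.app (X ⊗ Y) ≫ δ H X Y = δ F X Y ≫ (τ.app X ⊗ₘ τ.app Y) := by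
  have h := NatTrans.IsMonoidal.tensor (τ := τ) X Y
  rw [← cancel_epi (Functor.LaxMonoidal.μ F X Y), reassoc_of% h]
  simp

end Monoidal

namespace HomSCG

section

open MonoidalCategory Functor.OplaxMonoidal

variable {C : Type u} [Bicategory.{w, v} C] [∀ A B : C, MonoidalCategory (A ⟶ B)]
  [∀ {A' A B B' : C} (f : A' ⟶ A) (g : B ⟶ B'), (homMap f g).Monoidal] {A B X Y Z : C}

attribute [local simp] tensorHom_comp_tensorHom

/-- Composition on both sides preserves the tensor product of 1-cells. -/
def homTensor (f : X ⟶ A) (g : B ⟶ Y) (h k : A ⟶ B) :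
    (f ≫ (h ⊗ k)) ≫ g ⟶ ((f ≫ h) ≫ g) ⊗ ((f ≫ k) ≫ g) := δ (homMap f g) h k

open Bicategory in
theorem homTensor_naturality (f : X ⟶ A) (g : B ⟶ Y) {h h' k k' : A ⟶ B} (η : h ⟶ h')
    (θ : k ⟶ k') :
    whiskerRight (whiskerLeft f (η ⊗ₘ θ)) g ≫ homTensor f g h' k' = homTensor f g h k ≫
      (whiskerRight (whiskerLeft f η) g ⊗ₘ whiskerRight (whiskerLeft f θ) g) :=
  (δ_natural (homMap f g) η θ).symm

open Bicategory in
theorem homTensor_map₂ (H : ∀ {A' A B B' : C} {f f' : A' ⟶ A} {g g' : B ⟶ B'} (η : f ⟶ f')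
    (θ : g ⟶ g'), NatTrans.IsMonoidal (homMap₂ η θ)) {f f' : X ⟶ A} {g g' : B ⟶ Y} (η : f ⟶ f')
    (θ : g ⟶ g') (h k : A ⟶ B) :
    whiskerRight (whiskerRight η (h ⊗ k)) g ≫ whiskerLeft (f' ≫ (h ⊗ k)) θ ≫ homTensor f' g' h k =
      homTensor f g h k ≫
        ((whiskerRight (whiskerRight η h) g ≫ whiskerLeft (f' ≫ h) θ) ⊗ₘ
          (whiskerRight (whiskerRight η k) g ≫ whiskerLeft (f' ≫ k) θ)) := by
  have := H η θ
  exact (Category.assoc _ _ _).symm.trans (δ_app (homMap₂ η θ) h k)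

open Bicategory in
theorem homTensor_comp (H : ∀ {A'' A' A B B' B'' : C} (f' : A'' ⟶ A') (f : A' ⟶ A) (g : B ⟶ B')
    (g' : B' ⟶ B''), NatTrans.IsMonoidal (homComp f' f g g')) (f' : Z ⟶ X) (f : X ⟶ A) {Y' : C}
    (g : B ⟶ Y) (g' : Y ⟶ Y') (h k : A ⟶ B) :
    whiskerRight (associator f' (f ≫ (h ⊗ k)) g).inv g' ≫
      whiskerRight (whiskerRight (associator f' f (h ⊗ k)).inv g) g' ≫
        (associator ((f' ≫ f) ≫ (h ⊗ k)) g g').hom ≫ homTensor (f' ≫ f) (g ≫ g') h k =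
    whiskerRight (whiskerLeft f' (homTensor f g h k)) g' ≫ homTensor f' g' _ _ ≫
      ((whiskerRight (associator f' (f ≫ h) g).inv g' ≫
        whiskerRight (whiskerRight (associator f' f h).inv g) g' ≫
          (associator ((f' ≫ f) ≫ h) g g').hom) ⊗ₘ
      (whiskerRight (associator f' (f ≫ k) g).inv g' ≫
        whiskerRight (whiskerRight (associator f' f k).inv g) g' ≫
          (associator ((f' ≫ f) ≫ k) g g').hom)) := by
  have := H f' f g g'
  refine Eq.trans ?_ ((δ_app (homComp f' f g g') h k).trans ?_)
  · simp only [homComp_app]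
    erw [Category.assoc, Category.assoc]
    rfl
  · rw [Functor.OplaxMonoidal.comp_δ, Category.assoc]
    rfl

/-- Postcomposition preserves the tensor product of 1-cells. -/
def postTensor (y : B ⟶ Y) (f g : A ⟶ B) : (f ⊗ g) ≫ y ⟶ (f ≫ y) ⊗ (g ≫ y) :=
  Bicategory.whiskerRight (Bicategory.leftUnitor (f ⊗ g)).inv y ≫ homTensor (𝟙 A) y f g ≫
    (Bicategory.whiskerRight (Bicategory.leftUnitor f).hom y ⊗ₘ
      Bicategory.whiskerRight (Bicategory.leftUnitor g).hom y)

/-- Precomposition preserves the tensor product of 1-cells. -/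
def preTensor (x : X ⟶ A) (f g : A ⟶ B) : x ≫ (f ⊗ g) ⟶ (x ≫ f) ⊗ (x ≫ g) :=
  (Bicategory.rightUnitor (x ≫ (f ⊗ g))).inv ≫ homTensor x (𝟙 B) f g ≫
    ((Bicategory.rightUnitor (x ≫ f)).hom ⊗ₘ (Bicategory.rightUnitor (x ≫ g)).hom)

theorem postTensor_naturality (y : B ⟶ Y) {f f' g g' : A ⟶ B} (η : f ⟶ f') (θ : g ⟶ g') :
    Bicategory.whiskerRight (η ⊗ₘ θ) y ≫ postTensor y f' g' = postTensor y f g ≫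
      (Bicategory.whiskerRight η y ⊗ₘ Bicategory.whiskerRight θ y) := by
  have h := homTensor_naturality (𝟙 A) y η θ
  have e : Bicategory.whiskerRight (η ⊗ₘ θ) y ≫
      Bicategory.whiskerRight (Bicategory.leftUnitor (f' ⊗ g')).inv y =
      Bicategory.whiskerRight (Bicategory.leftUnitor (f ⊗ g)).inv y ≫
        Bicategory.whiskerRight (Bicategory.whiskerLeft (𝟙 A) (η ⊗ₘ θ)) y := by
    rw [← Bicategory.comp_whiskerRight, ← Bicategory.comp_whiskerRight,
      Bicategory.leftUnitor_inv_naturality]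
  rw [postTensor, postTensor, reassoc_of% e, reassoc_of% h, tensorHom_comp_tensorHom,
    Category.assoc, Category.assoc, tensorHom_comp_tensorHom]
  simp only [← Bicategory.comp_whiskerRight, Bicategory.leftUnitor_naturality]

theorem preTensor_naturality (x : X ⟶ A) {f f' g g' : A ⟶ B} (η : f ⟶ f') (θ : g ⟶ g') :
    Bicategory.whiskerLeft x (η ⊗ₘ θ) ≫ preTensor x f' g' = preTensor x f g ≫
      (Bicategory.whiskerLeft x η ⊗ₘ Bicategory.whiskerLeft x θ) := by
  have h := homTensor_naturality x (𝟙 B) η θ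
  rw [preTensor, preTensor, Bicategory.rightUnitor_inv_naturality_assoc, reassoc_of% h,
    tensorHom_comp_tensorHom, Category.assoc, Category.assoc, tensorHom_comp_tensorHom]
  simp only [Bicategory.rightUnitor_naturality]

theorem whiskerLeft_postTensor (H : ∀ {A' A B B' : C} {f f' : A' ⟶ A} {g g' : B ⟶ B'} (η : f ⟶ f')
    (θ : g ⟶ g'), NatTrans.IsMonoidal (homMap₂ η θ)) {y y' : B ⟶ Y} (ξ : y ⟶ y') (f g : A ⟶ B) :
    Bicategory.whiskerLeft (f ⊗ g) ξ ≫ postTensor y' f g = postTensor y f g ≫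
      (Bicategory.whiskerLeft f ξ ⊗ₘ Bicategory.whiskerLeft g ξ) := by
  have h := homTensor_map₂ H (𝟙 (𝟙 A)) ξ f g
  simp only [Bicategory.id_whiskerRight, Category.id_comp] at h
  rw [postTensor, postTensor, Bicategory.whisker_exchange_assoc, reassoc_of% h,
    tensorHom_comp_tensorHom, Category.assoc, Category.assoc, tensorHom_comp_tensorHom,
    Bicategory.whisker_exchange, Bicategory.whisker_exchange]

theorem whiskerRight_preTensor (H : ∀ {A' A B B' : C} {f f' : A' ⟶ A} {g g' : B ⟶ B'} (η : f ⟶ f')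
    (θ : g ⟶ g'), NatTrans.IsMonoidal (homMap₂ η θ)) {x x' : X ⟶ A} (ξ : x ⟶ x') (f g : A ⟶ B) :
    Bicategory.whiskerRight ξ (f ⊗ g) ≫ preTensor x' f g = preTensor x f g ≫
      (Bicategory.whiskerRight ξ f ⊗ₘ Bicategory.whiskerRight ξ g) := by
  have h := homTensor_map₂ H ξ (𝟙 (𝟙 B)) f g
  simp only [Bicategory.whiskerLeft_id, Category.comp_id, Category.id_comp] at h
  rw [preTensor, preTensor, Bicategory.rightUnitor_inv_naturality_assoc, reassoc_of% h,
    tensorHom_comp_tensorHom, Category.assoc, Category.assoc, tensorHom_comp_tensorHom,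
    Bicategory.rightUnitor_naturality, Bicategory.rightUnitor_naturality]

/-- One-sided composition is the two-sided one with an identity on the other side. Composing twice
produces `𝟙 ≫ 𝟙` there, which is removed by the monoidality of the transformation induced by its
unitor; the rest is bicategorical coherence. -/
theorem postTensor_comp (H : ∀ {A' A B B' : C} {f f' : A' ⟶ A} {g g' : B ⟶ B'} (η : f ⟶ f')
    (θ : g ⟶ g'), NatTrans.IsMonoidal (homMap₂ η θ))
    (H' : ∀ {A'' A' A B B' B'' : C} (f' : A'' ⟶ A') (f : A' ⟶ A) (g : B ⟶ B')
    (g' : B' ⟶ B''), NatTrans.IsMonoidal (homComp f' f g g'))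
    (y : B ⟶ Y) (z : Y ⟶ Z) (f g : A ⟶ B) :
    postTensor (y ≫ z) f g = (Bicategory.associator _ _ _).inv ≫
      Bicategory.whiskerRight (postTensor y f g) z ≫ postTensor z _ _ ≫
        ((Bicategory.associator _ _ _).hom ⊗ₘ (Bicategory.associator _ _ _).hom) := by
  have h := homTensor_comp H' (𝟙 A) (𝟙 A) y z f g
  have h1 := homTensor_map₂ H (Bicategory.leftUnitor (𝟙 A)).hom (𝟙 (y ≫ z)) f g
  have h2 := homTensor_naturality (𝟙 A) z (Bicategory.whiskerRight (Bicategory.leftUnitor f).hom y)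
    (Bicategory.whiskerRight (Bicategory.leftUnitor g).hom y)
  simp only [Bicategory.whiskerLeft_id, Category.comp_id, Category.id_comp] at h1
  have e {k k' : A ⟶ Y} (η : k ⟶ k') : Bicategory.whiskerRight η z ≫
      Bicategory.whiskerRight (Bicategory.leftUnitor _).inv z =
    Bicategory.whiskerRight (Bicategory.leftUnitor _).inv z ≫
      Bicategory.whiskerRight (Bicategory.whiskerLeft (𝟙 A) η) z := by
    simp only [← Bicategory.comp_whiskerRight, Bicategory.leftUnitor_inv_naturality]
  have r (f : A ⟶ B) : Bicategory.whiskerRight (Bicategory.whiskerLeft (𝟙 A)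
        (Bicategory.whiskerRight (Bicategory.leftUnitor f).hom y)) z ≫
      Bicategory.whiskerRight (Bicategory.leftUnitor (f ≫ y)).hom z ≫
        (Bicategory.associator f y z).hom =
      (Bicategory.whiskerRight (Bicategory.associator (𝟙 A) (𝟙 A ≫ f) y).inv z ≫
        Bicategory.whiskerRight (Bicategory.whiskerRight
          (Bicategory.associator (𝟙 A) (𝟙 A) f).inv y) z ≫
          (Bicategory.associator ((𝟙 A ≫ 𝟙 A) ≫ f) y z).hom) ≫
      Bicategory.whiskerRight (Bicategory.whiskerRight (Bicategory.leftUnitor (𝟙 A)).hom f)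
        (y ≫ z) ≫ Bicategory.whiskerRight (Bicategory.leftUnitor f).hom (y ≫ z) := by
    bicategory
  simp only [postTensor, Bicategory.comp_whiskerRight, Category.assoc]
  rw [reassoc_of% e, reassoc_of% h2, reassoc_of% e]
  simp only [tensorHom_comp_tensorHom, r]
  rw [← tensorHom_comp_tensorHom, ← reassoc_of% h, ← tensorHom_comp_tensorHom,
    ← reassoc_of% h1]
  simp only [← Category.assoc]
  congr 2
  bicategory

theorem preTensor_comp (H : ∀ {A' A B B' : C} {f f' : A' ⟶ A} {g g' : B ⟶ B'} (η : f ⟶ f')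
    (θ : g ⟶ g'), NatTrans.IsMonoidal (homMap₂ η θ))
    (H' : ∀ {A'' A' A B B' B'' : C} (f' : A'' ⟶ A') (f : A' ⟶ A) (g : B ⟶ B')
    (g' : B' ⟶ B''), NatTrans.IsMonoidal (homComp f' f g g'))
    (x : Z ⟶ X) (y : X ⟶ A) (f g : A ⟶ B) :
    preTensor (x ≫ y) f g = (Bicategory.associator _ _ _).hom ≫
      Bicategory.whiskerLeft x (preTensor y f g) ≫ preTensor x _ _ ≫
        ((Bicategory.associator _ _ _).inv ⊗ₘ (Bicategory.associator _ _ _).inv) := by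
  have h := homTensor_comp H' x y (𝟙 B) (𝟙 B) f g
  have h1 := homTensor_map₂ H (𝟙 (x ≫ y)) (Bicategory.leftUnitor (𝟙 B)).hom f g
  have h2 := homTensor_naturality x (𝟙 B) (Bicategory.rightUnitor (y ≫ f)).hom
    (Bicategory.rightUnitor (y ≫ g)).hom
  simp only [Bicategory.id_whiskerRight, Category.id_comp] at h1
  have r (f : A ⟶ B) : Bicategory.whiskerRight (Bicategory.whiskerLeft x
        (Bicategory.rightUnitor (y ≫ f)).hom) (𝟙 B) ≫
      (Bicategory.rightUnitor (x ≫ y ≫ f)).hom ≫ (Bicategory.associator x y f).inv =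
      (Bicategory.whiskerRight (Bicategory.associator x (y ≫ f) (𝟙 B)).inv (𝟙 B) ≫
        Bicategory.whiskerRight (Bicategory.whiskerRight
          (Bicategory.associator x y f).inv (𝟙 B)) (𝟙 B) ≫
          (Bicategory.associator ((x ≫ y) ≫ f) (𝟙 B) (𝟙 B)).hom) ≫
      Bicategory.whiskerLeft ((x ≫ y) ≫ f) (Bicategory.leftUnitor (𝟙 B)).hom ≫
        (Bicategory.rightUnitor ((x ≫ y) ≫ f)).hom := by
    bicategory
  simp only [preTensor, Bicategory.whiskerLeft_comp, Category.assoc]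
  rw [Bicategory.rightUnitor_inv_naturality_assoc, reassoc_of% h2,
    Bicategory.rightUnitor_inv_naturality_assoc]
  simp only [tensorHom_comp_tensorHom, r]
  rw [← tensorHom_comp_tensorHom, ← reassoc_of% h, ← tensorHom_comp_tensorHom,
    ← reassoc_of% h1]
  simp only [← Category.assoc]
  congr 2
  bicategory

end

end HomSCG

/-- The addition of 1-cells in a locally `SCG` 2-category. -/
def LocallySCG.homAdd {C : Type u} [Bicategory.{w, v} C] (S : LocallySCG C) :
    HomAdd S.toGpdStar :=
  letI := S.monoidal
  letI := S.symmetric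
  letI i {A' A B B' : C} (f : A' ⟶ A) (g : B ⟶ B') : (homMap f g).Monoidal :=
    (S.homBraided f g).toMonoidal
  have H := @S.homMap₂_monoidal
  have H' := @S.homComp_monoidal
  { add f g := MonoidalCategory.tensorObj f g
    map η θ := MonoidalCategory.tensorHom η θ
    map_id f g := MonoidalCategory.id_tensorHom_id f g
    map_comp_map η θ η' θ' := MonoidalCategory.tensorHom_comp_tensorHom η θ η' θ'
    map_bijective f f' g := by
      obtain ⟨n, ⟨e⟩⟩ := S.exists_inverse g
      -- The symmetry turns the given right inverse into a two-sided one.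
      exact map_id_bijective e (BraidedCategory.braiding n g ≪≫ e) f f'
    zero_add f := ⟨(MonoidalCategory.leftUnitor f).hom⟩
    add_zero f := ⟨(MonoidalCategory.rightUnitor f).hom⟩
    exists_neg f := by
      obtain ⟨n, ⟨e⟩⟩ := S.exists_inverse f
      exact ⟨n, ⟨e.hom⟩⟩
    post y f g := HomSCG.postTensor y f g
    post_naturality y _ _ _ _ η θ := HomSCG.postTensor_naturality y η θ
    whiskerLeft_post ξ f g := HomSCG.whiskerLeft_postTensor H ξ f g
    post_comp y z f g := HomSCG.postTensor_comp H H' y z f g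
    pre x f g := HomSCG.preTensor x f g
    pre_naturality x _ _ _ _ η θ := HomSCG.preTensor_naturality x η θ
    whiskerRight_pre ξ f g := HomSCG.whiskerRight_preTensor H ξ f g
    pre_comp x y f g := HomSCG.preTensor_comp H H' x y f g }

end TwoCat

/-! ### Calculus of null 1-cells; kernels of cokernels; 0-faithful versus faithful. -/

namespace TwoCat

open CategoryTheory Bicategory

namespace GpdStar

variable {C : Type u} [Bicategory.{w, v} C] (G : GpdStar C) {A B D Q X Y : C}

/-- The composite of a null 1-cell with a 1-cell is null. -/
def compNull {t : X ⟶ A} (e : t ⟶ G.zero X A) (h : A ⟶ B) : t ≫ h ⟶ G.zero X B :=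
  e ▷ h ≫ (G.zeroComp X h).hom

/-- The composite of a 1-cell with a null 1-cell is null. -/
def nullComp (h : A ⟶ B) {t : B ⟶ Y} (e : t ⟶ G.zero B Y) : h ≫ t ⟶ G.zero A Y :=
  h ◁ e ≫ (G.compZero h Y).hom

theorem whiskerLeft_compNull {t : X ⟶ A} (e : t ⟶ G.zero X A) {h h' : A ⟶ B} (κ : h ⟶ h') :
    t ◁ κ ≫ G.compNull e h' = G.compNull e h := by
  rw [compNull, whisker_exchange_assoc, G.zeroComp_naturality, compNull]

theorem whiskerRight_nullComp {h h' : A ⟶ B} (κ : h ⟶ h') {t : B ⟶ Y} (e : t ⟶ G.zero B Y) :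
    κ ▷ t ≫ G.nullComp h' e = G.nullComp h e := by
  rw [nullComp, ← whisker_exchange_assoc, G.compZero_naturality, nullComp]

theorem whiskerRight_compNull {t t' : X ⟶ A} (η : t ⟶ t') (e : t' ⟶ G.zero X A) (h : A ⟶ B) :
    η ▷ h ≫ G.compNull e h = G.compNull (η ≫ e) h := by
  simp [compNull]

theorem whiskerLeft_nullComp (h : A ⟶ B) {t t' : B ⟶ Y} (η : t ⟶ t') (e : t' ⟶ G.zero B Y) :
    h ◁ η ≫ G.nullComp h e = G.nullComp h (η ≫ e) := by
  simp [nullComp]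

theorem compNull_comp {t : X ⟶ A} (e : t ⟶ G.zero X A) (h : A ⟶ B) (h' : B ⟶ D) :
    G.compNull e (h ≫ h') = (α_ _ _ _).inv ≫ G.compNull (G.compNull e h) h' := by
  simp [compNull, G.zeroComp_comp]

theorem comp_nullComp (h : A ⟶ B) (h' : B ⟶ D) {t : D ⟶ Y} (e : t ⟶ G.zero D Y) :
    G.nullComp (h ≫ h') e = (α_ _ _ _).hom ≫ G.nullComp h (G.nullComp h' e) := by
  simp [nullComp, G.compZero_comp]

theorem compNull_id {t : X ⟶ A} (e : t ⟶ G.zero X A) : G.compNull e (𝟙 A) = (ρ_ t).hom ≫ e := by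
  simp [compNull, G.zeroComp_id]

theorem id_nullComp {t : B ⟶ Y} (e : t ⟶ G.zero B Y) : G.nullComp (𝟙 B) e = (λ_ t).hom ≫ e := by
  simp [nullComp, G.compZero_id]

theorem compNull_zero {t : X ⟶ A} (e : t ⟶ G.zero X A) (B : C) :
    G.compNull e (G.zero A B) = (G.compZero t B).hom := by
  rw [compNull, G.zero_zero, G.compZero_naturality]

theorem zero_nullComp {t : B ⟶ Y} (e : t ⟶ G.zero B Y) (A : C) :
    G.nullComp (G.zero A B) e = (G.zeroComp A t).hom := by
  rw [nullComp, ← G.zero_zero, G.zeroComp_naturality]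

/-- The composite `t ≫ f ≫ q` is null both because `t` is and because `f ≫ q` is; the two nullities
agree by the interchange law and the agreement of the nullities of `0 ∘ 0`. -/
theorem compNull_nullComp {t : X ⟶ A} (e : t ⟶ G.zero X A) {f : A ⟶ B} {q : B ⟶ Q}
    (π : f ≫ q ⟶ G.zero A Q) :
    G.compNull (G.compNull e f) q = (α_ _ _ _).hom ≫ G.nullComp t π := by
  rw [← Iso.inv_comp_eq, ← compNull_comp, ← G.whiskerLeft_compNull e π, compNull_zero, nullComp]

theorem nullComp_compNull {k : Q ⟶ A} {f : A ⟶ B} (κ : k ≫ f ⟶ G.zero Q B) {t : B ⟶ Y}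
    (e : t ⟶ G.zero B Y) :
    G.nullComp k (G.nullComp f e) = (α_ _ _ _).inv ≫ G.compNull κ t := by
  rw [Iso.eq_inv_comp, ← comp_nullComp, ← G.whiskerRight_nullComp κ e, zero_nullComp, compNull]

theorem compNull_nullComp_eq (h : X ⟶ A) {t : A ⟶ B} (e : t ⟶ G.zero A B) (h' : B ⟶ Y) :
    G.compNull (G.nullComp h e) h' = (α_ _ _ _).hom ≫ G.nullComp h (G.compNull e h') := by
  simp only [compNull, nullComp, comp_whiskerRight, Category.assoc, G.comp_zero_comp,
    whiskerLeft_comp]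
  simp

variable {G}

/-- A `β` compatible with the cokernel makes `a` and the zero 1-cell two factorizations of zero
through the kernel `f`, and these have a unique comparison. -/
theorem IsKerOfCok.isZeroMonomorphic {f : A ⟶ B} (h : G.IsKerOfCok f) : G.IsZeroMonomorphic f := by
  obtain ⟨Q, q, π, hq, hf⟩ := h
  exact ⟨Q, q, π, hq, fun {X} a β hβ => hf.unique_lift _ _ a β (G.zero X A) (G.zeroComp X f).hom hβ
    (by simpa [compNull, nullComp] using G.compNull_nullComp (𝟙 (G.zero X A)) π)⟩

theorem IsCokOfKer.isZeroEpimorphic {f : A ⟶ B} (h : G.IsCokOfKer f) : G.IsZeroEpimorphic f := by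
  obtain ⟨K, k, e, hk, hf⟩ := h
  exact ⟨K, k, e, hk, fun {Y} b β hβ => hf.unique_desc _ _ b β (G.zero B Y) (G.compZero f Y).hom hβ
    (by simpa [compNull, nullComp] using G.nullComp_compNull e (𝟙 (G.zero B Y)))⟩

/-- The canonical nullity of `0 ≫ f` is always compatible with the cokernel, so the uniqueness in
0-monomorphy applies to endomorphisms of zero. -/
theorem IsZeroMonomorphic.isZeroFaithful {f : A ⟶ B} (h : G.IsZeroMonomorphic f) :
    G.IsZeroFaithful f := by
  obtain ⟨Q, q, π, hq, hf⟩ := h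
  intro X α hα
  refine (hf (G.zero X A) (G.zeroComp X f).hom ?_).unique (by simp [hα]) (by simp)
  simpa [compNull, nullComp] using G.compNull_nullComp (𝟙 (G.zero X A)) π

theorem IsZeroEpimorphic.isZeroCofaithful {f : A ⟶ B} (h : G.IsZeroEpimorphic f) :
    G.IsZeroCofaithful f := by
  obtain ⟨K, k, e, hk, hf⟩ := h
  intro Y α hα
  refine (hf (G.zero B Y) (G.compZero f Y).hom ?_).unique (by simp [hα]) (by simp)
  simpa [compNull, nullComp] using G.nullComp_compNull e (𝟙 (G.zero B Y))

theorem IsFullyZeroFaithful.isZeroFaithful {f : A ⟶ B} (h : G.IsFullyZeroFaithful f) :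
    G.IsZeroFaithful f :=
  fun {X} _ hα => (h (G.zero X A) (G.zeroComp X f).hom).unique (by simp [hα]) (by simp)

theorem IsFullyZeroCofaithful.isZeroCofaithful {f : A ⟶ B} (h : G.IsFullyZeroCofaithful f) :
    G.IsZeroCofaithful f :=
  fun {Y} _ hα => (h (G.zero B Y) (G.compZero f Y).hom).unique (by simp [hα]) (by simp)

/-- A 1-cell that is the kernel of its cokernel is the kernel of any of its cokernels. -/
theorem IsKerOfCok.isKernel {f : A ⟶ B} (h : G.IsKerOfCok f) {q : B ⟶ Q} {π : f ≫ q ⟶ G.zero A Q}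
    (hq : G.IsCokernel f q π) : G.IsKernel q f π := by
  obtain ⟨Q₀, q₀, π₀, hq₀, hf⟩ := h
  have iso {A B : C} {f g : A ⟶ B} (η : f ⟶ g) : IsIso η := G.isIso_hom η
  obtain ⟨v, σ, hσ⟩ := hq.exists_desc q₀ π₀
  obtain ⟨u, τ, hτ⟩ := hq₀.exists_desc q π
  replace hσ : f ◁ σ ≫ π₀ = (α_ _ _ _).inv ≫ G.compNull π v := hσ
  replace hτ : f ◁ τ ≫ π = (α_ _ _ _).inv ≫ G.compNull π₀ u := hτ
  obtain ⟨ω, -, -⟩ := hq.unique_desc q π (v ≫ u) ((α_ _ _ _).inv ≫ σ ▷ u ≫ τ) (𝟙 Q) (ρ_ q).hom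
    (by
      change _ = (α_ _ _ _).inv ≫ G.compNull π (v ≫ u)
      rw [whiskerLeft_comp, whiskerLeft_comp, Category.assoc, Category.assoc, hτ,
        associator_inv_naturality_middle_assoc, whiskerRight_compNull, hσ,
        ← whiskerRight_compNull, G.compNull_comp]
      simp) (by simp [G.zeroComp_id])
  -- The comparison `v` of the cokernels has a one-sided inverse `u`, so composing with it is
  -- faithful. This suffices to identify the kernel conditions for `q` and for `q₀`, as `key` does.
  have inj {X : C} {x y : X ⟶ Q} {θ θ' : x ⟶ y} (hθ : θ ▷ v = θ' ▷ v) : θ = θ' := by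
    have h : θ ▷ 𝟙 Q = θ' ▷ 𝟙 Q := by
      rw [← cancel_epi (x ◁ ω), whisker_exchange, whisker_exchange, whiskerRight_comp, hθ]
      simp
    rw [← cancel_epi (ρ_ x).hom, ← rightUnitor_naturality, h, rightUnitor_naturality]
  have key {X : C} (x : X ⟶ B) (ξ : x ≫ q ⟶ G.zero X Q) (t : X ⟶ A) (κ : t ≫ f ⟶ x) :
      κ ▷ q₀ ≫ x ◁ inv σ ≫ (α_ _ _ _).inv ≫ G.compNull ξ v =
        (α_ _ _ _).hom ≫ G.nullComp t π₀ ↔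
      κ ▷ q ≫ ξ = (α_ _ _ _).hom ≫ G.nullComp t π := by
    have h₁ : κ ▷ q₀ ≫ x ◁ inv σ ≫ (α_ _ _ _).inv ≫ G.compNull ξ v =
        (t ≫ f) ◁ inv σ ≫ (α_ _ _ _).inv ≫ G.compNull (κ ▷ q ≫ ξ) v := by
      rw [← whisker_exchange_assoc, ← whiskerRight_compNull]
      simp
    have h₂ : (α_ _ _ _).hom ≫ G.nullComp t π₀ = (t ≫ f) ◁ inv σ ≫ (α_ _ _ _).inv ≫
        G.compNull ((α_ _ _ _).hom ≫ G.nullComp t π) v := by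
      have e : G.compNull π v = (α_ _ _ _).hom ≫ f ◁ σ ≫ π₀ := by rw [hσ]; simp
      rw [← whiskerRight_compNull, compNull_nullComp_eq, e, ← whiskerLeft_nullComp,
        ← whiskerLeft_nullComp]
      simp
    rw [h₁, h₂, cancel_epi, cancel_epi, compNull, compNull, cancel_mono]
    exact ⟨inj, fun h => by rw [h]⟩
  constructor
  · intro X x ξ
    obtain ⟨t, κ, hκ⟩ := hf.exists_lift x (x ◁ inv σ ≫ (α_ _ _ _).inv ≫ G.compNull ξ v)
    exact ⟨t, κ, (key x ξ t κ).1 hκ⟩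
  · intro X x ξ t κ t' κ' h h'
    exact hf.unique_lift x _ t κ t' κ' ((key x ξ t κ).2 h) ((key x ξ t' κ').2 h')

/-- A 1-cell that is the cokernel of its kernel is the cokernel of any of its kernels. -/
theorem IsCokOfKer.isCokernel {f : A ⟶ B} (h : G.IsCokOfKer f) {k : Q ⟶ A} {e : k ≫ f ⟶ G.zero Q B}
    (hk : G.IsKernel f k e) : G.IsCokernel k f e := by
  obtain ⟨K₀, k₀, e₀, hk₀, hf⟩ := h
  have iso {A B : C} {f g : A ⟶ B} (η : f ⟶ g) : IsIso η := G.isIso_hom η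
  obtain ⟨v, σ, hσ⟩ := hk.exists_lift k₀ e₀
  obtain ⟨u, τ, hτ⟩ := hk₀.exists_lift k e
  replace hσ : σ ▷ f ≫ e₀ = (α_ _ _ _).hom ≫ G.nullComp v e := hσ
  replace hτ : τ ▷ f ≫ e = (α_ _ _ _).hom ≫ G.nullComp u e₀ := hτ
  obtain ⟨ω, -, -⟩ := hk.unique_lift k e (u ≫ v) ((α_ _ _ _).hom ≫ u ◁ σ ≫ τ) (𝟙 Q) (λ_ k).hom
    (by
      change _ = (α_ _ _ _).hom ≫ G.nullComp (u ≫ v) e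
      rw [comp_whiskerRight, comp_whiskerRight, Category.assoc, Category.assoc, hτ,
        associator_naturality_middle_assoc, whiskerLeft_nullComp, hσ,
        ← whiskerLeft_nullComp, G.comp_nullComp]
      simp) (by simp [G.compZero_id])
  have inj {X : C} {x y : Q ⟶ X} {θ θ' : x ⟶ y} (hθ : v ◁ θ = v ◁ θ') : θ = θ' := by
    have h : 𝟙 Q ◁ θ = 𝟙 Q ◁ θ' := by
      rw [← cancel_epi (ω ▷ x), ← whisker_exchange, ← whisker_exchange, comp_whiskerLeft, hθ]
      simp
    rw [← cancel_epi (λ_ x).hom, ← leftUnitor_naturality, h, leftUnitor_naturality]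
  have key {X : C} (x : A ⟶ X) (ξ : k ≫ x ⟶ G.zero Q X) (t : B ⟶ X) (κ : f ≫ t ⟶ x) :
      k₀ ◁ κ ≫ inv σ ▷ x ≫ (α_ _ _ _).hom ≫ G.nullComp v ξ =
        (α_ _ _ _).inv ≫ G.compNull e₀ t ↔
      k ◁ κ ≫ ξ = (α_ _ _ _).inv ≫ G.compNull e t := by
    have h₁ : k₀ ◁ κ ≫ inv σ ▷ x ≫ (α_ _ _ _).hom ≫ G.nullComp v ξ =
        inv σ ▷ (f ≫ t) ≫ (α_ _ _ _).hom ≫ G.nullComp v (k ◁ κ ≫ ξ) := by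
      rw [whisker_exchange_assoc, ← whiskerLeft_nullComp]
      simp
    have h₂ : (α_ _ _ _).inv ≫ G.compNull e₀ t = inv σ ▷ (f ≫ t) ≫ (α_ _ _ _).hom ≫
        G.nullComp v ((α_ _ _ _).inv ≫ G.compNull e t) := by
      have e' : G.nullComp v e = (α_ _ _ _).inv ≫ σ ▷ f ≫ e₀ := by rw [hσ]; simp
      have h := G.compNull_nullComp_eq v e t
      rw [← Iso.inv_comp_eq] at h
      rw [← whiskerLeft_nullComp, ← h, e', ← whiskerRight_compNull, ← whiskerRight_compNull]
      simp
    rw [h₁, h₂, cancel_epi, cancel_epi, nullComp, nullComp, cancel_mono]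
    exact ⟨inj, fun h => by rw [h]⟩
  constructor
  · intro X x ξ
    obtain ⟨t, κ, hκ⟩ := hf.exists_desc x (inv σ ▷ x ≫ (α_ _ _ _).hom ≫ G.nullComp v ξ)
    exact ⟨t, κ, (key x ξ t κ).1 hκ⟩
  · intro X x ξ t κ t' κ' h h'
    exact hf.unique_desc x _ t κ t' κ' ((key x ξ t κ).2 h) ((key x ξ t' κ').2 h')

end GpdStar

namespace HomAdd

variable {C : Type u} [Bicategory.{w, v} C] {G : GpdStar C} {A B D X Y : C}

theorem map_injective (H : HomAdd G) {f f' g : A ⟶ B} {η η' : f ⟶ f'} {θ : g ⟶ g}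
    (h : H.map η θ = H.map η' θ) : η = η' := by
  have := G.isIso_hom θ
  have e (η : f ⟶ f') : H.map η θ = H.map η (𝟙 g) ≫ H.map (𝟙 f') θ := by
    rw [H.map_comp_map, Category.comp_id, Category.id_comp]
  have := G.isIso_hom (H.map (𝟙 f') θ)
  rw [e, e, cancel_mono] at h
  exact (H.map_bijective f f' g).1 h

/-- Faithfulness only concerns automorphisms `γ` of a 1-cell `t`. Adding a negative `n` of `t` turns
`γ` into an endomorphism of zero, to which 0-faithfulness applies, and adding `n` loses no
information. -/
theorem isFaithful_of_isZeroFaithful (H : HomAdd G) {f : A ⟶ B} (h : G.IsZeroFaithful f) :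
    IsFaithful f := by
  refine fun X => ⟨fun {s t} η θ hηθ => ?_⟩
  change η ▷ f = θ ▷ f at hηθ
  have iso {A B : C} {f g : A ⟶ B} (η : f ⟶ g) : IsIso η := G.isIso_hom η
  suffices inv η ≫ θ = 𝟙 t by rwa [IsIso.inv_comp_eq, Category.comp_id, eq_comm] at this
  have hγ : (inv η ≫ θ) ▷ f = 𝟙 _ := by rw [comp_whiskerRight, ← hηθ]; simp
  generalize inv η ≫ θ = γ at hγ
  obtain ⟨n, ⟨ν⟩⟩ := H.exists_neg t
  have e : H.map γ (𝟙 n) ▷ f = 𝟙 _ := by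
    rw [← cancel_mono (H.post f t n), H.post_naturality, hγ, id_whiskerRight, H.map_id]
    simp
  have e' := h (inv ν ≫ H.map γ (𝟙 n) ≫ ν) (by simp [e])
  rw [IsIso.inv_comp_eq, Category.comp_id, ← IsIso.eq_comp_inv, IsIso.hom_inv_id] at e'
  exact H.map_injective (e'.trans (H.map_id t n).symm)

theorem isCofaithful_of_isZeroCofaithful (H : HomAdd G) {f : A ⟶ B} (h : G.IsZeroCofaithful f) :
    IsCofaithful f := by
  refine fun Y => ⟨fun {s t} η θ hηθ => ?_⟩
  change f ◁ η = f ◁ θ at hηθ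
  have iso {A B : C} {f g : A ⟶ B} (η : f ⟶ g) : IsIso η := G.isIso_hom η
  suffices inv η ≫ θ = 𝟙 t by rwa [IsIso.inv_comp_eq, Category.comp_id, eq_comm] at this
  have hγ : f ◁ (inv η ≫ θ) = 𝟙 _ := by rw [whiskerLeft_comp, ← hηθ]; simp
  generalize inv η ≫ θ = γ at hγ
  obtain ⟨n, ⟨ν⟩⟩ := H.exists_neg t
  have e : f ◁ H.map γ (𝟙 n) = 𝟙 _ := by
    rw [← cancel_mono (H.pre f t n), H.pre_naturality, hγ, whiskerLeft_id, H.map_id]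
    simp
  have e' := h (inv ν ≫ H.map γ (𝟙 n) ≫ ν) (by simp [e])
  rw [IsIso.inv_comp_eq, Category.comp_id, ← IsIso.eq_comp_inv, IsIso.hom_inv_id] at e'
  exact H.map_injective (e'.trans (H.map_id t n).symm)

end HomAdd

end TwoCat

/-! ### Pushouts as cokernels of differences and the stability of (fully) 0-faithful 1-cells. -/

namespace TwoCat

open CategoryTheory Bicategory GpdStar

namespace HomAdd

variable {C : Type u} [Bicategory.{w, v} C] {G : GpdStar C} (H : HomAdd G) {A B D E P X Y Z : C}
  {i₁ : B ⟶ E} {i₂ : D ⟶ E}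

/-- The identity of a coproduct is the sum of the two projections. -/
theorem exists_hom_add_of_isCoproduct (hE : IsCoproduct i₁ i₂) {r₁ : E ⟶ B} {r₂ : E ⟶ D}
    (a₁₁ : i₁ ≫ r₁ ⟶ 𝟙 B) (a₁₂ : i₁ ≫ r₂ ⟶ G.zero B D) (a₂₁ : i₂ ≫ r₁ ⟶ G.zero D B)
    (a₂₂ : i₂ ≫ r₂ ⟶ 𝟙 D) : Nonempty (𝟙 E ⟶ H.add (r₁ ≫ i₁) (r₂ ≫ i₂)) := by
  obtain ⟨l⟩ := H.zero_add i₂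
  obtain ⟨r⟩ := H.add_zero i₁
  obtain ⟨τ, -, -⟩ := hE.unique_desc i₁ i₂ (𝟙 E) (ρ_ i₁).hom (ρ_ i₂).hom
    (H.add (r₁ ≫ i₁) (r₂ ≫ i₂))
    (H.pre _ _ _ ≫ H.map ((α_ _ _ _).inv ≫ a₁₁ ▷ i₁ ≫ (λ_ i₁).hom)
      ((α_ _ _ _).inv ≫ G.compNull a₁₂ i₂) ≫ r)
    (H.pre _ _ _ ≫ H.map ((α_ _ _ _).inv ≫ G.compNull a₂₁ i₁)
      ((α_ _ _ _).inv ≫ a₂₂ ▷ i₂ ≫ (λ_ i₂).hom) ≫ l)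
  exact ⟨τ⟩

variable [IsLocallyGroupoid C]

/-- The identity of `E` is the sum of the 1-cells through the two summands, so a 2-cell into `E` can
be recovered from its two projections. -/
theorem whiskerRight_ext {r₁ : E ⟶ B} {r₂ : E ⟶ D} (e : 𝟙 E ⟶ H.add (r₁ ≫ i₁) (r₂ ≫ i₂))
    {x x' : X ⟶ E} {θ θ' : x ⟶ x'} (h₁ : θ ▷ r₁ = θ' ▷ r₁) (h₂ : θ ▷ r₂ = θ' ▷ r₂) : θ = θ' := by
  have h : θ ▷ H.add (r₁ ≫ i₁) (r₂ ≫ i₂) = θ' ▷ H.add (r₁ ≫ i₁) (r₂ ≫ i₂) := by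
    rw [← cancel_mono (H.pre x' _ _), H.whiskerRight_pre, H.whiskerRight_pre]
    simp only [whiskerRight_comp, h₁, h₂]
  have h' : θ ▷ 𝟙 E = θ' ▷ 𝟙 E := by
    rw [← cancel_mono (x' ◁ e), ← whisker_exchange, ← whisker_exchange, h]
  rw [← cancel_epi (ρ_ x).hom, ← rightUnitor_naturality, h', rightUnitor_naturality]

theorem inv_map {f f' g g' : A ⟶ B} (η : f ⟶ f') (θ : g ⟶ g') :
    inv (H.map η θ) = H.map (inv η) (inv θ) := by
  rw [IsIso.inv_eq_of_hom_inv_id]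
  rw [H.map_comp_map, IsIso.hom_inv_id, IsIso.hom_inv_id, H.map_id]

section Difference

variable {m l n : A ⟶ E} (ν : H.add l n ⟶ G.zero A E)

/-- If `n` is a negative of `l`, then a 2-cell between the composites of `m` and `l` with `y`
trivializes the composite of the difference of `m` and `l` with `y`. -/
noncomputable def nullOfHom (y : E ⟶ Y) (θ : m ≫ y ⟶ l ≫ y) : H.add m n ≫ y ⟶ G.zero A Y :=
  H.post y m n ≫ H.map θ (𝟙 (n ≫ y)) ≫ inv (H.post y l n) ≫ G.compNull ν y

/-- Adding `n ≫ y` is fully faithful on 2-cells and all the other factors are invertible. -/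
theorem nullOfHom_bijective (y : E ⟶ Y) :
    Function.Bijective (H.nullOfHom ν y : (m ≫ y ⟶ l ≫ y) → _) := by
  constructor
  · intro θ θ' h
    simp only [nullOfHom, cancel_epi, compNull, cancel_mono] at h
    exact (H.map_bijective _ _ _).1 h
  · intro ξ
    obtain ⟨θ, hθ⟩ := (H.map_bijective (m ≫ y) (l ≫ y) (n ≫ y)).2
      (inv (H.post y m n) ≫ ξ ≫ inv (inv (H.post y l n) ≫ G.compNull ν y))
    have : IsIso (G.compNull ν y) := inferInstance
    refine ⟨θ, ?_⟩
    dsimp only at hθ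
    rw [nullOfHom, hθ]
    simp

/-- With `compNull_nullOfHom`, this translates the compatibility of a 2-cell with nullities of the
difference into compatibility with 2-cells between the two terms, that is, cokernel conditions into
pushout conditions. -/
theorem whiskerLeft_nullOfHom {y y' : E ⟶ Y} (κ : y ⟶ y') (θ : m ≫ y ⟶ l ≫ y)
    (θ' : m ≫ y' ⟶ l ≫ y') :
    H.add m n ◁ κ ≫ H.nullOfHom ν y' θ' = H.nullOfHom ν y θ ↔ m ◁ κ ≫ θ' = θ ≫ l ◁ κ := by
  have h₁ : H.add m n ◁ κ ≫ H.nullOfHom ν y' θ' = H.post y m n ≫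
      H.map (m ◁ κ ≫ θ') (n ◁ κ) ≫ inv (H.post y' l n) ≫ G.compNull ν y' := by
    rw [nullOfHom, reassoc_of% (H.whiskerLeft_post κ m n), reassoc_of% (H.map_comp_map),
      Category.comp_id]
  have h₂ : H.nullOfHom ν y θ = H.post y m n ≫
      H.map (θ ≫ l ◁ κ) (n ◁ κ) ≫ inv (H.post y' l n) ≫ G.compNull ν y' := by
    have e : inv (H.post y l n) ≫ H.add l n ◁ κ = H.map (l ◁ κ) (n ◁ κ) ≫ inv (H.post y' l n) := by
      rw [IsIso.inv_comp_eq, ← Category.assoc, IsIso.eq_comp_inv, H.whiskerLeft_post]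
    rw [nullOfHom, ← G.whiskerLeft_compNull ν κ, reassoc_of% e, reassoc_of% (H.map_comp_map),
      Category.id_comp]
  have e (a : m ≫ y ⟶ l ≫ y') : H.map a (n ◁ κ) = H.map a (𝟙 _) ≫ H.map (𝟙 _) (n ◁ κ) := by
    rw [H.map_comp_map, Category.comp_id, Category.id_comp]
  rw [h₁, h₂, cancel_epi, cancel_mono, e, e, cancel_mono]
  exact (H.map_bijective _ _ _).1.eq_iff

theorem compNull_nullOfHom (y : E ⟶ Y) (θ : m ≫ y ⟶ l ≫ y) (z : Y ⟶ Z) :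
    (α_ _ _ _).inv ≫ G.compNull (H.nullOfHom ν y θ) z =
      H.nullOfHom ν (y ≫ z) ((α_ _ _ _).inv ≫ θ ▷ z ≫ (α_ _ _ _).hom) := by
  have h := H.post_naturality z θ (𝟙 (n ≫ y))
  rw [id_whiskerRight] at h
  have e : inv (H.post (y ≫ z) l n) = inv (H.map (α_ l y z).hom (α_ n y z).hom) ≫
      inv (H.post z (l ≫ y) (n ≫ y)) ≫ inv (H.post y l n ▷ z) ≫ (α_ (H.add l n) y z).hom := by
    rw [H.post_comp]
    simp
  rw [nullOfHom, nullOfHom, e, H.post_comp, G.compNull_comp, H.inv_map]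
  simp only [Category.assoc, Iso.hom_inv_id_assoc]
  rw [reassoc_of% (H.map_comp_map), reassoc_of% (H.map_comp_map)]
  simp only [Category.assoc, IsIso.Iso.inv_hom, Iso.hom_inv_id_assoc, Iso.hom_inv_id,
    Category.comp_id]
  rw [← reassoc_of% h, IsIso.hom_inv_id_assoc, ← whiskerRight_compNull,
    ← whiskerRight_compNull, ← whiskerRight_compNull, inv_whiskerRight]

end Difference

section Pushout

variable {f : A ⟶ B} {g : A ⟶ D} {i : B ⟶ P} {j : D ⟶ P} {γ : f ≫ i ⟶ g ≫ j}
  {q : E ⟶ P} {n : A ⟶ E}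

/-- A pushout of `f` and `g` is a cokernel of the difference of `f` and `g` in the coproduct. -/
theorem isCokernel_of_isPushoutSq (hγ : IsPushoutSq γ) (hE : IsCoproduct i₁ i₂)
    (e₁ : i₁ ≫ q ⟶ i) (e₂ : i₂ ≫ q ⟶ j) (ν : H.add (g ≫ i₂) n ⟶ G.zero A E) :
    G.IsCokernel (H.add (f ≫ i₁) n) q (H.nullOfHom ν q
      ((α_ _ _ _).hom ≫ f ◁ e₁ ≫ γ ≫ g ◁ inv e₂ ≫ (α_ _ _ _).inv)) := by
  set k := H.add (f ≫ i₁) n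
  set θ := (α_ _ _ _).hom ≫ f ◁ e₁ ≫ γ ≫ g ◁ inv e₂ ≫ (α_ _ _ _).inv with hθ
  -- The cokernel condition on `κ` is the pushout condition on its restrictions along `i₁` and `i₂`.
  have key {Y : C} (y : E ⟶ Y) (δ : (f ≫ i₁) ≫ y ⟶ (g ≫ i₂) ≫ y) (t : P ⟶ Y) (κ : q ≫ t ⟶ y) :
      k ◁ κ ≫ H.nullOfHom ν y δ =
        (α_ _ _ _).inv ≫ H.nullOfHom ν q θ ▷ t ≫ (G.zeroComp A t).hom ↔
      f ◁ (inv e₁ ▷ t ≫ (α_ _ _ _).hom ≫ i₁ ◁ κ) ≫ (α_ _ _ _).inv ≫ δ ≫ (α_ _ _ _).hom =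
        (α_ f i t).inv ≫ γ ▷ t ≫ (α_ g j t).hom ≫
          g ◁ (inv e₂ ▷ t ≫ (α_ _ _ _).hom ≫ i₂ ◁ κ) := by
    change _ = (α_ _ _ _).inv ≫ G.compNull (H.nullOfHom ν q θ) t ↔ _
    have a₁ (e : i ⟶ i₁ ≫ q) : f ◁ e ▷ t ≫ f ◁ (α_ i₁ q t).hom ≫ (α_ f i₁ (q ≫ t)).inv ≫
        (α_ (f ≫ i₁) q t).inv ≫ (α_ f i₁ q).hom ▷ t = (α_ f i t).inv ≫ (f ◁ e) ▷ t := by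
      bicategory
    have a₂ (e : j ⟶ i₂ ≫ q) : (g ◁ e) ▷ t ≫ (α_ g i₂ q).inv ▷ t ≫ (α_ (g ≫ i₂) q t).hom ≫
        (g ≫ i₂) ◁ κ ≫ (α_ g i₂ y).hom =
        (α_ g j t).hom ≫ g ◁ (e ▷ t ≫ (α_ i₂ q t).hom ≫ i₂ ◁ κ) := by
      bicategory
    rw [H.compNull_nullOfHom, H.whiskerLeft_nullOfHom,
      ← cancel_epi (f ◁ inv e₁ ▷ t ≫ f ◁ (α_ _ _ _).hom ≫ (α_ _ _ _).inv),
      ← cancel_mono (α_ g i₂ y).hom, hθ]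
    simp only [comp_whiskerRight, Category.assoc]
    rw [a₂, reassoc_of% a₁, ← comp_whiskerRight_assoc, ← whiskerLeft_comp, IsIso.inv_hom_id]
    simp
  -- By the coproduct property, a 2-cell from `q ≫ t` to `y` amounts to a pair of 2-cells on the
  -- summands.
  have desc {Y : C} {y : E ⟶ Y} {t : P ⟶ Y} (σ : i ≫ t ⟶ i₁ ≫ y) (τ : j ≫ t ⟶ i₂ ≫ y) :
      ∃ κ : q ≫ t ⟶ y, inv e₁ ▷ t ≫ (α_ _ _ _).hom ≫ i₁ ◁ κ = σ ∧
        inv e₂ ▷ t ≫ (α_ _ _ _).hom ≫ i₂ ◁ κ = τ := by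
    obtain ⟨κ, ⟨h₁, h₂⟩, -⟩ := hE.unique_desc (i₁ ≫ y) (i₂ ≫ y) (q ≫ t)
      ((α_ _ _ _).inv ≫ e₁ ▷ t ≫ σ) ((α_ _ _ _).inv ≫ e₂ ▷ t ≫ τ) y (𝟙 _) (𝟙 _)
    rw [Category.comp_id] at h₁ h₂
    exact ⟨κ, by simp [h₁], by simp [h₂]⟩
  constructor
  · intro Y y ξ
    obtain ⟨δ, rfl⟩ := (H.nullOfHom_bijective ν y).2 ξ
    obtain ⟨t, σ, τ, h⟩ := hγ.exists_desc (i₁ ≫ y) (i₂ ≫ y)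
      ((α_ _ _ _).inv ≫ δ ≫ (α_ _ _ _).hom)
    obtain ⟨κ, rfl, rfl⟩ := desc σ τ
    exact ⟨t, κ, (key y δ t κ).2 h⟩
  · intro Y y ξ t κ t' κ' h h'
    obtain ⟨δ, rfl⟩ := (H.nullOfHom_bijective ν y).2 ξ
    obtain ⟨ω, ⟨h₁, h₂⟩, hω⟩ := hγ.unique_desc _ _ _ t _ _ t' _ _ ((key y δ t κ).1 h)
      ((key y δ t' κ').1 h')
    have e (ω : t ⟶ t') : (i ◁ ω ≫ inv e₁ ▷ t' ≫ (α_ _ _ _).hom ≫ i₁ ◁ κ' =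
          inv e₁ ▷ t ≫ (α_ _ _ _).hom ≫ i₁ ◁ κ ↔ i₁ ◁ (q ◁ ω ≫ κ') = i₁ ◁ κ) ∧
        (j ◁ ω ≫ inv e₂ ▷ t' ≫ (α_ _ _ _).hom ≫ i₂ ◁ κ' =
          inv e₂ ▷ t ≫ (α_ _ _ _).hom ≫ i₂ ◁ κ ↔ i₂ ◁ (q ◁ ω ≫ κ') = i₂ ◁ κ) := by
      constructor
      · rw [whisker_exchange_assoc, cancel_epi, comp_whiskerLeft]
        simp
      · rw [whisker_exchange_assoc, cancel_epi, comp_whiskerLeft]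
        simp
    refine ⟨ω, ?_, fun ω' h => hω ω' ⟨(e ω').1.2 (congrArg (i₁ ◁ ·) h),
      (e ω').2.2 (congrArg (i₂ ◁ ·) h)⟩⟩
    obtain ⟨_, -, u⟩ := hE.unique_desc (i₁ ≫ y) (i₂ ≫ y) (q ≫ t) (i₁ ◁ κ) (i₂ ◁ κ) y (𝟙 _) (𝟙 _)
    exact (u _ ⟨by simpa using (e ω).1.1 h₁, by simpa using (e ω).2.1 h₂⟩).trans
      (u _ ⟨by simp, by simp⟩).symm

/-- The projection `r₁` annihilates `g ≫ i₂`, hence also its negative `n`, so only the first term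
`f` survives. -/
theorem nonempty_difference_comp {r₁ : E ⟶ B} (a₁₁ : i₁ ≫ r₁ ⟶ 𝟙 B) (a₂₁ : i₂ ≫ r₁ ⟶ G.zero D B)
    (ν : H.add (g ≫ i₂) n ⟶ G.zero A E) : Nonempty (H.add (f ≫ i₁) n ≫ r₁ ⟶ f) := by
  obtain ⟨l⟩ := H.zero_add (n ≫ r₁)
  obtain ⟨r⟩ := H.add_zero f
  have z : n ≫ r₁ ⟶ G.zero A B := inv l ≫ H.map
    (inv ((α_ _ _ _).hom ≫ G.nullComp g a₂₁)) (𝟙 _) ≫ inv (H.post r₁ _ _) ≫ G.compNull ν r₁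
  exact ⟨H.post r₁ _ _ ≫ H.map ((α_ _ _ _).hom ≫ f ◁ a₁₁ ≫ (ρ_ f).hom) z ≫ r⟩

/-- The difference `k` inherits 0-faithfulness from `f` through `r₁`, so it is the kernel of its
cokernel, and the 1-cell `q` to the pushout is such a cokernel. The auxiliary data are collected
here for the two stability results that follow. -/
theorem exists_isKernel_of_isPushoutSq (H : HomAdd G) (hC : HasCoproducts C)
    (hK : ∀ {A B : C} (f : A ⟶ B), G.IsZeroFaithful f → G.IsKerOfCok f) (hγ : IsPushoutSq γ)
    (hf : G.IsZeroFaithful f) :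
    ∃ (E : C) (i₂ : D ⟶ E) (r₁ : E ⟶ B) (r₂ : E ⟶ D) (q : E ⟶ P) (k : A ⟶ E)
      (π : k ≫ q ⟶ G.zero A P), G.IsKernel q k π ∧ Nonempty (k ≫ r₁ ⟶ f) ∧
      Nonempty (i₂ ≫ q ⟶ j) ∧ Nonempty (i₂ ≫ r₁ ⟶ G.zero D B) ∧ Nonempty (i₂ ≫ r₂ ⟶ 𝟙 D) ∧
      ∀ {X : C} {x x' : X ⟶ E} {θ θ' : x ⟶ x'}, θ ▷ r₁ = θ' ▷ r₁ → θ ▷ r₂ = θ' ▷ r₂ → θ = θ' := by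
  obtain ⟨E, i₁, i₂, hE⟩ := hC B D
  obtain ⟨r₁, ⟨a₁₁⟩, ⟨a₂₁⟩⟩ := hE.exists_desc (𝟙 B) (G.zero D B)
  obtain ⟨r₂, ⟨a₁₂⟩, ⟨a₂₂⟩⟩ := hE.exists_desc (G.zero B D) (𝟙 D)
  obtain ⟨q, ⟨e₁⟩, ⟨e₂⟩⟩ := hE.exists_desc i j
  obtain ⟨n, ⟨ν⟩⟩ := H.exists_neg (g ≫ i₂)
  obtain ⟨e⟩ := H.exists_hom_add_of_isCoproduct hE a₁₁ a₁₂ a₂₁ a₂₂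
  obtain ⟨κ⟩ := H.nonempty_difference_comp (f := f) a₁₁ a₂₁ ν
  have hk : G.IsZeroFaithful (H.add (f ≫ i₁) n) := by
    intro X α hα
    exact hf α (whiskerRight_eq_id_of_hom (inv κ) (by simp [hα]))
  exact ⟨E, i₂, r₁, r₂, q, _, _, (hK _ hk).isKernel (H.isCokernel_of_isPushoutSq hγ hE e₁ e₂ ν),
    ⟨κ⟩, ⟨e₂⟩, ⟨a₂₁⟩, ⟨a₂₂⟩, H.whiskerRight_ext e⟩

/-- If `j` trivializes `α`, then `q` trivializes `α ▷ i₂`, which therefore comes from an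
endomorphism `τ` of zero through the kernel `k`. Projecting by `r₁` shows that `f` trivializes `τ`,
because `i₂ ≫ r₁` is null. So `τ`, then `α ▷ i₂`, and by the retraction `r₂` also `α`, are trivial.
-/
theorem isZeroFaithful_of_isPushoutSq (H : HomAdd G) (hC : HasCoproducts C)
    (hK : ∀ {A B : C} (f : A ⟶ B), G.IsZeroFaithful f → G.IsKerOfCok f) (hγ : IsPushoutSq γ)
    (hf : G.IsZeroFaithful f) : G.IsZeroFaithful j := by
  obtain ⟨E, i₂, r₁, r₂, q, k, π, hk, ⟨κ⟩, ⟨e₂⟩, ⟨a₂₁⟩, ⟨a₂₂⟩, -⟩ :=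
    H.exists_isKernel_of_isPushoutSq hC hK hγ hf
  intro X α hα
  have hq : α ▷ i₂ ▷ q = 𝟙 _ := by
    have h : α ▷ (i₂ ≫ q) = 𝟙 _ := whiskerRight_eq_id_of_hom e₂ hα
    rw [whiskerRight_comp, Iso.inv_comp_eq, Category.comp_id, ← Iso.eq_comp_inv] at h
    simpa using h
  have hr : α ▷ i₂ ▷ r₁ = 𝟙 _ := by
    have h : α ▷ (i₂ ≫ r₁) = 𝟙 _ := whiskerRight_eq_id_of_hom a₂₁ (by
      rw [← cancel_mono (G.compZero _ _).hom, G.compZero_naturality, Category.id_comp])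
    rw [whiskerRight_comp, Iso.inv_comp_eq, Category.comp_id, ← Iso.eq_comp_inv] at h
    simpa using h
  have c : G.compNull (G.compNull (𝟙 (G.zero X A)) k) q = _ := G.compNull_nullComp _ π
  obtain ⟨τ, hτ, -⟩ := hk.unique_lift (G.zero X E) (G.zeroComp X q).hom (G.zero X A)
    ((G.zeroComp X k).hom ≫ (G.zeroComp X i₂).inv ≫ α ▷ i₂ ≫ (G.zeroComp X i₂).hom) (G.zero X A)
    (G.zeroComp X k).hom
    (by
      simp only [comp_whiskerRight, Category.assoc, hq, Category.id_comp]
      rw [← comp_whiskerRight_assoc (G.zeroComp X i₂).inv]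
      simpa [compNull, nullComp] using c)
    (by simpa [compNull, nullComp] using c)
  rw [← Iso.eq_comp_inv] at hτ
  have e : α ▷ i₂ = 𝟙 _ := by
    have hτ' : τ = 𝟙 _ := by
      refine hf τ (whiskerRight_eq_id_of_hom (inv κ) ?_)
      rw [whiskerRight_comp, hτ]
      simp only [comp_whiskerRight, hr, Category.id_comp, Category.assoc]
      simp
    rw [hτ', id_whiskerRight] at hτ
    rw [eq_comm, Iso.comp_inv_eq, Category.id_comp] at hτ
    rw [← cancel_mono (G.zeroComp X i₂).hom, ← cancel_epi (G.zeroComp X i₂).inv,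
      ← cancel_epi (G.zeroComp X k).hom, hτ]
    simp
  exact eq_id_of_whiskerRight_id (whiskerRight_eq_id_of_hom (inv a₂₂) (by simp [e]))

/-- If `d ≫ j` is null, then `d ≫ i₂` factors through the kernel `k` as `t`. Projecting by `r₁`
makes `t ≫ f` null, hence `t` is null since `f` is fully 0-faithful. This nullifies `d ≫ i₂`, and
`r₂` brings the nullity back to `d`. Uniqueness is the faithfulness of `j`. -/
theorem isFullyZeroFaithful_of_isPushoutSq (H : HomAdd G) (hC : HasCoproducts C)
    (hK : ∀ {A B : C} (f : A ⟶ B), G.IsZeroFaithful f → G.IsKerOfCok f) (hγ : IsPushoutSq γ)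
    (hf : G.IsFullyZeroFaithful f) : G.IsFullyZeroFaithful j := by
  have hj := H.isFaithful_of_isZeroFaithful
    (H.isZeroFaithful_of_isPushoutSq hC hK hγ hf.isZeroFaithful)
  obtain ⟨E, i₂, r₁, r₂, q, k, π, hk, ⟨κ⟩, ⟨e₂⟩, ⟨a₂₁⟩, ⟨a₂₂⟩, ext⟩ :=
    H.exists_isKernel_of_isPushoutSq hC hK hγ hf.isZeroFaithful
  intro X d β
  have := hj X
  refine existsUnique_of_exists_of_unique ?_ fun α α' h h' =>
    (postcomp X j).map_injective ((cancel_mono (G.zeroComp X j).hom).1 (h.trans h'.symm))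
  obtain ⟨t, σ, hσ⟩ := hk.exists_lift (d ≫ i₂) ((α_ _ _ _).hom ≫ d ◁ e₂ ≫ β)
  obtain ⟨τ, hτ, -⟩ := hf t
    (t ◁ inv κ ≫ (α_ _ _ _).inv ≫ σ ▷ r₁ ≫ (α_ _ _ _).hom ≫ G.nullComp d a₂₁)
  replace hτ : G.compNull τ f = _ := hτ
  replace hσ : _ = (α_ _ _ _).hom ≫ G.nullComp t π := hσ
  -- The nullity of `d ≫ i₂` induced by that of `t`. Its image under `q` is the given `β`, and its
  -- image under `r₁` is the canonical nullity, so it comes from a nullity of `d`, as joint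
  -- faithfulness of `r₁` and `r₂` confirms.
  set σ₀ := inv σ ≫ G.compNull τ k with hσ₀
  have e₁ : G.compNull σ₀ r₁ = (α_ _ _ _).hom ≫ G.nullComp d a₂₁ := by
    have h := G.compNull_comp τ k r₁
    rw [Iso.eq_inv_comp] at h
    rw [hσ₀, ← whiskerRight_compNull, ← h, ← G.whiskerLeft_compNull τ κ, hτ]
    simp
  have e₃ : G.compNull σ₀ q = (α_ _ _ _).hom ≫ d ◁ e₂ ≫ β := by
    rw [hσ₀, ← whiskerRight_compNull, compNull_nullComp, ← hσ]
    simp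
  obtain ⟨α, h⟩ : ∃ α : d ⟶ G.zero X D, G.compNull α i₂ = σ₀ := by
    refine ⟨(ρ_ d).inv ≫ d ◁ inv a₂₂ ≫ (α_ _ _ _).inv ≫ G.compNull σ₀ r₂, ?_⟩
    set α := (ρ_ d).inv ≫ d ◁ inv a₂₂ ≫ (α_ _ _ _).inv ≫ G.compNull σ₀ r₂ with hα
    have c {V : C} (r : E ⟶ V) : G.compNull (G.compNull α i₂) r = (α_ _ _ _).hom ≫
        G.compNull α (i₂ ≫ r) := by
      rw [G.compNull_comp, Iso.hom_inv_id_assoc]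
    refine ext ((cancel_mono (G.zeroComp X r₁).hom).1 ?_) ((cancel_mono (G.zeroComp X r₂).hom).1 ?_)
    · change G.compNull (G.compNull α i₂) r₁ = G.compNull σ₀ r₁
      rw [e₁, c, ← G.whiskerLeft_compNull α a₂₁, compNull_zero, nullComp]
    · change G.compNull (G.compNull α i₂) r₂ = G.compNull σ₀ r₂
      rw [c, ← G.whiskerLeft_compNull α a₂₂, compNull_id, hα]
      simp
  refine ⟨α, (?_ : G.compNull α j = β)⟩
  rw [← G.whiskerLeft_compNull α (inv e₂), G.compNull_comp, h, e₃]
  simp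

end Pushout

end HomAdd

end TwoCat

/-! ### Pullbacks as kernels of differences, dually; relatively exact 2-categories are abelian. -/

namespace TwoCat

open CategoryTheory Bicategory GpdStar

namespace HomAdd

variable {C : Type u} [Bicategory.{w, v} C] {G : GpdStar C} (H : HomAdd G) {A B D E P X Y Z : C}
  {p₁ : E ⟶ A} {p₂ : E ⟶ D}

/-- The identity of a product is the sum of the two projections followed by the injections. -/
theorem exists_hom_add_of_isProduct (hE : IsProduct p₁ p₂) {s₁ : A ⟶ E} {s₂ : D ⟶ E}
    (a₁₁ : s₁ ≫ p₁ ⟶ 𝟙 A) (a₁₂ : s₁ ≫ p₂ ⟶ G.zero A D) (a₂₁ : s₂ ≫ p₁ ⟶ G.zero D A)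
    (a₂₂ : s₂ ≫ p₂ ⟶ 𝟙 D) : Nonempty (𝟙 E ⟶ H.add (p₁ ≫ s₁) (p₂ ≫ s₂)) := by
  obtain ⟨l⟩ := H.zero_add p₂
  obtain ⟨r⟩ := H.add_zero p₁
  obtain ⟨τ, -, -⟩ := hE.unique_lift p₁ p₂ (𝟙 E) (λ_ p₁).hom (λ_ p₂).hom
    (H.add (p₁ ≫ s₁) (p₂ ≫ s₂))
    (H.post _ _ _ ≫ H.map ((α_ _ _ _).hom ≫ p₁ ◁ a₁₁ ≫ (ρ_ p₁).hom)
      ((α_ _ _ _).hom ≫ G.nullComp p₂ a₂₁) ≫ r)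
    (H.post _ _ _ ≫ H.map ((α_ _ _ _).hom ≫ G.nullComp p₁ a₁₂)
      ((α_ _ _ _).hom ≫ p₂ ◁ a₂₂ ≫ (ρ_ p₂).hom) ≫ l)
  exact ⟨τ⟩

variable [IsLocallyGroupoid C]

/-- Dually, the identity of the product is a sum of 1-cells through the factors, so a 2-cell out of
`E` is recovered from its restrictions along `s₁` and `s₂`. -/
theorem whiskerLeft_ext {s₁ : A ⟶ E} {s₂ : D ⟶ E} (e : 𝟙 E ⟶ H.add (p₁ ≫ s₁) (p₂ ≫ s₂))
    {y y' : E ⟶ Y} {θ θ' : y ⟶ y'} (h₁ : s₁ ◁ θ = s₁ ◁ θ') (h₂ : s₂ ◁ θ = s₂ ◁ θ') : θ = θ' := by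
  have h : H.add (p₁ ≫ s₁) (p₂ ≫ s₂) ◁ θ = H.add (p₁ ≫ s₁) (p₂ ≫ s₂) ◁ θ' := by
    rw [← cancel_mono (H.post y' _ _), H.whiskerLeft_post, H.whiskerLeft_post]
    simp only [comp_whiskerLeft, h₁, h₂]
  have h' : 𝟙 E ◁ θ = 𝟙 E ◁ θ' := by
    rw [← cancel_mono (e ▷ y'), whisker_exchange, whisker_exchange, h]
  rw [← cancel_epi (λ_ y).hom, ← leftUnitor_naturality, h', leftUnitor_naturality]

section Difference

variable {m l n : E ⟶ B} (ν : H.add l n ⟶ G.zero E B)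

/-- If `n` is a negative of `l`, then a 2-cell between the composites of `x` with `m` and `l`
trivializes the composite of `x` with the difference of `m` and `l`. -/
noncomputable def homNull (x : X ⟶ E) (θ : x ≫ m ⟶ x ≫ l) : x ≫ H.add m n ⟶ G.zero X B :=
  H.pre x m n ≫ H.map θ (𝟙 (x ≫ n)) ≫ inv (H.pre x l n) ≫ G.nullComp x ν

theorem homNull_bijective (x : X ⟶ E) :
    Function.Bijective (H.homNull ν x : (x ≫ m ⟶ x ≫ l) → _) := by
  constructor
  · intro θ θ' h
    simp only [homNull, cancel_epi, nullComp, cancel_mono] at h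
    exact (H.map_bijective _ _ _).1 h
  · intro ξ
    obtain ⟨θ, hθ⟩ := (H.map_bijective (x ≫ m) (x ≫ l) (x ≫ n)).2
      (inv (H.pre x m n) ≫ ξ ≫ inv (inv (H.pre x l n) ≫ G.nullComp x ν))
    have : IsIso (G.nullComp x ν) := inferInstance
    refine ⟨θ, ?_⟩
    dsimp only at hθ
    rw [homNull, hθ]
    simp

theorem whiskerRight_homNull {x x' : X ⟶ E} (κ : x ⟶ x') (θ : x ≫ m ⟶ x ≫ l)
    (θ' : x' ≫ m ⟶ x' ≫ l) :
    κ ▷ H.add m n ≫ H.homNull ν x' θ' = H.homNull ν x θ ↔ κ ▷ m ≫ θ' = θ ≫ κ ▷ l := by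
  have h₁ : κ ▷ H.add m n ≫ H.homNull ν x' θ' = H.pre x m n ≫
      H.map (κ ▷ m ≫ θ') (κ ▷ n) ≫ inv (H.pre x' l n) ≫ G.nullComp x' ν := by
    rw [homNull, reassoc_of% (H.whiskerRight_pre κ m n), reassoc_of% (H.map_comp_map),
      Category.comp_id]
  have h₂ : H.homNull ν x θ = H.pre x m n ≫
      H.map (θ ≫ κ ▷ l) (κ ▷ n) ≫ inv (H.pre x' l n) ≫ G.nullComp x' ν := by
    have e : inv (H.pre x l n) ≫ κ ▷ H.add l n = H.map (κ ▷ l) (κ ▷ n) ≫ inv (H.pre x' l n) := by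
      rw [IsIso.inv_comp_eq, ← Category.assoc, IsIso.eq_comp_inv, H.whiskerRight_pre]
    rw [homNull, ← G.whiskerRight_nullComp κ ν, reassoc_of% e, reassoc_of% (H.map_comp_map),
      Category.id_comp]
  have e (a : x ≫ m ⟶ x' ≫ l) : H.map a (κ ▷ n) = H.map a (𝟙 _) ≫ H.map (𝟙 _) (κ ▷ n) := by
    rw [H.map_comp_map, Category.comp_id, Category.id_comp]
  rw [h₁, h₂, cancel_epi, cancel_mono, e, e, cancel_mono]
  exact (H.map_bijective _ _ _).1.eq_iff

theorem nullComp_homNull (x : X ⟶ E) (θ : x ≫ m ⟶ x ≫ l) (z : Z ⟶ X) :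
    (α_ _ _ _).hom ≫ G.nullComp z (H.homNull ν x θ) =
      H.homNull ν (z ≫ x) ((α_ _ _ _).hom ≫ z ◁ θ ≫ (α_ _ _ _).inv) := by
  have h := H.pre_naturality z θ (𝟙 (x ≫ n))
  rw [whiskerLeft_id] at h
  have e : inv (H.pre (z ≫ x) l n) = inv (H.map (α_ z x l).inv (α_ z x n).inv) ≫
      inv (H.pre z (x ≫ l) (x ≫ n)) ≫ inv (z ◁ H.pre x l n) ≫ (α_ z x (H.add l n)).inv := by
    rw [H.pre_comp]
    simp
  rw [homNull, homNull, e, H.pre_comp, G.comp_nullComp, H.inv_map]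
  simp only [Category.assoc, Iso.inv_hom_id_assoc]
  rw [reassoc_of% (H.map_comp_map), reassoc_of% (H.map_comp_map)]
  simp only [Category.assoc, IsIso.Iso.inv_inv, Iso.inv_hom_id_assoc, Iso.inv_hom_id,
    Category.comp_id]
  rw [← reassoc_of% h, IsIso.hom_inv_id_assoc, ← whiskerLeft_nullComp,
    ← whiskerLeft_nullComp, ← whiskerLeft_nullComp, inv_whiskerLeft]

end Difference

section Pullback

variable {f : A ⟶ B} {g : D ⟶ B} {p : P ⟶ A} {q : P ⟶ D} {γ : p ≫ f ⟶ q ≫ g}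
  {k : P ⟶ E} {n : E ⟶ B}

/-- A pullback of `f` and `g` is a kernel of the difference of `f` and `g` on the product. -/
theorem isKernel_of_isPullbackSq (hγ : IsPullbackSq γ) (hE : IsProduct p₁ p₂)
    (e₁ : k ≫ p₁ ⟶ p) (e₂ : k ≫ p₂ ⟶ q) (ν : H.add (p₂ ≫ g) n ⟶ G.zero E B) :
    G.IsKernel (H.add (p₁ ≫ f) n) k (H.homNull ν k
      ((α_ _ _ _).inv ≫ e₁ ▷ f ≫ γ ≫ inv e₂ ▷ g ≫ (α_ _ _ _).hom)) := by
  set c := H.add (p₁ ≫ f) n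
  set θ := (α_ _ _ _).inv ≫ e₁ ▷ f ≫ γ ≫ inv e₂ ▷ g ≫ (α_ _ _ _).hom with hθ
  -- The kernel condition on `κ` is the pullback condition on its two projections.
  have key {X : C} (x : X ⟶ E) (δ : x ≫ p₁ ≫ f ⟶ x ≫ p₂ ≫ g) (t : X ⟶ P) (κ : t ≫ k ⟶ x) :
      κ ▷ c ≫ H.homNull ν x δ =
        (α_ _ _ _).hom ≫ t ◁ H.homNull ν k θ ≫ (G.compZero t B).hom ↔
      (t ◁ inv e₁ ≫ (α_ _ _ _).inv ≫ κ ▷ p₁) ▷ f ≫ (α_ _ _ _).hom ≫ δ ≫ (α_ _ _ _).inv =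
        (α_ t p f).hom ≫ t ◁ γ ≫ (α_ t q g).inv ≫
          (t ◁ inv e₂ ≫ (α_ _ _ _).inv ≫ κ ▷ p₂) ▷ g := by
    change _ = (α_ _ _ _).hom ≫ G.nullComp t (H.homNull ν k θ) ↔ _
    have a₁ (e : p ⟶ k ≫ p₁) : (t ◁ e) ▷ f ≫ (α_ t k p₁).inv ▷ f ≫ (α_ (t ≫ k) p₁ f).hom ≫
        (α_ t k (p₁ ≫ f)).hom ≫ t ◁ (α_ k p₁ f).inv = (α_ t p f).hom ≫ t ◁ e ▷ f := by
      bicategory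
    have a₂ (e : q ⟶ k ≫ p₂) : t ◁ e ▷ g ≫ t ◁ (α_ k p₂ g).hom ≫ (α_ t k (p₂ ≫ g)).inv ≫
        κ ▷ (p₂ ≫ g) ≫ (α_ x p₂ g).inv =
        (α_ t q g).inv ≫ (t ◁ e ≫ (α_ t k p₂).inv ≫ κ ▷ p₂) ▷ g := by
      bicategory
    rw [H.nullComp_homNull, H.whiskerRight_homNull,
      ← cancel_epi ((t ◁ inv e₁) ▷ f ≫ (α_ _ _ _).inv ▷ f ≫ (α_ _ _ _).hom),
      ← cancel_mono (α_ x p₂ g).inv, hθ]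
    simp only [whiskerLeft_comp, Category.assoc]
    rw [a₂, reassoc_of% a₁, ← whiskerLeft_comp_assoc, ← comp_whiskerRight, IsIso.inv_hom_id]
    simp
  have lift {X : C} {x : X ⟶ E} {t : X ⟶ P} (σ : t ≫ p ⟶ x ≫ p₁) (τ : t ≫ q ⟶ x ≫ p₂) :
      ∃ κ : t ≫ k ⟶ x, t ◁ inv e₁ ≫ (α_ _ _ _).inv ≫ κ ▷ p₁ = σ ∧
        t ◁ inv e₂ ≫ (α_ _ _ _).inv ≫ κ ▷ p₂ = τ := by
    obtain ⟨κ, ⟨h₁, h₂⟩, -⟩ := hE.unique_lift (x ≫ p₁) (x ≫ p₂) (t ≫ k)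
      ((α_ _ _ _).hom ≫ t ◁ e₁ ≫ σ) ((α_ _ _ _).hom ≫ t ◁ e₂ ≫ τ) x (𝟙 _) (𝟙 _)
    rw [Category.comp_id] at h₁ h₂
    exact ⟨κ, by simp [h₁], by simp [h₂]⟩
  constructor
  · intro X x ξ
    obtain ⟨δ, rfl⟩ := (H.homNull_bijective ν x).2 ξ
    obtain ⟨t, σ, τ, h⟩ := hγ.exists_lift (x ≫ p₁) (x ≫ p₂)
      ((α_ _ _ _).hom ≫ δ ≫ (α_ _ _ _).inv)
    obtain ⟨κ, rfl, rfl⟩ := lift σ τ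
    exact ⟨t, κ, (key x δ t κ).2 h⟩
  · intro X x ξ t κ t' κ' h h'
    obtain ⟨δ, rfl⟩ := (H.homNull_bijective ν x).2 ξ
    obtain ⟨ω, ⟨h₁, h₂⟩, hω⟩ := hγ.unique_lift _ _ _ t _ _ t' _ _ ((key x δ t κ).1 h)
      ((key x δ t' κ').1 h')
    have e (ω : t ⟶ t') : (ω ▷ p ≫ t' ◁ inv e₁ ≫ (α_ _ _ _).inv ≫ κ' ▷ p₁ =
          t ◁ inv e₁ ≫ (α_ _ _ _).inv ≫ κ ▷ p₁ ↔ (ω ▷ k ≫ κ') ▷ p₁ = κ ▷ p₁) ∧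
        (ω ▷ q ≫ t' ◁ inv e₂ ≫ (α_ _ _ _).inv ≫ κ' ▷ p₂ =
          t ◁ inv e₂ ≫ (α_ _ _ _).inv ≫ κ ▷ p₂ ↔ (ω ▷ k ≫ κ') ▷ p₂ = κ ▷ p₂) := by
      constructor
      · rw [← whisker_exchange_assoc, cancel_epi, whiskerRight_comp]
        simp
      · rw [← whisker_exchange_assoc, cancel_epi, whiskerRight_comp]
        simp
    refine ⟨ω, ?_, fun ω' h => hω ω' ⟨(e ω').1.2 (congrArg (· ▷ p₁) h),
      (e ω').2.2 (congrArg (· ▷ p₂) h)⟩⟩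
    obtain ⟨_, -, u⟩ := hE.unique_lift (x ≫ p₁) (x ≫ p₂) (t ≫ k) (κ ▷ p₁) (κ ▷ p₂) x (𝟙 _) (𝟙 _)
    exact (u _ ⟨by simpa using (e ω).1.1 h₁, by simpa using (e ω).2.1 h₂⟩).trans
      (u _ ⟨by simp, by simp⟩).symm

theorem nonempty_comp_difference {s₁ : A ⟶ E} (a₁₁ : s₁ ≫ p₁ ⟶ 𝟙 A) (a₁₂ : s₁ ≫ p₂ ⟶ G.zero A D)
    (ν : H.add (p₂ ≫ g) n ⟶ G.zero E B) : Nonempty (s₁ ≫ H.add (p₁ ≫ f) n ⟶ f) := by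
  obtain ⟨l⟩ := H.zero_add (s₁ ≫ n)
  obtain ⟨r⟩ := H.add_zero f
  have z : s₁ ≫ n ⟶ G.zero A B := inv l ≫ H.map
    (inv ((α_ _ _ _).inv ≫ G.compNull a₁₂ g)) (𝟙 _) ≫ inv (H.pre s₁ _ _) ≫ G.nullComp s₁ ν
  exact ⟨H.pre s₁ _ _ ≫ H.map ((α_ _ _ _).inv ≫ a₁₁ ▷ f ≫ (λ_ f).hom) z ≫ r⟩

/-- The difference `c` restricts to `f` along `s₁`, so it is 0-cofaithful and is the cokernel of its
kernel, for which the 1-cell `k` from the pullback may be taken. -/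
theorem exists_isCokernel_of_isPullbackSq (H : HomAdd G) (hC : HasProducts C)
    (hK : ∀ {A B : C} (f : A ⟶ B), G.IsZeroCofaithful f → G.IsCokOfKer f) (hγ : IsPullbackSq γ)
    (hf : G.IsZeroCofaithful f) :
    ∃ (E : C) (p₂ : E ⟶ D) (s₁ : A ⟶ E) (s₂ : D ⟶ E) (k : P ⟶ E) (c : E ⟶ B)
      (π : k ≫ c ⟶ G.zero P B), G.IsCokernel k c π ∧ Nonempty (s₁ ≫ c ⟶ f) ∧
      Nonempty (k ≫ p₂ ⟶ q) ∧ Nonempty (s₁ ≫ p₂ ⟶ G.zero A D) ∧ Nonempty (s₂ ≫ p₂ ⟶ 𝟙 D) ∧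
      ∀ {Y : C} {y y' : E ⟶ Y} {θ θ' : y ⟶ y'}, s₁ ◁ θ = s₁ ◁ θ' → s₂ ◁ θ = s₂ ◁ θ' → θ = θ' := by
  obtain ⟨E, p₁, p₂, hE⟩ := hC A D
  obtain ⟨s₁, ⟨a₁₁⟩, ⟨a₁₂⟩⟩ := hE.exists_lift (𝟙 A) (G.zero A D)
  obtain ⟨s₂, ⟨a₂₁⟩, ⟨a₂₂⟩⟩ := hE.exists_lift (G.zero D A) (𝟙 D)
  obtain ⟨k, ⟨e₁⟩, ⟨e₂⟩⟩ := hE.exists_lift p q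
  obtain ⟨n, ⟨ν⟩⟩ := H.exists_neg (p₂ ≫ g)
  obtain ⟨e⟩ := H.exists_hom_add_of_isProduct hE a₁₁ a₁₂ a₂₁ a₂₂
  obtain ⟨κ⟩ := H.nonempty_comp_difference (f := f) a₁₁ a₁₂ ν
  have hk : G.IsZeroCofaithful (H.add (p₁ ≫ f) n) := by
    intro Y α hα
    exact hf α (whiskerLeft_eq_id_of_hom κ (by simp [hα]))
  exact ⟨E, p₂, s₁, s₂, k, _, _, (hK _ hk).isCokernel (H.isKernel_of_isPullbackSq hγ hE e₁ e₂ ν),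
    ⟨κ⟩, ⟨e₂⟩, ⟨a₁₂⟩, ⟨a₂₂⟩, H.whiskerLeft_ext e⟩

theorem isZeroCofaithful_of_isPullbackSq (H : HomAdd G) (hC : HasProducts C)
    (hK : ∀ {A B : C} (f : A ⟶ B), G.IsZeroCofaithful f → G.IsCokOfKer f) (hγ : IsPullbackSq γ)
    (hf : G.IsZeroCofaithful f) : G.IsZeroCofaithful q := by
  obtain ⟨E, p₂, s₁, s₂, k, c, π, hk, ⟨κ⟩, ⟨e₂⟩, ⟨a₁₂⟩, ⟨a₂₂⟩, -⟩ :=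
    H.exists_isCokernel_of_isPullbackSq hC hK hγ hf
  intro Y α hα
  have hq : k ◁ p₂ ◁ α = 𝟙 _ := by
    have h : (k ≫ p₂) ◁ α = 𝟙 _ := whiskerLeft_eq_id_of_hom (inv e₂) hα
    rw [comp_whiskerLeft, ← Iso.eq_inv_comp, Category.comp_id, Iso.comp_inv_eq] at h
    simpa using h
  have hr : s₁ ◁ p₂ ◁ α = 𝟙 _ := by
    have h : (s₁ ≫ p₂) ◁ α = 𝟙 _ := whiskerLeft_eq_id_of_hom (inv a₁₂) (by
      rw [← cancel_mono (G.zeroComp _ _).hom, G.zeroComp_naturality, Category.id_comp])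
    rw [comp_whiskerLeft, ← Iso.eq_inv_comp, Category.comp_id, Iso.comp_inv_eq] at h
    simpa using h
  have d : G.nullComp k (G.nullComp c (𝟙 (G.zero B Y))) = _ := G.nullComp_compNull π _
  obtain ⟨τ, hτ, -⟩ := hk.unique_desc (G.zero E Y) (G.compZero k Y).hom (G.zero B Y)
    ((G.compZero c Y).hom ≫ (G.compZero p₂ Y).inv ≫ p₂ ◁ α ≫ (G.compZero p₂ Y).hom) (G.zero B Y)
    (G.compZero c Y).hom
    (by
      simp only [whiskerLeft_comp, Category.assoc, hq, Category.id_comp]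
      rw [← whiskerLeft_comp_assoc k (G.compZero p₂ Y).inv]
      simpa [compNull, nullComp] using d)
    (by simpa [compNull, nullComp] using d)
  rw [← Iso.eq_comp_inv] at hτ
  have e : p₂ ◁ α = 𝟙 _ := by
    have hτ' : τ = 𝟙 _ := by
      refine hf τ (whiskerLeft_eq_id_of_hom κ ?_)
      rw [comp_whiskerLeft, hτ]
      simp only [whiskerLeft_comp, hr, Category.id_comp, Category.assoc]
      simp
    rw [hτ', whiskerLeft_id] at hτ
    rw [eq_comm, Iso.comp_inv_eq, Category.id_comp] at hτ
    rw [← cancel_mono (G.compZero p₂ Y).hom, ← cancel_epi (G.compZero p₂ Y).inv,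
      ← cancel_epi (G.compZero c Y).hom, hτ]
    simp
  exact eq_id_of_id_whiskerLeft (whiskerLeft_eq_id_of_hom a₂₂ (by simp [e]))

theorem isFullyZeroCofaithful_of_isPullbackSq (H : HomAdd G) (hC : HasProducts C)
    (hK : ∀ {A B : C} (f : A ⟶ B), G.IsZeroCofaithful f → G.IsCokOfKer f) (hγ : IsPullbackSq γ)
    (hf : G.IsFullyZeroCofaithful f) : G.IsFullyZeroCofaithful q := by
  have hj := H.isCofaithful_of_isZeroCofaithful
    (H.isZeroCofaithful_of_isPullbackSq hC hK hγ hf.isZeroCofaithful)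
  obtain ⟨E, p₂, s₁, s₂, k, c, π, hk, ⟨κ⟩, ⟨e₂⟩, ⟨a₁₂⟩, ⟨a₂₂⟩, ext⟩ :=
    H.exists_isCokernel_of_isPullbackSq hC hK hγ hf.isZeroCofaithful
  intro Y d β
  have := hj Y
  refine existsUnique_of_exists_of_unique ?_ fun α α' h h' =>
    (precomp Y q).map_injective ((cancel_mono (G.compZero q Y).hom).1 (h.trans h'.symm))
  obtain ⟨t, σ, hσ⟩ := hk.exists_desc (p₂ ≫ d) ((α_ _ _ _).inv ≫ e₂ ▷ d ≫ β)
  obtain ⟨τ, hτ, -⟩ := hf t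
    (inv κ ▷ t ≫ (α_ _ _ _).hom ≫ s₁ ◁ σ ≫ (α_ _ _ _).inv ≫ G.compNull a₁₂ d)
  replace hτ : G.nullComp f τ = _ := hτ
  replace hσ : _ = (α_ _ _ _).inv ≫ G.compNull π t := hσ
  set σ₀ := inv σ ≫ G.nullComp c τ with hσ₀
  have e₁ : G.nullComp s₁ σ₀ = (α_ _ _ _).inv ≫ G.compNull a₁₂ d := by
    have h := G.comp_nullComp s₁ c τ
    rw [← Iso.inv_comp_eq] at h
    rw [hσ₀, ← whiskerLeft_nullComp, ← h, ← G.whiskerRight_nullComp κ τ, hτ]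
    simp
  have e₃ : G.nullComp k σ₀ = (α_ _ _ _).inv ≫ e₂ ▷ d ≫ β := by
    rw [hσ₀, ← whiskerLeft_nullComp, nullComp_compNull, ← hσ]
    simp
  obtain ⟨α, h⟩ : ∃ α : d ⟶ G.zero D Y, G.nullComp p₂ α = σ₀ := by
    refine ⟨(λ_ d).inv ≫ inv a₂₂ ▷ d ≫ (α_ _ _ _).hom ≫ G.nullComp s₂ σ₀, ?_⟩
    set α := (λ_ d).inv ≫ inv a₂₂ ▷ d ≫ (α_ _ _ _).hom ≫ G.nullComp s₂ σ₀ with hα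
    have c {V : C} (r : V ⟶ E) : G.nullComp r (G.nullComp p₂ α) = (α_ _ _ _).inv ≫
        G.nullComp (r ≫ p₂) α := by
      rw [G.comp_nullComp, Iso.inv_hom_id_assoc]
    refine ext ((cancel_mono (G.compZero s₁ Y).hom).1 ?_) ((cancel_mono (G.compZero s₂ Y).hom).1 ?_)
    · change G.nullComp s₁ (G.nullComp p₂ α) = G.nullComp s₁ σ₀
      rw [e₁, c, ← G.whiskerRight_nullComp a₁₂ α, zero_nullComp, compNull]
    · change G.nullComp s₂ (G.nullComp p₂ α) = G.nullComp s₂ σ₀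
      rw [c, ← G.whiskerRight_nullComp a₂₂ α, id_nullComp, hα]
      simp
  refine ⟨α, (?_ : G.nullComp q α = β)⟩
  rw [← G.whiskerRight_nullComp (inv e₂) α, G.comp_nullComp, h, e₃]
  simp

end Pullback

end HomAdd

/-- Since 0-faithful means faithful here, 0-monomorphic, 0-faithful and kernel of the cokernel all
coincide; stability of 0-monomorphic 1-cells is thus stability of 0-faithful ones. The dual
statements are analogous. -/
theorem LocallySCG.IsRelativelyExact.isAbelian {C : Type u} [Bicategory.{w, v} C] {S : LocallySCG C}
    (h : S.IsRelativelyExact) : S.toGpdStar.IsAbelian := by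
  have := S.locallyGroupoid
  have hK {A B : C} (f : A ⟶ B) (hf : S.toGpdStar.IsZeroFaithful f) : S.toGpdStar.IsKerOfCok f :=
    (h.faithful_iff f).1 (S.homAdd.isFaithful_of_isZeroFaithful hf)
  have hK' {A B : C} (f : A ⟶ B) (hf : S.toGpdStar.IsZeroCofaithful f) :
      S.toGpdStar.IsCokOfKer f :=
    (h.cofaithful_iff f).1 (S.homAdd.isCofaithful_of_isZeroCofaithful hf)
  exact
    { zeroObject := S.zeroObject
      products := S.products
      coproducts := S.coproducts
      kernels := h.kernels
      cokernels := h.cokernels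
      zeroMonomorphic := fun f hf => hK f hf.isZeroFaithful
      zeroEpimorphic := fun f hf => hK' f hf.isZeroCofaithful
      fullyZeroFaithful_pushout := fun _ hγ hf =>
        S.homAdd.isFullyZeroFaithful_of_isPushoutSq S.coproducts hK hγ hf
      zeroMonomorphic_pushout := fun _ hγ hf => (hK _
        (S.homAdd.isZeroFaithful_of_isPushoutSq S.coproducts hK hγ hf.isZeroFaithful)
        ).isZeroMonomorphic
      fullyZeroCofaithful_pullback := fun _ hγ hf =>
        S.homAdd.isFullyZeroCofaithful_of_isPullbackSq S.products hK' hγ hf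
      zeroEpimorphic_pullback := fun _ hγ hf => (hK' _
        (S.homAdd.isZeroCofaithful_of_isPullbackSq S.products hK' hγ hf.isZeroCofaithful)
        ).isZeroEpimorphic }

end TwoCat

/-! ### Marked 2-vector spaces over `ℚ` as a locally `SCG` 2-category. -/

namespace TwoCat

open CategoryTheory Bicategory

/-- A 2-vector space over `ℚ`, given by the dimensions of its space of isomorphism classes of
objects and of its space of automorphisms of the zero object. The parameter `M` is the monoid of
marks of 1-cells, the parameter `T` fixes the universe of 2-cells. -/
structure TwoVect (M : Type v) (T : Type w) : Type u where
  dim₀ : ℕ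
  dim₁ : ℕ

namespace TwoVect

variable {M : Type v} {T : Type w}

/-- A 1-cell of 2-vector spaces: a linear map on isomorphism classes and a linear map on
automorphisms, together with a mark that distinguishes between isomorphic 1-cells. -/
@[ext]
structure Hom (A B : TwoVect.{w, v, u} M T) : Type v where
  f₀ : (Fin A.dim₀ → ℚ) →ₗ[ℚ] (Fin B.dim₀ → ℚ)
  f₁ : (Fin A.dim₁ → ℚ) →ₗ[ℚ] (Fin B.dim₁ → ℚ)
  mark : M

/-- A 2-cell between 1-cells with the same underlying linear maps. -/
@[ext]
structure Hom₂ {A B : TwoVect.{w, v, u} M T} (f g : Hom A B) : Type w where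
  h : (Fin A.dim₀ → ℚ) →ₗ[ℚ] (Fin B.dim₁ → ℚ)
  eq₀ : f.f₀ = g.f₀
  eq₁ : f.f₁ = g.f₁

instance (A B : TwoVect.{w, v, u} M T) : Category.{w} (Hom A B) where
  Hom := Hom₂
  id f := ⟨0, rfl, rfl⟩
  comp η θ := ⟨η.h + θ.h, η.eq₀.trans θ.eq₀, η.eq₁.trans θ.eq₁⟩
  id_comp _ := by simp
  comp_id _ := by simp
  assoc _ _ _ := by simp [add_assoc]

variable [Monoid M] {A B D E : TwoVect.{w, v, u} M T}

instance : CategoryStruct.{v} (TwoVect.{w, v, u} M T) where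
  Hom A B := Hom A B
  id _ := ⟨LinearMap.id, LinearMap.id, 1⟩
  comp f g := ⟨g.f₀ ∘ₗ f.f₀, g.f₁ ∘ₗ f.f₁, f.mark * g.mark⟩

@[simp] theorem comp_f₀ (f : A ⟶ B) (g : B ⟶ D) : (f ≫ g).f₀ = g.f₀ ∘ₗ f.f₀ := rfl

@[simp] theorem comp_f₁ (f : A ⟶ B) (g : B ⟶ D) : (f ≫ g).f₁ = g.f₁ ∘ₗ f.f₁ := rfl

/-- The trivial 2-cell between 1-cells with the same underlying linear maps. -/
def Hom.iso {f g : Hom A B} (e₀ : f.f₀ = g.f₀) (e₁ : f.f₁ = g.f₁) : f ≅ g where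
  hom := ⟨0, e₀, e₁⟩
  inv := ⟨0, e₀.symm, e₁.symm⟩
  hom_inv_id := Hom₂.ext (add_zero _)
  inv_hom_id := Hom₂.ext (add_zero _)

instance : Bicategory.{w, v} (TwoVect.{w, v, u} M T) where
  homCategory A B := inferInstanceAs (Category (Hom A B))
  whiskerLeft f _ _ η := ⟨η.h ∘ₗ f.f₀, by simp [η.eq₀], by simp [η.eq₁]⟩
  whiskerRight η g := ⟨g.f₁ ∘ₗ η.h, by simp [η.eq₀], by simp [η.eq₁]⟩
  associator f g h := Hom.iso rfl rfl
  leftUnitor f := Hom.iso rfl rfl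
  rightUnitor f := Hom.iso rfl rfl
  whiskerLeft_id f g := Hom₂.ext (LinearMap.zero_comp _)
  whiskerLeft_comp f _ _ _ η θ := Hom₂.ext (LinearMap.add_comp _ _ _)
  id_whiskerRight f g := Hom₂.ext (LinearMap.comp_zero _)
  comp_whiskerRight η θ g := Hom₂.ext (LinearMap.comp_add _ _ _)
  id_whiskerLeft η := Hom₂.ext (by change _ = 0 + (η.h + 0); rw [zero_add, add_zero]; rfl)
  whiskerRight_id η := Hom₂.ext (by change _ = 0 + (η.h + 0); rw [zero_add, add_zero]; rfl)
  comp_whiskerLeft f g _ _ η := Hom₂.ext (by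
    change _ = 0 + ((η.h ∘ₗ g.f₀) ∘ₗ f.f₀ + 0); rw [zero_add, add_zero]; rfl)
  whiskerRight_comp η f g := Hom₂.ext (by
    change _ = 0 + (g.f₁ ∘ₗ (f.f₁ ∘ₗ η.h) + 0); rw [zero_add, add_zero]; rfl)
  whisker_assoc f _ _ η g := Hom₂.ext (by
    change _ = 0 + ((g.f₁ ∘ₗ η.h) ∘ₗ f.f₀ + 0); rw [zero_add, add_zero]; rfl)
  whisker_exchange {A B D f g h i} η θ := Hom₂.ext (by
    -- A 2-cell forces both linear maps of its source and target to agree, so the two composites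
    -- differ only in the order of the summands.
    change θ.h ∘ₗ f.f₀ + i.f₁ ∘ₗ η.h = h.f₁ ∘ₗ η.h + θ.h ∘ₗ g.f₀
    rw [η.eq₀, θ.eq₁, add_comm])
  pentagon f _ _ i := Hom₂.ext (by
    change i.f₁ ∘ₗ 0 + (0 + 0 ∘ₗ f.f₀) = 0 + 0
    rw [LinearMap.comp_zero, LinearMap.zero_comp, zero_add])
  triangle f g := Hom₂.ext (by
    change 0 + 0 ∘ₗ f.f₀ = g.f₁ ∘ₗ 0
    rw [LinearMap.comp_zero, LinearMap.zero_comp, zero_add])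

variable {f g k : A ⟶ B}

@[ext]
theorem hom₂_ext {η θ : f ⟶ g} (h : η.h = θ.h) : η = θ :=
  Hom₂.ext h

@[simp] theorem id_h (f : A ⟶ B) : Hom₂.h (𝟙 f) = 0 := rfl

@[simp] theorem comp_h (η : f ⟶ g) (θ : g ⟶ k) : (η ≫ θ).h = η.h + θ.h := rfl

/-- A 2-cell between 1-cells with the same underlying linear maps. -/
def mkHom₂ (h : (Fin A.dim₀ → ℚ) →ₗ[ℚ] (Fin B.dim₁ → ℚ)) (e₀ : f.f₀ = g.f₀) (e₁ : f.f₁ = g.f₁) :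
    f ⟶ g := ⟨h, e₀, e₁⟩

@[simp] theorem mkHom₂_h (h : (Fin A.dim₀ → ℚ) →ₗ[ℚ] (Fin B.dim₁ → ℚ)) (e₀ : f.f₀ = g.f₀)
    (e₁ : f.f₁ = g.f₁) : (mkHom₂ h e₀ e₁).h = h := rfl

/-- The trivial 2-cell between 1-cells with the same underlying linear maps. -/
@[simps]
def mkIso (e₀ : f.f₀ = g.f₀) (e₁ : f.f₁ = g.f₁) : f ≅ g where
  hom := mkHom₂ 0 e₀ e₁
  inv := mkHom₂ 0 e₀.symm e₁.symm

@[simp] theorem whiskerLeft_h (f : A ⟶ B) {g k : B ⟶ D} (η : g ⟶ k) :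
    (f ◁ η).h = η.h ∘ₗ f.f₀ := rfl

@[simp] theorem whiskerRight_h {f g : A ⟶ B} (η : f ⟶ g) (k : B ⟶ D) :
    (η ▷ k).h = k.f₁ ∘ₗ η.h := rfl

@[simp] theorem associator_hom_h (f : A ⟶ B) (g : B ⟶ D) (k : D ⟶ E) :
    Hom₂.h (α_ f g k).hom = 0 := rfl

@[simp] theorem leftUnitor_hom_h (f : A ⟶ B) : Hom₂.h (λ_ f).hom = 0 := rfl

@[simp] theorem rightUnitor_hom_h (f : A ⟶ B) : Hom₂.h (ρ_ f).hom = 0 := rfl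

@[simp] theorem eqToHom_h {f g : A ⟶ B} (e : f = g) : Hom₂.h (eqToHom e) = 0 := by
  subst e
  rfl

theorem strict : Bicategory.Strict (TwoVect.{w, v, u} M T) where
  id_comp f := Hom.ext rfl rfl (one_mul _)
  comp_id f := Hom.ext rfl rfl (mul_one _)
  assoc f g h := Hom.ext rfl rfl (mul_assoc _ _ _)
  leftUnitor_eqToIso f := by ext; simp
  rightUnitor_eqToIso f := by ext; simp
  associator_eqToIso f g h := by ext; simp

theorem isIso_hom {f g : A ⟶ B} (η : f ⟶ g) : IsIso η :=
  ⟨mkHom₂ (-η.h) η.eq₀.symm η.eq₁.symm, by ext1; exact add_neg_cancel _,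
    by ext1; exact neg_add_cancel _⟩

/-- A sum always has mark `1`. Thus the unit laws fail as equalities of 1-cells, but 2-cells ignore
marks, so the trivial 2-cells serve as unit and associativity constraints. -/
instance : MonoidalCategory (A ⟶ B) where
  tensorObj f g := ⟨f.f₀ + g.f₀, f.f₁ + g.f₁, 1⟩
  tensorUnit := ⟨0, 0, 1⟩
  whiskerLeft f _ _ η := mkHom₂ η.h (by simp [η.eq₀]) (by simp [η.eq₁])
  whiskerRight η g := mkHom₂ η.h (by simp [η.eq₀]) (by simp [η.eq₁])
  tensorHom η θ := mkHom₂ (η.h + θ.h) (by simp [η.eq₀, θ.eq₀]) (by simp [η.eq₁, θ.eq₁])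
  tensorHom_def η θ := by ext1; simp
  id_tensorHom_id _ _ := by ext1; simp
  associator f g h := mkIso (add_assoc _ _ _) (add_assoc _ _ _)
  leftUnitor f := mkIso (zero_add _) (zero_add _)
  rightUnitor f := mkIso (add_zero _) (add_zero _)
  tensorHom_comp_tensorHom _ _ _ _ := by ext1; exact add_add_add_comm _ _ _ _
  whiskerLeft_id _ _ := by ext1; simp
  id_whiskerRight _ _ := by ext1; simp
  associator_naturality _ _ _ := by ext1; simp [add_assoc]
  leftUnitor_naturality _ := by ext1; simp
  rightUnitor_naturality _ := by ext1; simp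
  pentagon _ _ _ _ := by ext1; simp
  triangle _ _ := by ext1; simp

open MonoidalCategory (tensorObj tensorUnit tensorHom)

@[simp] theorem tensor_whiskerLeft_h (f : A ⟶ B) {g g' : A ⟶ B} (θ : g ⟶ g') :
    Hom₂.h (MonoidalCategory.whiskerLeft f θ) = θ.h := rfl

@[simp] theorem tensor_whiskerRight_h {f f' : A ⟶ B} (η : f ⟶ f') (g : A ⟶ B) :
    Hom₂.h (MonoidalCategory.whiskerRight η g) = η.h := rfl

@[simp] theorem tensor_associator_hom_h (f g k : A ⟶ B) :
    Hom₂.h (MonoidalCategory.associator f g k).hom = 0 := rfl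

@[simp] theorem tensor_associator_inv_h (f g k : A ⟶ B) :
    Hom₂.h (MonoidalCategory.associator f g k).inv = 0 := rfl

instance : SymmetricCategory (A ⟶ B) where
  braiding f g := mkIso (add_comm _ _) (add_comm _ _)
  braiding_naturality_right _ _ _ _ := by ext1; simp
  braiding_naturality_left _ _ := by ext1; simp
  hexagon_forward _ _ _ := by ext1; simp
  hexagon_reverse _ _ _ := by ext1; simp
  symmetry _ _ := by ext1; simp

@[simp] theorem tensorObj_f₀ (f g : A ⟶ B) : (tensorObj f g).f₀ = f.f₀ + g.f₀ := rfl

@[simp] theorem tensorObj_f₁ (f g : A ⟶ B) : (tensorObj f g).f₁ = f.f₁ + g.f₁ := rfl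

@[simp] theorem tensorUnit_f₀ : (tensorUnit (A ⟶ B)).f₀ = 0 := rfl

@[simp] theorem tensorUnit_f₁ : (tensorUnit (A ⟶ B)).f₁ = 0 := rfl

/-- Composition preserves the symmetric monoidal structure by means of trivial 2-cells. -/
def homMapCore (f : D ⟶ A) (g : B ⟶ E) : (homMap f g).CoreMonoidal where
  εIso := mkIso (by simp) (by simp)
  μIso h k := mkIso (by simp [LinearMap.add_comp, LinearMap.comp_add])
    (by simp [LinearMap.add_comp, LinearMap.comp_add])
  μIso_hom_natural_left _ _ := hom₂_ext ((add_zero _).trans (zero_add _).symm)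
  μIso_hom_natural_right _ _ := hom₂_ext ((add_zero _).trans (zero_add _).symm)
  associativity _ _ _ := hom₂_ext (by
    change 0 + (0 + g.f₁ ∘ₗ 0 ∘ₗ f.f₀) = 0 + (0 + 0)
    rw [LinearMap.zero_comp, LinearMap.comp_zero])
  left_unitality _ := hom₂_ext (by
    change 0 = 0 + (0 + g.f₁ ∘ₗ 0 ∘ₗ f.f₀)
    rw [LinearMap.zero_comp, LinearMap.comp_zero, zero_add, zero_add])
  right_unitality _ := hom₂_ext (by
    change 0 = 0 + (0 + g.f₁ ∘ₗ 0 ∘ₗ f.f₀)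
    rw [LinearMap.zero_comp, LinearMap.comp_zero, zero_add, zero_add])

instance (f : D ⟶ A) (g : B ⟶ E) : (homMap f g).Braided where
  __ := (homMapCore f g).toMonoidal
  braided h k := hom₂_ext (by
    change 0 + g.f₁ ∘ₗ 0 ∘ₗ f.f₀ = 0 + 0
    rw [LinearMap.zero_comp, LinearMap.comp_zero])

variable (M T) in
/-- Marked 2-vector spaces are enriched in symmetric categorical groups. -/
def homSCG : HomSCG (TwoVect.{w, v, u} M T) where
  strict := strict
  locallyGroupoid _ _ := ⟨isIso_hom⟩
  exists_inverse f := ⟨⟨-f.f₀, -f.f₁, 1⟩, ⟨mkIso (add_neg_cancel _) (add_neg_cancel _)⟩⟩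
  unit_comp_unit A B D := Hom.ext (LinearMap.zero_comp _) (LinearMap.zero_comp _) (one_mul _)
  homMap₂_monoidal {A' A B B' f f' g g'} η θ :=
    ⟨hom₂_ext (by
      change 0 + (g.f₁ ∘ₗ 0 ∘ₗ η.h + θ.h ∘ₗ 0 ∘ₗ f'.f₀) = 0
      simp),
    fun h k => hom₂_ext (by
      change 0 + (g.f₁ ∘ₗ (h.f₁ + k.f₁) ∘ₗ η.h + θ.h ∘ₗ (h.f₀ + k.f₀) ∘ₗ f'.f₀) =
        (g.f₁ ∘ₗ h.f₁ ∘ₗ η.h + θ.h ∘ₗ h.f₀ ∘ₗ f'.f₀) +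
          (g.f₁ ∘ₗ k.f₁ ∘ₗ η.h + θ.h ∘ₗ k.f₀ ∘ₗ f'.f₀) + 0
      simp only [LinearMap.comp_add, LinearMap.add_comp, zero_add, add_zero]
      abel)⟩
  homComp_monoidal f' f g g' :=
    ⟨hom₂_ext (by
      change (0 + g'.f₁ ∘ₗ 0 ∘ₗ f'.f₀) + (g'.f₁ ∘ₗ 0 + (g'.f₁ ∘ₗ g.f₁ ∘ₗ 0 + 0)) = 0
      simp),
    fun _ _ => hom₂_ext (by
      change (0 + g'.f₁ ∘ₗ 0 ∘ₗ f'.f₀) + (g'.f₁ ∘ₗ 0 + (g'.f₁ ∘ₗ g.f₁ ∘ₗ 0 + 0)) =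
        (g'.f₁ ∘ₗ 0 + (g'.f₁ ∘ₗ g.f₁ ∘ₗ 0 + 0)) + (g'.f₁ ∘ₗ 0 + (g'.f₁ ∘ₗ g.f₁ ∘ₗ 0 + 0)) + 0
      simp)⟩
  homId_monoidal A B :=
    ⟨hom₂_ext (by change 0 + (0 + 0) = 0; simp),
    fun _ _ => hom₂_ext (by change 0 + (0 + 0) = (0 + 0) + (0 + 0) + 0; simp)⟩

end TwoVect

end TwoCat

/-! ### Splittings of linear maps; products and coproducts of 2-vector spaces. -/

namespace TwoCat

open CategoryTheory Bicategory

/-- A generalized inverse `g` of a linear map `f`, together with splittings of its kernel and of its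
cokernel. -/
structure LinearSplitting {m n : ℕ} (f : (Fin m → ℚ) →ₗ[ℚ] (Fin n → ℚ)) where
  g : (Fin n → ℚ) →ₗ[ℚ] (Fin m → ℚ)
  ker : ℕ
  ι : (Fin ker → ℚ) →ₗ[ℚ] (Fin m → ℚ)
  p : (Fin m → ℚ) →ₗ[ℚ] (Fin ker → ℚ)
  coker : ℕ
  j : (Fin coker → ℚ) →ₗ[ℚ] (Fin n → ℚ)
  π : (Fin n → ℚ) →ₗ[ℚ] (Fin coker → ℚ)
  p_ι : ∀ x, p (ι x) = x
  ι_p : ∀ x, ι (p x) = x - g (f x)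
  π_j : ∀ y, π (j y) = y
  j_π : ∀ y, j (π y) = y - f (g y)
  f_ι : ∀ x, f (ι x) = 0
  π_f : ∀ x, π (f x) = 0
  p_g : ∀ y, p (g y) = 0
  g_j : ∀ y, g (j y) = 0

namespace LinearSplitting

theorem exists_split_idempotent {n : ℕ} (e : (Fin n → ℚ) →ₗ[ℚ] (Fin n → ℚ))
    (he : ∀ x, e (e x) = e x) : ∃ (k : ℕ) (ι : (Fin k → ℚ) →ₗ[ℚ] (Fin n → ℚ))
      (p : (Fin n → ℚ) →ₗ[ℚ] (Fin k → ℚ)), (∀ x, p (ι x) = x) ∧ ∀ x, ι (p x) = e x := by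
  let φ := (Module.finBasis ℚ (LinearMap.range e)).equivFun
  refine ⟨_, (LinearMap.range e).subtype ∘ₗ φ.symm.toLinearMap, φ.toLinearMap ∘ₗ e.rangeRestrict,
    fun x => ?_, fun x => ?_⟩
  · have h : e.rangeRestrict (φ.symm x : Fin n → ℚ) = φ.symm x := by
      obtain ⟨y, hy⟩ := (φ.symm x).2
      ext1
      rw [LinearMap.codRestrict_apply, ← hy, he]
    simp [h]
  · simp

theorem nonempty {m n : ℕ} (f : (Fin m → ℚ) →ₗ[ℚ] (Fin n → ℚ)) : Nonempty (LinearSplitting f) := by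
  obtain ⟨g, hg, hg'⟩ : ∃ g : (Fin n → ℚ) →ₗ[ℚ] (Fin m → ℚ),
      (∀ x, f (g (f x)) = f x) ∧ ∀ y, g (f (g y)) = g y := by
    obtain ⟨s, hs⟩ := f.rangeRestrict.exists_rightInverse_of_surjective f.range_rangeRestrict
    obtain ⟨q, hq⟩ := (LinearMap.range f).subtype.exists_leftInverse_of_injective
      (LinearMap.range f).ker_subtype
    have h (x) : f (s (q (f x))) = f x := by
      have h₁ : q (f x) = f.rangeRestrict x := LinearMap.congr_fun hq (f.rangeRestrict x)
      have h₂ := congrArg Subtype.val (LinearMap.congr_fun hs (f.rangeRestrict x))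
      rw [h₁]
      exact h₂
    -- With `s` a section of `f` onto its range and `q` a retraction onto the range, `g₀ = s q`
    -- satisfies `f g₀ f = f`; replacing it by `g₀ f g₀` also gives `g f g = g`.
    exact ⟨s ∘ₗ q ∘ₗ f ∘ₗ s ∘ₗ q, by simp [h], by simp [h]⟩
  -- The idempotents `1 - g f` and `1 - f g` project onto the kernel of `f` and onto a complement of
  -- its range.
  obtain ⟨k, ι, p, h₁, h₂⟩ := exists_split_idempotent (LinearMap.id - g ∘ₗ f) (by simp [hg])
  obtain ⟨c, j, π, h₃, h₄⟩ := exists_split_idempotent (LinearMap.id - f ∘ₗ g) (by simp [hg])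
  simp only [LinearMap.sub_apply, LinearMap.id_apply, LinearMap.comp_apply] at h₂ h₄
  refine ⟨g, k, ι, p, c, j, π, h₁, h₂, h₃, h₄, fun x => ?_, fun x => ?_, fun y => ?_, fun y => ?_⟩
  · rw [← h₁ x, h₂]
    simp [hg]
  · rw [← h₃ (π (f x)), h₄, hg]
    simp
  · rw [← h₁ (p (g y)), h₂, hg']
    simp
  · rw [← h₃ y, h₄]
    simp [hg']

end LinearSplitting

namespace TwoVect

open MonoidalCategory (tensorUnit)

variable {M : Type v} {T : Type w} [Monoid M] {A B D K Q : TwoVect.{w, v, u} M T}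

/-- Coordinates on a direct sum. -/
noncomputable def sumEquiv (m n : ℕ) :
    ((Fin m → ℚ) × (Fin n → ℚ)) ≃ₗ[ℚ] (Fin (m + n) → ℚ) :=
  LinearEquiv.ofFinrankEq _ _ (by simp)

/-- A 1-cell with given linear maps. -/
def mkHom (f₀ : (Fin A.dim₀ → ℚ) →ₗ[ℚ] (Fin B.dim₀ → ℚ))
    (f₁ : (Fin A.dim₁ → ℚ) →ₗ[ℚ] (Fin B.dim₁ → ℚ)) : A ⟶ B := ⟨f₀, f₁, 1⟩

@[simp] theorem mkHom_f₀ (f₀ : (Fin A.dim₀ → ℚ) →ₗ[ℚ] (Fin B.dim₀ → ℚ))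
    (f₁ : (Fin A.dim₁ → ℚ) →ₗ[ℚ] (Fin B.dim₁ → ℚ)) : (mkHom f₀ f₁).f₀ = f₀ := rfl

@[simp] theorem mkHom_f₁ (f₀ : (Fin A.dim₀ → ℚ) →ₗ[ℚ] (Fin B.dim₀ → ℚ))
    (f₁ : (Fin A.dim₁ → ℚ) →ₗ[ℚ] (Fin B.dim₁ → ℚ)) : (mkHom f₀ f₁).f₁ = f₁ := rfl

theorem hasProducts : HasProducts (TwoVect.{w, v, u} M T) := by
  intro A B
  let φ := sumEquiv A.dim₀ B.dim₀
  let ψ := sumEquiv A.dim₁ B.dim₁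
  refine ⟨⟨A.dim₀ + B.dim₀, A.dim₁ + B.dim₁⟩, mkHom (LinearMap.fst ℚ _ _ ∘ₗ φ.symm.toLinearMap)
    (LinearMap.fst ℚ _ _ ∘ₗ ψ.symm.toLinearMap), mkHom (LinearMap.snd ℚ _ _ ∘ₗ φ.symm.toLinearMap)
    (LinearMap.snd ℚ _ _ ∘ₗ ψ.symm.toLinearMap), fun {X} x₁ x₂ => ?_,
    fun {X} x₁ x₂ t σ₁ σ₂ t' σ₁' σ₂' => ?_⟩
  · exact ⟨mkHom (φ.toLinearMap ∘ₗ x₁.f₀.prod x₂.f₀) (ψ.toLinearMap ∘ₗ x₁.f₁.prod x₂.f₁),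
      ⟨mkHom₂ 0 (LinearMap.ext fun x => by simp) (LinearMap.ext fun x => by simp)⟩,
      ⟨mkHom₂ 0 (LinearMap.ext fun x => by simp) (LinearMap.ext fun x => by simp)⟩⟩
  · have e₀ : t.f₀ = t'.f₀ := LinearMap.ext fun x => φ.symm.injective
      (Prod.ext (LinearMap.congr_fun (σ₁.eq₀.trans σ₁'.eq₀.symm) x)
        (LinearMap.congr_fun (σ₂.eq₀.trans σ₂'.eq₀.symm) x))
    have e₁ : t.f₁ = t'.f₁ := LinearMap.ext fun x => ψ.symm.injective
      (Prod.ext (LinearMap.congr_fun (σ₁.eq₁.trans σ₁'.eq₁.symm) x)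
        (LinearMap.congr_fun (σ₂.eq₁.trans σ₂'.eq₁.symm) x))
    refine ⟨mkHom₂ (ψ.toLinearMap ∘ₗ (σ₁.h - σ₁'.h).prod (σ₂.h - σ₂'.h)) e₀ e₁,
      ⟨hom₂_ext (LinearMap.ext fun x => by simp), hom₂_ext (LinearMap.ext fun x => by simp)⟩,
      fun τ h => hom₂_ext (LinearMap.ext fun x => ψ.symm.injective (Prod.ext ?_ ?_))⟩
    · have h := LinearMap.congr_fun (congrArg Hom₂.h h.1) x
      simpa [eq_sub_iff_add_eq] using h
    · have h := LinearMap.congr_fun (congrArg Hom₂.h h.2) x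
      simpa [eq_sub_iff_add_eq] using h

theorem hasCoproducts : HasCoproducts (TwoVect.{w, v, u} M T) := by
  intro A B
  let φ := sumEquiv A.dim₀ B.dim₀
  let ψ := sumEquiv A.dim₁ B.dim₁
  refine ⟨⟨A.dim₀ + B.dim₀, A.dim₁ + B.dim₁⟩, mkHom (φ.toLinearMap ∘ₗ LinearMap.inl ℚ _ _)
    (ψ.toLinearMap ∘ₗ LinearMap.inl ℚ _ _), mkHom (φ.toLinearMap ∘ₗ LinearMap.inr ℚ _ _)
    (ψ.toLinearMap ∘ₗ LinearMap.inr ℚ _ _), fun {Y} y₁ y₂ => ?_,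
    fun {Y} y₁ y₂ t σ₁ σ₂ t' σ₁' σ₂' => ?_⟩
  · exact ⟨mkHom (y₁.f₀.coprod y₂.f₀ ∘ₗ φ.symm.toLinearMap)
      (y₁.f₁.coprod y₂.f₁ ∘ₗ ψ.symm.toLinearMap),
      ⟨mkHom₂ 0 (LinearMap.ext fun x => by simp) (LinearMap.ext fun x => by simp)⟩,
      ⟨mkHom₂ 0 (LinearMap.ext fun x => by simp) (LinearMap.ext fun x => by simp)⟩⟩
  · have ext {m n k : ℕ} {a b : (Fin (m + n) → ℚ) →ₗ[ℚ] (Fin k → ℚ)}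
        (h₁ : ∀ x, a (sumEquiv m n (x, 0)) = b (sumEquiv m n (x, 0)))
        (h₂ : ∀ x, a (sumEquiv m n (0, x)) = b (sumEquiv m n (0, x))) : a = b := by
      refine LinearMap.ext fun z => ?_
      obtain ⟨⟨x, y⟩, rfl⟩ := (sumEquiv m n).surjective z
      rw [← add_zero x, ← zero_add y, ← Prod.mk_add_mk, map_add, map_add, map_add, h₁, h₂]
    have e₀ : t.f₀ = t'.f₀ := ext (LinearMap.congr_fun (σ₁.eq₀.trans σ₁'.eq₀.symm))
      (LinearMap.congr_fun (σ₂.eq₀.trans σ₂'.eq₀.symm))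
    have e₁ : t.f₁ = t'.f₁ := ext (LinearMap.congr_fun (σ₁.eq₁.trans σ₁'.eq₁.symm))
      (LinearMap.congr_fun (σ₂.eq₁.trans σ₂'.eq₁.symm))
    refine ⟨mkHom₂ ((σ₁.h - σ₁'.h).coprod (σ₂.h - σ₂'.h) ∘ₗ φ.symm.toLinearMap) e₀ e₁,
      ⟨hom₂_ext (LinearMap.ext fun x => by simp), hom₂_ext (LinearMap.ext fun x => by simp)⟩,
      fun τ h => hom₂_ext (ext (fun x => ?_) fun x => ?_)⟩
    · have h := LinearMap.congr_fun (congrArg Hom₂.h h.1) x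
      simpa [eq_sub_iff_add_eq, φ] using h
    · have h := LinearMap.congr_fun (congrArg Hom₂.h h.2) x
      simpa [eq_sub_iff_add_eq, φ] using h

theorem preUnit_h (f : D ⟶ A) (B : TwoVect.{w, v, u} M T) :
    Hom₂.h ((homSCG M T).preUnit f B).hom = 0 := add_zero _

theorem postUnit_h (B : TwoVect.{w, v, u} M T) (f : D ⟶ A) :
    Hom₂.h ((homSCG M T).postUnit B f).hom = 0 := by
  change f.f₁ ∘ₗ 0 + 0 = 0
  rw [LinearMap.comp_zero, zero_add]

variable (M T) in
/-- The 2-category of marked 2-vector spaces. -/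
def locallySCG : LocallySCG (TwoVect.{w, v, u} M T) where
  toHomSCG := homSCG M T
  preUnit_zero A B D :=
    Iso.ext (hom₂_ext ((preUnit_h _ _).trans (eqToHom_h ((homSCG M T).unit_comp_unit A B D)).symm))
  postUnit_zero A B D :=
    Iso.ext (hom₂_ext ((postUnit_h _ _).trans (eqToHom_h ((homSCG M T).unit_comp_unit A B D)).symm))
  zeroObject := ⟨⟨0, 0⟩,
    fun f => ⟨mkHom₂ 0 (LinearMap.ext fun x => by rw [Subsingleton.elim x 0, map_zero, map_zero])
      (LinearMap.ext fun x => by rw [Subsingleton.elim x 0, map_zero, map_zero]), trivial,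
      fun _ _ => hom₂_ext (LinearMap.ext fun x => by
        rw [Subsingleton.elim x 0, map_zero, map_zero])⟩,
    fun f => ⟨mkHom₂ 0 (LinearMap.ext fun x => Subsingleton.elim (α := Fin 0 → ℚ) _ _)
      (LinearMap.ext fun x => Subsingleton.elim (α := Fin 0 → ℚ) _ _), trivial,
      fun _ _ => hom₂_ext (LinearMap.ext fun x => Subsingleton.elim (α := Fin 0 → ℚ) _ _)⟩⟩
  products := hasProducts
  coproducts := hasCoproducts

end TwoVect

end TwoCat

/-! ### Kernels and cokernels of 2-vector spaces; relative exactness and the failure of strict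
zeros. -/

namespace TwoCat

open CategoryTheory Bicategory

namespace TwoVect

variable {M : Type v} {T : Type w} [Monoid M] {A B D K Q : TwoVect.{w, v, u} M T}

variable (M T) in
/-- The underlying `Gpd*`-category of the 2-category of marked 2-vector spaces. -/
abbrev gpdStar : GpdStar (TwoVect.{w, v, u} M T) := (locallySCG M T).toGpdStar

@[simp] theorem compZero_h (f : D ⟶ A) (B : TwoVect.{w, v, u} M T) :
    Hom₂.h ((gpdStar M T).compZero f B).hom = 0 := preUnit_h f B

@[simp] theorem zeroComp_h (B : TwoVect.{w, v, u} M T) (f : D ⟶ A) :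
    Hom₂.h ((gpdStar M T).zeroComp B f).hom = 0 := postUnit_h B f

/-- All associators and nullities have zero linear part, so only the contributions of `σ`, `ξ` and
`e` remain. -/
theorem kernel_condition_iff {X : TwoVect.{w, v, u} M T} {f : A ⟶ B} {k : K ⟶ A}
    (e : k ≫ f ⟶ (gpdStar M T).zero K B) {x : X ⟶ A} (ξ : x ≫ f ⟶ (gpdStar M T).zero X B)
    {t : X ⟶ K} (σ : t ≫ k ⟶ x) :
    σ ▷ f ≫ ξ = (α_ t k f).hom ≫ t ◁ e ≫ ((gpdStar M T).compZero t B).hom ↔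
      ∀ y, f.f₁ (σ.h y) + ξ.h y = e.h (t.f₀ y) := by
  have h : Hom₂.h ((α_ t k f).hom ≫ t ◁ e ≫ ((gpdStar M T).compZero t B).hom) =
      0 + (e.h ∘ₗ t.f₀ + Hom₂.h ((gpdStar M T).compZero t B).hom) := rfl
  rw [compZero_h, zero_add, add_zero] at h
  constructor
  · intro H y
    exact LinearMap.congr_fun ((congrArg Hom₂.h H).trans h) y
  · intro H
    exact hom₂_ext ((LinearMap.ext H).trans h.symm)

theorem cokernel_condition_iff {Y : TwoVect.{w, v, u} M T} {f : A ⟶ B} {q : B ⟶ Q}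
    (π : f ≫ q ⟶ (gpdStar M T).zero A Q) {y : B ⟶ Y} (ξ : f ≫ y ⟶ (gpdStar M T).zero A Y)
    {t : Q ⟶ Y} (σ : q ≫ t ⟶ y) :
    f ◁ σ ≫ ξ = (α_ f q t).inv ≫ π ▷ t ≫ ((gpdStar M T).zeroComp A t).hom ↔
      ∀ x, σ.h (f.f₀ x) + ξ.h x = t.f₁ (π.h x) := by
  have h : Hom₂.h ((α_ f q t).inv ≫ π ▷ t ≫ ((gpdStar M T).zeroComp A t).hom) =
      0 + (t.f₁ ∘ₗ π.h + Hom₂.h ((gpdStar M T).zeroComp A t).hom) := rfl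
  rw [zeroComp_h, zero_add, add_zero] at h
  constructor
  · intro H y
    exact LinearMap.congr_fun ((congrArg Hom₂.h H).trans h) y
  · intro H
    exact hom₂_ext ((LinearMap.ext H).trans h.symm)

/-- A linear criterion. The injectivity of `k` on the first space is required only jointly with `e`
modulo the image of `f.f₁`, since that is the ambiguity of a nullity. The map `r` lifts the
difference of two comparisons, which `f.f₁` kills, and so produces the 2-cell between them. -/
theorem isKernel_of {f : A ⟶ B} {k : K ⟶ A} {e : k ≫ f ⟶ (gpdStar M T).zero K B}
    (ex : ∀ {X : TwoVect.{w, v, u} M T} (x : X ⟶ A)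
      (ξ : (Fin X.dim₀ → ℚ) →ₗ[ℚ] (Fin B.dim₁ → ℚ)), (∀ y, f.f₀ (x.f₀ y) = 0) →
      (∀ y, f.f₁ (x.f₁ y) = 0) → ∃ (t : X ⟶ K) (σ : (Fin X.dim₀ → ℚ) →ₗ[ℚ] (Fin A.dim₁ → ℚ)),
        (∀ y, k.f₀ (t.f₀ y) = x.f₀ y) ∧ (∀ y, k.f₁ (t.f₁ y) = x.f₁ y) ∧
          ∀ y, f.f₁ (σ y) + ξ y = e.h (t.f₀ y))
    (inj₀ : ∀ a b, k.f₀ a = 0 → e.h a = f.f₁ b → a = 0) (inj₁ : ∀ a, k.f₁ a = 0 → a = 0)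
    (r : (Fin A.dim₁ → ℚ) →ₗ[ℚ] (Fin K.dim₁ → ℚ)) (hr : ∀ b, f.f₁ b = 0 → k.f₁ (r b) = b) :
    (gpdStar M T).IsKernel f k e := by
  constructor
  · intro X x ξ
    obtain ⟨t, σ, h₀, h₁, h⟩ := ex x ξ.h (LinearMap.congr_fun ξ.eq₀) (LinearMap.congr_fun ξ.eq₁)
    exact ⟨t, mkHom₂ σ (LinearMap.ext h₀) (LinearMap.ext h₁), (kernel_condition_iff e ξ _).2 h⟩
  · intro X x ξ t σ t' σ' h h'
    rw [kernel_condition_iff] at h h'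
    have s₀ (y) : k.f₀ (t.f₀ y) = k.f₀ (t'.f₀ y) :=
      LinearMap.congr_fun (σ.eq₀.trans σ'.eq₀.symm) y
    have s₁ (y) : k.f₁ (t.f₁ y) = k.f₁ (t'.f₁ y) :=
      LinearMap.congr_fun (σ.eq₁.trans σ'.eq₁.symm) y
    have e₀ : t.f₀ = t'.f₀ := LinearMap.ext fun y => by
      refine sub_eq_zero.1 (inj₀ _ (σ.h y - σ'.h y) (by rw [map_sub, s₀, sub_self]) ?_)
      rw [map_sub, map_sub, ← h, ← h']
      abel
    have e₁ : t.f₁ = t'.f₁ := LinearMap.ext fun y =>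
      sub_eq_zero.1 (inj₁ _ (by rw [map_sub, s₁, sub_self]))
    have hσ (y) : k.f₁ (r (σ.h y - σ'.h y)) = σ.h y - σ'.h y := by
      refine hr _ ?_
      rw [map_sub, sub_eq_zero, ← add_left_inj (ξ.h y), h, h', e₀]
    refine ⟨mkHom₂ (r ∘ₗ (σ.h - σ'.h)) e₀ e₁, hom₂_ext (LinearMap.ext fun y => ?_), fun τ hτ =>
      hom₂_ext (LinearMap.ext fun y => sub_eq_zero.1 (inj₁ _ ?_))⟩
    · change k.f₁ (r (σ.h y - σ'.h y)) + σ'.h y = σ.h y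
      rw [hσ, sub_add_cancel]
    · have hτ : k.f₁ (τ.h y) + σ'.h y = σ.h y := LinearMap.congr_fun (congrArg Hom₂.h hτ) y
      change k.f₁ (τ.h y - r (σ.h y - σ'.h y)) = 0
      rw [map_sub, hσ, ← hτ]
      abel

theorem isCokernel_of {f : A ⟶ B} {q : B ⟶ Q} {π : f ≫ q ⟶ (gpdStar M T).zero A Q}
    (ex : ∀ {Y : TwoVect.{w, v, u} M T} (y : B ⟶ Y)
      (ξ : (Fin A.dim₀ → ℚ) →ₗ[ℚ] (Fin Y.dim₁ → ℚ)), (∀ x, y.f₀ (f.f₀ x) = 0) →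
      (∀ x, y.f₁ (f.f₁ x) = 0) → ∃ (t : Q ⟶ Y) (σ : (Fin B.dim₀ → ℚ) →ₗ[ℚ] (Fin Y.dim₁ → ℚ)),
        (∀ x, t.f₀ (q.f₀ x) = y.f₀ x) ∧ (∀ x, t.f₁ (q.f₁ x) = y.f₁ x) ∧
          ∀ x, σ (f.f₀ x) + ξ x = t.f₁ (π.h x))
    (surj₀ : ∀ z, ∃ b, q.f₀ b = z) (surj₁ : ∀ z, ∃ a b, f.f₀ a = 0 ∧ z = q.f₁ b + π.h a)
    (r : (Fin Q.dim₀ → ℚ) →ₗ[ℚ] (Fin B.dim₀ → ℚ)) (hr : ∀ b, ∃ a, r (q.f₀ b) = b + f.f₀ a) :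
    (gpdStar M T).IsCokernel f q π := by
  constructor
  · intro Y y ξ
    obtain ⟨t, σ, h₀, h₁, h⟩ := ex y ξ.h (LinearMap.congr_fun ξ.eq₀) (LinearMap.congr_fun ξ.eq₁)
    exact ⟨t, mkHom₂ σ (LinearMap.ext h₀) (LinearMap.ext h₁), (cokernel_condition_iff π ξ _).2 h⟩
  · intro Y y ξ t σ t' σ' h h'
    rw [cokernel_condition_iff] at h h'
    have e₀ : t.f₀ = t'.f₀ := LinearMap.ext fun z => by
      obtain ⟨b, rfl⟩ := surj₀ z
      exact LinearMap.congr_fun (σ.eq₀.trans σ'.eq₀.symm) b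
    have e₁ : t.f₁ = t'.f₁ := LinearMap.ext fun z => by
      obtain ⟨a, b, ha, rfl⟩ := surj₁ z
      have hb : t.f₁ (q.f₁ b) = t'.f₁ (q.f₁ b) :=
        LinearMap.congr_fun (σ.eq₁.trans σ'.eq₁.symm) b
      rw [map_add, map_add, ← h, ← h', hb, ha, map_zero, map_zero]
    have hσ (b) : (σ.h - σ'.h) (r (q.f₀ b)) = σ.h b - σ'.h b := by
      obtain ⟨a, ha⟩ := hr b
      have ha' : σ.h (f.f₀ a) = σ'.h (f.f₀ a) := by
        rw [← add_left_inj (ξ.h a), h, h', e₁]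
      rw [ha, LinearMap.sub_apply, map_add, map_add, ha']
      abel
    refine ⟨mkHom₂ ((σ.h - σ'.h) ∘ₗ r) e₀ e₁, hom₂_ext (LinearMap.ext fun b => ?_), fun τ hτ =>
      hom₂_ext (LinearMap.ext fun z => ?_)⟩
    · change (σ.h - σ'.h) (r (q.f₀ b)) + σ'.h b = σ.h b
      rw [hσ, sub_add_cancel]
    · obtain ⟨b, rfl⟩ := surj₀ z
      have hτ : τ.h (q.f₀ b) + σ'.h b = σ.h b := LinearMap.congr_fun (congrArg Hom₂.h hτ) b
      change τ.h (q.f₀ b) = (σ.h - σ'.h) (r (q.f₀ b))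
      rw [hσ, ← hτ]
      abel

section Kernel

variable {f : A ⟶ B} (S₀ : LinearSplitting f.f₀) (S₁ : LinearSplitting f.f₁)

/-- The kernel of a 1-cell of 2-vector spaces. -/
noncomputable def kernelι :
    (⟨S₀.ker + S₁.coker, S₁.ker⟩ : TwoVect.{w, v, u} M T) ⟶ A :=
  mkHom (S₀.ι ∘ₗ LinearMap.fst ℚ _ _ ∘ₗ (sumEquiv S₀.ker S₁.coker).symm.toLinearMap) S₁.ι

noncomputable def kernelNull : kernelι S₀ S₁ ≫ f ⟶ (gpdStar M T).zero _ B :=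
  mkHom₂ (S₁.j ∘ₗ LinearMap.snd ℚ _ _ ∘ₗ (sumEquiv S₀.ker S₁.coker).symm.toLinearMap)
    (LinearMap.ext fun _ => S₀.f_ι _) (LinearMap.ext fun x => S₁.f_ι x)

theorem kernelι_f₀ (x) : (kernelι S₀ S₁).f₀ (sumEquiv _ _ x) = S₀.ι x.1 := by
  simp [kernelι]

theorem kernelι_f₁ (x) : (kernelι S₀ S₁).f₁ x = S₁.ι x := rfl

theorem kernelNull_h (x) : (kernelNull S₀ S₁).h (sumEquiv _ _ x) = S₁.j x.2 := by
  simp [kernelNull]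

/-- A class in the kernel is a class killed by `f.f₀` with a trivialization of its image, the latter
counting modulo the image of `f.f₁`. This accounts for the first space being `ker f.f₀ ⊕ coker
f.f₁`, while the second is `ker f.f₁`. -/
theorem isKernel_kernelι : (gpdStar M T).IsKernel f (kernelι S₀ S₁) (kernelNull S₀ S₁) := by
  refine isKernel_of (fun {X} x ξ h₀ h₁ => ⟨mkHom
    ((sumEquiv S₀.ker S₁.coker).toLinearMap ∘ₗ (S₀.p ∘ₗ x.f₀).prod (S₁.π ∘ₗ ξ)) (S₁.p ∘ₗ x.f₁),
    -(S₁.g ∘ₗ ξ), fun y => ?_, fun y => ?_, fun y => ?_⟩) (fun a b ha hb => ?_) (fun a ha => ?_)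
    S₁.p fun b hb => ?_
  · refine (kernelι_f₀ S₀ S₁ _).trans ?_
    change S₀.ι (S₀.p (x.f₀ y)) = _
    rw [S₀.ι_p, h₀, map_zero, sub_zero]
  · change S₁.ι (S₁.p (x.f₁ y)) = _
    rw [S₁.ι_p, h₁, map_zero, sub_zero]
  · refine Eq.trans ?_ (kernelNull_h S₀ S₁ _).symm
    change f.f₁ (-(S₁.g (ξ y))) + ξ y = S₁.j (S₁.π (ξ y))
    rw [S₁.j_π, map_neg, neg_add_eq_sub]
  · obtain ⟨⟨a₁, a₂⟩, rfl⟩ := (sumEquiv S₀.ker S₁.coker).surjective a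
    rw [kernelι_f₀] at ha
    rw [kernelNull_h] at hb
    rw [← S₀.p_ι a₁, ← S₁.π_j a₂, ha, hb, S₁.π_f, map_zero]
    exact map_zero _
  · rw [← S₁.p_ι a]
    exact (congrArg S₁.p ha).trans (map_zero _)
  · change S₁.ι (S₁.p b) = b
    rw [S₁.ι_p, hb, map_zero, sub_zero]

/-- The cokernel of a 1-cell of 2-vector spaces. -/
noncomputable def cokernelπ :
    B ⟶ (⟨S₀.coker, S₁.coker + S₀.ker⟩ : TwoVect.{w, v, u} M T) :=
  mkHom S₀.π ((sumEquiv S₁.coker S₀.ker).toLinearMap ∘ₗ LinearMap.inl ℚ _ _ ∘ₗ S₁.π)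

noncomputable def cokernelNull : f ≫ cokernelπ S₀ S₁ ⟶ (gpdStar M T).zero A _ :=
  mkHom₂ ((sumEquiv S₁.coker S₀.ker).toLinearMap ∘ₗ LinearMap.inr ℚ _ _ ∘ₗ S₀.p)
    (LinearMap.ext fun x => S₀.π_f x) (LinearMap.ext fun x => by
      change sumEquiv S₁.coker S₀.ker (S₁.π (f.f₁ x), 0) = 0
      rw [S₁.π_f]
      exact map_zero _)

theorem cokernelπ_f₁ (x) : (cokernelπ S₀ S₁).f₁ x = sumEquiv _ _ (S₁.π x, 0) := rfl

theorem cokernelNull_h (x) : (cokernelNull S₀ S₁).h x = sumEquiv _ _ (0, S₀.p x) := rfl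

/-- Dually, the elements killed by `f.f₀` contribute new automorphisms of zero in the cokernel, so
its second space is `coker f.f₁ ⊕ ker f.f₀`. -/
theorem isCokernel_cokernelπ :
    (gpdStar M T).IsCokernel f (cokernelπ S₀ S₁) (cokernelNull S₀ S₁) := by
  refine isCokernel_of (fun {Y} y ξ h₀ h₁ => ⟨mkHom (y.f₀ ∘ₗ S₀.j)
    ((y.f₁ ∘ₗ S₁.j).coprod (ξ ∘ₗ S₀.ι) ∘ₗ (sumEquiv S₁.coker S₀.ker).symm.toLinearMap),
    -(ξ ∘ₗ S₀.g), fun x => ?_, fun x => ?_, fun x => ?_⟩) (fun z => ⟨S₀.j z, S₀.π_j z⟩)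
    (fun z => ?_) S₀.j fun b => ⟨-S₀.g b, ?_⟩
  · change y.f₀ (S₀.j (S₀.π x)) = _
    rw [S₀.j_π, map_sub, h₀, sub_zero]
  · rw [cokernelπ_f₁]
    have h : y.f₁ (S₁.j (S₁.π x)) = y.f₁ x := by rw [S₁.j_π, map_sub, h₁, sub_zero]
    simpa using h
  · rw [cokernelNull_h]
    have h : -ξ (S₀.g (f.f₀ x)) + ξ x = ξ (S₀.ι (S₀.p x)) := by
      rw [S₀.ι_p, map_sub, neg_add_eq_sub]
    simpa using h
  · obtain ⟨⟨c, a⟩, rfl⟩ := (sumEquiv S₁.coker S₀.ker).surjective z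
    refine ⟨S₀.ι a, S₁.j c, S₀.f_ι a, ?_⟩
    rw [cokernelπ_f₁, cokernelNull_h, S₁.π_j, S₀.p_ι, ← map_add, Prod.mk_add_mk, add_zero,
      zero_add]
  · change S₀.j (S₀.π b) = _
    rw [S₀.j_π, map_neg, sub_eq_add_neg]

/-- The hypothesis says that `f.f₁` is injective. A preimage under `f.f₀` is determined up to `ker
f.f₀`, and the component of `ξ` there fixes it; the component of `ξ` in `coker f.f₁` is absorbed
into the comparison 2-cell. -/
theorem isKernel_cokernelπ (h : ∀ x, S₁.g (f.f₁ x) = x) :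
    (gpdStar M T).IsKernel (cokernelπ S₀ S₁) f (cokernelNull S₀ S₁) := by
  have hc (x : Fin B.dim₁ → ℚ) (hx : (cokernelπ S₀ S₁).f₁ x = 0) : f.f₁ (S₁.g x) = x := by
    have hx : S₁.π x = 0 := congrArg Prod.fst
      ((sumEquiv S₁.coker S₀.ker).injective (hx.trans (map_zero _).symm))
    have := S₁.j_π x
    rw [hx, map_zero] at this
    exact (sub_eq_zero.1 this.symm).symm
  refine isKernel_of (fun {X} x ξ h₀ h₁ => ⟨mkHom (S₀.g ∘ₗ x.f₀ + S₀.ι ∘ₗ LinearMap.snd ℚ _ _ ∘ₗ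
      (sumEquiv S₁.coker S₀.ker).symm.toLinearMap ∘ₗ ξ) (S₁.g ∘ₗ x.f₁),
    -(S₁.j ∘ₗ LinearMap.fst ℚ _ _ ∘ₗ (sumEquiv S₁.coker S₀.ker).symm.toLinearMap ∘ₗ ξ),
    fun y => ?_, fun y => hc _ (h₁ y), fun y => ?_⟩) (fun a b ha hb => ?_) (fun a ha => ?_)
    S₁.g hc
  · have hx := S₀.j_π (x.f₀ y)
    rw [show S₀.π (x.f₀ y) = 0 from h₀ y, map_zero, eq_comm, sub_eq_zero] at hx
    change f.f₀ (S₀.g (x.f₀ y) + S₀.ι _) = _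
    rw [map_add, ← hx, S₀.f_ι, add_zero]
  · rw [cokernelπ_f₁, cokernelNull_h]
    obtain ⟨⟨c, a⟩, hca⟩ := (sumEquiv S₁.coker S₀.ker).surjective (ξ y)
    have hs : (sumEquiv S₁.coker S₀.ker).symm (ξ y) = (c, a) := by
      rw [← hca, LinearEquiv.symm_apply_apply]
    have e₁ : (-(S₁.j ∘ₗ LinearMap.fst ℚ _ _ ∘ₗ
        (sumEquiv S₁.coker S₀.ker).symm.toLinearMap ∘ₗ ξ)) y = -S₁.j c := by simp [hs]
    have e₂ : (S₀.g ∘ₗ x.f₀ + S₀.ι ∘ₗ LinearMap.snd ℚ _ _ ∘ₗ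
      (sumEquiv S₁.coker S₀.ker).symm.toLinearMap ∘ₗ ξ) y = S₀.g (x.f₀ y) + S₀.ι a := by simp [hs]
    rw [mkHom_f₀, e₁, e₂, ← hca, map_neg, S₁.π_j, map_add, S₀.p_g, S₀.p_ι, zero_add, ← map_add,
      Prod.mk_add_mk, neg_add_cancel, zero_add]
  · rw [cokernelπ_f₁, cokernelNull_h] at hb
    have hp : S₀.p a = 0 := congrArg Prod.snd ((sumEquiv S₁.coker S₀.ker).injective hb)
    have := S₀.ι_p a
    rw [hp, ha, map_zero, map_zero, sub_zero] at this
    exact this.symm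
  · rw [← h a, ha, map_zero]

/-- Here `f.f₀` is surjective. The part of `ξ` on `coker f.f₁` determines the factorization outside
the range of `f.f₁`, the part on `ker f.f₀` goes into the comparison 2-cell. -/
theorem isCokernel_kernelι (h : ∀ x, f.f₀ (S₀.g x) = x) :
    (gpdStar M T).IsCokernel (kernelι S₀ S₁) f (kernelNull S₀ S₁) := by
  refine isCokernel_of (fun {Y} y ξ h₀ h₁ => ⟨mkHom (y.f₀ ∘ₗ S₀.g) (y.f₁ ∘ₗ S₁.g + ξ ∘ₗ
      (sumEquiv S₀.ker S₁.coker).toLinearMap ∘ₗ LinearMap.inr ℚ _ _ ∘ₗ S₁.π),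
    -(ξ ∘ₗ (sumEquiv S₀.ker S₁.coker).toLinearMap ∘ₗ LinearMap.inl ℚ _ _ ∘ₗ S₀.p),
    fun x => ?_, fun x => ?_, fun x => ?_⟩) (fun z => ⟨S₀.g z, h z⟩)
    (fun z => ⟨sumEquiv _ _ (0, S₁.π z), S₁.g z, ?_, ?_⟩) S₀.g
    fun b => ⟨sumEquiv _ _ (-S₀.p b, 0), ?_⟩
  · have hx := h₀ (sumEquiv _ _ (S₀.p x, 0))
    rw [kernelι_f₀] at hx
    rw [S₀.ι_p, map_sub, sub_eq_zero] at hx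
    exact hx.symm
  · have hx := h₁ (S₁.p x)
    rw [kernelι_f₁, S₁.ι_p, map_sub, sub_eq_zero] at hx
    change y.f₁ (S₁.g (f.f₁ x)) + ξ (sumEquiv _ _ (0, S₁.π (f.f₁ x))) = _
    rw [S₁.π_f, ← hx, show ((0, 0) : (Fin S₀.ker → ℚ) × (Fin S₁.coker → ℚ)) = 0 from rfl, map_zero,
      map_zero, add_zero]
  · obtain ⟨⟨a, c⟩, rfl⟩ := (sumEquiv S₀.ker S₁.coker).surjective x
    rw [kernelι_f₀, kernelNull_h]
    change -ξ (sumEquiv _ _ (S₀.p (S₀.ι a), 0)) + ξ (sumEquiv _ _ (a, c)) =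
      y.f₁ (S₁.g (S₁.j c)) + ξ (sumEquiv _ _ (0, S₁.π (S₁.j c)))
    rw [S₁.g_j, S₁.π_j, S₀.p_ι, map_zero, zero_add, ← map_neg, ← map_neg, ← map_add, ← map_add,
      Prod.neg_mk, Prod.mk_add_mk, neg_add_cancel, neg_zero, zero_add]
  · rw [kernelι_f₀, map_zero]
  · rw [kernelNull_h, S₁.j_π]
    abel
  · rw [kernelι_f₀, map_neg, S₀.ι_p]
    abel

end Kernel

theorem isRelativelyExact : (locallySCG M T : LocallySCG (TwoVect.{w, v, u} M T)).IsRelativelyExact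
    where
  kernels f := by
    obtain ⟨S₀⟩ := LinearSplitting.nonempty f.f₀
    obtain ⟨S₁⟩ := LinearSplitting.nonempty f.f₁
    exact ⟨_, _, _, isKernel_kernelι S₀ S₁⟩
  cokernels f := by
    obtain ⟨S₀⟩ := LinearSplitting.nonempty f.f₀
    obtain ⟨S₁⟩ := LinearSplitting.nonempty f.f₁
    exact ⟨_, _, _, isCokernel_cokernelπ S₀ S₁⟩
  faithful_iff {A B} f := by
    refine ⟨fun hf => ?_, fun ⟨_, _, _, _, hf⟩ => hf.isFaithful⟩
    obtain ⟨S₀⟩ := LinearSplitting.nonempty f.f₀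
    obtain ⟨S₁⟩ := LinearSplitting.nonempty f.f₁
    refine ⟨_, _, _, isCokernel_cokernelπ S₀ S₁, isKernel_cokernelπ S₀ S₁ fun x => ?_⟩
    -- A test object: the inclusion of `ker f.f₁` is an endomorphism of zero out of `X` that becomes
    -- trivial after `f`, so faithfulness forces this kernel to vanish.
    let X : TwoVect.{w, v, u} M T := ⟨S₁.ker, 0⟩
    have := hf X
    have hι : (mkHom₂ S₁.ι rfl rfl : (gpdStar M T).zero X A ⟶ (gpdStar M T).zero X A) =
        mkHom₂ 0 rfl rfl :=
      (postcomp X f).map_injective (hom₂_ext (LinearMap.ext fun x => by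
        change f.f₁ (S₁.ι x) = f.f₁ 0
        rw [S₁.f_ι, map_zero]))
    have hx : S₁.ι (S₁.p x) = 0 := LinearMap.congr_fun (congrArg Hom₂.h hι) _
    rw [S₁.ι_p, sub_eq_zero] at hx
    exact hx.symm
  cofaithful_iff {A B} f := by
    refine ⟨fun hf => ?_, fun ⟨_, _, _, _, hf⟩ => hf.isCofaithful⟩
    obtain ⟨S₀⟩ := LinearSplitting.nonempty f.f₀
    obtain ⟨S₁⟩ := LinearSplitting.nonempty f.f₁
    refine ⟨_, _, _, isKernel_kernelι S₀ S₁, isCokernel_kernelι S₀ S₁ fun x => ?_⟩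
    -- The projection to `coker f.f₀` is an endomorphism of zero into `Y` that is trivial on `f`, so
    -- cofaithfulness makes `f.f₀` surjective.
    let Y : TwoVect.{w, v, u} M T := ⟨0, S₀.coker⟩
    have := hf Y
    have hπ : (mkHom₂ S₀.π rfl rfl : (gpdStar M T).zero B Y ⟶ (gpdStar M T).zero B Y) =
        mkHom₂ 0 rfl rfl :=
      (precomp Y f).map_injective (hom₂_ext (LinearMap.ext fun x => S₀.π_f x))
    have hx : S₀.π x = 0 := LinearMap.congr_fun (congrArg Hom₂.h hπ) x
    have := S₀.j_π x
    rw [hx, map_zero, eq_comm, sub_eq_zero] at this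
    exact this.symm

theorem not_hasStrictZeros [Nontrivial M] :
    ¬ (gpdStar M T : GpdStar (TwoVect.{w, v, u} M T)).HasStrictZeros := by
  intro h
  obtain ⟨m, hm⟩ := exists_ne (1 : M)
  let A : TwoVect.{w, v, u} M T := ⟨0, 0⟩
  -- Even on the zero object: composing zero, of mark `1`, with `f` gives mark `m`.
  let f : A ⟶ A := ⟨0, 0, m⟩
  have e : 1 * m = (1 : M) := congrArg Hom.mark (h.zero_comp A f)
  exact hm (by rwa [one_mul] at e)

end TwoVect

end TwoCat

theorem mainTheorem1 :
    -- every strictly described 2-abelian `Gpd`-category is relatively exact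
    (∀ (C : Type u) [CategoryTheory.Bicategory.{w, v} C] (G : TwoCat.GpdStar C),
      G.IsStrictlyDescribed → G.IsTwoAbelian →
        ∃ S : TwoCat.LocallySCG C, S.toGpdStar = G ∧ S.IsRelativelyExact) ∧
    -- every relatively exact 2-category is an abelian `Gpd`-category
    (∀ (C : Type u) [CategoryTheory.Bicategory.{w, v} C] (S : TwoCat.LocallySCG C),
      S.IsRelativelyExact → S.toGpdStar.IsAbelian) ∧
    -- but composition with zero need not be strictly zero, so it need not be strictly described
    (∃ (C : Type u) (_ : CategoryTheory.Bicategory.{w, v} C) (S : TwoCat.LocallySCG C),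
      S.IsRelativelyExact ∧ ¬ S.toGpdStar.HasStrictZeros ∧ ¬ S.toGpdStar.IsStrictlyDescribed) := by
  refine ⟨fun C _ G hG h => h.exists_relativelyExact hG, fun C _ S h => h.isAbelian, ?_⟩
  -- Any nontrivial monoid of marks would do; lifting it puts the 1-cells in the required universe,
  -- and `PUnit` below merely selects the universe of 2-cells.
  let M := ULift.{v} (Multiplicative (ZMod 2))
  have : Nontrivial M := inferInstanceAs (Nontrivial (ULift.{v} (ZMod 2)))
  have hz := TwoCat.TwoVect.not_hasStrictZeros.{w, v, u} (M := M) (T := PUnit.{w + 1})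
  exact ⟨TwoCat.TwoVect.{w, v, u} M PUnit.{w + 1}, inferInstance, TwoCat.TwoVect.locallySCG _ _,
    TwoCat.TwoVect.isRelativelyExact, hz, fun h => hz h.toHasStrictZeros⟩
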